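/- **Setting.** Let $B_s\subset\mathbb R^3$ be a bounded open set (the reference configuration of the solid) and let $S_s\subset B_s$ be an embedded oriented $C^1$ surface of finite area, relatively closed in $B_s$, with unit normal $m_s$. For a field $f$ on $B_s\setminus S_s$ and $X\in S_s$ put $f^\pm(X)=\lim_{s\to0^+}f(X\pm s\,m_s(X))$ and $[\![f]\!]=f^+-f^-$. "Piecewise $C^k$" means $C^k$ on $B_s\setminus S_s$ with bounded derivatives up to order $k$, and $C^k$ up to $S_s$ from each side. Every field below is given as a function of the solid's reference position $X$ and of $t\in(0,T)$. "Eulerian" operators act through the chain rule, $\nabla f:=(\nabla_X f)F^{-1}$, with $\operatorname{div}$ the corresponding trace. *Kinematics.* The unknowns are the solid displacement $u_s$, the fluid velocity $v_f$, the pore pressure $p$ and the interface multiplier $\mathfrak p$ (defined on $S_s$). Put $\chi_t(X)=X+u_s(X,t)$, $B(t)=\chi_t(B_s)$, $\mathcal S(t)=\chi_t(S_s)$, $F=\nabla_X\chi_t$, $J=\det F$, $v_s=\partial_t\chi_t$, $a_s=\partial_t v_s$, $w=v_f-v_s$, $a_f=\partial_t v_f+(\nabla v_f)w$, $L_a=\nabla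 v_a$, $D_a=\tfrac12(L_a+L_a^{T})$, $N=JF^{-T}m_s$ and $m=N/\|N\|$ on $S_s$. Assume: $u_s$ is continuous on $B_s\times(0,T)$ and piecewise $C^2$ in $(X,t)$; $\chi_t$ is injective; $J$ is bounded below by a positive constant; $v_f$ is piecewise $C^1$ in $(X,t)$; for each $t$, $p$ is piecewise $C^1$ in $X$ and $\mathfrak p$ is bounded and continuous on $S_s$. *Constitutive data.* Constants $\rho_s^*,\rho_f^*,\mu_{\mathcal S}>0$; a piecewise $C^1$ time-independent $\phi_R$ with $\phi_s:=\phi_R/J\in[0,1]$, $\phi_f:=1-\phi_s$; $\rho_a=\rho_a^*\phi_a$; $v_{\rm flt}=\phi_f w$; nonnegative coefficient fields $\mu_f,\mu_B,\mu_D,\kappa_s$, at each time bounded and continuous off $S_s$, with $\kappa_s$ bounded away from $0$; a nonnegative strain energy $\hat\Psi(\bar C,X)$, with $C=F^{T}F$ and $\bar C=J^{-2/3}C$, continuous in $(\bar C,X)$ for $X\notin S_s$, $C^1$ in $\bar C$ with $\bar C$-derivative continuous in $(\bar C,X)$, and, together with that derivative, bounded for $\bar C$ in compact sets of positive definite tensors.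 Put $k_a=\tfrac12\rho_a\|v_a\|^2$, $\psi_s=J^{-1}\phi_R\hat\Psi$, and $$T^e_s=2\phi_RJ^{-1}F\,\frac{\partial\hat\Psi}{\partial C}F^{T},\quad T_s^v=2\mu_B(D_s-D_f),\quad T_f^v=2\mu_fD_f+2\mu_B(D_f-D_s),$$ $$T_s=-\phi_sp\,I+T_s^e+T_s^v,\quad T_f=-\phi_fp\,I+T_f^v,\quad f_f=-\frac{\mu_D\phi_f^2}{\kappa_s}w,\quad p_f=p\nabla\phi_f+f_f,$$ $$\mathscr D=2\mu_f\|D_f\|^2+2\mu_B\|D_f-D_s\|^2+\frac{\mu_D\phi_f^2}{\kappa_s}\|w\|^2,\qquad \mathscr D_{\mathcal S}=\tfrac12\mu_{\mathcal S}\|[\![v_{\rm flt}]\!]\|^2 .$$ *Zero data.* There are no body forces, and $u_s$ and $v_f$ vanish on $\partial B_s$. *Variational equations at time $t$.* Solid tests $a$ are continuous on $B_s$ and piecewise $C^1$, fluid tests $b$ are piecewise $C^1$ (they may jump across $S_s$), and both vanish on $\partial B_s$; pressure tests $\pi$ are piecewise $C^1$; multiplier tests $r$ are bounded and continuous on $S_s$.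 (H) (Hamilton–Rayleigh form) $T_s$ and $T_f$ are piecewise $C^1$, the constraints $\operatorname{div}(v_s+v_{\rm flt})=0$ on $B_s\setminus S_s$ and $[\![v_{\rm flt}\cdot N]\!]=0$ on $S_s$ hold, and for all $a$ (playing the role of $\delta\chi_s$) and $b$ (playing the role of $F_sF_{sf}^{-1}\delta\chi_{sf}$) $$\begin{aligned}0&=\int_{B_s}J[\rho_sa_s+\rho_fa_f-\operatorname{div}(T_s+T_f)]\cdot a-\int_{B_s}J(\rho_fa_f-\operatorname{div}T_f-p_f)\cdot b+\int_{S_s}[\![(\rho_f w\otimes w-T_s-T_f)N]\!]\cdot a\\&\quad+\int_{S_s}[\![(k_fI-\rho_fv_f\otimes w)N\cdot b]\!]+\int_{S_s}[\![(\phi_f\mathfrak p I+T_f-\tfrac12\phi_f\mu_{\mathcal S}[\![v_{\rm flt}]\!]\otimes m)N\cdot b]\!].\end{aligned}$$ (W) (mixed weak form) for all $a,b,\pi,r$ $$\begin{aligned}0&=\int_{B_s}J(\rho_sa_s+\rho_fa_f+\nabla p)\cdot a+\int_{B_s}J(T_s^e+T_s^v+T_f^v)F^{-T}:\nabla_Xa\\&\quad+\int_{B_s}J\big[(\rho_fa_f+\phi_f\nabla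 p-f_f)\cdot b+T_f^vF^{-T}:\nabla_Xb\big]+\int_{S_s}[\![(\rho_fw\otimes w+pI)N]\!]\cdot a\\&\quad-\int_{S_s}[\![(k_fI-\rho_fv_f\otimes w)N\cdot b]\!]-\int_{S_s}[\![(\phi_f(\mathfrak p-p)I-\tfrac12\phi_f\mu_{\mathcal S}[\![v_{\rm flt}]\!]\otimes m)N\cdot b]\!]\\&\quad-\int_{B_s}J(v_s+v_{\rm flt})\cdot F^{-T}\nabla_X\pi-\int_{S_s}[\![\pi(v_s+v_{\rm flt})\cdot N]\!]+\int_{S_s}r\,[\![v_{\rm flt}\cdot N]\!].\end{aligned}$$ **Proposition (formal stability estimate).** Suppose that for almost every $t\in[0,T]$ the fields $u_s,v_f,p,\mathfrak p$ solve the variational equations, in the form (H) or in the form (W). Then for almost every $t\in[0,T]$ the integrals below (of fields transported to $B(t)$ and $\mathcal S(t)$ by $\chi_t$) converge, the energy is differentiable at $t$, and $$\frac{\mathrm d}{\mathrm dt}\int_{B(t)}(k_s+k_f+\psi_s)+\int_{B(t)}\mathscr D+\int_{\mathcal S(t)}\mathscr D_{\mathcal S}=0 .$$ -/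

import Mathlib

open MeasureTheory Set Filter Topology

open scoped InnerProductSpace

noncomputable section

namespace PermeableInterface

/-! Throughout, `E` is the three-dimensional Euclidean (vector) space: a real inner product space whose
dimension is fixed to be three in the theorem. (Completeness is automatic in finite dimension.) -/

variable {E : Type*} [NormedAddCommGroup E] [InnerProductSpace ℝ E] [FiniteDimensional ℝ E]
  [CompleteSpace E] [MeasurableSpace E] [BorelSpace E]

/-- Second-order tensors, viewed as linear operators. -/
abbrev Tensor (E : Type*) [NormedAddCommGroup E] [InnerProductSpace ℝ E] : Type _ := E →L[ℝ] E

/-- An orthonormal basis. -/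
def basisVec (i : Fin (Module.finrank ℝ E)) : E := stdOrthonormalBasis ℝ E i

/-- The transpose of a second-order tensor. -/
def transpose (A : Tensor E) : Tensor E := ContinuousLinearMap.adjoint A

/-- The dyadic product `a ⊗ b`, i.e. `(a ⊗ b) c = (b · c) a`. -/
def dyad (a b : E) : Tensor E := (innerSL ℝ b).smulRight a

/-- The trace of a tensor. -/
def tr (A : Tensor E) : ℝ := LinearMap.trace ℝ E (A : E →ₗ[ℝ] E)

/-- The scalar product of tensors, `A : B = tr (Aᵀ B)`. -/
def ddot (A B : Tensor E) : ℝ := tr (transpose A ∘L B)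

/-- The symmetric part of a tensor. -/
def symPart (A : Tensor E) : Tensor E := (1 / 2 : ℝ) • (A + transpose A)

/-- The one-sided limit of `f` at `X` in the direction `ν`, as `X` is approached along
`X + s ν`, `s → 0⁺`. -/
def sideLim {V : Type*} [NormedAddCommGroup V] (ν X : E) (f : E → V) : V :=
  limUnder (𝓝[>] (0 : ℝ)) fun s => f (X + s • ν)

/-- The jump `⟦f⟧ = f⁺ - f⁻` at `X`, across a surface oriented at `X` by the unit vector `ν`. -/
def jump {V : Type*} [NormedAddCommGroup V] (ν X : E) (f : E → V) : V :=
  sideLim ν X f - sideLim (-ν) X f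

/-! ### Interfaces and piecewise smooth fields -/

/-- On the open set `U` the surface `S` is the regular zero level set of the `C¹` function `ℓ`, and
it is oriented by the unit normal `m = ∇ℓ / ‖∇ℓ‖`; so `{ℓ > 0}` is the side into which `m` points. -/
structure IsDefining (S : Set E) (m : E → E) (U : Set E) (ℓ : E → ℝ) : Prop where
  isOpen : IsOpen U
  contDiffOn : ContDiffOn ℝ 1 ℓ U
  gradient_ne_zero : ∀ Y ∈ U, gradient ℓ Y ≠ 0
  mem_iff : ∀ Y ∈ U, (Y ∈ S ↔ ℓ Y = 0)
  normal_eq : ∀ Y ∈ U, Y ∈ S → m Y = ‖gradient ℓ Y‖⁻¹ • gradient ℓ Y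

/-- `S` is an embedded oriented surface of finite area in the open set `B`, relatively closed in `B`,
with unit normal `m`. -/
structure IsInterface (B S : Set E) (m : E → E) : Prop where
  subset : S ⊆ B
  closed : closure S ∩ B ⊆ S
  locally_level : ∀ X ∈ S, ∃ U ℓ, X ∈ U ∧ U ⊆ B ∧ IsDefining S m U ℓ
  area_finite : μHE[2] S < ⊤

/-- `f` is of class `Cⁿ` on `B` away from `S`, with bounded derivatives, and of class `Cⁿ` up to `S`
from each side of `S`. The values of `f` on `S` are irrelevant. -/
structure PiecewiseC {V : Type*} [NormedAddCommGroup V] [NormedSpace ℝ V]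
    (n : ℕ) (B S : Set E) (m : E → E) (f : E → V) : Prop where
  contDiffOn : ContDiffOn ℝ n f (B \ S)
  bounded : ∀ k ≤ n, ∃ c : ℝ, ∀ X ∈ B \ S, ‖iteratedFDeriv ℝ k f X‖ ≤ c
  sides : ∀ X ∈ S, ∃ (U : Set E) (ℓ : E → ℝ) (g₁ g₂ : E → V),
    X ∈ U ∧ U ⊆ B ∧ IsDefining S m U ℓ ∧ ContDiffOn ℝ n g₁ U ∧ ContDiffOn ℝ n g₂ U ∧
      ∀ Y ∈ U, (0 < ℓ Y → f Y = g₁ Y) ∧ (ℓ Y < 0 → f Y = g₂ Y)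

/-- The analogue of `PiecewiseC` for time-dependent fields, on the time interval `(0, T)` and
jointly in space and time. -/
structure PiecewiseCTime {V : Type*} [NormedAddCommGroup V] [NormedSpace ℝ V]
    (n : ℕ) (B S : Set E) (m : E → E) (T : ℝ) (f : E → ℝ → V) : Prop where
  contDiffOn : ContDiffOn ℝ n (fun q : E × ℝ => f q.1 q.2) ((B \ S) ×ˢ Ioo 0 T)
  bounded : ∀ k ≤ n, ∃ c : ℝ, ∀ q ∈ (B \ S) ×ˢ Ioo 0 T,
    ‖iteratedFDeriv ℝ k (fun q : E × ℝ => f q.1 q.2) q‖ ≤ c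
  sides : ∀ X ∈ S, ∀ t ∈ Ioo 0 T,
    ∃ (U : Set E) (ℓ : E → ℝ) (I : Set ℝ) (g₁ g₂ : E × ℝ → V),
      X ∈ U ∧ U ⊆ B ∧ IsDefining S m U ℓ ∧ t ∈ I ∧ I ⊆ Ioo 0 T ∧ IsOpen I ∧
        ContDiffOn ℝ n g₁ (U ×ˢ I) ∧ ContDiffOn ℝ n g₂ (U ×ˢ I) ∧
          ∀ Y ∈ U, ∀ τ ∈ I, (0 < ℓ Y → f Y τ = g₁ (Y, τ)) ∧ (ℓ Y < 0 → f Y τ = g₂ (Y, τ))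

/-- `f` vanishes on the external boundary of `B`. -/
def VanishesOnBoundary (B S : Set E) (f : E → E) : Prop :=
  ∀ X ∈ frontier B, Tendsto f (𝓝[B \ S] X) (𝓝 0)

/-! ### Data of the mixture -/

/-- The data of a biphasic mixture with a permeable interface. All fields are represented on the
reference configuration of the solid. -/
structure Mixture (E : Type*) [NormedAddCommGroup E] [InnerProductSpace ℝ E] where
  /-- reference configuration of the solid -/
  B : Set E
  /-- reference interface -/
  S : Set E
  /-- unit normal orienting the reference interface -/
  m : E → E
  /-- final time -/
  T : ℝ
  /-- mass density of the pure solid -/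
  rhoS : ℝ
  /-- mass density of the pure fluid -/
  rhoF : ℝ
  /-- referential volume fraction of the solid (independent of time) -/
  phiR : E → ℝ
  /-- strain energy of the pure solid, a function of the isochoric part of the right Cauchy-Green
  tensor and of the material point -/
  Psi : Tensor E → E → ℝ
  /-- viscosity of the fluid in the mixture, as a field; any dependence on the volume fractions is
  allowed, and the same holds for the next three fields -/
  muF : E → ℝ → ℝ
  /-- Brinkman viscosity -/
  muB : E → ℝ → ℝ
  /-- Darcy viscosity -/
  muD : E → ℝ → ℝ
  /-- permeability -/
  kappa : E → ℝ → ℝ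
  /-- interface viscosity -/
  muS : ℝ

/-- Tensors with positive definite symmetric part; the symmetric ones among them are the positive
definite symmetric tensors. -/
def posTensors : Set (Tensor E) := {A | ∀ x : E, x ≠ 0 → 0 < ⟪A x, x⟫_ℝ}

/-- A nonnegative coefficient, at each time continuous and bounded away from the interface. -/
def IsCoefficient (B S : Set E) (T : ℝ) (c : E → ℝ → ℝ) : Prop :=
  ∀ t ∈ Ioo 0 T, ContinuousOn (fun X => c X t) (B \ S) ∧ (∀ X ∈ B \ S, 0 ≤ c X t) ∧
    ∃ K : ℝ, ∀ X ∈ B \ S, c X t ≤ K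

/-- Standing assumptions on the data. -/
structure Mixture.Admissible (M : Mixture E) : Prop where
  isOpen : IsOpen M.B
  isBounded : Bornology.IsBounded M.B
  interface : IsInterface M.B M.S M.m
  rhoS_pos : 0 < M.rhoS
  rhoF_pos : 0 < M.rhoF
  phiR_regular : PiecewiseC 1 M.B M.S M.m M.phiR
  Psi_nonneg : ∀ A ∈ posTensors, ∀ X ∈ M.B \ M.S, 0 ≤ M.Psi A X
  Psi_contDiffOn : ∀ X ∈ M.B \ M.S, ContDiffOn ℝ 1 (fun A => M.Psi A X) posTensors
  Psi_continuousOn :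
    ContinuousOn (fun q : Tensor E × E => M.Psi q.1 q.2) (posTensors ×ˢ (M.B \ M.S))
  fderiv_Psi_continuousOn :
    ContinuousOn (fun q : Tensor E × E => fderiv ℝ (fun A => M.Psi A q.2) q.1)
      (posTensors ×ˢ (M.B \ M.S))
  Psi_bounded : ∀ K ⊆ posTensors, IsCompact K → ∃ c : ℝ, ∀ A ∈ K, ∀ X ∈ M.B \ M.S,
    |M.Psi A X| ≤ c ∧ ‖fderiv ℝ (fun A' => M.Psi A' X) A‖ ≤ c
  muF_coeff : IsCoefficient M.B M.S M.T M.muF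
  muB_coeff : IsCoefficient M.B M.S M.T M.muB
  muD_coeff : IsCoefficient M.B M.S M.T M.muD
  kappa_coeff : IsCoefficient M.B M.S M.T M.kappa
  kappa_pos : ∀ t ∈ Ioo 0 M.T, ∃ c > 0, ∀ X ∈ M.B \ M.S, c ≤ M.kappa X t
  muS_pos : 0 < M.muS

/-! ### Unknowns and kinematics -/

/-- The principal unknowns, all as functions of the solid's reference position and of time. -/
structure Fields (E : Type*) [NormedAddCommGroup E] [InnerProductSpace ℝ E] where
  /-- solid displacement -/
  u : E → ℝ → E
  /-- fluid velocity -/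
  v : E → ℝ → E
  /-- pore pressure -/
  p : E → ℝ → ℝ
  /-- multiplier on the interface -/
  q : E → ℝ → ℝ

namespace Fields

variable (M : Mixture E) (Z : Fields E)

/-- The motion of the solid at time `t`. -/
def chi (t : ℝ) (X : E) : E := X + Z.u X t

/-- The deformation gradient `F` of the solid. -/
def defGrad (t : ℝ) (X : E) : Tensor E := fderiv ℝ (Z.chi t) X

/-- The inverse `F⁻¹`. -/
def defGradInv (t : ℝ) (X : E) : Tensor E := (Z.defGrad t X).inverse

/-- The Jacobian `J = det F`. -/
def jac (t : ℝ) (X : E) : ℝ := (Z.defGrad t X).det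

/-- The current configuration `B(t)`. -/
def body (t : ℝ) : Set E := Z.chi t '' M.B

/-- The current interface `S(t)`. -/
def surface (t : ℝ) : Set E := Z.chi t '' M.S

/-- The Eulerian representation `f ∘ χ⁻¹` of a field `f` given on the reference configuration. -/
def eulerian {V : Type*} (t : ℝ) (f : E → V) (x : E) : V :=
  f (Function.invFunOn (Z.chi t) M.B x)

/-- The solid velocity. -/
def vs (t : ℝ) (X : E) : E := deriv (fun τ => Z.chi τ X) t

/-- The solid acceleration. -/
def as (t : ℝ) (X : E) : E := deriv (fun τ => Z.vs τ X) t

/-- The fluid velocity at time `t`. -/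
def vf (t : ℝ) (X : E) : E := Z.v X t

/-- The velocity of the fluid relative to the solid. -/
def vrel (t : ℝ) (X : E) : E := Z.vf t X - Z.vs t X

/-- The gradient with respect to the current position of a field given on the reference
configuration (chain rule: `∇ₓ f = (∇_X f) F⁻¹`). -/
def grad {V : Type*} [NormedAddCommGroup V] [NormedSpace ℝ V] (t : ℝ) (f : E → V) (X : E) :
    E →L[ℝ] V :=
  (fderiv ℝ f X) ∘L (Z.defGradInv t X)

/-- The spatial gradient of a scalar field, as a vector: `F⁻ᵀ ∇_X f`. -/
def gradScalar (t : ℝ) (f : E → ℝ) (X : E) : E :=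
  transpose (Z.defGradInv t X) (gradient f X)

/-- The spatial divergence of a vector field. -/
def divVec (t : ℝ) (f : E → E) (X : E) : ℝ := tr (Z.grad t f X)

/-- The spatial divergence of a tensor field, `(div A)ᵢ = ∑ⱼ ∂Aᵢⱼ/∂xⱼ`. -/
def divTensor (t : ℝ) (f : E → Tensor E) (X : E) : E :=
  ∑ j : Fin (Module.finrank ℝ E), (Z.grad t f X (basisVec j)) (basisVec j)

/-- The fluid acceleration: the derivative of the fluid velocity along the motion of the fluid. At a
fixed point of the solid's reference configuration it is `∂ₜ v + (∇ₓ v) (v - vₛ)`, since the fluid moves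
relative to that point with velocity `v - vₛ`. -/
def af (t : ℝ) (X : E) : E :=
  deriv (fun τ => Z.v X τ) t + Z.grad t (Z.vf t) X (Z.vrel t X)

/-- Velocity gradient of the solid. -/
def Ls (t : ℝ) (X : E) : Tensor E := Z.grad t (Z.vs t) X

/-- Velocity gradient of the fluid. -/
def Lf (t : ℝ) (X : E) : Tensor E := Z.grad t (Z.vf t) X

/-- Rate of strain of the solid. -/
def Ds (t : ℝ) (X : E) : Tensor E := symPart (Z.Ls t X)

/-- Rate of strain of the fluid. -/
def Df (t : ℝ) (X : E) : Tensor E := symPart (Z.Lf t X)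

/-- `J F⁻ᵀ ν`: image of the oriented area element with referential unit normal `ν`. -/
def areaVec (t : ℝ) (ν X : E) : E := Z.jac t X • transpose (Z.defGradInv t X) ν

/-- The unit normal to the current interface. -/
def normal (t : ℝ) (ν X : E) : E := ‖Z.areaVec t ν X‖⁻¹ • Z.areaVec t ν X

/-! ### Volume fractions, constitutive equations -/

/-- Volume fraction of the solid, `φₛ = φ_R / J` (balance of mass of the solid). -/
def phiS (t : ℝ) (X : E) : ℝ := M.phiR X / Z.jac t X

/-- Volume fraction of the fluid (saturation condition). -/
def phiF (t : ℝ) (X : E) : ℝ := 1 - Z.phiS M t X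

/-- Mass density of the solid in the mixture. -/
def densS (t : ℝ) (X : E) : ℝ := M.rhoS * Z.phiS M t X

/-- Mass density of the fluid in the mixture. -/
def densF (t : ℝ) (X : E) : ℝ := M.rhoF * Z.phiF M t X

/-- Filtration velocity. -/
def vflt (t : ℝ) (X : E) : E := Z.phiF M t X • Z.vrel t X

/-- Kinetic energy density of the solid. -/
def kS (t : ℝ) (X : E) : ℝ := 1 / 2 * Z.densS M t X * ‖Z.vs t X‖ ^ 2

/-- Kinetic energy density of the fluid. -/
def kF (t : ℝ) (X : E) : ℝ := 1 / 2 * Z.densF M t X * ‖Z.vf t X‖ ^ 2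

/-- The right Cauchy-Green tensor `C = Fᵀ F`. -/
def rightCG (t : ℝ) (X : E) : Tensor E := transpose (Z.defGrad t X) ∘L Z.defGrad t X

end Fields

/-- The strain energy of the pure solid as a function of the whole tensor `C`, through its isochoric
part `(det C)^(-1/3) C = J^(-2/3) C`. -/
def Mixture.strainEnergy (M : Mixture E) (X : E) (C : Tensor E) : ℝ :=
  M.Psi (C.det ^ (-(1 / 3) : ℝ) • C) X

/-- The derivative of the strain energy with respect to the symmetric tensor `C`: the symmetric tensor
`G` with `DΨ(C)[H] = G : H` for all symmetric `H`. -/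
def Mixture.strainEnergyDeriv (M : Mixture E) (X : E) (C : Tensor E) : Tensor E :=
  ∑ i : Fin (Module.finrank ℝ E), ∑ j : Fin (Module.finrank ℝ E),
    lineDeriv ℝ (M.strainEnergy X) C (symPart (dyad (basisVec i) (basisVec j))) •
    dyad (basisVec i) (basisVec j)

namespace Fields

variable (M : Mixture E) (Z : Fields E)

/-- Strain energy of the mixture per unit current volume, `ψₛ = J⁻¹ φ_R Ψ̂ₛ`. -/
def psiS (t : ℝ) (X : E) : ℝ :=
  (Z.jac t X)⁻¹ * (M.phiR X * M.strainEnergy X (Z.rightCG t X))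

/-- Elastic Cauchy stress `2 φ_R J⁻¹ F (∂Ψ̂ₛ/∂C) Fᵀ`. -/
def stressElastic (t : ℝ) (X : E) : Tensor E :=
  (2 * M.phiR X * (Z.jac t X)⁻¹) •
    (Z.defGrad t X ∘L M.strainEnergyDeriv X (Z.rightCG t X) ∘L transpose (Z.defGrad t X))

/-- Viscous stress of the solid. -/
def stressViscS (t : ℝ) (X : E) : Tensor E := (2 * M.muB X t) • (Z.Ds t X - Z.Df t X)

/-- Viscous stress of the fluid. -/
def stressViscF (t : ℝ) (X : E) : Tensor E :=
  (2 * M.muF X t) • Z.Df t X + (2 * M.muB X t) • (Z.Df t X - Z.Ds t X)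

/-- Cauchy stress of the solid. -/
def stressS (t : ℝ) (X : E) : Tensor E :=
  -((Z.phiS M t X * Z.p X t) • ContinuousLinearMap.id ℝ E) + Z.stressElastic M t X +
    Z.stressViscS M t X

/-- Cauchy stress of the fluid. -/
def stressF (t : ℝ) (X : E) : Tensor E :=
  -((Z.phiF M t X * Z.p X t) • ContinuousLinearMap.id ℝ E) + Z.stressViscF M t X

/-- Drag force on the fluid. -/
def drag (t : ℝ) (X : E) : E :=
  -((M.muD X t * Z.phiF M t X ^ 2 / M.kappa X t) • Z.vrel t X)

/-- Interaction force on the fluid. -/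
def interaction (t : ℝ) (X : E) : E :=
  Z.p X t • Z.gradScalar t (Z.phiF M t) X + Z.drag M t X

/-- Rate of dissipation per unit current volume. -/
def dissipation (t : ℝ) (X : E) : ℝ :=
  2 * M.muF X t * ddot (Z.Df t X) (Z.Df t X)
    + 2 * M.muB X t * ddot (Z.Df t X - Z.Ds t X) (Z.Df t X - Z.Ds t X)
    + M.muD X t * Z.phiF M t X ^ 2 / M.kappa X t * ‖Z.vrel t X‖ ^ 2

/-- The jump of the filtration velocity at the point `X` of the reference interface. -/
def jumpFlt (t : ℝ) (X : E) : E := jump (M.m X) X (Z.vflt M t)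

/-- Rate of dissipation per unit current area of the interface. -/
def surfaceDissipation (t : ℝ) (X : E) : ℝ := 1 / 2 * M.muS * ‖Z.jumpFlt M t X‖ ^ 2

/-- Density, per unit current volume, of kinetic plus strain energy. -/
def energyDensity (t : ℝ) (X : E) : ℝ := Z.kS M t X + Z.kF M t X + Z.psiS M t X

/-- Total kinetic plus strain energy. -/
def energy (t : ℝ) : ℝ := ∫ x in Z.body M t, Z.eulerian M t (Z.energyDensity M t) x

/-! ### Regularity and boundary data -/

/-- The kinematic framework: the solid motion is continuous, injective, and piecewise smooth with
positive Jacobian; the fluid velocity and the pore pressure are piecewise smooth and may jump. -/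
structure Regular : Prop where
  u_regular : PiecewiseCTime 2 M.B M.S M.m M.T Z.u
  u_continuous : ContinuousOn (fun y : E × ℝ => Z.u y.1 y.2) (M.B ×ˢ Ioo 0 M.T)
  chi_injOn : ∀ t ∈ Ioo 0 M.T, InjOn (Z.chi t) M.B
  jac_pos : ∃ c > 0, ∀ t ∈ Ioo 0 M.T, ∀ X ∈ M.B \ M.S, c ≤ Z.jac t X
  phiS_mem : ∀ t ∈ Ioo 0 M.T, ∀ X ∈ M.B \ M.S, Z.phiS M t X ∈ Icc (0 : ℝ) 1
  v_regular : PiecewiseCTime 1 M.B M.S M.m M.T Z.v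
  p_regular : ∀ t ∈ Ioo 0 M.T, PiecewiseC 1 M.B M.S M.m fun X => Z.p X t
  q_continuous : ∀ t ∈ Ioo 0 M.T, ContinuousOn (fun X => Z.q X t) M.S
  q_bounded : ∀ t ∈ Ioo 0 M.T, ∃ c : ℝ, ∀ X ∈ M.S, |Z.q X t| ≤ c

/-- Homogeneous Dirichlet data for the solid displacement and the fluid velocity. -/
structure ZeroBoundaryData : Prop where
  u_zero : ∀ t ∈ Ioo 0 M.T, VanishesOnBoundary M.B M.S fun X => Z.u X t
  v_zero : ∀ t ∈ Ioo 0 M.T, VanishesOnBoundary M.B M.S fun X => Z.v X t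

end Fields

/-! ### Test functions and variational equations -/

/-- Test functions for the solid motion: continuous across the interface. -/
structure IsSolidTest (M : Mixture E) (a : E → E) : Prop where
  regular : PiecewiseC 1 M.B M.S M.m a
  continuous : ContinuousOn a M.B
  boundary : VanishesOnBoundary M.B M.S a

/-- Test functions for the fluid motion: arbitrary jumps across the interface are allowed. -/
structure IsFluidTest (M : Mixture E) (b : E → E) : Prop where
  regular : PiecewiseC 1 M.B M.S M.m b
  boundary : VanishesOnBoundary M.B M.S b

/-- Test functions for the interface multiplier. -/
structure IsSurfaceTest (M : Mixture E) (r : E → ℝ) : Prop where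
  continuous : ContinuousOn r M.S
  bounded : ∃ c : ℝ, ∀ X ∈ M.S, |r X| ≤ c

namespace Fields

variable (M : Mixture E) (Z : Fields E)

/-- The Hamilton-Rayleigh functional at time `t` without body forces, for the variations
`a = δχₛ` and `b = F F_sf⁻¹ δχ_sf`. -/
def hamiltonForm (t : ℝ) (a b : E → E) : ℝ :=
  (∫ X in M.B, Z.jac t X *
      ⟪Z.densS M t X • Z.as t X + Z.densF M t X • Z.af t X
        - Z.divTensor t (fun Y => Z.stressS M t Y + Z.stressF M t Y) X, a X⟫_ℝ)
  - (∫ X in M.B, Z.jac t X *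
      ⟪Z.densF M t X • Z.af t X - Z.divTensor t (Z.stressF M t) X - Z.interaction M t X, b X⟫_ℝ)
  + (∫ X in M.S,
      ⟪jump (M.m X) X (fun Y =>
        (Z.densF M t Y • dyad (Z.vrel t Y) (Z.vrel t Y) - Z.stressS M t Y - Z.stressF M t Y)
          (Z.areaVec t (M.m X) Y)), a X⟫_ℝ ∂μHE[2])
  + (∫ X in M.S,
      jump (M.m X) X (fun Y =>
        ⟪(Z.kF M t Y • ContinuousLinearMap.id ℝ E
          - Z.densF M t Y • dyad (Z.vf t Y) (Z.vrel t Y)) (Z.areaVec t (M.m X) Y), b Y⟫_ℝ) ∂μHE[2])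
  + (∫ X in M.S,
      jump (M.m X) X (fun Y =>
        ⟪((Z.phiF M t Y * Z.q X t) • ContinuousLinearMap.id ℝ E + Z.stressF M t Y
          - (1 / 2 * Z.phiF M t Y * M.muS) • dyad (Z.jumpFlt M t X) (Z.normal t (M.m X) Y))
            (Z.areaVec t (M.m X) Y), b Y⟫_ℝ) ∂μHE[2])

/-- The fields solve at time `t` the variational equation of the Hamilton-Rayleigh principle, whose
stresses are differentiable on each side of the interface, together with the two constraints that go
with the multipliers: the volume average velocity `vₛ + v_flt` is solenoidal away from the interface,
and the normal component of the filtration velocity is continuous across it. -/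
structure SolvesHamilton (t : ℝ) : Prop where
  stressS_regular : PiecewiseC 1 M.B M.S M.m (Z.stressS M t)
  stressF_regular : PiecewiseC 1 M.B M.S M.m (Z.stressF M t)
  solenoidal : ∀ X ∈ M.B \ M.S, Z.divVec t (fun Y => Z.vs t Y + Z.vflt M t Y) X = 0
  normal_jump : ∀ X ∈ M.S,
    jump (M.m X) X (fun Y => ⟪Z.vflt M t Y, Z.areaVec t (M.m X) Y⟫_ℝ) = 0
  equation : ∀ a b : E → E, IsSolidTest M a → IsFluidTest M b → Z.hamiltonForm M t a b = 0

/-- The mixed weak formulation at time `t` without body forces, for the test functions `a` (solid),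
`b` (fluid), `π` (pore pressure) and `r` (interface multiplier). There is no integral over the external
boundary, because the velocities vanish there. -/
def weakForm (t : ℝ) (a b : E → E) (π r : E → ℝ) : ℝ :=
  (∫ X in M.B, Z.jac t X *
      ⟪Z.densS M t X • Z.as t X + Z.densF M t X • Z.af t X
        + Z.gradScalar t (fun Y => Z.p Y t) X, a X⟫_ℝ)
  + (∫ X in M.B, Z.jac t X *
      ddot ((Z.stressElastic M t X + Z.stressViscS M t X + Z.stressViscF M t X)
        ∘L transpose (Z.defGradInv t X)) (fderiv ℝ a X))
  + (∫ X in M.B, Z.jac t X *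
      (⟪Z.densF M t X • Z.af t X + Z.phiF M t X • Z.gradScalar t (fun Y => Z.p Y t) X
          - Z.drag M t X, b X⟫_ℝ
        + ddot (Z.stressViscF M t X ∘L transpose (Z.defGradInv t X)) (fderiv ℝ b X)))
  + (∫ X in M.S,
      ⟪jump (M.m X) X (fun Y =>
        (Z.densF M t Y • dyad (Z.vrel t Y) (Z.vrel t Y)
          + Z.p Y t • ContinuousLinearMap.id ℝ E) (Z.areaVec t (M.m X) Y)), a X⟫_ℝ ∂μHE[2])
  - (∫ X in M.S,
      jump (M.m X) X (fun Y =>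
        ⟪(Z.kF M t Y • ContinuousLinearMap.id ℝ E
          - Z.densF M t Y • dyad (Z.vf t Y) (Z.vrel t Y)) (Z.areaVec t (M.m X) Y), b Y⟫_ℝ) ∂μHE[2])
  - (∫ X in M.S,
      jump (M.m X) X (fun Y =>
        ⟪((Z.phiF M t Y * (Z.q X t - Z.p Y t)) • ContinuousLinearMap.id ℝ E
          - (1 / 2 * Z.phiF M t Y * M.muS) • dyad (Z.jumpFlt M t X) (Z.normal t (M.m X) Y))
            (Z.areaVec t (M.m X) Y), b Y⟫_ℝ) ∂μHE[2])
  - (∫ X in M.B, Z.jac t X * ⟪Z.vs t X + Z.vflt M t X, Z.gradScalar t π X⟫_ℝ)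
  - (∫ X in M.S,
      jump (M.m X) X (fun Y =>
        ⟪π Y • (Z.vs t Y + Z.vflt M t Y), Z.areaVec t (M.m X) Y⟫_ℝ) ∂μHE[2])
  + (∫ X in M.S,
      r X * jump (M.m X) X (fun Y => ⟪Z.vflt M t Y, Z.areaVec t (M.m X) Y⟫_ℝ) ∂μHE[2])

/-- The fields solve the mixed weak formulation at time `t`. -/
def SolvesWeak (t : ℝ) : Prop :=
  ∀ (a b : E → E) (π r : E → ℝ), IsSolidTest M a → IsFluidTest M b →
    PiecewiseC 1 M.B M.S M.m π → IsSurfaceTest M r → Z.weakForm M t a b π r = 0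

end Fields

end PermeableInterface

end

open MeasureTheory Set Filter Topology

open scoped InnerProductSpace

set_option linter.unusedSectionVars false

noncomputable section

namespace PermeableInterface

variable {E : Type*} [NormedAddCommGroup E] [InnerProductSpace ℝ E] [FiniteDimensional ℝ E]
  [CompleteSpace E] [MeasurableSpace E] [BorelSpace E]

/-! ### Geometry of defining functions and interfaces -/

section Interface

variable {B S U U' : Set E} {m : E → E} {ℓ ℓ' : E → ℝ} {X : E}

namespace IsDefining

/-! The weak form is tested with the solution itself: `a = v_s`, `b = w = v_f - v_s`, `π = p +
½ρ_F|v_f|²` and `r = 𝔭 + ρ_F|v_s|²`. The first two tests add up to `v_f`, so the fluid inertia is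
paired with the full fluid velocity. The kinetic term in `π` is a Bernoulli pressure: through the
volume constraint it removes the convective part of the fluid acceleration. In the bulk
(`weak_integrand`) what remains is the rate of the energy per unit reference volume, plus the
dissipation, minus `J div(k v_s)` with `k = ½ρ_F|v_f|²`. On the interface (`weak_surface`) all
pressures and multipliers cancel. So do the kinetic terms carried by the filtration flux, because
`w·v_s + v_f·w - |v_f|² = -|v_s|²`. What remains is the interfacial dissipation minus `⟦k v_s·N⟧`.
The two leftover terms cancel by the divergence theorem (`weakForm_velocities`).

The power thus obtained is the derivative of the energy. Pulled back to the fixed set `B \ S`, the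
energy has an integrand with uniformly bounded time derivative, so one may differentiate under the
integral (`hasDerivAt_energy`); there the identities `J' = J tr L_s`, `∂ₜF = ∇v_s` and `J T_e : L_s
= φ_R ∂ₜΨ̂` enter.

The Hamilton–Rayleigh form reduces to the weak form by integration by parts with `b` replaced by
`-b` (`weakForm_eq_hamiltonForm`): the two forms differ by three divergences, and each is balanced
by a jump integral.

The analytic work lies in the divergence theorem on a bounded open set with no regularity of its
boundary, for fields that vanish there and jump across `S` (`integral_fderiv_of_boundary`). Near the
surface it follows from integration by parts against a smoothed Heaviside function of the defining
function, then from a change of variables that flattens the surface. The limiting plane integral is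
carried back to the surface by an area formula for `μHE[2]` (`measure_image_interface`), which also
transports surface integrals by `χ_t`. The Piola transform (`tr_fderiv_piola`) moves the theorem to
the current configuration. Hadamard's compatibility condition together with Nanson's formula
(`areaVec_sides`) shows that `N` is the same from both sides of `S`. -/

lemma mono (h : IsDefining S m U ℓ) (hV : IsOpen U') (hVU : U' ⊆ U) : IsDefining S m U' ℓ where
  isOpen := hV
  contDiffOn := h.contDiffOn.mono hVU
  gradient_ne_zero Y hY := h.gradient_ne_zero Y (hVU hY)
  mem_iff Y hY := h.mem_iff Y (hVU hY)
  normal_eq Y hY := h.normal_eq Y (hVU hY)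

lemma contDiffAt (h : IsDefining S m U ℓ) (hX : X ∈ U) : ContDiffAt ℝ 1 ℓ X :=
  h.contDiffOn.contDiffAt (h.isOpen.mem_nhds hX)

lemma differentiableAt (h : IsDefining S m U ℓ) (hX : X ∈ U) : DifferentiableAt ℝ ℓ X :=
  (h.contDiffAt hX).differentiableAt one_ne_zero

lemma continuousOn_fderiv (h : IsDefining S m U ℓ) : ContinuousOn (fderiv ℝ ℓ) U :=
  h.contDiffOn.continuousOn_fderiv_of_isOpen h.isOpen le_rfl

lemma continuousOn_gradient (h : IsDefining S m U ℓ) : ContinuousOn (gradient ℓ) U :=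
  (InnerProductSpace.toDual ℝ E).symm.continuous.comp_continuousOn h.continuousOn_fderiv

lemma norm_normal (h : IsDefining S m U ℓ) (hX : X ∈ U) (hS : X ∈ S) : ‖m X‖ = 1 := by
  rw [h.normal_eq X hX hS, norm_smul, norm_inv, norm_norm,
    inv_mul_cancel₀ (norm_ne_zero_iff.2 (h.gradient_ne_zero X hX))]

lemma gradient_eq (h : IsDefining S m U ℓ) (hX : X ∈ U) (hS : X ∈ S) :
    gradient ℓ X = ‖gradient ℓ X‖ • m X := by
  rw [h.normal_eq X hX hS, smul_smul,
    mul_inv_cancel₀ (norm_ne_zero_iff.2 (h.gradient_ne_zero X hX)), one_smul]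

lemma fderiv_apply (h : IsDefining S m U ℓ) (hX : X ∈ U) (hS : X ∈ S) (e : E) :
    fderiv ℝ ℓ X e = ‖gradient ℓ X‖ * ⟪m X, e⟫_ℝ := by
  rw [← inner_gradient_left]
  conv_lhs => rw [h.gradient_eq hX hS]
  rw [real_inner_smul_left]

lemma fderiv_normal_pos (h : IsDefining S m U ℓ) (hX : X ∈ U) (hS : X ∈ S) :
    0 < fderiv ℝ ℓ X (m X) := by
  rw [h.fderiv_apply hX hS, real_inner_self_eq_norm_sq, h.norm_normal hX hS]
  simpa using norm_pos_iff.2 (h.gradient_ne_zero X hX)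

lemma continuousOn_normal (h : IsDefining S m U ℓ) : ContinuousOn m (S ∩ U) := by
  refine ContinuousOn.congr (f := fun Y => ‖gradient ℓ Y‖⁻¹ • gradient ℓ Y) ?_
    fun Y hY => h.normal_eq Y hY.2 hY.1
  have hc := h.continuousOn_gradient.mono (inter_subset_right : S ∩ U ⊆ U)
  exact (hc.norm.inv₀ fun Y hY => norm_ne_zero_iff.2 (h.gradient_ne_zero Y hY.2)).smul hc

lemma exists_ball_fderiv_pos (h : IsDefining S m U ℓ) (hX : X ∈ U) (hS : X ∈ S) :
    ∃ r > 0, Metric.ball X r ⊆ U ∧ ∀ Y ∈ Metric.ball X r, 0 < fderiv ℝ ℓ Y (m X) := by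
  have hc : ContinuousAt (fun Y => fderiv ℝ ℓ Y (m X)) X :=
    (h.continuousOn_fderiv.continuousAt (h.isOpen.mem_nhds hX)).clm_apply continuousAt_const
  have h1 : ∀ᶠ Y in 𝓝 X, Y ∈ U ∧ 0 < fderiv ℝ ℓ Y (m X) :=
    Filter.Eventually.and (h.isOpen.mem_nhds hX) (hc.eventually (lt_mem_nhds (h.fderiv_normal_pos hX hS)))
  obtain ⟨r, hr, hb⟩ := Metric.eventually_nhds_iff_ball.1 h1
  exact ⟨r, hr, fun Y hY => (hb Y hY).1, fun Y hY => (hb Y hY).2⟩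

end IsDefining

/-- Convexity of the ball keeps the whole segment in it, where the derivative of `ℓ` along `n` is
positive. With `n` the normal at `X`, this fixes the sign of `ℓ` at points reached from the surface
along the normal. -/
lemma strictMonoOn_line {r : ℝ} {n : E} (hd : ∀ Y ∈ Metric.ball X r, DifferentiableAt ℝ ℓ Y)
    (hp : ∀ Y ∈ Metric.ball X r, 0 < fderiv ℝ ℓ Y n) {Y : E} {s : ℝ} (hs : 0 < s)
    (hY : Y ∈ Metric.ball X r) (hYs : Y + s • n ∈ Metric.ball X r) : ℓ Y < ℓ (Y + s • n) := by
  have hmem : ∀ u ∈ Icc 0 s, Y + u • n ∈ Metric.ball X r := by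
    intro u hu
    have := (convex_ball X r).add_smul_sub_mem hY hYs
      (t := u / s) ⟨div_nonneg hu.1 hs.le, (div_le_one hs).2 hu.2⟩
    simpa [smul_smul, div_mul_cancel₀ _ hs.ne'] using this
  have hder : ∀ u ∈ Icc 0 s, HasDerivAt (fun u : ℝ => ℓ (Y + u • n)) (fderiv ℝ ℓ (Y + u • n) n) u := by
    intro u hu
    have h1 : HasDerivAt (fun u : ℝ => Y + u • n) n u := by
      simpa using ((hasDerivAt_id u).smul_const n).const_add Y
    exact (hd _ (hmem u hu)).hasFDerivAt.comp_hasDerivAt u h1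
  have hmono : StrictMonoOn (fun u : ℝ => ℓ (Y + u • n)) (Icc 0 s) := by
    refine strictMonoOn_of_deriv_pos (convex_Icc 0 s)
      (fun u hu => (hder u hu).continuousAt.continuousWithinAt) fun u hu => ?_
    rw [interior_Icc] at hu
    rw [(hder u (Ioo_subset_Icc_self hu)).deriv]
    exact hp _ (hmem u (Ioo_subset_Icc_self hu))
  simpa using hmono (left_mem_Icc.2 hs.le) (right_mem_Icc.2 hs.le) hs

namespace IsDefining

lemma eventually_normal_pos (h : IsDefining S m U ℓ) (hX : X ∈ U) (hS : X ∈ S) :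
    ∀ᶠ s in 𝓝[>] (0 : ℝ), X + s • m X ∈ U ∧ 0 < ℓ (X + s • m X) := by
  obtain ⟨r, hr, hU, hp⟩ := h.exists_ball_fderiv_pos hX hS
  filter_upwards [Ioo_mem_nhdsGT hr] with s hs
  have hb : X + s • m X ∈ Metric.ball X r := by
    simpa [norm_smul, h.norm_normal hX hS, abs_of_pos hs.1] using hs.2
  refine ⟨hU hb, ?_⟩
  have := strictMonoOn_line (fun Y hY => h.differentiableAt (hU hY)) hp hs.1
    (Metric.mem_ball_self hr) hb
  rwa [(h.mem_iff X hX).1 hS] at this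

lemma eventually_normal_neg (h : IsDefining S m U ℓ) (hX : X ∈ U) (hS : X ∈ S) :
    ∀ᶠ s in 𝓝[>] (0 : ℝ), X + s • (-m X) ∈ U ∧ ℓ (X + s • (-m X)) < 0 := by
  obtain ⟨r, hr, hU, hp⟩ := h.exists_ball_fderiv_pos hX hS
  filter_upwards [Ioo_mem_nhdsGT hr] with s hs
  have hb : X + s • (-m X) ∈ Metric.ball X r := by
    simpa [norm_smul, h.norm_normal hX hS, abs_of_pos hs.1] using hs.2
  refine ⟨hU hb, ?_⟩
  have := strictMonoOn_line (fun Y hY => h.differentiableAt (hU hY)) hp hs.1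
    (Y := X + s • (-m X)) hb (by simpa using hr)
  simpa [(h.mem_iff X hX).1 hS] using this

/-- A point with `ℓ > 0`, moved against the normal, meets `S` before `ℓ` turns negative. The way
back from the meeting point runs along the normal, and there `ℓ'` increases from zero. -/
lemma eventually_pos_imp (h : IsDefining S m U ℓ) (h' : IsDefining S m U' ℓ') (hX : X ∈ U)
    (hX' : X ∈ U') (hS : X ∈ S) : ∀ᶠ Y in 𝓝 X, 0 < ℓ Y → 0 < ℓ' Y := by
  obtain ⟨r₁, hr₁, hU₁, hp₁⟩ := h.exists_ball_fderiv_pos hX hS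
  obtain ⟨r₂, hr₂, hU₂, hp₂⟩ := h'.exists_ball_fderiv_pos hX' hS
  set r := min r₁ r₂
  have hr : 0 < r := lt_min hr₁ hr₂
  have hb₁ : Metric.ball X r ⊆ Metric.ball X r₁ := Metric.ball_subset_ball (min_le_left _ _)
  have hb₂ : Metric.ball X r ⊆ Metric.ball X r₂ := Metric.ball_subset_ball (min_le_right _ _)
  have hn := h.norm_normal hX hS
  -- One shift `s < r/2` serves for all `Y` near `X`: by continuity it brings them to the negative
  -- side, and from the ball of radius `r/2` it does not leave the ball of radius `r`.
  obtain ⟨s, ⟨hsU, hsneg⟩, hs⟩ :=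
    ((h.eventually_normal_neg hX hS).and (Ioo_mem_nhdsGT (half_pos hr))).exists
  have hcont : ContinuousAt (fun Y => ℓ (Y + s • (-m X))) X :=
    ContinuousAt.comp (g := ℓ) (f := fun Y => Y + s • (-m X))
      (h.differentiableAt hsU).continuousAt (by fun_prop)
  filter_upwards [hcont.eventually (gt_mem_nhds hsneg), Metric.ball_mem_nhds X (half_pos hr)]
    with Y hY hYr hpos
  have hin : ∀ u ∈ Icc 0 s, Y + u • (-m X) ∈ Metric.ball X r := by
    intro u hu
    rw [Metric.mem_ball, dist_eq_norm] at hYr ⊢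
    calc ‖Y + u • (-m X) - X‖ = ‖(Y - X) + u • (-m X)‖ := by congr 1; abel
      _ ≤ ‖Y - X‖ + ‖u • (-m X)‖ := norm_add_le _ _
      _ = ‖Y - X‖ + u := by rw [norm_smul, norm_neg, hn, Real.norm_of_nonneg hu.1, mul_one]
      _ < r := by linarith [hu.2, hs.2]
  have hcts : ContinuousOn (fun u : ℝ => ℓ (Y + u • (-m X))) (Icc 0 s) := by
    intro u hu
    refine ContinuousAt.continuousWithinAt ?_
    exact ContinuousAt.comp (g := ℓ) (f := fun u : ℝ => Y + u • (-m X))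
      (h.differentiableAt (hU₁ (hb₁ (hin u hu)))).continuousAt (by fun_prop)
  obtain ⟨u, hu, hu0⟩ := intermediate_value_Icc' hs.1.le hcts
    (show (0 : ℝ) ∈ Icc _ _ from ⟨hY.le, by simpa using hpos.le⟩)
  have hZ := hin u hu
  have hZS : Y + u • (-m X) ∈ S := (h.mem_iff _ (hU₁ (hb₁ hZ))).2 hu0
  have hu_pos : 0 < u := by
    rcases hu.1.eq_or_lt with h0 | h0
    · subst h0; simp at hu0; linarith
    · exact h0
  have hYb : Y ∈ Metric.ball X r := by simpa using hin 0 ⟨le_rfl, hs.1.le⟩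
  have := strictMonoOn_line (fun Y hY => h'.differentiableAt (hU₂ hY)) hp₂ hu_pos
    (Y := Y + u • (-m X)) (hb₂ hZ) (by simpa using hb₂ hYb)
  rw [(h'.mem_iff _ (hU₂ (hb₂ hZ))).1 hZS] at this
  simpa using this

/-- Two defining functions of the same oriented surface have the same sign near the surface. -/
lemma eventually_sign (h : IsDefining S m U ℓ) (h' : IsDefining S m U' ℓ') (hX : X ∈ U)
    (hX' : X ∈ U') (hS : X ∈ S) :
    ∀ᶠ Y in 𝓝 X, (0 < ℓ Y → 0 < ℓ' Y) ∧ (ℓ Y < 0 → ℓ' Y < 0) := by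
  filter_upwards [h.eventually_pos_imp h' hX hX' hS, h'.eventually_pos_imp h hX' hX hS,
    h.isOpen.mem_nhds hX, h'.isOpen.mem_nhds hX'] with Y h1 h2 hU hU'
  refine ⟨h1, fun hneg => ?_⟩
  rcases lt_trichotomy (ℓ' Y) 0 with h0 | h0 | h0
  · exact h0
  · have := (h.mem_iff Y hU).1 ((h'.mem_iff Y hU').2 h0)
    linarith
  · linarith [h2 h0]

end IsDefining

lemma IsInterface.norm_normal (h : IsInterface B S m) (hX : X ∈ S) : ‖m X‖ = 1 := by
  obtain ⟨U, ℓ, hXU, -, hd⟩ := h.locally_level X hX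
  exact hd.norm_normal hXU hX

lemma IsInterface.continuousOn_normal (h : IsInterface B S m) : ContinuousOn m S := by
  intro X hX
  obtain ⟨U, ℓ, hXU, -, hd⟩ := h.locally_level X hX
  exact (hd.continuousOn_normal X ⟨hX, hXU⟩).mono_of_mem_nhdsWithin
    (inter_mem_nhdsWithin S (hd.isOpen.mem_nhds hXU))

lemma IsInterface.eq_closure_inter (h : IsInterface B S m) : S = closure S ∩ B :=
  Subset.antisymm (subset_inter subset_closure h.subset) h.closed

lemma IsInterface.measurableSet (h : IsInterface B S m) (hB : IsOpen B) : MeasurableSet S := by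
  rw [h.eq_closure_inter]
  exact isClosed_closure.measurableSet.inter hB.measurableSet

lemma IsInterface.isOpen_diff (h : IsInterface B S m) (hB : IsOpen B) : IsOpen (B \ S) := by
  have : B \ S = B ∩ (closure S)ᶜ := by
    ext X
    constructor
    · rintro ⟨h1, h2⟩
      exact ⟨h1, fun h3 => h2 (h.closed ⟨h3, h1⟩)⟩
    · rintro ⟨h1, h2⟩
      exact ⟨h1, fun h3 => h2 (subset_closure h3)⟩
  rw [this]
  exact hB.inter isClosed_closure.isOpen_compl

/-- Finite two-dimensional measure forces zero three-dimensional measure. Hence the interface never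
contributes to volume integrals. -/
lemma volume_eq_zero_of_area_lt_top (hdim : Module.finrank ℝ E = 3) {A : Set E}
    (hA : μHE[2] A < ⊤) : volume A = 0 := by
  rw [← InnerProductSpace.euclideanHausdorffMeasure_eq_volume, hdim]
  exact (Measure.euclideanHausdorffMeasure_zero_or_top (by norm_num : 2 < 3) A).resolve_right hA.ne

lemma IsInterface.finite_restrict (h : IsInterface B S m) :
    IsFiniteMeasure ((μHE[2] : Measure E).restrict S) :=
  ⟨by simpa using h.area_finite⟩

end Interface


/-! ### Calculus of piecewise smooth fields -/

section Piecewise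

variable {V W G : Type*} [NormedAddCommGroup V] [NormedSpace ℝ V] [NormedAddCommGroup W]
  [NormedSpace ℝ W] [NormedAddCommGroup G] [NormedSpace ℝ G]
  {B S U : Set E} {m : E → E} {ℓ : E → ℝ} {X : E} {n : ℕ} {f f' : E → V} {g : E → W}

namespace IsInterface

lemma eventually_mem_pos (hI : IsInterface B S m) (hX : X ∈ S) :
    ∀ᶠ s in 𝓝[>] (0 : ℝ), X + s • m X ∈ B \ S := by
  obtain ⟨U, ℓ, hXU, hUB, hd⟩ := hI.locally_level X hX
  filter_upwards [hd.eventually_normal_pos hXU hX] with s hs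
  exact ⟨hUB hs.1, fun h => hs.2.ne' ((hd.mem_iff _ hs.1).1 h)⟩

lemma eventually_mem_neg (hI : IsInterface B S m) (hX : X ∈ S) :
    ∀ᶠ s in 𝓝[>] (0 : ℝ), X + s • (-m X) ∈ B \ S := by
  obtain ⟨U, ℓ, hXU, hUB, hd⟩ := hI.locally_level X hX
  filter_upwards [hd.eventually_normal_neg hXU hX] with s hs
  exact ⟨hUB hs.1, fun h => hs.2.ne ((hd.mem_iff _ hs.1).1 h)⟩

end IsInterface

lemma tendsto_add_smul_nhds (X ν : E) : Tendsto (fun s : ℝ => X + s • ν) (𝓝[>] 0) (𝓝 X) := by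
  have : Continuous fun s : ℝ => X + s • ν := by fun_prop
  simpa using (this.tendsto 0).mono_left nhdsWithin_le_nhds

namespace PiecewiseC

lemma norm_le (hf : PiecewiseC n B S m f) : ∃ c, 0 ≤ c ∧ ∀ X ∈ B \ S, ‖f X‖ ≤ c := by
  obtain ⟨c, hc⟩ := hf.bounded 0 (Nat.zero_le n)
  exact ⟨max c 0, le_max_right _ _, fun X hX =>
    (norm_iteratedFDeriv_zero (𝕜 := ℝ) (f := f) (x := X) ▸ hc X hX).trans (le_max_left c 0)⟩

lemma norm_fderiv_le (hf : PiecewiseC 1 B S m f) :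
    ∃ c, 0 ≤ c ∧ ∀ X ∈ B \ S, ‖fderiv ℝ f X‖ ≤ c := by
  obtain ⟨c, hc⟩ := hf.bounded 1 le_rfl
  exact ⟨max c 0, le_max_right _ _, fun X hX =>
    (norm_iteratedFDeriv_one (𝕜 := ℝ) (x := X) f ▸ hc X hX).trans (le_max_left c 0)⟩

/-- Up to order one the bounds on iterated derivatives are bounds on the field and on `fderiv`.
Regularity of composite fields is established through this constructor. -/
lemma of_bounds (hn : n ≤ 1) (hc : ContDiffOn ℝ n f (B \ S))
    (h0 : ∃ c : ℝ, ∀ X ∈ B \ S, ‖f X‖ ≤ c)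
    (h1 : n = 1 → ∃ c : ℝ, ∀ X ∈ B \ S, ‖fderiv ℝ f X‖ ≤ c)
    (hs : ∀ X ∈ S, ∃ (U : Set E) (ℓ : E → ℝ) (g₁ g₂ : E → V),
      X ∈ U ∧ U ⊆ B ∧ IsDefining S m U ℓ ∧ ContDiffOn ℝ n g₁ U ∧ ContDiffOn ℝ n g₂ U ∧
        ∀ Y ∈ U, (0 < ℓ Y → f Y = g₁ Y) ∧ (ℓ Y < 0 → f Y = g₂ Y)) : PiecewiseC n B S m f where
  contDiffOn := hc
  bounded k hk := by
    rcases Nat.le_one_iff_eq_zero_or_eq_one.1 (hk.trans hn) with rfl | rfl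
    · simpa only [norm_iteratedFDeriv_zero] using h0
    · simpa only [norm_iteratedFDeriv_one] using h1 (le_antisymm hn hk)
  sides := hs

/-- The one-sided extensions can be taken with respect to any given defining function. -/
lemma exists_sides (hf : PiecewiseC n B S m f) (hX : X ∈ S) (hd : IsDefining S m U ℓ)
    (hXU : X ∈ U) : ∃ (U' : Set E) (g₁ g₂ : E → V),
      X ∈ U' ∧ U' ⊆ U ∧ U' ⊆ B ∧ IsOpen U' ∧ ContDiffOn ℝ n g₁ U' ∧ ContDiffOn ℝ n g₂ U' ∧
        ∀ Y ∈ U', (0 < ℓ Y → f Y = g₁ Y) ∧ (ℓ Y < 0 → f Y = g₂ Y) := by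
  obtain ⟨U₁, ℓ₁, g₁, g₂, hX₁, hB₁, hd₁, hg₁, hg₂, hs⟩ := hf.sides X hX
  have hev : ∀ᶠ Y in 𝓝 X, (Y ∈ U ∧ Y ∈ U₁) ∧ ((0 < ℓ Y → 0 < ℓ₁ Y) ∧ (ℓ Y < 0 → ℓ₁ Y < 0)) :=
    (Filter.Eventually.and (hd.isOpen.mem_nhds hXU) (hd₁.isOpen.mem_nhds hX₁)).and
      (hd.eventually_sign hd₁ hXU hX₁ hX)
  obtain ⟨U', hU', ho, hXU'⟩ := eventually_nhds_iff.1 hev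
  exact ⟨U', g₁, g₂, hXU', fun Y hY => (hU' Y hY).1.1, fun Y hY => hB₁ (hU' Y hY).1.2, ho,
    hg₁.mono fun Y hY => (hU' Y hY).1.2, hg₂.mono fun Y hY => (hU' Y hY).1.2,
    fun Y hY => ⟨fun h => (hs Y (hU' Y hY).1.2).1 ((hU' Y hY).2.1 h),
      fun h => (hs Y (hU' Y hY).1.2).2 ((hU' Y hY).2.2 h)⟩⟩

/-- `B \ S` is open, so agreement there passes to all derivatives, and points with `ℓ ≠ 0` lie off
`S`. -/
lemma congr (hB : IsOpen B) (hI : IsInterface B S m) (hf : PiecewiseC n B S m f)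
    (h : ∀ X ∈ B \ S, f' X = f X) : PiecewiseC n B S m f' where
  contDiffOn := hf.contDiffOn.congr h
  bounded k hk := by
    obtain ⟨c, hc⟩ := hf.bounded k hk
    refine ⟨c, fun X hX => ?_⟩
    have : f' =ᶠ[𝓝 X] f := by
      filter_upwards [(hI.isOpen_diff hB).mem_nhds hX] with Y hY using h Y hY
    rw [this.iteratedFDeriv ℝ k |>.eq_of_nhds]
    exact hc X hX
  sides X hX := by
    obtain ⟨U, ℓ, g₁, g₂, hXU, hUB, hd, h1, h2, hs⟩ := hf.sides X hX
    refine ⟨U, ℓ, g₁, g₂, hXU, hUB, hd, h1, h2, fun Y hY => ⟨fun hp => ?_, fun hp => ?_⟩⟩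
    · rw [h Y ⟨hUB hY, fun hS => hp.ne' ((hd.mem_iff Y hY).1 hS)⟩, (hs Y hY).1 hp]
    · rw [h Y ⟨hUB hY, fun hS => hp.ne ((hd.mem_iff Y hY).1 hS)⟩, (hs Y hY).2 hp]

lemma of_one (hf : PiecewiseC 1 B S m f) : PiecewiseC 0 B S m f where
  contDiffOn := hf.contDiffOn.of_le (by simp)
  bounded k hk := hf.bounded k (hk.trans zero_le_one)
  sides X hX := by
    obtain ⟨U, ℓ, g₁, g₂, hXU, hUB, hd, h1, h2, hs⟩ := hf.sides X hX
    exact ⟨U, ℓ, g₁, g₂, hXU, hUB, hd, h1.of_le (by simp), h2.of_le (by simp), hs⟩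

lemma continuousOn (hf : PiecewiseC n B S m f) : ContinuousOn f (B \ S) := hf.contDiffOn.continuousOn

lemma differentiableAt (hB : IsOpen B) (hI : IsInterface B S m) (hf : PiecewiseC 1 B S m f)
    (hX : X ∈ B \ S) : DifferentiableAt ℝ f X :=
  (hf.contDiffOn.contDiffAt ((hI.isOpen_diff hB).mem_nhds hX)).differentiableAt (by simp)

lemma prodMk (hn : n ≤ 1) (hB : IsOpen B) (hI : IsInterface B S m) (hf : PiecewiseC n B S m f)
    (hg : PiecewiseC n B S m g) : PiecewiseC n B S m fun X => (f X, g X) := by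
  obtain ⟨c, hc0, hc⟩ := hf.norm_le
  obtain ⟨d, hd0, hd⟩ := hg.norm_le
  refine of_bounds hn (hf.contDiffOn.prodMk hg.contDiffOn)
    ⟨max c d, fun X hX => max_le_max (hc X hX) (hd X hX)⟩ ?_ ?_
  · rintro rfl
    obtain ⟨c, hc0, hc⟩ := hf.norm_fderiv_le
    obtain ⟨d, hd0, hd⟩ := hg.norm_fderiv_le
    refine ⟨max c d, fun X hX => ?_⟩
    rw [(hf.differentiableAt hB hI hX).fderiv_prodMk (hg.differentiableAt hB hI hX)]
    rw [ContinuousLinearMap.opNorm_prod]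
    exact max_le_max (hc X hX) (hd X hX)
  · intro X hX
    obtain ⟨U, ℓ, g₁, g₂, hXU, hUB, hd, h1, h2, hs⟩ := hf.sides X hX
    obtain ⟨U', k₁, k₂, hXU', hU', hUB', ho, h1', h2', hs'⟩ := hg.exists_sides hX hd hXU
    exact ⟨U', ℓ, fun Y => (g₁ Y, k₁ Y), fun Y => (g₂ Y, k₂ Y), hXU', hUB', hd.mono ho hU',
      (h1.mono hU').prodMk h1', (h2.mono hU').prodMk h2', fun Y hY =>
      ⟨fun hp => by rw [(hs Y (hU' hY)).1 hp, (hs' Y hY).1 hp],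
        fun hp => by rw [(hs Y (hU' hY)).2 hp, (hs' Y hY).2 hp]⟩⟩

/-- The one-sided extensions at `X` are limits of values of `f` along `±m`. Closed constraints, such
as a lower bound on a determinant, therefore survive on the interface. -/
lemma side_mem (hI : IsInterface B S m) {K : Set V} (hK : IsClosed K) (hX : X ∈ S)
    (hd : IsDefining S m U ℓ) (hXU : X ∈ U) (hfK : ∀ Y ∈ B \ S, f Y ∈ K) {g₁ g₂ : E → V}
    (h1 : ContinuousAt g₁ X) (h2 : ContinuousAt g₂ X)
    (hs : ∀ Y ∈ U, (0 < ℓ Y → f Y = g₁ Y) ∧ (ℓ Y < 0 → f Y = g₂ Y)) : g₁ X ∈ K ∧ g₂ X ∈ K := by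
  constructor
  · refine hK.mem_of_tendsto (h1.tendsto.comp (tendsto_add_smul_nhds X (m X))) ?_
    filter_upwards [hI.eventually_mem_pos hX, hd.eventually_normal_pos hXU hX] with s h3 h4
    have := hfK _ h3
    rwa [(hs _ h4.1).1 h4.2] at this
  · refine hK.mem_of_tendsto (h2.tendsto.comp (tendsto_add_smul_nhds X (-m X))) ?_
    filter_upwards [hI.eventually_mem_neg hX, hd.eventually_normal_neg hXU hX] with s h3 h4
    have := hfK _ h3
    rwa [(hs _ h4.1).2 h4.2] at this

/-- Composition with a function that is smooth near a compact set containing all values. -/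
lemma comp (hn : n ≤ 1) (hB : IsOpen B) (hI : IsInterface B S m) (hf : PiecewiseC n B S m f)
    {Ω K : Set V} (hΩ : IsOpen Ω) (hK : IsCompact K) (hKΩ : K ⊆ Ω) (hfK : ∀ X ∈ B \ S, f X ∈ K)
    {φ : V → W} (hφ : ContDiffOn ℝ n φ Ω) : PiecewiseC n B S m fun X => φ (f X) := by
  refine of_bounds hn (hφ.comp hf.contDiffOn fun X hX => hKΩ (hfK X hX)) ?_ ?_ ?_
  · obtain ⟨c, hc⟩ := hK.exists_bound_of_continuousOn (hφ.continuousOn.mono hKΩ)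
    exact ⟨c, fun X hX => hc _ (hfK X hX)⟩
  · rintro rfl
    obtain ⟨c, hc⟩ := hK.exists_bound_of_continuousOn
      ((hφ.continuousOn_fderiv_of_isOpen hΩ (by simp)).mono hKΩ)
    obtain ⟨d, hd0, hd⟩ := hf.norm_fderiv_le
    refine ⟨c * d, fun X hX => ?_⟩
    have h1 : DifferentiableAt ℝ φ (f X) :=
      (hφ.contDiffAt (hΩ.mem_nhds (hKΩ (hfK X hX)))).differentiableAt (by simp)
    have h2 := (h1.hasFDerivAt.comp X (hf.differentiableAt hB hI hX).hasFDerivAt).fderiv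
    change fderiv ℝ (fun X => φ (f X)) X = _ at h2
    rw [h2]
    exact (ContinuousLinearMap.opNorm_comp_le _ _).trans (mul_le_mul (hc _ (hfK X hX)) (hd X hX)
      (norm_nonneg _) ((norm_nonneg _).trans (hc _ (hfK X hX))))
  · intro X hX
    obtain ⟨U, ℓ, g₁, g₂, hXU, hUB, hd, h1, h2, hs⟩ := hf.sides X hX
    have hc1 := h1.continuousOn.continuousAt (hd.isOpen.mem_nhds hXU)
    have hc2 := h2.continuousOn.continuousAt (hd.isOpen.mem_nhds hXU)
    obtain ⟨hm1, hm2⟩ := side_mem hI hK.isClosed hX hd hXU hfK hc1 hc2 hs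
    -- On the wrong side of the surface the extensions are unconstrained and could leave the domain
    -- of smoothness of `φ`. Their values at `X` lie in `K`, so a smaller neighbourhood keeps them
    -- in `Ω`.
    have hev : ∀ᶠ Y in 𝓝 X, Y ∈ U ∧ g₁ Y ∈ Ω ∧ g₂ Y ∈ Ω :=
      Filter.Eventually.and (hd.isOpen.mem_nhds hXU)
        (Filter.Eventually.and (hc1 (hΩ.mem_nhds (hKΩ hm1))) (hc2 (hΩ.mem_nhds (hKΩ hm2))))
    obtain ⟨U', hU', ho, hXU'⟩ := eventually_nhds_iff.1 hev
    have hU : U' ⊆ U := fun Y hY => (hU' Y hY).1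
    exact ⟨U', ℓ, fun Y => φ (g₁ Y), fun Y => φ (g₂ Y), hXU', hU.trans hUB, hd.mono ho hU,
      hφ.comp (h1.mono hU) fun Y hY => (hU' Y hY).2.1,
      hφ.comp (h2.mono hU) fun Y hY => (hU' Y hY).2.2, fun Y hY =>
      ⟨fun hp => by rw [(hs Y (hU hY)).1 hp], fun hp => by rw [(hs Y (hU hY)).2 hp]⟩⟩

lemma comp_contDiff [FiniteDimensional ℝ V] (hn : n ≤ 1) (hB : IsOpen B) (hI : IsInterface B S m)
    (hf : PiecewiseC n B S m f) {φ : V → W} (hφ : ContDiff ℝ n φ) :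
    PiecewiseC n B S m fun X => φ (f X) := by
  obtain ⟨c, -, hc⟩ := hf.norm_le
  have : ProperSpace V := FiniteDimensional.proper_real V
  exact hf.comp hn hB hI isOpen_univ (isCompact_closedBall (0 : V) c) (subset_univ _)
    (fun X hX => by simpa using hc X hX) hφ.contDiffOn

lemma comp₂ [FiniteDimensional ℝ V] [FiniteDimensional ℝ W] (hn : n ≤ 1) (hB : IsOpen B)
    (hI : IsInterface B S m) (hf : PiecewiseC n B S m f) (hg : PiecewiseC n B S m g)
    {φ : V → W → G} (hφ : ContDiff ℝ n fun q : V × W => φ q.1 q.2) :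
    PiecewiseC n B S m fun X => φ (f X) (g X) :=
  (hf.prodMk hn hB hI hg).comp_contDiff hn hB hI hφ

/-- A point with `ℓ > 0` has a neighbourhood on which `f` coincides with `g₁`, so the derivatives of
the extensions extend the derivative. -/
lemma fderiv (hB : IsOpen B) (hI : IsInterface B S m) (hf : PiecewiseC 1 B S m f) :
    PiecewiseC 0 B S m (fderiv ℝ f) := by
  obtain ⟨c, -, hc⟩ := hf.norm_fderiv_le
  refine of_bounds zero_le_one ?_ ⟨c, hc⟩ (by simp) fun X hX => ?_
  · simpa using hf.contDiffOn.continuousOn_fderiv_of_isOpen (hI.isOpen_diff hB) (by simp)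
  · obtain ⟨U, ℓ, g₁, g₂, hXU, hUB, hd, h1, h2, hs⟩ := hf.sides X hX
    refine ⟨U, ℓ, _root_.fderiv ℝ g₁, _root_.fderiv ℝ g₂, hXU, hUB, hd, ?_, ?_, fun Y hY =>
      ⟨fun hp => ?_, fun hp => ?_⟩⟩
    · simpa using h1.continuousOn_fderiv_of_isOpen hd.isOpen (by simp)
    · simpa using h2.continuousOn_fderiv_of_isOpen hd.isOpen (by simp)
    · refine Filter.EventuallyEq.fderiv_eq ?_
      filter_upwards [hd.isOpen.mem_nhds hY, (hd.differentiableAt hY).continuousAt.eventually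
        (lt_mem_nhds hp)] with Z h3 h4 using (hs Z h3).1 h4
    · refine Filter.EventuallyEq.fderiv_eq ?_
      filter_upwards [hd.isOpen.mem_nhds hY, (hd.differentiableAt hY).continuousAt.eventually
        (gt_mem_nhds hp)] with Z h3 h4 using (hs Z h3).2 h4

/-! One-sided traces on the interface. -/

/-- Near a point of the interface the two traces are the one-sided extensions. -/
lemma exists_trace (hf : PiecewiseC n B S m f) (hX : X ∈ S) (hd : IsDefining S m U ℓ)
    (hXU : X ∈ U) : ∃ (U' : Set E) (g₁ g₂ : E → V),
      X ∈ U' ∧ U' ⊆ U ∧ U' ⊆ B ∧ IsOpen U' ∧ ContDiffOn ℝ n g₁ U' ∧ ContDiffOn ℝ n g₂ U' ∧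
      (∀ Y ∈ U', (0 < ℓ Y → f Y = g₁ Y) ∧ (ℓ Y < 0 → f Y = g₂ Y)) ∧
      ∀ Y ∈ S ∩ U', Tendsto (fun s : ℝ => f (Y + s • m Y)) (𝓝[>] 0) (𝓝 (g₁ Y)) ∧
        Tendsto (fun s : ℝ => f (Y + s • (-m Y))) (𝓝[>] 0) (𝓝 (g₂ Y)) := by
  obtain ⟨U', g₁, g₂, hXU', hU', hUB', ho, h1, h2, hs⟩ := hf.exists_sides hX hd hXU
  refine ⟨U', g₁, g₂, hXU', hU', hUB', ho, h1, h2, hs, fun Y hY => ⟨?_, ?_⟩⟩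
  · refine ((h1.continuousOn.continuousAt (ho.mem_nhds hY.2)).tendsto.comp
      (tendsto_add_smul_nhds Y (m Y))).congr' ?_
    filter_upwards [(hd.mono ho hU').eventually_normal_pos hY.2 hY.1] with s h3
    exact ((hs _ h3.1).1 h3.2).symm
  · refine ((h2.continuousOn.continuousAt (ho.mem_nhds hY.2)).tendsto.comp
      (tendsto_add_smul_nhds Y (-m Y))).congr' ?_
    filter_upwards [(hd.mono ho hU').eventually_normal_neg hY.2 hY.1] with s h3
    exact ((hs _ h3.1).2 h3.2).symm

lemma tendsto_pos (hI : IsInterface B S m) (hf : PiecewiseC n B S m f) (hX : X ∈ S) :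
    Tendsto (fun s : ℝ => f (X + s • m X)) (𝓝[>] 0) (𝓝 (sideLim (m X) X f)) := by
  obtain ⟨U, ℓ, hXU, hUB, hd⟩ := hI.locally_level X hX
  obtain ⟨U', g₁, g₂, hXU', -, -, -, -, -, -, ht⟩ := hf.exists_trace hX hd hXU
  exact tendsto_nhds_limUnder ⟨_, (ht X ⟨hX, hXU'⟩).1⟩

lemma tendsto_neg (hI : IsInterface B S m) (hf : PiecewiseC n B S m f) (hX : X ∈ S) :
    Tendsto (fun s : ℝ => f (X + s • (-m X))) (𝓝[>] 0) (𝓝 (sideLim (-m X) X f)) := by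
  obtain ⟨U, ℓ, hXU, hUB, hd⟩ := hI.locally_level X hX
  obtain ⟨U', g₁, g₂, hXU', -, -, -, -, -, -, ht⟩ := hf.exists_trace hX hd hXU
  exact tendsto_nhds_limUnder ⟨_, (ht X ⟨hX, hXU'⟩).2⟩

lemma continuousOn_pos (hI : IsInterface B S m) (hf : PiecewiseC n B S m f) :
    ContinuousOn (fun X => sideLim (m X) X f) S := by
  intro X hX
  obtain ⟨U, ℓ, hXU, hUB, hd⟩ := hI.locally_level X hX
  obtain ⟨U', g₁, g₂, hXU', -, -, ho, h1, -, -, ht⟩ := hf.exists_trace hX hd hXU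
  have hc := (h1.continuousOn.continuousAt (ho.mem_nhds hXU')).continuousWithinAt (s := S)
  refine hc.congr_of_eventuallyEq ?_ (ht X ⟨hX, hXU'⟩).1.limUnder_eq
  filter_upwards [self_mem_nhdsWithin, mem_nhdsWithin_of_mem_nhds (ho.mem_nhds hXU')] with Y h3 h4
  exact (ht Y ⟨h3, h4⟩).1.limUnder_eq

lemma continuousOn_neg (hI : IsInterface B S m) (hf : PiecewiseC n B S m f) :
    ContinuousOn (fun X => sideLim (-m X) X f) S := by
  intro X hX
  obtain ⟨U, ℓ, hXU, hUB, hd⟩ := hI.locally_level X hX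
  obtain ⟨U', g₁, g₂, hXU', -, -, ho, -, h2, -, ht⟩ := hf.exists_trace hX hd hXU
  have hc := (h2.continuousOn.continuousAt (ho.mem_nhds hXU')).continuousWithinAt (s := S)
  refine hc.congr_of_eventuallyEq ?_ (ht X ⟨hX, hXU'⟩).2.limUnder_eq
  filter_upwards [self_mem_nhdsWithin, mem_nhdsWithin_of_mem_nhds (ho.mem_nhds hXU')] with Y h3 h4
  exact (ht Y ⟨h3, h4⟩).2.limUnder_eq

lemma pos_mem (hI : IsInterface B S m) (hf : PiecewiseC n B S m f) {K : Set V} (hK : IsClosed K)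
    (hfK : ∀ Y ∈ B \ S, f Y ∈ K) (hX : X ∈ S) : sideLim (m X) X f ∈ K := by
  refine hK.mem_of_tendsto (hf.tendsto_pos hI hX) ?_
  filter_upwards [hI.eventually_mem_pos hX] with s hs using hfK _ hs

lemma neg_mem (hI : IsInterface B S m) (hf : PiecewiseC n B S m f) {K : Set V} (hK : IsClosed K)
    (hfK : ∀ Y ∈ B \ S, f Y ∈ K) (hX : X ∈ S) : sideLim (-m X) X f ∈ K := by
  refine hK.mem_of_tendsto (hf.tendsto_neg hI hX) ?_
  filter_upwards [hI.eventually_mem_neg hX] with s hs using hfK _ hs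

lemma norm_traces_le (hI : IsInterface B S m) (hf : PiecewiseC n B S m f) : ∃ c, 0 ≤ c ∧ ∀ X ∈ S,
    ‖sideLim (m X) X f‖ ≤ c ∧ ‖sideLim (-m X) X f‖ ≤ c := by
  obtain ⟨c, hc0, hc⟩ := hf.norm_le
  refine ⟨c, hc0, fun X hX => ⟨?_, ?_⟩⟩
  · simpa using hf.pos_mem hI (Metric.isClosed_closedBall (x := 0) (ε := c)) (by simpa using hc) hX
  · simpa using hf.neg_mem hI (Metric.isClosed_closedBall (x := 0) (ε := c)) (by simpa using hc) hX

end PiecewiseC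

/-- Fields that are continuous and bounded on a given set. -/
structure BddContOn {α : Type*} [TopologicalSpace α] (S : Set α) (k : α → V) : Prop where
  continuousOn : ContinuousOn k S
  bounded : ∃ c : ℝ, ∀ X ∈ S, ‖k X‖ ≤ c

namespace BddContOn

variable {α : Type*} [TopologicalSpace α] {A : Set α} {k k' : α → V} {l : α → W}

lemma prodMk (hk : BddContOn A k) (hl : BddContOn A l) : BddContOn A fun X => (k X, l X) := by
  obtain ⟨c, hc⟩ := hk.bounded
  obtain ⟨d, hd⟩ := hl.bounded
  exact ⟨hk.continuousOn.prodMk hl.continuousOn, max c d, fun X hX =>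
    max_le_max (hc X hX) (hd X hX)⟩

lemma comp_of_isCompact {K : Set V} (hk : BddContOn A k) (hK : IsCompact K) (hkK : ∀ X ∈ A, k X ∈ K)
    {φ : V → W} (hφ : ContinuousOn φ K) : BddContOn A fun X => φ (k X) := by
  obtain ⟨d, hd⟩ := hK.exists_bound_of_continuousOn hφ
  exact ⟨hφ.comp hk.continuousOn hkK, d, fun X hX => hd _ (hkK X hX)⟩

lemma comp [FiniteDimensional ℝ V] (hk : BddContOn A k) {φ : V → W} (hφ : Continuous φ) :
    BddContOn A fun X => φ (k X) := by
  obtain ⟨c, hc⟩ := hk.bounded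
  have : ProperSpace V := FiniteDimensional.proper_real V
  exact hk.comp_of_isCompact (isCompact_closedBall (0 : V) c) (fun X hX => by simpa using hc X hX)
    hφ.continuousOn

lemma comp₂ [FiniteDimensional ℝ V] [FiniteDimensional ℝ W] (hk : BddContOn A k)
    (hl : BddContOn A l) {φ : V → W → G} (hφ : Continuous fun q : V × W => φ q.1 q.2) :
    BddContOn A fun X => φ (k X) (l X) :=
  (hk.prodMk hl).comp hφ

lemma congr (hk : BddContOn A k) (h : ∀ X ∈ A, k' X = k X) : BddContOn A k' := by
  obtain ⟨c, hc⟩ := hk.bounded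
  exact ⟨hk.continuousOn.congr h, c, fun X hX => by rw [h X hX]; exact hc X hX⟩

lemma const (c : V) : BddContOn A fun _ => c := ⟨continuousOn_const, ‖c‖, fun _ _ => le_rfl⟩

lemma integrableOn {k : E → V} [SecondCountableTopologyEither E V] (hk : BddContOn S k)
    (hB : IsOpen B) (hI : IsInterface B S m) : IntegrableOn k S μHE[2] := by
  obtain ⟨c, hc⟩ := hk.bounded
  have := hI.finite_restrict
  have hS := hI.measurableSet hB
  exact Integrable.of_bound (hk.continuousOn.aestronglyMeasurable hS) c
    ((ae_restrict_iff' hS).2 (ae_of_all _ hc))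

variable {a b : α → ℝ} {x y : α → E}

lemma add [FiniteDimensional ℝ V] (hk : BddContOn A k) (hk' : BddContOn A k') :
    BddContOn A fun X => k X + k' X := hk.comp₂ hk' (φ := fun a b => a + b) (by fun_prop)

lemma sub [FiniteDimensional ℝ V] (hk : BddContOn A k) (hk' : BddContOn A k') :
    BddContOn A fun X => k X - k' X := hk.comp₂ hk' (φ := fun a b => a - b) (by fun_prop)

lemma neg [FiniteDimensional ℝ V] (hk : BddContOn A k) : BddContOn A fun X => -k X :=
  hk.comp (φ := fun a => -a) (by fun_prop)

lemma smul [FiniteDimensional ℝ V] (ha : BddContOn A a) (hk : BddContOn A k) :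
    BddContOn A fun X => a X • k X := ha.comp₂ hk (φ := fun a b => a • b) (by fun_prop)

lemma mul (ha : BddContOn A a) (hb : BddContOn A b) : BddContOn A fun X => a X * b X := ha.smul hb

lemma inner (hx : BddContOn A x) (hy : BddContOn A y) : BddContOn A fun X => ⟪x X, y X⟫_ℝ :=
  hx.comp₂ hy (φ := fun a b => ⟪a, b⟫_ℝ) (by fun_prop)

lemma norm_sq (hx : BddContOn A x) : BddContOn A fun X => ‖x X‖ ^ 2 :=
  hx.comp (φ := fun x => ‖x‖ ^ 2) (by fun_prop)

lemma clm_apply [FiniteDimensional ℝ V] [FiniteDimensional ℝ W] {L : α → V →L[ℝ] W}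
    (hL : BddContOn A L) (hk : BddContOn A k) : BddContOn A fun X => L X (k X) :=
  hL.comp₂ hk (φ := fun (L : V →L[ℝ] W) x => L x) (continuous_fst.clm_apply continuous_snd)

lemma clm_comp [FiniteDimensional ℝ V] [FiniteDimensional ℝ W] [FiniteDimensional ℝ G]
    {L : α → V →L[ℝ] W} {L' : α → G →L[ℝ] V} (hL : BddContOn A L) (hL' : BddContOn A L') :
    BddContOn A fun X => L X ∘L L' X :=
  hL.comp₂ hL' (φ := fun (L : V →L[ℝ] W) (L' : G →L[ℝ] V) => L ∘L L')
    (continuous_fst.clm_comp continuous_snd)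

lemma inv {δ : ℝ} (ha : BddContOn A a) (hδ : 0 < δ) (h : ∀ X ∈ A, δ ≤ a X) :
    BddContOn A fun X => (a X)⁻¹ := by
  refine ⟨ha.continuousOn.inv₀ fun X hX => (hδ.trans_le (h X hX)).ne', δ⁻¹, fun X hX => ?_⟩
  rw [norm_inv, Real.norm_of_nonneg (hδ.le.trans (h X hX))]
  exact inv_anti₀ hδ (h X hX)

end BddContOn

lemma IsInterface.bddContOn_normal (hI : IsInterface B S m) : BddContOn S m :=
  ⟨hI.continuousOn_normal, 1, fun _ hX => (hI.norm_normal hX).le⟩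

lemma PiecewiseC.bddContOn_pos (hI : IsInterface B S m) (hf : PiecewiseC n B S m f) :
    BddContOn S fun X => sideLim (m X) X f := by
  obtain ⟨c, -, hc⟩ := hf.norm_traces_le hI
  exact ⟨hf.continuousOn_pos hI, c, fun X hX => (hc X hX).1⟩

lemma PiecewiseC.bddContOn_neg (hI : IsInterface B S m) (hf : PiecewiseC n B S m f) :
    BddContOn S fun X => sideLim (-m X) X f := by
  obtain ⟨c, -, hc⟩ := hf.norm_traces_le hI
  exact ⟨hf.continuousOn_neg hI, c, fun X hX => (hc X hX).2⟩

lemma jump_eq {ν : E} {a b : V} (ha : Tendsto (fun s : ℝ => f (X + s • ν)) (𝓝[>] 0) (𝓝 a))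
    (hb : Tendsto (fun s : ℝ => f (X + s • (-ν))) (𝓝[>] 0) (𝓝 b)) : jump ν X f = a - b := by
  rw [jump, sideLim, sideLim, ha.limUnder_eq, hb.limUnder_eq]

lemma PiecewiseC.bddContOn_jump [FiniteDimensional ℝ V] (hI : IsInterface B S m)
    (hf : PiecewiseC n B S m f) : BddContOn S fun X => jump (m X) X f :=
  (hf.bddContOn_pos hI).comp₂ (hf.bddContOn_neg hI) (φ := fun a b => a - b) (by fun_prop)

/-! Volume integrals. -/

/-- The interface is null and `B` has finite volume, so continuity and a bound off the interface
suffice. -/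
lemma integrableOn_of_continuousOn_diff (hdim : Module.finrank ℝ E = 3) (hB : IsOpen B)
    (hb : Bornology.IsBounded B) (hI : IsInterface B S m) (hc : ContinuousOn f (B \ S))
    (hbd : ∃ c : ℝ, ∀ X ∈ B \ S, ‖f X‖ ≤ c) : IntegrableOn f B := by
  have h0 : B \ S =ᵐ[volume] B := sdiff_null_ae_eq_self
    (volume_eq_zero_of_area_lt_top hdim hI.area_finite)
  rw [← integrableOn_congr_set_ae h0]
  obtain ⟨c, hc'⟩ := hbd
  have hm := (hI.isOpen_diff hB).measurableSet
  exact IntegrableOn.of_bound ((measure_mono sdiff_subset).trans_lt hb.measure_lt_top)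
    (hc.aestronglyMeasurable hm) c ((ae_restrict_iff' hm).2 (ae_of_all _ hc'))

lemma setIntegral_diff_interface (hdim : Module.finrank ℝ E = 3) (hI : IsInterface B S m) :
    ∫ X in B \ S, f X = ∫ X in B, f X :=
  setIntegral_congr_set (sdiff_null_ae_eq_self
    (volume_eq_zero_of_area_lt_top hdim hI.area_finite))

lemma BddContOn.integrableOn_diff (hdim : Module.finrank ℝ E = 3) (hB : IsOpen B)
    (hb : Bornology.IsBounded B) (hI : IsInterface B S m) (hf : BddContOn (B \ S) f) :
    IntegrableOn f B :=
  integrableOn_of_continuousOn_diff hdim hB hb hI hf.continuousOn hf.bounded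

lemma PiecewiseC.bddContOn (hf : PiecewiseC n B S m f) : BddContOn (B \ S) f :=
  ⟨hf.continuousOn, hf.norm_le.imp fun _ h => h.2⟩

lemma PiecewiseC.integrableOn (hdim : Module.finrank ℝ E = 3) (hB : IsOpen B)
    (hb : Bornology.IsBounded B) (hI : IsInterface B S m) (hf : PiecewiseC n B S m f) :
    IntegrableOn f B := hf.bddContOn.integrableOn_diff hdim hB hb hI

end Piecewise


/-! ### Measures on images, from local comparison of sizes -/

section ImageMeasure

variable {F : Type*} [NormedAddCommGroup F] [NormedSpace ℝ F]

lemma ENNReal_le_of_forall_mul {a b : ENNReal} (h : ∀ t : ℝ, 1 < t → a ≤ ENNReal.ofReal t * b) :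
    a ≤ b := by
  have h1 : Tendsto (fun t : ℝ => ENNReal.ofReal t * b) (𝓝[>] 1) (𝓝 (1 * b)) := by
    refine ENNReal.Tendsto.mul_const ?_ (Or.inl one_ne_zero)
    have := (ENNReal.continuous_ofReal.tendsto 1).mono_left (nhdsWithin_le_nhds (s := Ioi 1))
    simpa using this
  rw [one_mul] at h1
  exact ge_of_tendsto h1 (by filter_upwards [self_mem_nhdsWithin] with t ht using h t ht)

/-- A set function that is locally comparable with `θ μ`, with factors arbitrarily close to one, is
the measure with density `θ`. -/
lemma eq_setLIntegral_of_local {S : Set E} {θ : E → ℝ} (hθc : ContinuousOn θ S)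
    (hθ : ∀ X ∈ S, 0 < θ X) {μ : Measure E} {ν : Set E → ENNReal} (hν0 : ν ∅ = 0)
    (hν : ∀ A : ℕ → Set E, Pairwise (Function.onFun Disjoint A) → (∀ i, MeasurableSet (A i)) →
      (∀ i, A i ⊆ S) → ν (⋃ i, A i) = ∑' i, ν (A i))
    (hup : ∀ X ∈ S, ∀ t : ℝ, 1 < t → ∃ W ∈ 𝓝 X, ∀ A ⊆ S ∩ W, MeasurableSet A →
      ν A ≤ ENNReal.ofReal (t * θ X) * μ A)
    (hlow : ∀ X ∈ S, ∀ t : ℝ, 1 < t → ∃ W ∈ 𝓝 X, ∀ A ⊆ S ∩ W, MeasurableSet A →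
      ENNReal.ofReal (θ X) * μ A ≤ ENNReal.ofReal t * ν A)
    {A : Set E} (hA : A ⊆ S) (hAm : MeasurableSet A) :
    ν A = ∫⁻ X in A, ENNReal.ofReal (θ X) ∂μ := by
  -- One factor `t` pays for the comparison of `ν` with `θ(X) μ`, the other for the variation of `θ`
  -- near `X`.
  have key : ∀ t : ℝ, 1 < t → ν A ≤ ENNReal.ofReal (t * t) * ∫⁻ X in A, ENNReal.ofReal (θ X) ∂μ ∧
      ∫⁻ X in A, ENNReal.ofReal (θ X) ∂μ ≤ ENNReal.ofReal (t * t) * ν A := by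
    intro t ht
    have ht0 : 0 < t := one_pos.trans ht
    have hloc : ∀ X ∈ S, ∃ W ∈ 𝓝 X, ∀ A ⊆ S ∩ W, MeasurableSet A →
        ν A ≤ ENNReal.ofReal (t * t) * ∫⁻ X in A, ENNReal.ofReal (θ X) ∂μ ∧
        ∫⁻ X in A, ENNReal.ofReal (θ X) ∂μ ≤ ENNReal.ofReal (t * t) * ν A := by
      intro X hX
      obtain ⟨W₁, hW₁, h1⟩ := hup X hX t ht
      obtain ⟨W₂, hW₂, h2⟩ := hlow X hX t ht
      have h3 : ∀ᶠ Y in 𝓝[S] X, θ X < t * θ Y ∧ θ Y < t * θ X := by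
        refine ((continuousWithinAt_const.mul (hθc X hX)).eventually_const_lt
          (lt_mul_of_one_lt_left (hθ X hX) ht)).and ((hθc X hX).eventually_lt_const
          (lt_mul_of_one_lt_left (hθ X hX) ht))
      obtain ⟨W₃, hW₃, h3⟩ := mem_nhdsWithin_iff_exists_mem_nhds_inter.1 h3
      refine ⟨W₁ ∩ W₂ ∩ W₃, inter_mem (inter_mem hW₁ hW₂) hW₃, fun A hA hAm => ⟨?_, ?_⟩⟩
      · refine (h1 A (fun Y hY => ⟨(hA hY).1, (hA hY).2.1.1⟩) hAm).trans ?_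
        rw [← lintegral_const_mul' _ _ ENNReal.ofReal_ne_top, ← setLIntegral_const]
        refine setLIntegral_mono' hAm fun Y hY => ?_
        rw [← ENNReal.ofReal_mul (by positivity)]
        refine ENNReal.ofReal_le_ofReal ?_
        have := (h3 ⟨(hA hY).2.2, (hA hY).1⟩).1
        nlinarith
      · calc ∫⁻ X in A, ENNReal.ofReal (θ X) ∂μ ≤ ∫⁻ _ in A, ENNReal.ofReal (t * θ X) ∂μ :=
              setLIntegral_mono' hAm fun Y hY =>
                ENNReal.ofReal_le_ofReal (h3 ⟨(hA hY).2.2, (hA hY).1⟩).2.le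
          _ = ENNReal.ofReal t * (ENNReal.ofReal (θ X) * μ A) := by
              rw [setLIntegral_const, ENNReal.ofReal_mul ht0.le, mul_assoc]
          _ ≤ ENNReal.ofReal t * (ENNReal.ofReal t * ν A) := by
              gcongr ENNReal.ofReal t * ?_
              exact h2 A (fun Y hY => ⟨(hA hY).1, (hA hY).2.1.2⟩) hAm
          _ = ENNReal.ofReal (t * t) * ν A := by rw [ENNReal.ofReal_mul ht0.le, mul_assoc]
    choose! W hW hWA using hloc
    -- By the Lindelöf property countably many of the neighbourhoods cover `S`. Made disjoint, they
    -- cut `A` into pieces on which the local comparison holds, and both sides are countably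
    -- additive.
    obtain ⟨C, hCS, hCc, hCcov⟩ := TopologicalSpace.countable_cover_nhdsWithin (s := S)
      (f := fun X => interior (W X)) fun X hX =>
        mem_nhdsWithin_of_mem_nhds (interior_mem_nhds.2 (hW X hX))
    rcases A.eq_empty_or_nonempty with rfl | hne
    · simp [hν0]
    obtain ⟨Y₀, hY₀⟩ := hne
    have hCne : C.Nonempty := by
      obtain ⟨X, hX, -⟩ := mem_iUnion₂.1 (hCcov (hA hY₀))
      exact ⟨X, hX⟩
    obtain ⟨e, he⟩ := hCc.exists_eq_range hCne
    set D : ℕ → Set E := fun i => A ∩ disjointed (fun i => interior (W (e i))) i with hD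
    have heS : ∀ i, e i ∈ S := fun i => hCS (he ▸ mem_range_self i)
    have hDm : ∀ i, MeasurableSet (D i) := fun i =>
      hAm.inter (.disjointed (fun _ => isOpen_interior.measurableSet) i)
    have hDU : ⋃ i, D i = A := by
      rw [hD, ← inter_iUnion, iUnion_disjointed]
      refine inter_eq_left.2 fun Y hY => ?_
      obtain ⟨X, hX, hYX⟩ := mem_iUnion₂.1 (hCcov (hA hY))
      rw [he] at hX
      obtain ⟨i, rfl⟩ := hX
      exact mem_iUnion.2 ⟨i, hYX⟩
    have hDd : Pairwise (Function.onFun Disjoint D) := fun i k hik =>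
      ((disjoint_disjointed _) hik).mono inter_subset_right inter_subset_right
    have hDS : ∀ i, D i ⊆ S := fun i => inter_subset_left.trans hA
    have hDW : ∀ i, D i ⊆ S ∩ W (e i) := fun i Y hY =>
      ⟨hA hY.1, interior_subset (disjointed_subset _ i hY.2)⟩
    have e1 : ν A = ∑' i, ν (D i) := by rw [← hν D hDd hDm hDS, hDU]
    have e2 : ∫⁻ X in A, ENNReal.ofReal (θ X) ∂μ =
        ∑' i, ∫⁻ X in D i, ENNReal.ofReal (θ X) ∂μ := by
      rw [← lintegral_iUnion hDm hDd, hDU]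
    rw [e1, e2, ← ENNReal.tsum_mul_left, ← ENNReal.tsum_mul_left]
    exact ⟨ENNReal.tsum_le_tsum fun i => (hWA _ (heS i) _ (hDW i) (hDm i)).1,
      ENNReal.tsum_le_tsum fun i => (hWA _ (heS i) _ (hDW i) (hDm i)).2⟩
  have hs : ∀ t : ℝ, 1 < t → ∃ s, 1 < s ∧ s * s = t := fun t ht =>
    ⟨√t, by rwa [Real.lt_sqrt (by norm_num), one_pow], Real.mul_self_sqrt (by linarith)⟩
  refine le_antisymm (ENNReal_le_of_forall_mul fun t ht => ?_)
    (ENNReal_le_of_forall_mul fun t ht => ?_)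
  · obtain ⟨s, hs1, rfl⟩ := hs t ht
    exact (key s hs1).1
  · obtain ⟨s, hs1, rfl⟩ := hs t ht
    exact (key s hs1).2

variable {s : Set E} {f : E → E} {θ : E → ℝ} {μ μ' : Measure E}

/-- This is the change of variables with the Jacobian determinant replaced by a hypothesis on
measures of images, so that it also applies to surface measures. -/
lemma map_domRestrict_withDensity (hs : MeasurableSet s) (hf : ContinuousOn f s)
    (hν : ∀ A ⊆ s, MeasurableSet A → μ' (f '' A) = ∫⁻ X in A, ENNReal.ofReal (θ X) ∂μ) :
    Measure.map (s.domRestrict f)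
      (Measure.comap (↑) (μ.withDensity fun x => ENNReal.ofReal (θ x))) = μ'.restrict (f '' s) := by
  -- Only the restriction of `f` to `s` is controlled, whereas the push-forward needs a globally
  -- measurable representative.
  obtain ⟨u, u_meas, uf⟩ : ∃ u, Measurable u ∧ EqOn u f s := by
    classical
    refine ⟨piecewise s f 0, ?_, piecewise_eqOn _ _ _⟩
    exact ContinuousOn.measurable_piecewise hf continuous_zero.continuousOn hs
  have h1 : s.domRestrict f = u ∘ (↑) := by
    ext x
    exact (uf x.2).symm
  rw [h1, ← Measure.map_map u_meas measurable_subtype_coe, map_comap_subtype_coe hs,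
    restrict_withDensity hs]
  refine Measure.ext fun t ht => ?_
  have hm : MeasurableSet (u ⁻¹' t ∩ s) := (u_meas ht).inter hs
  rw [Measure.map_apply u_meas ht, withDensity_apply _ (u_meas ht), Measure.restrict_apply ht,
    Measure.restrict_restrict (u_meas ht), ← hν _ inter_subset_right hm]
  congr 1
  ext y
  constructor
  · rintro ⟨x, hx, rfl⟩
    exact ⟨by simpa [uf hx.2] using hx.1, ⟨x, hx.2, rfl⟩⟩
  · rintro ⟨hy, x, hx, rfl⟩
    exact ⟨x, ⟨by simpa [uf hx] using hy, hx⟩, rfl⟩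

lemma integral_image_eq_of_density (hs : MeasurableSet s) (hf : ContinuousOn f s)
    (hinj : InjOn f s) (hθ : AEMeasurable θ (μ.restrict s)) (hθ0 : ∀ x, 0 ≤ θ x)
    (hν : ∀ A ⊆ s, MeasurableSet A → μ' (f '' A) = ∫⁻ X in A, ENNReal.ofReal (θ X) ∂μ)
    (g : E → F) : ∫ x in f '' s, g x ∂μ' = ∫ x in s, θ x • g (f x) ∂μ := by
  rw [← map_domRestrict_withDensity hs hf hν, (hf.measurableEmbedding hs hinj).integral_map]
  simp only [Set.domRestrict_apply, ← Function.comp_apply (f := g), ENNReal.ofReal]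
  rw [← (MeasurableEmbedding.subtype_coe hs).integral_map, map_comap_subtype_coe hs,
    setIntegral_withDensity_eq_setIntegral_smul₀ hθ.real_toNNReal _ hs]
  congr with x
  rw [NNReal.smul_def, Real.coe_toNNReal _ (hθ0 x)]

lemma integrableOn_image_iff_of_density (hs : MeasurableSet s) (hf : ContinuousOn f s)
    (hinj : InjOn f s) (hθ : AEMeasurable θ (μ.restrict s)) (hθ0 : ∀ x, 0 ≤ θ x)
    (hν : ∀ A ⊆ s, MeasurableSet A → μ' (f '' A) = ∫⁻ X in A, ENNReal.ofReal (θ X) ∂μ)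
    (g : E → F) : IntegrableOn g (f '' s) μ' ↔ IntegrableOn (fun x => θ x • g (f x)) s μ := by
  rw [IntegrableOn, ← map_domRestrict_withDensity hs hf hν,
    (hf.measurableEmbedding hs hinj).integrable_map_iff]
  simp only [Set.domRestrict_eq, ← Function.comp_assoc, ENNReal.ofReal]
  rw [← (MeasurableEmbedding.subtype_coe hs).integrable_map_iff, map_comap_subtype_coe hs,
    restrict_withDensity hs, integrable_withDensity_iff_integrable_coe_smul₀ hθ.real_toNNReal]
  simp_rw [IntegrableOn, Real.coe_toNNReal _ (hθ0 _), Function.comp_apply]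

end ImageMeasure

/-! ### Comparison of Hausdorff measures of two images of a set. -/

section Lipschitz

variable {α V W : Type*} [MetricSpace V] [MeasurableSpace V] [BorelSpace V] [MetricSpace W]
  [MeasurableSpace W] [BorelSpace W]

/-- The estimate forces `f` to factor on `A` through `g`, by a map that is `K`-Lipschitz on `g ''
A`; injectivity of `g` is not needed, since points with equal `g` have equal `f`. -/
lemma euclideanHausdorffMeasure_image_le {A : Set α} {f : α → V} {g : α → W} {K : NNReal} (d : ℕ)
    (h : ∀ x ∈ A, ∀ y ∈ A, dist (f x) (f y) ≤ K * dist (g x) (g y)) :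
    μHE[d] (f '' A) ≤ (K : ENNReal) ^ d * μHE[d] (g '' A) := by
  rcases A.eq_empty_or_nonempty with rfl | ⟨x₀, hx₀⟩
  · simp
  have : Nonempty α := ⟨x₀⟩
  set k : W → V := fun w => f (Function.invFunOn g A w) with hk
  have hmem : ∀ x ∈ A, Function.invFunOn g A (g x) ∈ A ∧ g (Function.invFunOn g A (g x)) = g x :=
    fun x hx => ⟨Function.invFunOn_mem ⟨x, hx, rfl⟩, Function.invFunOn_eq ⟨x, hx, rfl⟩⟩
  have hL : LipschitzOnWith K k (g '' A) := by
    refine LipschitzOnWith.of_dist_le_mul ?_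
    rintro _ ⟨x, hx, rfl⟩ _ ⟨y, hy, rfl⟩
    have := h _ (hmem x hx).1 _ (hmem y hy).1
    rwa [(hmem x hx).2, (hmem y hy).2] at this
  have himg : f '' A = k '' (g '' A) := by
    rw [image_image]
    refine image_congr fun x hx => ?_
    have := h _ (hmem x hx).1 _ hx
    rw [(hmem x hx).2, dist_self, mul_zero] at this
    exact (dist_le_zero.1 this).symm
  rw [himg, Measure.euclideanHausdorffMeasure_def, Measure.euclideanHausdorffMeasure_def]
  have := hL.hausdorffMeasure_image_le (d := d) (Nat.cast_nonneg d)
  simp only [Measure.smul_apply, Measure.nnreal_smul_coe_apply]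
  rw [mul_left_comm]
  gcongr
  simpa using this

end Lipschitz


/-! ### The area formula on an interface -/

section Area

lemma inverse_apply_self {L : Tensor E} (hL : L.det ≠ 0) (x : E) : L.inverse (L x) = x := by
  have h := ContinuousLinearMap.inverse_equiv (L.toContinuousLinearEquivOfDetNeZero hL)
  rw [ContinuousLinearMap.coe_toContinuousLinearEquivOfDetNeZero] at h
  rw [h]
  exact (L.toContinuousLinearEquivOfDetNeZero hL).symm_apply_apply x

lemma apply_inverse_self {L : Tensor E} (hL : L.det ≠ 0) (x : E) : L (L.inverse x) = x := by
  have h := ContinuousLinearMap.inverse_equiv (L.toContinuousLinearEquivOfDetNeZero hL)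
  rw [ContinuousLinearMap.coe_toContinuousLinearEquivOfDetNeZero] at h
  rw [h]
  exact (L.toContinuousLinearEquivOfDetNeZero hL).apply_symm_apply x

lemma inner_transpose_left (A : Tensor E) (x y : E) : ⟪transpose A x, y⟫_ℝ = ⟪x, A y⟫_ℝ :=
  ContinuousLinearMap.adjoint_inner_left A y x

lemma inner_transpose_right (A : Tensor E) (x y : E) : ⟪x, transpose A y⟫_ℝ = ⟪A x, y⟫_ℝ :=
  ContinuousLinearMap.adjoint_inner_right A x y

/-- The ratio by which a linear map changes the area of plane figures orthogonal to `n`. -/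
def areaFactor (L : Tensor E) (n : E) : ℝ := ‖L.det • transpose L.inverse n‖

lemma areaFactor_pos {L : Tensor E} (hL : L.det ≠ 0) {n : E} (hn : n ≠ 0) : 0 < areaFactor L n := by
  refine norm_pos_iff.2 (smul_ne_zero hL fun h => hn ?_)
  have : ⟪transpose L.inverse n, L n⟫_ℝ = 0 := by rw [h, inner_zero_left]
  rwa [inner_transpose_left, inverse_apply_self hL, inner_self_eq_zero] at this

variable (b : OrthonormalBasis (Fin 3) ℝ E)

/-- The isometric inclusion of the plane orthogonal to the first basis vector. -/
def planeIncl : EuclideanSpace ℝ (Fin 2) →ₗᵢ[ℝ] E :=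
  ((EuclideanSpace.basisFun (Fin 2) ℝ).toBasis.constr ℝ fun i => b i.succ).isometryOfOrthonormal
    (v := (EuclideanSpace.basisFun (Fin 2) ℝ).toBasis)
    (by simp)
    (by
      have : ((EuclideanSpace.basisFun (Fin 2) ℝ).toBasis.constr ℝ fun i => b i.succ) ∘
          (EuclideanSpace.basisFun (Fin 2) ℝ).toBasis = b ∘ Fin.succ := by
        ext i
        simp only [Function.comp_apply, Module.Basis.constr_basis]
      rw [this]
      exact b.orthonormal.comp _ (Fin.succ_injective _))

lemma planeIncl_single (i : Fin 2) : planeIncl b (EuclideanSpace.basisFun (Fin 2) ℝ i) = b i.succ := by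
  have := (EuclideanSpace.basisFun (Fin 2) ℝ).toBasis.constr_basis ℝ (fun i => b i.succ) i
  rwa [OrthonormalBasis.coe_toBasis] at this

lemma planeIncl_apply (y : EuclideanSpace ℝ (Fin 2)) : planeIncl b y = ∑ i, y i • b i.succ := by
  conv_lhs => rw [← (EuclideanSpace.basisFun (Fin 2) ℝ).sum_repr y]
  simp only [map_sum, map_smul, planeIncl_single, EuclideanSpace.basisFun_repr]

/-- The orthogonal projection onto the plane orthogonal to the first basis vector. -/
def planeProj : E →L[ℝ] EuclideanSpace ℝ (Fin 2) :=
  ContinuousLinearMap.adjoint (planeIncl b).toContinuousLinearMap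

lemma planeProj_apply (x : E) (i : Fin 2) : planeProj b x i = ⟪b i.succ, x⟫_ℝ := by
  rw [← planeIncl_single]
  have := ContinuousLinearMap.adjoint_inner_right (planeIncl b).toContinuousLinearMap
    (EuclideanSpace.basisFun (Fin 2) ℝ i) x
  rw [LinearIsometry.coe_toContinuousLinearMap] at this
  rw [← this, planeProj]
  simp [EuclideanSpace.inner_single_left]

lemma planeIncl_planeProj (x : E) : planeIncl b (planeProj b x) = x - ⟪b 0, x⟫_ℝ • b 0 := by
  have h := b.sum_repr' x
  rw [Fin.sum_univ_succ] at h
  rw [planeIncl_apply, eq_sub_iff_add_eq, add_comm]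
  simpa only [planeProj_apply] using h

lemma norm_planeProj_le (x : E) : ‖planeProj b x‖ ≤ ‖x‖ := by
  have h2 : ⟪planeIncl b (planeProj b x), x⟫_ℝ = ‖planeProj b x‖ ^ 2 := by
    have := ContinuousLinearMap.adjoint_inner_right (planeIncl b).toContinuousLinearMap
      (planeProj b x) x
    rw [LinearIsometry.coe_toContinuousLinearMap] at this
    rw [← this, ← planeProj, real_inner_self_eq_norm_sq]
  have h3 := real_inner_le_norm (planeIncl b (planeProj b x)) x
  rw [h2, LinearIsometry.norm_map] at h3
  rcases (norm_nonneg (planeProj b x)).eq_or_lt with h | h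
  · rw [← h]; exact norm_nonneg x
  · nlinarith

/-- Let `C` be the matrix of `LᵀL` in the basis `b`. The squared area ratio on the plane is a Gram
determinant, namely the minor of `C` without row and column 0, that is, the corresponding entry of
the adjugate. By Cramer's rule it equals `det C · (C⁻¹)₀₀ = (det L)² |L⁻ᵀ b₀|²`. -/
lemma normDet_comp_planeIncl {L : Tensor E} (hL : L.det ≠ 0) :
    ((L : E →ₗ[ℝ] E) ∘ₗ (planeIncl b).toLinearMap).normDet = areaFactor L (b 0) := by
  rw [areaFactor, ← sq_eq_sq₀ (LinearMap.normDet_nonneg _) (norm_nonneg _)]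
  set C : Matrix (Fin 3) (Fin 3) ℝ := Matrix.of fun i k => ⟪L (b i), L (b k)⟫_ℝ with hC
  set A : Matrix (Fin 3) (Fin 3) ℝ := LinearMap.toMatrix b.toBasis b.toBasis (L : E →ₗ[ℝ] E) with hA
  have hAapp : ∀ i k, A i k = ⟪b i, L (b k)⟫_ℝ := fun i k => by
    rw [hA, LinearMap.toMatrix_apply]
    simp [OrthonormalBasis.repr_apply_apply]
  have hCA : C = A.transpose * A := by
    ext i k
    rw [Matrix.mul_apply]
    simp only [hC, Matrix.of_apply, Matrix.transpose_apply, hAapp]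
    rw [← b.sum_inner_mul_inner]
    exact Finset.sum_congr rfl fun l _ => by rw [real_inner_comm]
  have hdetC : C.det = L.det ^ 2 := by
    rw [hCA, Matrix.det_mul, Matrix.det_transpose, hA, LinearMap.det_toMatrix, sq]
  have hgram : (((L : E →ₗ[ℝ] E) ∘ₗ (planeIncl b).toLinearMap).normDet) ^ 2 =
      (C.submatrix Fin.succ Fin.succ).det := by
    have := ((L : E →ₗ[ℝ] E) ∘ₗ (planeIncl b).toLinearMap).normDet_sq_eq_det_gram
      (EuclideanSpace.basisFun (Fin 2) ℝ)
    simp only [RCLike.ofReal_real_eq_id, id_eq] at this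
    rw [this]
    congr 1
    ext i k
    simp only [Matrix.gram_apply, hC, Matrix.submatrix_apply, Matrix.of_apply, LinearMap.comp_apply,
      LinearIsometry.coe_toLinearMap, planeIncl_single, ContinuousLinearMap.coe_coe]
  have hadj : C.adjugate 0 0 = (C.submatrix Fin.succ Fin.succ).det := by
    rw [Matrix.adjugate_fin_succ_eq_det_submatrix]
    simp
  -- The coordinates of `u = (LᵀL)⁻¹ b₀` form the first column of `C⁻¹`.
  set u : E := L.inverse (transpose L.inverse (b 0)) with hu
  have hCu : C.mulVec (fun k => ⟪b k, u⟫_ℝ) = Pi.single 0 1 := by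
    ext i
    have h1 : ∑ k, ⟪L (b i), L (b k)⟫_ℝ * ⟪b k, u⟫_ℝ = ⟪b i, b 0⟫_ℝ := by
      have h2 : L u = ∑ k, ⟪b k, u⟫_ℝ • L (b k) := by
        conv_lhs => rw [← b.sum_repr' u]
        simp
      calc ∑ k, ⟪L (b i), L (b k)⟫_ℝ * ⟪b k, u⟫_ℝ = ⟪L (b i), L u⟫_ℝ := by
            rw [h2, inner_sum]
            exact Finset.sum_congr rfl fun k _ => by rw [real_inner_smul_right, mul_comm]
        _ = ⟪b i, b 0⟫_ℝ := by
            rw [hu, apply_inverse_self hL, inner_transpose_right, inverse_apply_self hL]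
    simp only [Matrix.mulVec, dotProduct, hC, Matrix.of_apply]
    rw [h1, orthonormal_iff_ite.1 b.orthonormal]
    simp [Pi.single_apply]
  have h3 : C.adjugate 0 0 = C.det * ⟪b 0, u⟫_ℝ := by
    have h4 : C.adjugate.mulVec (C.mulVec fun k => ⟪b k, u⟫_ℝ) = C.det • fun k => ⟪b k, u⟫_ℝ := by
      rw [Matrix.mulVec_mulVec, Matrix.adjugate_mul, Matrix.smul_mulVec, Matrix.one_mulVec]
    rw [hCu, Matrix.mulVec_single_one] at h4
    simpa using congrFun h4 0
  rw [hgram, ← hadj, h3, hdetC, norm_smul, mul_pow, Real.norm_eq_abs, sq_abs, hu,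
    ← inner_transpose_left, real_inner_self_eq_norm_sq]

lemma exists_orthonormalBasis_first (hdim : Module.finrank ℝ E = 3) {n : E} (hn : ‖n‖ = 1) :
    ∃ b : OrthonormalBasis (Fin 3) ℝ E, b 0 = n := by
  have hv : Orthonormal ℝ (({0} : Set (Fin 3)).domRestrict fun _ => n) := by
    refine ⟨fun _ => hn, fun i j hij => absurd (Subsingleton.elim i j) hij⟩
  obtain ⟨b, hb⟩ := hv.exists_orthonormalBasis_extension_of_card_eq (by simp [hdim])
  exact ⟨b, hb 0 rfl⟩

variable {b}

/-- Near `X` the map `Φ`, restricted to the surface, is almost isometric to its linear part on the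
tangent plane, and so is the projection onto the tangent plane. -/
lemma eventually_compare {S U : Set E} {m : E → E} {ℓ : E → ℝ} {X : E} {Φ : E → E} {L : Tensor E}
    (hd : IsDefining S m U ℓ) (hXU : X ∈ U) (hXS : X ∈ S) (hb : b 0 = m X)
    (hΦ : HasStrictFDerivAt Φ L X) (hL : L.det ≠ 0) {K : ℝ} (hK : 1 < K) :
    ∃ W ∈ 𝓝 X, ∀ x ∈ S ∩ W, ∀ y ∈ S ∩ W,
      dist (Φ x) (Φ y) ≤ K * dist (L (planeIncl b (planeProj b x))) (L (planeIncl b (planeProj b y))) ∧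
      dist (L (planeIncl b (planeProj b x))) (L (planeIncl b (planeProj b y))) ≤ K * dist (Φ x) (Φ y) ∧
      dist x y ≤ K * dist (planeProj b x) (planeProj b y) := by
  set q : E →L[ℝ] E := (planeIncl b).toContinuousLinearMap ∘L planeProj b with hq
  have hqapp : ∀ x, q x = planeIncl b (planeProj b x) := fun x => rfl
  set l : Filter (E × E) := 𝓝 (X, X) ⊓ 𝓟 (S ×ˢ S) with hl
  have hℓ : HasStrictFDerivAt ℓ (fderiv ℝ ℓ X) X :=
    (hd.contDiffAt hXU).hasStrictFDerivAt one_ne_zero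
  set g := ‖gradient ℓ X‖ with hg
  have hg0 : 0 < g := norm_pos_iff.2 (hd.gradient_ne_zero X hXU)
  have hUl : ∀ᶠ p : E × E in l, p.1 ∈ S ∧ p.2 ∈ S ∧ p.1 ∈ U ∧ p.2 ∈ U := by
    have h1 : ∀ᶠ p : E × E in 𝓝 (X, X), p.1 ∈ U ∧ p.2 ∈ U := by
      rw [nhds_prod_eq]
      exact Filter.Eventually.prod_mk (hd.isOpen.mem_nhds hXU) (hd.isOpen.mem_nhds hXU)
    filter_upwards [h1.filter_mono inf_le_left, mem_inf_of_right (mem_principal_self _)] with p h2 h3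
    exact ⟨h3.1, h3.2, h2.1, h2.2⟩
  -- Secants of the surface are almost tangent: `ℓ` vanishes at both endpoints, so strict
  -- differentiability makes the normal component of the secant of smaller order.
  have o1 : (fun p : E × E => (p.1 - p.2) - q (p.1 - p.2)) =o[l] fun p => p.1 - p.2 := by
    have h1 := (hℓ.isLittleO.mono (inf_le_left : l ≤ _)).const_mul_left g⁻¹
    refine Asymptotics.IsLittleO.of_norm_left (Asymptotics.IsLittleO.congr' h1.norm_left ?_ .rfl)
    filter_upwards [hUl] with p hp
    rw [hqapp, planeIncl_planeProj, sub_sub_cancel, norm_smul, b.orthonormal.1, mul_one,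
      (hd.mem_iff _ hp.2.2.1).1 hp.1, (hd.mem_iff _ hp.2.2.2).1 hp.2.1,
      hd.fderiv_apply hXU hXS, ← hg, hb, sub_self, zero_sub, norm_mul, norm_neg, norm_mul, norm_inv,
      Real.norm_of_nonneg hg0.le, ← mul_assoc, inv_mul_cancel₀ hg0.ne', one_mul]
  have O1 : (fun p : E × E => p.1 - p.2) =O[l] fun p => q (p.1 - p.2) := by
    have := o1.right_isBigO_sub
    refine (this.congr_right fun p => ?_ : _)
    abel
  have O2 : (fun p : E × E => q (p.1 - p.2)) =O[l] fun p => L (q (p.1 - p.2)) := by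
    have : (fun p : E × E => q (p.1 - p.2)) = fun p => L.inverse (L (q (p.1 - p.2))) := by
      ext p
      rw [inverse_apply_self hL]
    rw [this]
    exact L.inverse.isBigO_comp _ _
  have o2 : (fun p : E × E => Φ p.1 - Φ p.2 - L (q (p.1 - p.2))) =o[l] fun p => p.1 - p.2 := by
    have h1 := hΦ.isLittleO.mono (inf_le_left : l ≤ _)
    have h2 := (L.isBigO_comp (fun p : E × E => (p.1 - p.2) - q (p.1 - p.2)) l).trans_isLittleO o1
    refine (h1.add h2).congr_left fun p => ?_
    rw [map_sub L (p.1 - p.2) (q (p.1 - p.2))]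
    abel
  have o3 := o2.trans_isBigO (O1.trans O2)
  have o4 := o1.trans_isBigO O1
  -- With this choice `1 + η ≤ K` and `K (1 - η) = 1`, as the two directions of the comparison
  -- require.
  set η : ℝ := (K - 1) / K with hη
  have hη0 : 0 < η := div_pos (by linarith) (by linarith)
  have hηK : η ≤ K - 1 := div_le_self (by linarith) hK.le
  have e3 := o3.def hη0
  have e4 := o4.def hη0
  have ev := (e3.and e4)
  rw [hl, Filter.eventually_inf_principal, nhds_prod_eq] at ev
  obtain ⟨W, hW, hev⟩ := Filter.eventually_prod_self_iff'.1 ev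
  refine ⟨W, hW, fun x hx y hy => ?_⟩
  obtain ⟨h1, h2⟩ := hev x hx.2 y hy.2 ⟨hx.1, hy.1⟩
  simp only [dist_eq_norm] at *
  have e5 : L (planeIncl b (planeProj b x)) - L (planeIncl b (planeProj b y)) = L (q (x - y)) := by
    rw [hqapp, map_sub, map_sub, map_sub]
  have e6 : ‖planeProj b x - planeProj b y‖ = ‖q (x - y)‖ := by
    rw [hqapp, LinearIsometry.norm_map, map_sub]
  rw [e5, e6]
  have t1 := norm_sub_norm_le (Φ x - Φ y) (L (q (x - y)))
  have t2 := norm_sub_norm_le (L (q (x - y))) (Φ x - Φ y)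
  rw [norm_sub_rev (L (q (x - y)))] at t2
  have t3 := norm_sub_norm_le (x - y) (q (x - y))
  have hKη : K * (1 - η) = 1 := by rw [hη]; field_simp; ring
  refine ⟨?_, ?_, ?_⟩
  · nlinarith [norm_nonneg (L (q (x - y)))]
  · have : (1 - η) * ‖L (q (x - y))‖ ≤ ‖Φ x - Φ y‖ := by linarith
    calc ‖L (q (x - y))‖ = K * ((1 - η) * ‖L (q (x - y))‖) := by rw [← mul_assoc, hKη, one_mul]
      _ ≤ K * ‖Φ x - Φ y‖ := by gcongr
  · nlinarith [norm_nonneg (q (x - y))]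

/-- Area formula: the measure of the image of a part of an interface. -/
theorem measure_image_interface (hdim : Module.finrank ℝ E = 3) {S A₀ : Set E} {m : E → E}
    {Φ : E → E} {L : E → Tensor E} (hA₀ : A₀ ⊆ S)
    (hloc : ∀ X ∈ A₀, ∃ U ℓ, X ∈ U ∧ IsDefining S m U ℓ)
    (hc : ContinuousOn Φ A₀) (hinj : InjOn Φ A₀)
    (hΦ : ∀ X ∈ A₀, ∃ Ψ : E → E, HasStrictFDerivAt Ψ (L X) X ∧ ∀ᶠ Y in 𝓝[A₀] X, Φ Y = Ψ Y)
    (hL : ∀ X ∈ A₀, (L X).det ≠ 0) (hθ : ContinuousOn (fun X => areaFactor (L X) (m X)) A₀)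
    {A : Set E} (hA : A ⊆ A₀) (hAm : MeasurableSet A) :
    μHE[2] (Φ '' A) = ∫⁻ X in A, ENNReal.ofReal (areaFactor (L X) (m X)) ∂μHE[2] := by
  have hpos : ∀ X ∈ A₀, 0 < areaFactor (L X) (m X) := fun X hX => by
    obtain ⟨U, ℓ, hXU, hd⟩ := hloc X hX
    refine areaFactor_pos (hL X hX) fun h0 => ?_
    have := hd.norm_normal hXU (hA₀ hX)
    rw [h0] at this
    simp at this
  have hcmp : ∀ X ∈ A₀, ∀ t : ℝ, 1 < t → ∃ W ∈ 𝓝 X, ∀ A ⊆ A₀ ∩ W,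
      μHE[2] (Φ '' A) ≤ ENNReal.ofReal (t * areaFactor (L X) (m X)) * μHE[2] A ∧
      ENNReal.ofReal (areaFactor (L X) (m X)) * μHE[2] A ≤ ENNReal.ofReal t * μHE[2] (Φ '' A) := by
    intro X hX t ht
    obtain ⟨U, ℓ, hXU, hd⟩ := hloc X hX
    obtain ⟨b, hb⟩ := exists_orthonormalBasis_first hdim (hd.norm_normal hXU (hA₀ hX))
    -- `Φ` need only agree on the surface with a strictly differentiable map. This admits the solid
    -- motion, whose gradient may jump across the interface.
    obtain ⟨Ψ, hΨ, hΦΨ⟩ := hΦ X hX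
    obtain ⟨W₁, hW₁, hΦΨ⟩ := mem_nhdsWithin_iff_exists_mem_nhds_inter.1 hΦΨ
    -- Each Lipschitz comparison costs `K²` in area. The lower bound uses two of them, one for the
    -- projection to the tangent plane and one for the image.
    obtain ⟨K, hK1, hKt⟩ : ∃ K : ℝ, 1 < K ∧ K ^ 4 = t := by
      refine ⟨t ^ ((1 : ℝ) / 4), Real.one_lt_rpow ht (by norm_num), ?_⟩
      rw [← Real.rpow_natCast, ← Real.rpow_mul (by linarith)]
      norm_num
    have hK0 : 0 ≤ K := by linarith
    obtain ⟨W, hW, hcomp⟩ := eventually_compare hd hXU (hA₀ hX) hb hΨ (hL X hX) hK1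
    refine ⟨W ∩ W₁, inter_mem hW hW₁, fun A hA => ?_⟩
    have hAW : ∀ x ∈ A, x ∈ S ∩ W := fun x hx => ⟨hA₀ (hA hx).1, (hA hx).2.1⟩
    have himg : Φ '' A = Ψ '' A := image_congr fun x hx => hΦΨ ⟨(hA hx).2.2, (hA hx).1⟩
    set T : EuclideanSpace ℝ (Fin 2) →ₗ[ℝ] E := (L X : E →ₗ[ℝ] E) ∘ₗ (planeIncl b).toLinearMap
    have hT : ∀ x, L X (planeIncl b (planeProj b x)) = T (planeProj b x) := fun x => rfl
    have hTA : μHE[2] ((fun x => T (planeProj b x)) '' A) =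
        ENNReal.ofReal (areaFactor (L X) (m X)) * μHE[2] (planeProj b '' A) := by
      have := T.euclideanHausdorffMeasure_image (planeProj b '' A)
      rw [finrank_euclideanSpace_fin, image_image] at this
      rw [this, normDet_comp_planeIncl b (hL X hX), hb]
    set k : NNReal := ⟨K, hK0⟩
    have hk : (k : ENNReal) = ENNReal.ofReal K := (ENNReal.ofReal_eq_coe_nnreal hK0).symm
    have m1 : μHE[2] (Ψ '' A) ≤ (k : ENNReal) ^ 2 * μHE[2] ((fun x => T (planeProj b x)) '' A) :=
      euclideanHausdorffMeasure_image_le 2 fun x hx y hy => (hcomp x (hAW x hx) y (hAW y hy)).1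
    have m2 : μHE[2] ((fun x => T (planeProj b x)) '' A) ≤ (k : ENNReal) ^ 2 * μHE[2] (Ψ '' A) :=
      euclideanHausdorffMeasure_image_le 2 fun x hx y hy => (hcomp x (hAW x hx) y (hAW y hy)).2.1
    have m3 : μHE[2] A ≤ (k : ENNReal) ^ 2 * μHE[2] (planeProj b '' A) := by
      have := euclideanHausdorffMeasure_image_le (f := (id : E → E)) (g := planeProj b) (A := A)
        (K := k) 2 fun x hx y hy => (hcomp x (hAW x hx) y (hAW y hy)).2.2
      rwa [image_id] at this
    have m4 : μHE[2] (planeProj b '' A) ≤ μHE[2] A := by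
      have := euclideanHausdorffMeasure_image_le (g := (id : E → E)) (f := planeProj b) (A := A)
        (K := 1) 2 fun x _ y _ => by
          rw [dist_eq_norm, dist_eq_norm, ← map_sub]
          simpa using norm_planeProj_le b (x - y)
      simpa using this
    rw [hTA] at m1 m2
    have hKK : ENNReal.ofReal t = (k : ENNReal) ^ 2 * (k : ENNReal) ^ 2 := by
      rw [← hKt, hk, ← pow_add, ENNReal.ofReal_pow hK0]
    have hk1 : (1 : ENNReal) ≤ (k : ENNReal) ^ 2 := one_le_pow₀ (by
      rw [hk]; exact ENNReal.one_le_ofReal.2 hK1.le)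
    rw [himg]
    constructor
    · calc μHE[2] (Ψ '' A) ≤ (k : ENNReal) ^ 2 *
            (ENNReal.ofReal (areaFactor (L X) (m X)) * μHE[2] A) := m1.trans (by gcongr)
        _ ≤ ((k : ENNReal) ^ 2 * (k : ENNReal) ^ 2) *
            (ENNReal.ofReal (areaFactor (L X) (m X)) * μHE[2] A) := by
            gcongr
            exact le_mul_of_one_le_left (by positivity) hk1
        _ = _ := by rw [← hKK, ← mul_assoc, ENNReal.ofReal_mul (by linarith)]
    · calc ENNReal.ofReal (areaFactor (L X) (m X)) * μHE[2] A
          ≤ ENNReal.ofReal (areaFactor (L X) (m X)) *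
            ((k : ENNReal) ^ 2 * μHE[2] (planeProj b '' A)) := by gcongr
        _ = (k : ENNReal) ^ 2 *
            (ENNReal.ofReal (areaFactor (L X) (m X)) * μHE[2] (planeProj b '' A)) := by ring
        _ ≤ (k : ENNReal) ^ 2 * ((k : ENNReal) ^ 2 * μHE[2] (Ψ '' A)) := by gcongr
        _ = _ := by rw [hKK, mul_assoc]
  refine eq_setLIntegral_of_local (S := A₀) hθ hpos (ν := fun A => μHE[2] (Φ '' A)) (by simp)
    (fun A hAd hAm hAS => ?_) (fun X hX t ht => ?_) (fun X hX t ht => ?_) hA hAm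
  · simp only [image_iUnion]
    refine measure_iUnion (fun i j hij => ?_) fun i =>
      (hAm i).image_of_continuousOn_injOn (hc.mono (hAS i)) (hinj.mono (hAS i))
    refine disjoint_left.2 ?_
    rintro _ ⟨x, hx, rfl⟩ ⟨y, hy, hxy⟩
    rw [hinj (hAS j hy) (hAS i hx) hxy] at hy
    exact disjoint_left.1 (hAd hij) hx hy
  · obtain ⟨W, hW, h⟩ := hcmp X hX t ht
    exact ⟨W, hW, fun A hA _ => (h A hA).1⟩
  · obtain ⟨W, hW, h⟩ := hcmp X hX t ht
    exact ⟨W, hW, fun A hA _ => (h A hA).2⟩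

end Area


/-! ### The divergence theorem on one side of a surface -/

section HalfSpace

/-- It glues a function controlled only near a closed set with zero outside that set. -/
lemma continuous_of_eq_zero_off {α F : Type*} [TopologicalSpace α] [TopologicalSpace F] [Zero F]
    {f : α → F} {V C : Set α} (hV : IsOpen V) (hC : IsClosed C) (hCV : C ⊆ V)
    (hf : ContinuousOn f V) (h0 : ∀ x ∉ C, f x = 0) : Continuous f := by
  refine continuous_iff_continuousAt.2 fun x => ?_
  by_cases hx : x ∈ C
  · exact hf.continuousAt (hV.mem_nhds (hCV hx))
  · refine (continuousAt_const (y := (0 : F))).congr ?_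
    filter_upwards [hC.isOpen_compl.mem_nhds hx] with y hy using (h0 y hy).symm

variable (b : OrthonormalBasis (Fin 3) ℝ E)

lemma continuous_planeCoord :
    Continuous fun p : ℝ × EuclideanSpace ℝ (Fin 2) => p.1 • b 0 + planeIncl b p.2 :=
  (continuous_fst.smul continuous_const).add ((planeIncl b).continuous.comp continuous_snd)

lemma inner_planeIncl (y : EuclideanSpace ℝ (Fin 2)) : ⟪b 0, planeIncl b y⟫_ℝ = 0 := by
  rw [planeIncl_apply, inner_sum]
  refine Finset.sum_eq_zero fun i _ => ?_
  rw [real_inner_smul_right, b.orthonormal.2 (Fin.succ_ne_zero i).symm, mul_zero]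

lemma inner_planeCoord (p : ℝ × EuclideanSpace ℝ (Fin 2)) :
    ⟪b 0, p.1 • b 0 + planeIncl b p.2⟫_ℝ = p.1 := by
  rw [inner_add_right, inner_planeIncl, real_inner_smul_right, real_inner_self_eq_norm_sq,
    b.orthonormal.1]
  simp

/-- In the basis `b` the map merely merges the coordinate along `b 0` with the two others. It makes
Fubini's theorem available for the normal direction and the planes parallel to the tangent plane. -/
lemma measurePreserving_planeCoord :
    MeasurePreserving fun p : ℝ × EuclideanSpace ℝ (Fin 2) => p.1 • b 0 + planeIncl b p.2 := by
  have h1 : MeasurePreserving (Prod.map id (@WithLp.ofLp 2 (Fin 2 → ℝ)) :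
      ℝ × EuclideanSpace ℝ (Fin 2) → ℝ × (Fin 2 → ℝ)) :=
    (MeasurePreserving.id volume).prod (PiLp.volume_preserving_ofLp (Fin 2))
  have h2 := (volume_preserving_piFinSuccAbove (fun _ : Fin 3 => ℝ) 0).symm
  have h3 := PiLp.volume_preserving_toLp (Fin 3)
  have h4 := b.measurePreserving_repr_symm
  have h := h4.comp (h3.comp (h2.comp h1))
  refine (congrArg (fun f => MeasurePreserving f volume volume) ?_).mpr h
  refine funext fun p => ?_
  change _ = b.repr.symm (WithLp.toLp 2 ((MeasurableEquiv.piFinSuccAbove (fun _ => ℝ) 0).symm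
    (p.1, WithLp.ofLp p.2)))
  rw [← b.sum_repr_symm, Fin.sum_univ_succ, planeIncl_apply]
  simp [MeasurableEquiv.piFinSuccAbove]

/-- The derivative of the smooth transition function, a bump supported in `[0, 1]`. -/
lemma deriv_smoothTransition_eq_zero {x : ℝ} (hx : x ∉ Icc (0 : ℝ) 1) :
    deriv Real.smoothTransition x = 0 := by
  rcases lt_or_ge x 0 with h | h
  · have : Real.smoothTransition =ᶠ[𝓝 x] fun _ => 0 := by
      filter_upwards [gt_mem_nhds h] with y hy using Real.smoothTransition.zero_of_nonpos hy.le
    rw [this.deriv_eq, deriv_const]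
  · have h1 : 1 < x := by
      by_contra h2
      exact hx ⟨h, not_lt.1 h2⟩
    have : Real.smoothTransition =ᶠ[𝓝 x] fun _ => 1 := by
      filter_upwards [lt_mem_nhds h1] with y hy using Real.smoothTransition.one_of_one_le hy.le
    rw [this.deriv_eq, deriv_const]

lemma continuous_deriv_smoothTransition : Continuous (deriv Real.smoothTransition) :=
  (Real.smoothTransition.contDiff (n := 1)).continuous_deriv le_rfl

lemma hasDerivAt_smoothTransition (x : ℝ) :
    HasDerivAt Real.smoothTransition (deriv Real.smoothTransition x) x :=
  ((Real.smoothTransition.contDiff (n := 1)).differentiable one_ne_zero x).hasDerivAt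

lemma integral_deriv_smoothTransition : ∫ x, deriv Real.smoothTransition x = 1 := by
  have hi : Integrable (deriv Real.smoothTransition) :=
    continuous_deriv_smoothTransition.integrable_of_hasCompactSupport
      (HasCompactSupport.intro isCompact_Icc fun x hx => deriv_smoothTransition_eq_zero hx)
  have h0 : Tendsto Real.smoothTransition atBot (𝓝 0) := by
    refine tendsto_const_nhds.congr' ?_
    filter_upwards [eventually_le_atBot 0] with x hx
      using (Real.smoothTransition.zero_of_nonpos hx).symm
  have h1 : Tendsto Real.smoothTransition atTop (𝓝 1) := by
    refine tendsto_const_nhds.congr' ?_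
    filter_upwards [eventually_ge_atTop 1] with x hx
      using (Real.smoothTransition.one_of_one_le hx).symm
  rw [integral_of_hasDerivAt_of_tendsto hasDerivAt_smoothTransition hi h0 h1, sub_zero]

/-- Averages over thin layers converge to the integral over the plane. -/
lemma tendsto_layer_integral {K : E → ℝ} (hK : Continuous K) (hKc : HasCompactSupport K) :
    Tendsto (fun c : ℝ => ∫ x, c * deriv Real.smoothTransition (c * ⟪b 0, x⟫_ℝ) * K x) atTop
      (𝓝 (∫ y, K (planeIncl b y))) := by
  set P : ℝ × EuclideanSpace ℝ (Fin 2) → E := fun p => p.1 • b 0 + planeIncl b p.2 with hP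
  have hPc : Continuous P := continuous_planeCoord b
  have hnorm : ∀ p, ‖P p‖ ^ 2 = p.1 ^ 2 + ‖p.2‖ ^ 2 := by
    intro p
    rw [hP]
    simp only
    rw [norm_add_sq_real, real_inner_smul_left, inner_planeIncl, norm_smul, b.orthonormal.1,
      LinearIsometry.norm_map]
    simp
  obtain ⟨R, hR⟩ := hKc.isCompact.isBounded.exists_norm_le
  have hKR : ∀ x, R < ‖x‖ → K x = 0 := fun x hx => by
    by_contra h
    exact absurd (hR x (subset_tsupport K h)) (not_le.2 hx)
  set g : ℝ → ℝ := fun s => ∫ y, K (P (s, y)) with hg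
  have hball : ∀ s, g s = ∫ y in Metric.closedBall 0 R, K (P (s, y)) := by
    intro s
    refine (setIntegral_eq_integral_of_forall_compl_eq_zero fun y hy => hKR _ ?_).symm
    have h1 : R < ‖y‖ := by simpa using hy
    have h2 := hnorm (s, y)
    exact h1.trans_le (abs_le_of_sq_le_sq' (by nlinarith [sq_nonneg s]) (norm_nonneg _)).2
  have hgc : Continuous g := by
    have : Continuous (Function.uncurry fun (s : ℝ) (y : EuclideanSpace ℝ (Fin 2)) =>
      K (P (s, y))) := hK.comp hPc
    have h2 := continuous_parametric_integral_of_continuous (μ := volume) this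
      (isCompact_closedBall (0 : EuclideanSpace ℝ (Fin 2)) R)
    rwa [show g = fun s => ∫ y in Metric.closedBall 0 R, K (P (s, y)) from funext hball]
  have hgs : HasCompactSupport g := by
    refine HasCompactSupport.intro (isCompact_closedBall (0 : ℝ) R) fun s hs => ?_
    have h1 : R < |s| := by simpa using hs
    refine integral_eq_zero_of_ae (ae_of_all _ fun y => hKR _ ?_)
    have h2 := hnorm (s, y)
    exact h1.trans_le (abs_le_of_sq_le_sq (by nlinarith [sq_nonneg ‖y‖]) (norm_nonneg _))
  have hgi : Integrable g := hgc.integrable_of_hasCompactSupport hgs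
  -- The kernel depends only on the coordinate along `b 0`; integration over the parallel planes
  -- comes first and gives `g`.
  have hfub : ∀ c : ℝ, ∫ x, c * deriv Real.smoothTransition (c * ⟪b 0, x⟫_ℝ) * K x =
      ∫ s, c * deriv Real.smoothTransition (c * s) * g s := by
    intro c
    have hcont : Continuous fun x => c * deriv Real.smoothTransition (c * ⟪b 0, x⟫_ℝ) * K x := by
      have := continuous_deriv_smoothTransition
      fun_prop
    have hint : Integrable fun x => c * deriv Real.smoothTransition (c * ⟪b 0, x⟫_ℝ) * K x :=
      hcont.integrable_of_hasCompactSupport hKc.mul_left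
    have hmp := measurePreserving_planeCoord b
    rw [← hmp.map_eq, integral_map hPc.aemeasurable hcont.aestronglyMeasurable]
    have hint' := (hmp.integrable_comp hcont.aestronglyMeasurable).2 hint
    rw [Measure.volume_eq_prod]
    refine (integral_prod _ hint').trans ?_
    refine integral_congr_ae (ae_of_all _ fun s => ?_)
    simp only [hg]
    rw [← integral_const_mul]
    refine integral_congr_ae (ae_of_all _ fun y => ?_)
    simp only [Function.comp_apply, inner_planeCoord b (s, y), hP]
  simp_rw [hfub]
  -- The approximate identity is evaluated at `c (0 - s)`, hence the reflected bump. That its mass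
  -- lies on one side of zero is harmless, because `g` is continuous.
  have hpeak := tendsto_integral_comp_smul_smul_of_integrable' (F := ℝ) (μ := volume)
    (φ := fun x => deriv Real.smoothTransition (-x)) (g := g) (x₀ := 0)
    (fun x => Real.smoothTransition.monotone.deriv_nonneg)
    (by rw [integral_neg_eq_self]; exact integral_deriv_smoothTransition) ?_ hgi
    hgc.continuousAt
  · have h0 : g 0 = ∫ y, K (planeIncl b y) := by simp [hg, hP]
    rw [h0] at hpeak
    refine hpeak.congr fun c => integral_congr_ae (ae_of_all _ fun s => ?_)
    simp
  · refine tendsto_const_nhds.congr' ?_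
    filter_upwards [Bornology.isBounded_def.1 (Metric.isBounded_Icc (-1 : ℝ) 0)] with x hx
    rw [deriv_smoothTransition_eq_zero, mul_zero]
    intro h
    exact hx ⟨by linarith [h.2], by linarith [h.1]⟩

end HalfSpace


/-! ### Flattening a surface by its defining function. -/

section HalfSpaceFormula

variable {S U : Set E} {m : E → E} {ℓ : E → ℝ} {X : E}

lemma det_ne_zero_of_forall {L : Tensor E} (h : ∀ v, L v = 0 → v = 0) : L.det ≠ 0 := by
  intro h0
  obtain ⟨v, hv, hv0⟩ := (Submodule.ne_bot_iff _).1
    (LinearMap.bot_lt_ker_of_det_eq_zero (f := (L : E →ₗ[ℝ] E)) h0).ne'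
  exact hv0 (h v hv)

/-- The divergence theorem for functions supported near a point of a surface, on the positive side. -/
lemma exists_integral_pos_side (hdim : Module.finrank ℝ E = 3) (hd : IsDefining S m U ℓ)
    (hXU : X ∈ U) (hXS : X ∈ S) : ∃ V, IsOpen V ∧ X ∈ V ∧ V ⊆ U ∧
      ∀ h : E → ℝ, ContDiff ℝ 1 h → HasCompactSupport h → tsupport h ⊆ V → ∀ e : E,
        ∫ x in V ∩ {x | 0 < ℓ x}, fderiv ℝ h x e = -∫ x in S ∩ V, h x * ⟪m x, e⟫_ℝ ∂μHE[2] := by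
  obtain ⟨r, hr, hVU, hpos⟩ := hd.exists_ball_fderiv_pos hXU hXS
  have hn := hd.norm_normal hXU hXS
  obtain ⟨b, hb⟩ := exists_orthonormalBasis_first hdim hn
  set n : E := m X
  set V := Metric.ball X r
  have hVo : IsOpen V := Metric.isOpen_ball
  refine ⟨V, hVo, Metric.mem_ball_self hr, hVU, fun h hh hhc hhV e => ?_⟩
  have hnn : ⟪n, n⟫_ℝ = 1 := by rw [real_inner_self_eq_norm_sq, hn, one_pow]
  -- `Φ` replaces the coordinate along `n` by `ℓ` and keeps the orthogonal ones. It sends level sets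
  -- of `ℓ` into planes orthogonal to `n`, and the surface into the plane through the origin.
  set Φ : E → E := fun x => x + (ℓ x - ⟪n, x⟫_ℝ) • n with hΦ
  set L : E → Tensor E := fun x =>
    ContinuousLinearMap.id ℝ E + (fderiv ℝ ℓ x - innerSL ℝ n).smulRight n with hLdef
  have hLapp : ∀ x v, L x v = v + (fderiv ℝ ℓ x v - ⟪n, v⟫_ℝ) • n := fun x v => rfl
  have hLn : ∀ x v, ⟪n, L x v⟫_ℝ = fderiv ℝ ℓ x v := by
    intro x v
    rw [hLapp, inner_add_right, real_inner_smul_right, hnn]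
    ring
  have hΦn : ∀ x, ⟪n, Φ x⟫_ℝ = ℓ x := by
    intro x
    rw [hΦ]
    simp only
    rw [inner_add_right, real_inner_smul_right, hnn]
    ring
  have hdet : ∀ x ∈ V, (L x).det ≠ 0 := fun x hx => det_ne_zero_of_forall fun v hv => by
    have h1 : fderiv ℝ ℓ x v = 0 := by rw [← hLn, hv, inner_zero_right]
    rw [hLapp, h1, zero_sub, neg_smul, ← sub_eq_add_neg, sub_eq_zero] at hv
    rw [hv, map_smul, smul_eq_mul] at h1
    rw [hv, (mul_eq_zero.1 h1).resolve_right (hpos x hx).ne', zero_smul]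
  have hstrict : ∀ x ∈ V, HasStrictFDerivAt Φ (L x) x := fun x hx =>
    (hasStrictFDerivAt_id x).add ((((hd.contDiffAt (hVU hx)).hasStrictFDerivAt one_ne_zero).sub
      (innerSL ℝ n).hasStrictFDerivAt).smul_const n)
  have hmap : ∀ x ∈ V, map Φ (𝓝 x) = 𝓝 (Φ x) := fun x hx => by
    have h1 := hstrict x hx
    rw [← (L x).coe_toContinuousLinearEquivOfDetNeZero (hdet x hx)] at h1
    exact h1.map_nhds_eq_of_equiv
  have hΦc : ContinuousOn Φ V := fun x hx => (hstrict x hx).continuousAt.continuousWithinAt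
  have hℓc : ContinuousOn ℓ V := hd.contDiffOn.continuousOn.mono hVU
  have hDc : ContinuousOn (fderiv ℝ ℓ) V := hd.continuousOn_fderiv.mono hVU
  have hinj : InjOn Φ V := by
    have key : ∀ x ∈ V, ∀ s : ℝ, x + s • n ∈ V → 0 < s → ℓ x < ℓ (x + s • n) := fun x hx s hs h0 =>
      strictMonoOn_line (fun Y hY => hd.differentiableAt (hVU hY)) hpos h0 hx hs
    intro x hx y hy hxy
    have hℓ : ℓ x = ℓ y := by rw [← hΦn, ← hΦn, hxy]
    have hs : y = x + (⟪n, y⟫_ℝ - ⟪n, x⟫_ℝ) • n := by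
      have h1 : x + (ℓ x - ⟪n, x⟫_ℝ) • n = y + (ℓ y - ⟪n, y⟫_ℝ) • n := hxy
      rw [hℓ, sub_smul, sub_smul] at h1
      rw [sub_smul, ← sub_eq_zero]
      rw [← sub_eq_zero] at h1
      rw [← neg_eq_zero, ← h1]
      abel
    rcases lt_trichotomy 0 (⟪n, y⟫_ℝ - ⟪n, x⟫_ℝ) with h0 | h0 | h0
    · have := key x hx _ (hs ▸ hy) h0
      rw [← hs, hℓ] at this
      exact absurd this (lt_irrefl _)
    · rw [← h0, zero_smul, add_zero] at hs
      exact hs.symm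
    · have hs' : x = y + (⟪n, x⟫_ℝ - ⟪n, y⟫_ℝ) • n := by
        calc x = (x + (⟪n, y⟫_ℝ - ⟪n, x⟫_ℝ) • n) + (⟪n, x⟫_ℝ - ⟪n, y⟫_ℝ) • n := by
              rw [add_assoc, ← add_smul]
              simp
          _ = _ := by rw [← hs]
      have := key y hy _ (hs' ▸ hx) (by linarith)
      rw [← hs', hℓ] at this
      exact absurd this (lt_irrefl _)
  have hdetc : ContinuousOn (fun x => |(L x).det|) V := by
    refine (ContinuousLinearMap.continuous_det.comp_continuousOn ?_).abs
    refine continuousOn_const.add ?_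
    exact ((ContinuousLinearMap.smulRightL ℝ E E).flip n).continuous.comp_continuousOn
      (hDc.sub continuousOn_const)
  -- The division by `|det L|` absorbs the Jacobian of `Φ`; `K` below is this function carried to
  -- the flattened coordinates.
  set G : E → ℝ := fun x => h x * fderiv ℝ ℓ x e / |(L x).det| with hG
  have hGc : ContinuousOn G V :=
    (hh.continuous.continuousOn.mul (hDc.clm_apply continuousOn_const)).div hdetc
      fun x hx => abs_ne_zero.2 (hdet x hx)
  have hG0 : ∀ x ∉ tsupport h, G x = 0 := fun x hx => by
    rw [hG]
    simp [image_eq_zero_of_notMem_tsupport hx]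
  set K : E → ℝ := (Φ '' V).indicator fun y => G (Function.invFunOn Φ V y) with hKdef
  have hKΦ : ∀ x ∈ V, K (Φ x) = G x := fun x hx => by
    rw [hKdef, indicator_of_mem (mem_image_of_mem Φ hx), hinj.leftInvOn_invFunOn hx]
  set C := Φ '' tsupport h
  have hC : IsCompact C := hhc.isCompact.image_of_continuousOn (hΦc.mono hhV)
  have hK0 : ∀ y ∉ C, K y = 0 := by
    intro y hy
    by_cases hyV : y ∈ Φ '' V
    · obtain ⟨x, hx, rfl⟩ := hyV
      rw [hKΦ x hx]
      exact hG0 x fun h1 => hy ⟨x, h1, rfl⟩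
    · exact indicator_of_notMem hyV _
  have hKcont : Continuous K := by
    have hmapV : ∀ x ∈ V, Φ '' V ∈ 𝓝 (Φ x) := fun x hx => by
      rw [← hmap x hx]
      exact image_mem_map (hVo.mem_nhds hx)
    refine continuous_of_eq_zero_off (V := Φ '' V) (isOpen_iff_mem_nhds.2 ?_) hC.isClosed
      (image_mono hhV) ?_ hK0
    · rintro _ ⟨x, hx, rfl⟩
      exact hmapV x hx
    · rintro _ ⟨x, hx, rfl⟩
      refine ContinuousAt.continuousWithinAt ?_
      rw [ContinuousAt, ← hmap x hx, tendsto_map'_iff, hKΦ x hx]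
      refine (hGc.continuousAt (hVo.mem_nhds hx)).tendsto.congr' ?_
      filter_upwards [hVo.mem_nhds hx] with y hy using (hKΦ y hy).symm
  have hKcs : HasCompactSupport K := HasCompactSupport.intro hC hK0
  have hlim := tendsto_layer_integral b hKcont hKcs
  rw [hb] at hlim
  have hDh : Continuous fun x => fderiv ℝ h x e :=
    (hh.continuous_fderiv one_ne_zero).clm_apply continuous_const
  have hDh0 : ∀ x ∉ tsupport h, fderiv ℝ h x e = 0 := fun x hx => by
    have : x ∉ tsupport (fderiv ℝ h) := fun h1 => hx (tsupport_fderiv_subset ℝ h1)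
    rw [image_eq_zero_of_notMem_tsupport this]
    rfl
  have hσ : ∀ c : ℝ, ∀ x ∈ V, HasFDerivAt (fun x => Real.smoothTransition (c * ℓ x))
      ((deriv Real.smoothTransition (c * ℓ x) * c) • fderiv ℝ ℓ x) x := fun c x hx => by
    have h1 := (hasDerivAt_smoothTransition (c * ℓ x)).comp_hasFDerivAt x
      ((hd.differentiableAt (hVU hx)).hasFDerivAt.const_mul c)
    rwa [smul_smul] at h1
  have hcc : ∀ c : ℝ, Continuous fun x => Real.smoothTransition (c * ℓ x) * fderiv ℝ h x e := fun c =>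
    continuous_of_eq_zero_off hVo (isClosed_tsupport h) hhV
      ((Real.smoothTransition.continuous.comp_continuousOn (continuousOn_const.mul hℓc)).mul
        hDh.continuousOn) fun x hx => by rw [hDh0 x hx, mul_zero]
  -- Integration by parts moves the derivative onto the smoothed Heaviside function of `c ℓ`. Its
  -- gradient lives in a thin layer, which `Φ` turns into a flat slab.
  have hleft : ∀ c : ℝ, ∫ x, Real.smoothTransition (c * ℓ x) * fderiv ℝ h x e =
      -∫ x, c * deriv Real.smoothTransition (c * ⟪n, x⟫_ℝ) * K x := by
    intro c
    have hq : ∀ x, fderiv ℝ (fun x => Real.smoothTransition (c * ℓ x)) x e * h x =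
        V.indicator (fun x => |(L x).det| • (c * deriv Real.smoothTransition (c * ⟪n, Φ x⟫_ℝ) *
          K (Φ x))) x := by
      intro x
      by_cases hx : x ∈ V
      · rw [indicator_of_mem hx, (hσ c x hx).fderiv, hKΦ x hx, hΦn, hG]
        have := abs_ne_zero.2 (hdet x hx)
        simp only [_root_.smul_apply, smul_eq_mul]
        field_simp
      · rw [indicator_of_notMem hx, image_eq_zero_of_notMem_tsupport fun h1 => hx (hhV h1), mul_zero]
    have hqc : Continuous fun x => fderiv ℝ (fun x => Real.smoothTransition (c * ℓ x)) x e * h x := by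
      refine continuous_of_eq_zero_off hVo (isClosed_tsupport h) hhV
        (ContinuousOn.congr (f := fun x => deriv Real.smoothTransition (c * ℓ x) * c *
          fderiv ℝ ℓ x e * h x) ?_ fun x hx => ?_)
        fun x hx => by rw [image_eq_zero_of_notMem_tsupport hx, mul_zero]
      · exact (((continuous_deriv_smoothTransition.comp_continuousOn
          (continuousOn_const.mul hℓc)).mul continuousOn_const).mul
          (hDc.clm_apply continuousOn_const)).mul hh.continuous.continuousOn
      · simp only [(hσ c x hx).fderiv]
        rfl
    have hfc : Continuous fun x => Real.smoothTransition (c * ℓ x) * h x :=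
      continuous_of_eq_zero_off hVo (isClosed_tsupport h) hhV
        ((Real.smoothTransition.continuous.comp_continuousOn (continuousOn_const.mul hℓc)).mul
          hh.continuous.continuousOn) fun x hx => by
            rw [image_eq_zero_of_notMem_tsupport hx, mul_zero]
    rw [integral_mul_fderiv_eq_neg_fderiv_mul_of_integrable
      (hqc.integrable_of_hasCompactSupport hhc.mul_left)
      ((hcc c).integrable_of_hasCompactSupport
        (HasCompactSupport.intro hhc.isCompact fun x hx => by rw [hDh0 x hx, mul_zero]))
      (hfc.integrable_of_hasCompactSupport hhc.mul_left)
      (fun x hx => (hσ c x (hhV hx)).differentiableAt)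
      (fun x _ => hh.differentiable one_ne_zero x)]
    simp_rw [hq]
    rw [integral_indicator hVo.measurableSet,
      ← integral_image_eq_integral_abs_det_fderiv_smul volume hVo.measurableSet
      (fun x hx => (hstrict x hx).hasFDerivAt.hasFDerivWithinAt) hinj
      fun y => c * deriv Real.smoothTransition (c * ⟪n, y⟫_ℝ) * K y]
    rw [setIntegral_eq_integral_of_forall_compl_eq_zero]
    intro y hy
    rw [hKdef, indicator_of_notMem hy, mul_zero]
  -- Since the transition function vanishes at zero, the smoothed step converges pointwise to the
  -- indicator of `ℓ > 0`.
  have hlim2 : Tendsto (fun c : ℝ => ∫ x, Real.smoothTransition (c * ℓ x) * fderiv ℝ h x e) atTop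
      (𝓝 (∫ x in V ∩ {x | 0 < ℓ x}, fderiv ℝ h x e)) := by
    have hVm : MeasurableSet (V ∩ {x | 0 < ℓ x}) :=
      (hℓc.isOpen_inter_preimage hVo isOpen_Ioi).measurableSet
    rw [← integral_indicator hVm]
    refine tendsto_integral_filter_of_dominated_convergence (fun x => ‖fderiv ℝ h x e‖)
      (Eventually.of_forall fun c => (hcc c).aestronglyMeasurable)
      (Eventually.of_forall fun c => ae_of_all _ fun x => ?_)
      (hDh.norm.integrable_of_hasCompactSupport (HasCompactSupport.intro hhc.isCompact
        fun x hx => by rw [hDh0 x hx, norm_zero])) (ae_of_all _ fun x => ?_)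
    · rw [norm_mul, Real.norm_of_nonneg (Real.smoothTransition.nonneg _)]
      exact mul_le_of_le_one_left (norm_nonneg _) (Real.smoothTransition.le_one _)
    · by_cases hx : x ∈ V
      · by_cases hx0 : 0 < ℓ x
        · rw [indicator_of_mem (show x ∈ V ∩ {x | 0 < ℓ x} from ⟨hx, hx0⟩)]
          refine tendsto_const_nhds.congr' ?_
          filter_upwards [eventually_ge_atTop (ℓ x)⁻¹] with c hc
          rw [Real.smoothTransition.one_of_one_le, one_mul]
          rwa [inv_eq_one_div, div_le_iff₀ hx0] at hc
        · rw [indicator_of_notMem fun h1 => hx0 h1.2]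
          refine tendsto_const_nhds.congr' ?_
          filter_upwards [eventually_ge_atTop (0 : ℝ)] with c hc
          rw [Real.smoothTransition.zero_of_nonpos, zero_mul]
          exact mul_nonpos_of_nonneg_of_nonpos hc (not_lt.1 hx0)
      · rw [indicator_of_notMem fun h1 => hx h1.1, hDh0 x fun h1 => hx (hhV h1)]
        simp
  simp_rw [hleft] at hlim2
  rw [tendsto_nhds_unique hlim2 hlim.neg]
  congr 1
  have hSV : S ∩ V = V ∩ ℓ ⁻¹' {0} := by
    ext x
    constructor
    · rintro ⟨h1, h2⟩
      exact ⟨h2, (hd.mem_iff x (hVU h2)).1 h1⟩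
    · rintro ⟨h1, h2⟩
      exact ⟨(hd.mem_iff x (hVU h1)).2 h2, h1⟩
  have hSVm : MeasurableSet (S ∩ V) := by
    have : S ∩ V = V \ (V ∩ ℓ ⁻¹' {0}ᶜ) := by
      rw [hSV]
      ext x
      simp only [mem_inter_iff, Set.mem_sdiff, mem_preimage, mem_compl_iff]
      tauto
    rw [this]
    exact hVo.measurableSet.diff
      (hℓc.isOpen_inter_preimage hVo isClosed_singleton.isOpen_compl).measurableSet
  have hiso := (planeIncl b).isometry.map_euclideanHausdorffMeasure (d := 2)
  rw [EuclideanSpace.euclideanHausdorffMeasure_eq_volume] at hiso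
  have e1 : ∫ y, K (planeIncl b y) = ∫ x in range (planeIncl b), K x ∂μHE[2] := by
    rw [← hiso, integral_map (planeIncl b).continuous.aemeasurable hKcont.aestronglyMeasurable]
  have hsub : Φ '' (S ∩ V) ⊆ range (planeIncl b) := by
    rintro _ ⟨x, hx, rfl⟩
    refine ⟨planeProj b (Φ x), ?_⟩
    rw [planeIncl_planeProj, hb, hΦn, (hd.mem_iff x (hVU hx.2)).1 hx.1, zero_smul, sub_zero]
  have e2 : ∫ x in range (planeIncl b), K x ∂μHE[2] = ∫ x in Φ '' (S ∩ V), K x ∂μHE[2] := by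
    refine (setIntegral_eq_of_subset_of_forall_sdiff_eq_zero
      (planeIncl b).isometry.isClosedEmbedding.isClosed_range.measurableSet hsub fun y hy => ?_)
    by_contra hne
    have hyV : y ∈ Φ '' V := by
      by_contra h1
      exact hne (indicator_of_notMem h1 _)
    obtain ⟨x, hx, rfl⟩ := hyV
    obtain ⟨z, hz⟩ := hy.1
    refine hy.2 ⟨x, ⟨(hd.mem_iff x (hVU hx)).2 ?_, hx⟩, rfl⟩
    rw [← hΦn, ← hz, ← hb, inner_planeIncl]
  -- From `⟪n, L v⟫ = dℓ(v)` it follows that `L⁻ᵀ` maps the gradient of `ℓ` to `n`. The resulting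
  -- area factor turns `G` into `h ⟪m, e⟫`.
  have hfac : ∀ x ∈ S ∩ V, areaFactor (L x) (m x) = |(L x).det| / ‖gradient ℓ x‖ := by
    intro x hx
    have hg := norm_ne_zero_iff.2 (hd.gradient_ne_zero x (hVU hx.2))
    have h1 : transpose (L x).inverse (gradient ℓ x) = n := by
      refine ext_inner_right ℝ fun v => ?_
      rw [inner_transpose_left, inner_gradient_left, ← hLn, apply_inverse_self (hdet x hx.2)]
    rw [hd.normal_eq x (hVU hx.2) hx.1, areaFactor, map_smul, h1, norm_smul, norm_smul, hn, norm_inv,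
      norm_norm, mul_one, Real.norm_eq_abs, div_eq_mul_inv]
  have hθ : ContinuousOn (fun x => areaFactor (L x) (m x)) (S ∩ V) := by
    refine ContinuousOn.congr (f := fun x => |(L x).det| / ‖gradient ℓ x‖) ?_ hfac
    exact (hdetc.mono inter_subset_right).div
      (hd.continuousOn_gradient.norm.mono (inter_subset_right.trans hVU))
      fun x hx => norm_ne_zero_iff.2 (hd.gradient_ne_zero x (hVU hx.2))
  rw [e1, e2, integral_image_eq_of_density (μ := μHE[2]) hSVm (hΦc.mono inter_subset_right)
    (hinj.mono inter_subset_right) (hθ.aemeasurable hSVm) (fun x => norm_nonneg _)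
    (fun A hA hAm => measure_image_interface hdim (S := S) inter_subset_left
      (fun x hx => ⟨U, ℓ, hVU hx.2, hd⟩) (hΦc.mono inter_subset_right)
      (hinj.mono inter_subset_right)
      (fun x hx => ⟨Φ, hstrict x hx.2, Eventually.of_forall fun _ => rfl⟩)
      (fun x hx => hdet x hx.2) hθ hA hAm)]
  refine setIntegral_congr_fun hSVm fun x hx => ?_
  have hg := norm_ne_zero_iff.2 (hd.gradient_ne_zero x (hVU hx.2))
  have hdt := abs_ne_zero.2 (hdet x hx.2)
  simp only [hfac x hx, hKΦ x hx.2, hG, hd.fderiv_apply (hVU hx.2) hx.1, smul_eq_mul]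
  field_simp

end HalfSpaceFormula


/-! ### The divergence theorem for piecewise smooth functions -/

section Divergence

variable {B S U V : Set E} {m : E → E} {ℓ f ψ ψ₁ ψ₂ : E → ℝ} {X e : E}

/-- The divergence theorem for `f`, tested with `ψ`. -/
def DivIdentity (B S : Set E) (m : E → E) (f : E → ℝ) (e : E) (ψ : E → ℝ) : Prop :=
  ∫ X in B, (fderiv ℝ ψ X e * f X + ψ X * fderiv ℝ f X e) =
    -∫ X in S, ψ X * (jump (m X) X f * ⟪m X, e⟫_ℝ) ∂μHE[2]

lemma contDiff_mul_of_tsupport {g : E → ℝ} (hV : IsOpen V) (hψ : ContDiff ℝ 1 ψ)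
    (hψV : tsupport ψ ⊆ V) (hg : ContDiffOn ℝ 1 g V) : ContDiff ℝ 1 fun x => ψ x * g x := by
  refine contDiff_iff_contDiffAt.2 fun x => ?_
  by_cases hx : x ∈ tsupport ψ
  · exact hψ.contDiffAt.mul (hg.contDiffAt (hV.mem_nhds (hψV hx)))
  · refine (contDiffAt_const (c := (0 : ℝ))).congr_of_eventuallyEq ?_
    filter_upwards [(isClosed_tsupport ψ).isOpen_compl.mem_nhds hx] with y hy
    rw [image_eq_zero_of_notMem_tsupport hy, zero_mul]

lemma fderiv_eq_zero_of_notMem (hx : X ∉ tsupport ψ) : fderiv ℝ ψ X = 0 :=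
  image_eq_zero_of_notMem_tsupport fun h => hx (tsupport_fderiv_subset ℝ h)

lemma integrable_fderiv_apply {h : E → ℝ} (hh : ContDiff ℝ 1 h) (hc : HasCompactSupport h) (e : E) :
    Integrable fun x => fderiv ℝ h x e :=
  ((hh.continuous_fderiv one_ne_zero).clm_apply continuous_const).integrable_of_hasCompactSupport
    (HasCompactSupport.intro hc.isCompact fun x hx => by rw [fderiv_eq_zero_of_notMem hx]; rfl)

lemma integral_fderiv_eq_zero {h : E → ℝ} (hh : ContDiff ℝ 1 h) (hc : HasCompactSupport h) (e : E) :
    ∫ x, fderiv ℝ h x e = 0 := by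
  have hint := integrable_fderiv_apply hh hc e
  have h1 := integral_mul_fderiv_eq_neg_fderiv_mul_of_integrable (𝕜 := ℝ) (μ := volume)
    (f := fun _ : E => (1 : ℝ)) (g := h) (v := e) (by simp)
    (by simpa using hint)
    (by simpa using hh.continuous.integrable_of_hasCompactSupport hc)
    (fun x _ => differentiableAt_const _) (fun x _ => hh.differentiable one_ne_zero x)
  simpa using h1

/-- The derivative of a compactly supported function has zero total integral and the surface is
null, so the two sides contribute opposite amounts. -/
lemma exists_integral_neg_side (hdim : Module.finrank ℝ E = 3) (hS : volume S = 0)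
    (hd : IsDefining S m U ℓ) (hXU : X ∈ U) (hXS : X ∈ S) : ∃ V, IsOpen V ∧ X ∈ V ∧ V ⊆ U ∧
      ∀ h : E → ℝ, ContDiff ℝ 1 h → HasCompactSupport h → tsupport h ⊆ V → ∀ e : E,
        ∫ x in V ∩ {x | 0 < ℓ x}, fderiv ℝ h x e = -∫ x in S ∩ V, h x * ⟪m x, e⟫_ℝ ∂μHE[2] ∧
        ∫ x in V ∩ {x | ℓ x < 0}, fderiv ℝ h x e = ∫ x in S ∩ V, h x * ⟪m x, e⟫_ℝ ∂μHE[2] := by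
  obtain ⟨V, hVo, hXV, hVU, hV⟩ := exists_integral_pos_side hdim hd hXU hXS
  refine ⟨V, hVo, hXV, hVU, fun h hh hc hhV e => ⟨hV h hh hc hhV e, ?_⟩⟩
  have h0 := integral_fderiv_eq_zero hh hc e
  have hℓc := hd.contDiffOn.continuousOn.mono hVU
  have hp : MeasurableSet (V ∩ {x | 0 < ℓ x}) :=
    (hℓc.isOpen_inter_preimage hVo isOpen_Ioi).measurableSet
  have hn : MeasurableSet (V ∩ {x | ℓ x < 0}) :=
    (hℓc.isOpen_inter_preimage hVo isOpen_Iio).measurableSet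
  have hint := integrable_fderiv_apply hh hc e
  have h1 : ∫ x, fderiv ℝ h x e =
      ∫ x in (V ∩ {x | 0 < ℓ x}) ∪ (V ∩ {x | ℓ x < 0}), fderiv ℝ h x e := by
    refine (setIntegral_eq_integral_of_ae_compl_eq_zero ?_).symm
    filter_upwards [measure_eq_zero_iff_ae_notMem.1 hS] with x hx hxc
    by_cases hxV : x ∈ V
    · exfalso
      rcases lt_trichotomy (ℓ x) 0 with h2 | h2 | h2
      · exact hxc (Or.inr ⟨hxV, h2⟩)
      · exact hx ((hd.mem_iff x (hVU hxV)).2 h2)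
      · exact hxc (Or.inl ⟨hxV, h2⟩)
    · rw [fderiv_eq_zero_of_notMem fun h2 => hxV (hhV h2)]
      rfl
  rw [h1, setIntegral_union (disjoint_left.2 fun x hx hx' => lt_asymm (show 0 < ℓ x from hx.2) (show ℓ x < 0 from hx'.2)) hn
    hint.integrableOn hint.integrableOn, hV h hh hc hhV e] at h0
  linarith

/-- Near an interface point the one-sided formulas are applied to `ψ g₁` and `ψ g₂`, where `g₁`,
`g₂` extend `f` smoothly across the surface; their sum produces the jump. Away from the interface
this is ordinary integration by parts. -/
lemma exists_divIdentity (hdim : Module.finrank ℝ E = 3) (hB : IsOpen B) (hI : IsInterface B S m)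
    (hf : PiecewiseC 1 B S m f) (hX : X ∈ B) (e : E) : ∃ V, IsOpen V ∧ X ∈ V ∧
      ∀ ψ : E → ℝ, ContDiff ℝ 1 ψ → HasCompactSupport ψ → tsupport ψ ⊆ V →
        DivIdentity B S m f e ψ := by
  have hO := hI.isOpen_diff hB
  have hSm := hI.measurableSet hB
  have hS0 := volume_eq_zero_of_area_lt_top hdim hI.area_finite
  by_cases hXS : X ∈ S
  · obtain ⟨U, ℓ, hXU, hUB, hd⟩ := hI.locally_level X hXS
    obtain ⟨U', g₁, g₂, hXU', hU', hUB', ho', hg₁, hg₂, hs, ht⟩ := hf.exists_trace hXS hd hXU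
    have hd' := hd.mono ho' hU'
    obtain ⟨V, hVo, hXV, hVU, hV⟩ := exists_integral_neg_side hdim hS0 hd' hXU' hXS
    refine ⟨V, hVo, hXV, fun ψ hψ hψc hψV => ?_⟩
    have hg₁' : ContDiffOn ℝ 1 g₁ V := by simpa using hg₁.mono hVU
    have hg₂' : ContDiffOn ℝ 1 g₂ V := by simpa using hg₂.mono hVU
    have c1 := contDiff_mul_of_tsupport hVo hψ hψV hg₁'
    have c2 := contDiff_mul_of_tsupport hVo hψ hψV hg₂'
    have s1 : tsupport (fun x => ψ x * g₁ x) ⊆ V := (tsupport_mul_subset_left).trans hψV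
    have s2 : tsupport (fun x => ψ x * g₂ x) ⊆ V := (tsupport_mul_subset_left).trans hψV
    have k1 : HasCompactSupport fun x => ψ x * g₁ x := hψc.mul_right
    have k2 : HasCompactSupport fun x => ψ x * g₂ x := hψc.mul_right
    have i1 := (hV _ c1 k1 s1 e).1
    have i2 := (hV _ c2 k2 s2 e).2
    have hℓc : ContinuousOn ℓ V := hd'.contDiffOn.continuousOn.mono hVU
    have hop := hℓc.isOpen_inter_preimage hVo (isOpen_Ioi (a := (0 : ℝ)))
    have hon := hℓc.isOpen_inter_preimage hVo (isOpen_Iio (a := (0 : ℝ)))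
    have hp : MeasurableSet (V ∩ {x | 0 < ℓ x}) := hop.measurableSet
    have hn : MeasurableSet (V ∩ {x | ℓ x < 0}) := hon.measurableSet
    have eqp : ∀ x ∈ V ∩ {x | 0 < ℓ x}, fderiv ℝ ψ x e * f x + ψ x * fderiv ℝ f x e =
        fderiv ℝ (fun x => ψ x * g₁ x) x e := by
      intro x hx
      have h1 : f =ᶠ[𝓝 x] g₁ := by
        filter_upwards [hop.mem_nhds hx] with y hy using (hs y (hVU hy.1)).1 hy.2
      rw [h1.fderiv_eq, h1.eq_of_nhds, fderiv_fun_mul (hψ.differentiable one_ne_zero x)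
        ((hg₁'.contDiffAt (hVo.mem_nhds hx.1)).differentiableAt one_ne_zero)]
      simp only [_root_.add_apply, _root_.smul_apply, smul_eq_mul]
      ring
    have eqn : ∀ x ∈ V ∩ {x | ℓ x < 0}, fderiv ℝ ψ x e * f x + ψ x * fderiv ℝ f x e =
        fderiv ℝ (fun x => ψ x * g₂ x) x e := by
      intro x hx
      have h1 : f =ᶠ[𝓝 x] g₂ := by
        filter_upwards [hon.mem_nhds hx] with y hy using (hs y (hVU hy.1)).2 hy.2
      rw [h1.fderiv_eq, h1.eq_of_nhds, fderiv_fun_mul (hψ.differentiable one_ne_zero x)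
        ((hg₂'.contDiffAt (hVo.mem_nhds hx.1)).differentiableAt one_ne_zero)]
      simp only [_root_.add_apply, _root_.smul_apply, smul_eq_mul]
      ring
    have hvol : ∫ X in B, (fderiv ℝ ψ X e * f X + ψ X * fderiv ℝ f X e) =
        ∫ X in (V ∩ {x | 0 < ℓ x}) ∪ (V ∩ {x | ℓ x < 0}),
          (fderiv ℝ ψ X e * f X + ψ X * fderiv ℝ f X e) := by
      refine setIntegral_eq_of_subset_of_ae_sdiff_eq_zero hB.measurableSet.nullMeasurableSet
        (union_subset (inter_subset_left.trans (hVU.trans hUB'))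
          (inter_subset_left.trans (hVU.trans hUB'))) ?_
      filter_upwards [measure_eq_zero_iff_ae_notMem.1 hS0] with x hx hxc
      have hxV : x ∉ V := fun hxV => by
        rcases lt_trichotomy (ℓ x) 0 with h2 | h2 | h2
        · exact hxc.2 (Or.inr ⟨hxV, h2⟩)
        · exact hx ((hd'.mem_iff x (hVU hxV)).2 h2)
        · exact hxc.2 (Or.inl ⟨hxV, h2⟩)
      rw [fderiv_eq_zero_of_notMem fun h2 => hxV (hψV h2),
        image_eq_zero_of_notMem_tsupport fun h2 => hxV (hψV h2)]
      simp
    have hsurf : ∫ X in S, ψ X * (jump (m X) X f * ⟪m X, e⟫_ℝ) ∂μHE[2] =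
        ∫ X in S ∩ V, (ψ X * g₁ X * ⟪m X, e⟫_ℝ - ψ X * g₂ X * ⟪m X, e⟫_ℝ) ∂μHE[2] := by
      rw [setIntegral_eq_of_subset_of_forall_sdiff_eq_zero hSm (inter_subset_left : S ∩ V ⊆ S)
        fun x hx => ?_]
      · refine setIntegral_congr_fun (hSm.inter hVo.measurableSet) fun x hx => ?_
        have := ht x ⟨hx.1, hVU hx.2⟩
        simp only [jump_eq this.1 this.2]
        ring
      · rw [image_eq_zero_of_notMem_tsupport fun h2 => hx.2 ⟨hx.1, hψV h2⟩, zero_mul]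
    have tint : ∀ {h : E → ℝ}, Continuous h → HasCompactSupport h →
        IntegrableOn (fun x => h x * ⟪m x, e⟫_ℝ) (S ∩ V) μHE[2] := fun hc hk => by
      obtain ⟨c, hc'⟩ := hk.exists_bound_of_continuous hc
      refine IntegrableOn.mono_set (BddContOn.integrableOn ?_ hB hI) inter_subset_left
      exact BddContOn.comp₂ ⟨hc.continuousOn, c, fun x _ => hc' x⟩ hI.bddContOn_normal
        (φ := fun (a : ℝ) (n : E) => a * ⟪n, e⟫_ℝ) (by fun_prop)
    rw [DivIdentity, hvol, hsurf, integral_sub (tint c1.continuous k1) (tint c2.continuous k2),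
      setIntegral_union (disjoint_left.2 fun x hx hx' => lt_asymm (show 0 < ℓ x from hx.2) (show ℓ x < 0 from hx'.2)) hn
        ((integrable_fderiv_apply c1 k1 e).integrableOn.congr_fun (fun x hx => (eqp x hx).symm) hp)
        ((integrable_fderiv_apply c2 k2 e).integrableOn.congr_fun (fun x hx => (eqn x hx).symm) hn),
      setIntegral_congr_fun hp eqp, setIntegral_congr_fun hn eqn, i1, i2]
    ring
  · refine ⟨B \ S, hO, ⟨hX, hXS⟩, fun ψ hψ hψc hψV => ?_⟩
    have hfc : ContDiffOn ℝ 1 f (B \ S) := by simpa using hf.contDiffOn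
    have c1 : Continuous fun x => fderiv ℝ f x e * ψ x :=
      continuous_of_eq_zero_off hO (isClosed_tsupport ψ) hψV
        (((hfc.continuousOn_fderiv_of_isOpen hO le_rfl).clm_apply continuousOn_const).mul
          hψ.continuous.continuousOn)
        fun x hx => by rw [image_eq_zero_of_notMem_tsupport hx, mul_zero]
    have c2 : Continuous fun x => f x * fderiv ℝ ψ x e :=
      continuous_of_eq_zero_off hO (isClosed_tsupport ψ) hψV
        (hfc.continuousOn.mul ((hψ.continuous_fderiv one_ne_zero).clm_apply
          continuous_const).continuousOn)
        fun x hx => by rw [fderiv_eq_zero_of_notMem hx]; simp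
    have c3 : Continuous fun x => f x * ψ x :=
      continuous_of_eq_zero_off hO (isClosed_tsupport ψ) hψV
        (hfc.continuousOn.mul hψ.continuous.continuousOn)
        fun x hx => by rw [image_eq_zero_of_notMem_tsupport hx, mul_zero]
    have j1 := c1.integrable_of_hasCompactSupport (μ := volume) hψc.mul_left
    have j2 := c2.integrable_of_hasCompactSupport (μ := volume)
      (HasCompactSupport.intro hψc.isCompact fun x hx => by rw [fderiv_eq_zero_of_notMem hx]; simp)
    have h1 := integral_mul_fderiv_eq_neg_fderiv_mul_of_integrable j1 j2
      (c3.integrable_of_hasCompactSupport hψc.mul_left)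
      (fun x hx => (hfc.contDiffAt (hO.mem_nhds (hψV hx))).differentiableAt one_ne_zero)
      fun x _ => hψ.differentiable one_ne_zero x
    have h2 : ∫ X in S, ψ X * (jump (m X) X f * ⟪m X, e⟫_ℝ) ∂μHE[2] = 0 := by
      refine setIntegral_eq_zero_of_forall_eq_zero fun x hx => ?_
      rw [image_eq_zero_of_notMem_tsupport fun h => (hψV h).2 hx, zero_mul]
    rw [DivIdentity, h2, neg_zero, setIntegral_eq_integral_of_forall_compl_eq_zero fun x hx => by
      rw [image_eq_zero_of_notMem_tsupport fun h => hx (hψV h).1,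
        fderiv_eq_zero_of_notMem fun h => hx (hψV h).1]
      simp]
    have h3 : ∀ x, fderiv ℝ ψ x e * f x + ψ x * fderiv ℝ f x e =
        f x * fderiv ℝ ψ x e + fderiv ℝ f x e * ψ x := fun x => by ring
    simp_rw [h3]
    rw [integral_add j2 j1, h1]
    ring

lemma DivIdentity.add (hdim : Module.finrank ℝ E = 3) (hB : IsOpen B)
    (hb : Bornology.IsBounded B) (hI : IsInterface B S m)
    (hf : PiecewiseC 1 B S m f) (h₁ : DivIdentity B S m f e ψ₁) (h₂ : DivIdentity B S m f e ψ₂)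
    (hψ₁ : ContDiff ℝ 1 ψ₁) (hψ₂ : ContDiff ℝ 1 ψ₂) (hc₁ : HasCompactSupport ψ₁)
    (hc₂ : HasCompactSupport ψ₂) : DivIdentity B S m f e fun x => ψ₁ x + ψ₂ x := by
  have hint : ∀ {ψ : E → ℝ}, ContDiff ℝ 1 ψ → HasCompactSupport ψ →
      IntegrableOn (fun X => fderiv ℝ ψ X e * f X + ψ X * fderiv ℝ f X e) B := fun {ψ} hψ hc => by
    have hD : Continuous (fderiv ℝ ψ) := hψ.continuous_fderiv one_ne_zero
    obtain ⟨c, hc'⟩ := hc.exists_bound_of_continuous hψ.continuous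
    obtain ⟨d, hd'⟩ := (hc.fderiv (𝕜 := ℝ)).exists_bound_of_continuous hD
    obtain ⟨a, ha0, ha⟩ := hf.norm_le
    obtain ⟨a', ha0', ha'⟩ := hf.norm_fderiv_le
    have hfd : ContinuousOn (fderiv ℝ f) (B \ S) :=
      hf.contDiffOn.continuousOn_fderiv_of_isOpen (hI.isOpen_diff hB) (by simp)
    refine integrableOn_of_continuousOn_diff hdim hB hb hI ?_
      ⟨d * ‖e‖ * a + c * (a' * ‖e‖), fun X hX => ?_⟩
    · exact ((hD.clm_apply continuous_const).continuousOn.mul hf.continuousOn).add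
        (hψ.continuous.continuousOn.mul (hfd.clm_apply continuousOn_const))
    · refine (norm_add_le _ _).trans ?_
      rw [norm_mul, norm_mul]
      have q1 := ((fderiv ℝ ψ X).le_opNorm e).trans
        (mul_le_mul_of_nonneg_right (hd' X) (norm_nonneg e))
      have q2 := ((fderiv ℝ f X).le_opNorm e).trans
        (mul_le_mul_of_nonneg_right (ha' X hX) (norm_nonneg e))
      have q3 : 0 ≤ c := (norm_nonneg _).trans (hc' X)
      have q4 := (norm_nonneg _).trans q1
      exact add_le_add (mul_le_mul q1 (ha X hX) (norm_nonneg _) q4)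
        (mul_le_mul (hc' X) q2 (norm_nonneg _) q3)
  have sint : ∀ {ψ : E → ℝ}, ContDiff ℝ 1 ψ → HasCompactSupport ψ →
      IntegrableOn (fun X => ψ X * (jump (m X) X f * ⟪m X, e⟫_ℝ)) S μHE[2] := fun {ψ} hψ hc => by
    obtain ⟨c, hc'⟩ := hc.exists_bound_of_continuous hψ.continuous
    have t1 : BddContOn S ψ := ⟨hψ.continuous.continuousOn, c, fun x _ => hc' x⟩
    have t2 : BddContOn S fun X => jump (m X) X f * ⟪m X, e⟫_ℝ :=
      (hf.bddContOn_jump hI).comp₂ hI.bddContOn_normal (φ := fun (a : ℝ) (n : E) => a * ⟪n, e⟫_ℝ)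
        (by fun_prop)
    exact (t1.comp₂ t2 (φ := fun a b : ℝ => a * b) (by fun_prop)).integrableOn hB hI
  rw [DivIdentity] at *
  have h3 : ∀ X, fderiv ℝ (fun x => ψ₁ x + ψ₂ x) X = fderiv ℝ ψ₁ X + fderiv ℝ ψ₂ X := fun X =>
    fderiv_fun_add (hψ₁.differentiable one_ne_zero X) (hψ₂.differentiable one_ne_zero X)
  simp_rw [h3, add_mul]
  rw [integral_add (sint hψ₁ hc₁) (sint hψ₂ hc₂), neg_add, ← h₁, ← h₂,
    ← integral_add (hint hψ₁ hc₁) (hint hψ₂ hc₂)]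
  refine integral_congr_ae (ae_of_all _ fun X => ?_)
  simp only [_root_.add_apply]
  ring

lemma exists_cutoff {C W : Set E} (hC : IsCompact C) (hW : IsOpen W) (hCW : C ⊆ W) :
    ∃ ρ : E → ℝ, ContDiff ℝ 1 ρ ∧ HasCompactSupport ρ ∧ tsupport ρ ⊆ W ∧
      ∀ x ∈ C, ρ =ᶠ[𝓝 x] fun _ => 1 := by
  obtain ⟨t, ht, hCt, htW⟩ := exists_compact_between hC hW hCW
  obtain ⟨ρ, h1, h0, -⟩ := exists_contMDiffMap_one_nhds_of_subset_interior (n := 1)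
    (modelWithCornersSelf ℝ E) hC.isClosed hCt
  have hsub : tsupport ρ ⊆ t := closure_minimal (fun x hx => by
    by_contra h
    exact hx (h0 x h)) ht.isClosed
  exact ⟨ρ, ρ.contMDiff.contDiff, ht.of_isClosed_subset (isClosed_tsupport _) hsub,
    hsub.trans htW, fun x hx => eventually_nhdsSet_iff_forall.1 h1 x hx⟩

/-- The identity is additive in `ψ`, so compactness induction with cutoffs takes the place of a
partition of unity. -/
lemma exists_divIdentity_compact (hdim : Module.finrank ℝ E = 3) (hB : IsOpen B)
    (hb : Bornology.IsBounded B) (hI : IsInterface B S m) (hf : PiecewiseC 1 B S m f) (e : E)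
    {C : Set E} (hC : IsCompact C) (hCB : C ⊆ B) : ∃ W, IsOpen W ∧ C ⊆ W ∧
      ∀ ψ : E → ℝ, ContDiff ℝ 1 ψ → HasCompactSupport ψ → tsupport ψ ⊆ W →
        DivIdentity B S m f e ψ := by
  refine hC.induction_on (p := fun C => ∃ W, IsOpen W ∧ C ⊆ W ∧
      ∀ ψ : E → ℝ, ContDiff ℝ 1 ψ → HasCompactSupport ψ → tsupport ψ ⊆ W →
        DivIdentity B S m f e ψ) ?_ ?_ ?_ ?_
  · refine ⟨∅, isOpen_empty, subset_rfl, fun ψ _ _ h => ?_⟩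
    have h0 : ψ = fun _ => 0 := funext fun x => image_eq_zero_of_notMem_tsupport fun hx => h hx
    simp [h0, DivIdentity]
  · rintro s t hst ⟨W, hW, htW, h⟩
    exact ⟨W, hW, hst.trans htW, h⟩
  · rintro s t ⟨W₁, hW₁, hs, h₁⟩ ⟨W₂, hW₂, ht, h₂⟩
    refine ⟨W₁ ∪ W₂, hW₁.union hW₂, union_subset_union hs ht, fun ψ hψ hc hψW => ?_⟩
    -- `ρ` is one near the part of the support outside `W₂`; hence `ρψ` is supported in `W₁` and `(1
    -- - ρ)ψ` in `W₂`.
    obtain ⟨ρ, hρ, hρc, hρW, hρ1⟩ := exists_cutoff (hc.isCompact.diff hW₂) hW₁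
      (fun x hx => (hψW hx.1).resolve_right hx.2)
    have a1 : DivIdentity B S m f e fun x => ρ x * ψ x :=
      h₁ _ (hρ.mul hψ) hρc.mul_right (tsupport_mul_subset_left.trans hρW)
    have a2 : DivIdentity B S m f e fun x => (1 - ρ x) * ψ x := by
      refine h₂ _ ((contDiff_const.sub hρ).mul hψ) hc.mul_left fun x hx => ?_
      by_contra hxW
      have h3 := hρ1 x ⟨tsupport_mul_subset_right hx, hxW⟩
      refine notMem_tsupport_iff_eventuallyEq.2 ?_ hx
      filter_upwards [h3] with y hy
      simp [hy]
    have := a1.add hdim hB hb hI hf a2 (hρ.mul hψ) ((contDiff_const.sub hρ).mul hψ) hρc.mul_right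
      hc.mul_left
    convert this using 2 with x
    ring
  · intro x hx
    obtain ⟨V, hV, hxV, h⟩ := exists_divIdentity hdim hB hI hf (hCB hx) e
    exact ⟨V, mem_nhdsWithin_of_mem_nhds (hV.mem_nhds hxV), V, hV, subset_rfl, h⟩

/-- The divergence theorem for functions that vanish near the boundary. -/
lemma integral_fderiv_of_compact (hdim : Module.finrank ℝ E = 3) (hB : IsOpen B)
    (hb : Bornology.IsBounded B) (hI : IsInterface B S m) (hf : PiecewiseC 1 B S m f) {C : Set E}
    (hC : IsCompact C) (hCB : C ⊆ B) (h0 : ∀ X ∈ B \ S, X ∉ C → f X = 0) (e : E) :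
    ∫ X in B, fderiv ℝ f X e = -∫ X in S, jump (m X) X f * ⟪m X, e⟫_ℝ ∂μHE[2] := by
  have hO := hI.isOpen_diff hB
  have hSm := hI.measurableSet hB
  obtain ⟨W, hW, hCW, h⟩ := exists_divIdentity_compact hdim hB hb hI hf e hC hCB
  -- Wherever `f` does not vanish the cutoff is locally one, so testing with it removes the test
  -- function altogether.
  obtain ⟨ρ, hρ, hρc, hρW, hρ1⟩ := exists_cutoff hC hW hCW
  have hid : DivIdentity B S m f e ρ := h ρ hρ hρc hρW
  rw [DivIdentity, ← setIntegral_diff_interface hdim hI] at hid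
  rw [← setIntegral_diff_interface hdim hI]
  have e1 : ∫ X in B \ S, (fderiv ℝ ρ X e * f X + ρ X * fderiv ℝ f X e) =
      ∫ X in B \ S, fderiv ℝ f X e := by
    refine setIntegral_congr_fun hO.measurableSet fun X hX => ?_
    by_cases hXC : X ∈ C
    · have h1 := hρ1 X hXC
      have h2 : fderiv ℝ ρ X = 0 := by rw [h1.fderiv_eq]; simp
      simp [h2, h1.eq_of_nhds]
    · have h1 : f =ᶠ[𝓝 X] fun _ => 0 := by
        filter_upwards [hO.mem_nhds hX, hC.isClosed.isOpen_compl.mem_nhds hXC] with Y hY hYC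
          using h0 Y hY hYC
      have h2 : fderiv ℝ f X = 0 := by rw [h1.fderiv_eq]; simp
      simp [h2, h1.eq_of_nhds]
  have e2 : ∫ X in S, ρ X * (jump (m X) X f * ⟪m X, e⟫_ℝ) ∂μHE[2] =
      ∫ X in S, jump (m X) X f * ⟪m X, e⟫_ℝ ∂μHE[2] := by
    refine setIntegral_congr_fun hSm fun X hX => ?_
    by_cases hXC : X ∈ C
    · simp [(hρ1 X hXC).eq_of_nhds]
    · have h1 : Tendsto (fun s : ℝ => f (X + s • m X)) (𝓝[>] 0) (𝓝 0) := by
        refine tendsto_const_nhds.congr' ?_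
        filter_upwards [hI.eventually_mem_pos hX,
          tendsto_add_smul_nhds X (m X) (hC.isClosed.isOpen_compl.mem_nhds hXC)] with s h2 h3
          using (h0 _ h2 h3).symm
      have h2 : Tendsto (fun s : ℝ => f (X + s • (-m X))) (𝓝[>] 0) (𝓝 0) := by
        refine tendsto_const_nhds.congr' ?_
        filter_upwards [hI.eventually_mem_neg hX,
          tendsto_add_smul_nhds X (-m X) (hC.isClosed.isOpen_compl.mem_nhds hXC)] with s h2 h3
          using (h0 _ h2 h3).symm
      simp [jump_eq h1 h2]
  rwa [e1, e2] at hid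

end Divergence


/-! ### The divergence theorem for functions vanishing on the boundary -/

section Truncation

variable {B S O : Set E} {m : E → E} {f : E → ℝ} {e : E}

/-- On a line parallel to `e`, a zero of `f` with nonzero derivative along `e` is isolated among
such zeros. The exceptional set is thus countable on every such line, hence null in space. -/
lemma measure_zero_of_fderiv_ne_zero (hO : IsOpen O) (hf : ContDiffOn ℝ 1 f O) (e : E) :
    ∀ᵐ x : E, x ∈ O → f x = 0 → fderiv ℝ f x e = 0 := by
  have hD : ContinuousOn (fun x => fderiv ℝ f x e) O :=
    (hf.continuousOn_fderiv_of_isOpen hO le_rfl).clm_apply continuousOn_const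
  have hm : MeasurableSet ((O ∩ (fun x => fderiv ℝ f x e) ⁻¹' {0}ᶜ) \ (O ∩ f ⁻¹' {0}ᶜ)) :=
    (hD.isOpen_inter_preimage hO isOpen_compl_singleton).measurableSet.diff
      (hf.continuousOn.isOpen_inter_preimage hO isOpen_compl_singleton).measurableSet
  have := ae_mem_of_ae_add_linearMap_mem (LinearMap.toSpanSingleton ℝ E e) volume
    (volume : Measure E) hm.compl fun y => by
      set N : Set ℝ := {s | y + s • e ∈ O ∧ f (y + s • e) = 0 ∧ fderiv ℝ f (y + s • e) e ≠ 0}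
      have hN : N.Countable := by
        refine (countable_setOfPred_isolated_right_within (s := N)).mono fun s hs => ?_
        refine ⟨hs, ?_⟩
        have h1 : HasDerivAt (fun s : ℝ => f (y + s • e)) (fderiv ℝ f (y + s • e) e) s := by
          have h2 := ((hf.contDiffAt (hO.mem_nhds hs.1)).differentiableAt one_ne_zero).hasFDerivAt
          have h3 : HasDerivAt (fun s : ℝ => y + s • e) e s := by
            simpa using ((hasDerivAt_id s).smul_const e).const_add y
          exact h2.comp_hasDerivAt s h3
        have h4 := (h1.eventually_ne (c := 0) hs.2.2).filter_mono
          (nhdsWithin_mono s fun z (hz : z ∈ N ∩ Ioi s) => (ne_of_gt hz.2 : z ≠ s))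
        refine eventually_false_iff_eq_bot.1 ?_
        filter_upwards [h4, self_mem_nhdsWithin] with z hz hz' using hz hz'.1.2.1
      filter_upwards [hN.ae_notMem volume] with s hs hmem
      refine hs ⟨hmem.1.1, ?_, hmem.1.2⟩
      by_contra h
      exact hmem.2 ⟨hmem.1.1, h⟩
  filter_upwards [this] with x hx hxO hfx
  by_contra h
  exact hx ⟨⟨hxO, h⟩, fun h' => h'.2 hfx⟩

/-- A smooth truncation of the identity that vanishes near zero. -/
def truncation (n : ℕ) (s : ℝ) : ℝ := s * Real.smoothTransition (n * s ^ 2 - 1)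

lemma contDiff_truncation (n : ℕ) : ContDiff ℝ 1 (truncation n) :=
  contDiff_id.mul (Real.smoothTransition.contDiff.comp
    ((contDiff_const.mul (contDiff_id.pow 2)).sub contDiff_const))

lemma truncation_eq_zero {n : ℕ} {s : ℝ} (h : n * s ^ 2 ≤ 1) : truncation n s = 0 := by
  rw [truncation, Real.smoothTransition.zero_of_nonpos (by linarith), mul_zero]

lemma abs_truncation_le (n : ℕ) (s : ℝ) : |truncation n s| ≤ |s| := by
  rw [truncation, abs_mul, abs_of_nonneg (Real.smoothTransition.nonneg _)]
  exact mul_le_of_le_one_right (abs_nonneg s) (Real.smoothTransition.le_one _)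

lemma deriv_truncation (n : ℕ) (s : ℝ) : deriv (truncation n) s =
    Real.smoothTransition (n * s ^ 2 - 1) +
      2 * (n * s ^ 2) * deriv Real.smoothTransition (n * s ^ 2 - 1) := by
  have h1 : HasDerivAt (fun s : ℝ => n * s ^ 2 - 1) (n * (2 * s)) s := by
    simpa using ((hasDerivAt_pow 2 s).const_mul (n : ℝ)).sub_const 1
  have h2 := (hasDerivAt_id s).mul ((hasDerivAt_smoothTransition (n * s ^ 2 - 1)).comp s h1)
  refine h2.deriv.trans ?_
  simp only [id, Function.comp]
  ring

/-- The growing factor `n s²` is at most 2 wherever the derivative of the transition function is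
nonzero, so the bound does not depend on `n`. -/
lemma exists_abs_deriv_truncation_le : ∃ K : ℝ, ∀ n s, |deriv (truncation n) s| ≤ K := by
  obtain ⟨K, hK⟩ := (isCompact_Icc (a := (0 : ℝ)) (b := 1)).exists_bound_of_continuousOn
    continuous_deriv_smoothTransition.continuousOn
  have hK0 : 0 ≤ K := (norm_nonneg _).trans (hK 0 (by simp))
  refine ⟨1 + 4 * K, fun n s => ?_⟩
  rw [deriv_truncation]
  refine (abs_add_le _ _).trans (add_le_add ?_ ?_)
  · rw [abs_of_nonneg (Real.smoothTransition.nonneg _)]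
    exact Real.smoothTransition.le_one _
  · by_cases h : (n * s ^ 2 - 1 : ℝ) ∈ Icc (0 : ℝ) 1
    · have h0 : 0 ≤ (n * s ^ 2 : ℝ) := by positivity
      rw [abs_mul, abs_of_nonneg (by positivity)]
      have := hK _ h
      rw [Real.norm_eq_abs] at this
      exact mul_le_mul (by linarith [h.2]) this (abs_nonneg _) (by norm_num)
    · rw [deriv_smoothTransition_eq_zero h, mul_zero, abs_zero]
      positivity

lemma eventually_two_lt {s : ℝ} (hs : s ≠ 0) : ∀ᶠ n : ℕ in atTop, 2 < n * s ^ 2 :=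
  ((tendsto_natCast_atTop_atTop (R := ℝ)).atTop_mul_const (by positivity)).eventually_gt_atTop 2

lemma tendsto_truncation (s : ℝ) : Tendsto (fun n => truncation n s) atTop (𝓝 s) := by
  by_cases hs : s = 0
  · simp [truncation, hs]
  · refine tendsto_const_nhds.congr' ?_
    filter_upwards [eventually_two_lt hs] with n hn
    rw [truncation, Real.smoothTransition.one_of_one_le (by linarith), mul_one]

lemma tendsto_deriv_truncation {s : ℝ} (hs : s ≠ 0) :
    Tendsto (fun n => deriv (truncation n) s) atTop (𝓝 1) := by
  refine tendsto_const_nhds.congr' ?_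
  filter_upwards [eventually_two_lt hs] with n hn
  rw [deriv_truncation, Real.smoothTransition.one_of_one_le (by linarith),
    deriv_smoothTransition_eq_zero fun h => by linarith [h.2], mul_zero, add_zero]

/-- The divergence theorem for piecewise smooth functions vanishing on the boundary. -/
lemma integral_fderiv_of_boundary (hdim : Module.finrank ℝ E = 3) (hB : IsOpen B)
    (hb : Bornology.IsBounded B) (hI : IsInterface B S m) (hf : PiecewiseC 1 B S m f)
    (h0 : ∀ X ∈ frontier B, Tendsto f (𝓝[B \ S] X) (𝓝 0)) (e : E) :
    ∫ X in B, fderiv ℝ f X e = -∫ X in S, jump (m X) X f * ⟪m X, e⟫_ℝ ∂μHE[2] := by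
  have hO := hI.isOpen_diff hB
  have hSm := hI.measurableSet hB
  have hF : ∀ n, PiecewiseC 1 B S m fun X => truncation n (f X) := fun n =>
    hf.comp_contDiff le_rfl hB hI (φ := truncation n) (by simpa using contDiff_truncation n)
  have hid : ∀ n : ℕ, ∫ X in B, fderiv ℝ (fun X => truncation n (f X)) X e =
      -∫ X in S, jump (m X) X (fun X => truncation n (f X)) * ⟪m X, e⟫_ℝ ∂μHE[2] := by
    intro n
    -- As `f` tends to zero at the boundary, the set where the truncation is active stays away from
    -- it and has compact closure in `B`. This is why the boundary needs no regularity.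
    refine integral_fderiv_of_compact hdim hB hb hI (hF n)
      (C := closure {X | X ∈ B \ S ∧ 1 ≤ n * f X ^ 2})
      (hb.subset fun X hX => hX.1.1).isCompact_closure ?_ ?_ e
    · intro X hX
      by_contra hXB
      have hfr : X ∈ frontier B := by
        rw [hB.frontier_eq]
        exact ⟨closure_mono (fun Y hY => hY.1.1) hX, hXB⟩
      have h1 : Tendsto (fun Y => (n : ℝ) * f Y ^ 2) (𝓝[B \ S] X) (𝓝 0) := by
        simpa using ((h0 X hfr).pow 2).const_mul (n : ℝ)
      have h2 := eventually_nhdsWithin_iff.1 (h1.eventually (gt_mem_nhds zero_lt_one))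
      obtain ⟨Y, hY1, hY2, hY3⟩ := mem_closure_iff_nhds.1 hX _ h2
      exact absurd (hY1 hY2) (not_lt.2 hY3)
    · intro X hX hXC
      refine truncation_eq_zero ?_
      by_contra! h
      exact hXC (subset_closure ⟨hX, h.le⟩)
  have hD : ∀ n, ∀ X ∈ B \ S, fderiv ℝ (fun X => truncation n (f X)) X e =
      deriv (truncation n) (f X) * fderiv ℝ f X e := fun n X hX => by
    have h1 := ((contDiff_truncation n).differentiable one_ne_zero (f X)).hasDerivAt
    have h2 := (h1.comp_hasFDerivAt X (hf.differentiableAt hB hI hX).hasFDerivAt).fderiv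
    change fderiv ℝ (fun X => truncation n (f X)) X = _ at h2
    rw [h2]
    simp
  obtain ⟨K, hK⟩ := exists_abs_deriv_truncation_le
  obtain ⟨c, hc0, hc⟩ := hf.norm_fderiv_le
  have hfc : ContDiffOn ℝ 1 f (B \ S) := by simpa using hf.contDiffOn
  have hvol : Tendsto (fun n : ℕ => ∫ X in B, fderiv ℝ (fun X => truncation n (f X)) X e) atTop
      (𝓝 (∫ X in B, fderiv ℝ f X e)) := by
    simp_rw [← setIntegral_diff_interface hdim hI (B := B)]
    refine tendsto_integral_of_dominated_convergence (fun _ => K * (c * ‖e‖)) (fun n => ?_) ?_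
      (fun n => (ae_restrict_iff' hO.measurableSet).2 (ae_of_all _ fun X hX => ?_))
      ((ae_restrict_iff' hO.measurableSet).2 ?_)
    · have := ((hF n).fderiv hB hI).integrableOn hdim hB hb hI
      exact ((this.mono_set sdiff_subset).apply_continuousLinearMap e).aestronglyMeasurable
    · exact integrableOn_const ((measure_mono sdiff_subset).trans_lt hb.measure_lt_top).ne
    · rw [hD n X hX, norm_mul]
      exact mul_le_mul (hK n _) (((fderiv ℝ f X).le_opNorm e).trans
        (mul_le_mul_of_nonneg_right (hc X hX) (norm_nonneg e))) (norm_nonneg _)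
        ((abs_nonneg _).trans (hK 0 0))
    -- The derivative of the truncation tends to one except where `f = 0`, and there the derivative
    -- of `f` vanishes almost everywhere.
    · filter_upwards [measure_zero_of_fderiv_ne_zero hO hfc e] with X hX0 hX
      simp_rw [hD _ X hX]
      by_cases hfX : f X = 0
      · simp [hX0 hX hfX]
      · simpa using (tendsto_deriv_truncation hfX).mul_const (fderiv ℝ f X e)
  obtain ⟨d, hd0, hd⟩ := hf.norm_traces_le hI
  have := hI.finite_restrict
  have hj : ∀ n, ∀ X ∈ S, jump (m X) X (fun X => truncation n (f X)) =
      truncation n (sideLim (m X) X f) - truncation n (sideLim (-m X) X f) := fun n X hX =>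
    jump_eq (((contDiff_truncation n).continuous.tendsto _).comp (hf.tendsto_pos hI hX))
      (((contDiff_truncation n).continuous.tendsto _).comp (hf.tendsto_neg hI hX))
  have hsurf : Tendsto (fun n : ℕ =>
      ∫ X in S, jump (m X) X (fun X => truncation n (f X)) * ⟪m X, e⟫_ℝ ∂μHE[2]) atTop
      (𝓝 (∫ X in S, jump (m X) X f * ⟪m X, e⟫_ℝ ∂μHE[2])) := by
    refine tendsto_integral_of_dominated_convergence (fun _ => (d + d) * ‖e‖) (fun n => ?_)
      (integrable_const _) (fun n => (ae_restrict_iff' hSm).2 (ae_of_all _ fun X hX => ?_))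
      ((ae_restrict_iff' hSm).2 (ae_of_all _ fun X hX => ?_))
    · exact ((((hF n).bddContOn_jump hI).comp₂ hI.bddContOn_normal
        (φ := fun (a : ℝ) (n : E) => a * ⟪n, e⟫_ℝ) (by fun_prop)).integrableOn hB
          hI).aestronglyMeasurable
    · rw [hj n X hX, norm_mul]
      refine mul_le_mul ((norm_sub_le _ _).trans (add_le_add
        ((abs_truncation_le n _).trans (hd X hX).1) ((abs_truncation_le n _).trans (hd X hX).2)))
        ?_ (norm_nonneg _) (add_nonneg hd0 hd0)
      simpa [hI.norm_normal hX] using norm_inner_le_norm (𝕜 := ℝ) (m X) e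
    · simp_rw [hj _ X hX]
      exact ((tendsto_truncation _).sub (tendsto_truncation _)).mul_const _
  simp_rw [hid] at hvol
  exact tendsto_nhds_unique hvol hsurf.neg

end Truncation

/-! ### Tensor algebra and calculus -/

section TensorCalculus

variable {A A' L H : Tensor E} {x y : E}

lemma tr_eq_sum (A : Tensor E) : tr A = ∑ i, ⟪A (basisVec i), basisVec i⟫_ℝ := by
  rw [tr, LinearMap.trace_eq_sum_inner _ (stdOrthonormalBasis ℝ E)]
  exact Finset.sum_congr rfl fun i _ => real_inner_comm _ _

lemma sum_inner_basisVec_smul (x : E) : ∑ i, ⟪x, basisVec i⟫_ℝ • (basisVec i : E) = x := by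
  conv_rhs => rw [← (stdOrthonormalBasis ℝ E).sum_repr' x]
  exact Finset.sum_congr rfl fun i _ => by rw [real_inner_comm]; rfl

lemma sum_inner_basisVec_mul (x y : E) :
    ∑ i, ⟪x, basisVec i⟫_ℝ * ⟪(basisVec i : E), y⟫_ℝ = ⟪x, y⟫_ℝ := by
  conv_rhs => rw [← sum_inner_basisVec_smul x, sum_inner]
  exact Finset.sum_congr rfl fun i _ => by rw [real_inner_smul_left]

@[simp] lemma tr_add (A A' : Tensor E) : tr (A + A') = tr A + tr A' := by simp [tr]

@[simp] lemma tr_smul (c : ℝ) (A : Tensor E) : tr (c • A) = c * tr A := by simp [tr]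

@[simp] lemma tr_sub (A A' : Tensor E) : tr (A - A') = tr A - tr A' := by simp [tr]

lemma tr_comp_comm (A A' : Tensor E) : tr (A ∘L A') = tr (A' ∘L A) :=
  LinearMap.trace_mul_comm ℝ (A : E →ₗ[ℝ] E) (A' : E →ₗ[ℝ] E)

@[simp] lemma transpose_transpose (A : Tensor E) : transpose (transpose A) = A :=
  ContinuousLinearMap.adjoint_adjoint A

@[simp] lemma transpose_add (A A' : Tensor E) : transpose (A + A') = transpose A + transpose A' :=
  map_add _ _ _

@[simp] lemma transpose_sub (A A' : Tensor E) : transpose (A - A') = transpose A - transpose A' :=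
  map_sub _ _ _

@[simp] lemma transpose_smul (c : ℝ) (A : Tensor E) : transpose (c • A) = c • transpose A := by
  simp [transpose]

@[simp] lemma transpose_id : transpose (ContinuousLinearMap.id ℝ E) = ContinuousLinearMap.id ℝ E := by
  ext x
  refine ext_inner_right ℝ fun y => ?_
  rw [inner_transpose_left]
  rfl

lemma transpose_comp (A A' : Tensor E) : transpose (A ∘L A') = transpose A' ∘L transpose A :=
  ContinuousLinearMap.adjoint_comp A A'

@[simp] lemma tr_transpose (A : Tensor E) : tr (transpose A) = tr A := by
  rw [tr_eq_sum, tr_eq_sum]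
  exact Finset.sum_congr rfl fun i _ => by rw [inner_transpose_left, real_inner_comm]

lemma dyad_apply (a b c : E) : dyad a b c = ⟪b, c⟫_ℝ • a := rfl

@[simp] lemma transpose_dyad (a b : E) : transpose (dyad a b) = dyad b a := by
  ext x
  refine ext_inner_right ℝ fun y => ?_
  rw [inner_transpose_left, dyad_apply, dyad_apply, real_inner_smul_left, real_inner_smul_right,
    real_inner_comm x a]
  ring

lemma tr_comp_dyad (A : Tensor E) (a b : E) : tr (A ∘L dyad a b) = ⟪A a, b⟫_ℝ := by
  rw [tr_eq_sum, ← sum_inner_basisVec_mul b (A a) |>.trans (real_inner_comm _ _)]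
  refine Finset.sum_congr rfl fun i _ => ?_
  rw [ContinuousLinearMap.comp_apply, dyad_apply, map_smul, real_inner_smul_left,
    real_inner_comm (A a)]

lemma tr_dyad (a b : E) : tr (dyad a b) = ⟪a, b⟫_ℝ := tr_comp_dyad (ContinuousLinearMap.id ℝ E) a b

lemma continuous_tr : Continuous (tr : Tensor E → ℝ) := by
  have : (tr : Tensor E → ℝ) = fun A => ∑ i, ⟪A (basisVec i), basisVec i⟫_ℝ := funext tr_eq_sum
  rw [this]
  fun_prop

/-- The trace as a continuous linear functional. -/
def trCLM : Tensor E →L[ℝ] ℝ where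
  toFun := tr
  map_add' := tr_add
  map_smul' := tr_smul
  cont := continuous_tr

@[simp] lemma trCLM_apply (A : Tensor E) : trCLM A = tr A := rfl

/-- Transposition as a continuous linear map. -/
def transposeCLM : Tensor E →L[ℝ] Tensor E where
  toFun := transpose
  map_add' := transpose_add
  map_smul' := transpose_smul
  cont := ContinuousLinearMap.adjoint.continuous

@[simp] lemma transposeCLM_apply (A : Tensor E) : transposeCLM A = transpose A := rfl

lemma contDiff_transpose {n : WithTop ℕ∞} : ContDiff ℝ n (transpose : Tensor E → Tensor E) :=
  (transposeCLM (E := E)).contDiff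

/-- The Leibniz expansion exhibits the determinant as a polynomial in the matrix entries. -/
lemma contDiff_det {n : WithTop ℕ∞} : ContDiff ℝ n fun A : Tensor E => A.det := by
  have : (fun A : Tensor E => A.det) = fun A => ∑ σ : Equiv.Perm (Fin (Module.finrank ℝ E)),
      ((Equiv.Perm.sign σ : ℤ) : ℝ) * ∏ i, ⟪(basisVec (σ i) : E), A (basisVec i)⟫_ℝ := by
    ext A
    rw [ContinuousLinearMap.det,
      ← LinearMap.det_toMatrix (stdOrthonormalBasis ℝ E).toBasis, Matrix.det_apply']
    refine Finset.sum_congr rfl fun σ _ => ?_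
    congr 1
    refine Finset.prod_congr rfl fun i _ => ?_
    rw [LinearMap.toMatrix_apply, OrthonormalBasis.coe_toBasis,
      OrthonormalBasis.coe_toBasis_repr_apply, OrthonormalBasis.repr_apply_apply]
    rfl
  rw [this]
  refine ContDiff.sum fun σ _ => contDiff_const.mul (contDiff_prod fun i _ => ?_)
  exact contDiff_const.inner ℝ (ContinuousLinearMap.apply ℝ E (basisVec i)).contDiff

lemma det_comp (A A' : Tensor E) : (A ∘L A').det = A.det * A'.det := by
  simp [ContinuousLinearMap.det]

@[simp] lemma det_transpose (A : Tensor E) : (transpose A).det = A.det := by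
  rw [ContinuousLinearMap.det, ContinuousLinearMap.det,
    ← LinearMap.det_toMatrix (stdOrthonormalBasis ℝ E).toBasis,
    ← LinearMap.det_toMatrix (stdOrthonormalBasis ℝ E).toBasis (A : E →ₗ[ℝ] E),
    ← Matrix.det_transpose]
  congr 1
  ext i j
  simp only [Matrix.transpose_apply, LinearMap.toMatrix_apply, OrthonormalBasis.coe_toBasis,
    OrthonormalBasis.coe_toBasis_repr_apply, OrthonormalBasis.repr_apply_apply,
    ContinuousLinearMap.coe_coe]
  rw [inner_transpose_right, real_inner_comm]

lemma inverse_comp_self (hL : L.det ≠ 0) : L.inverse ∘L L = ContinuousLinearMap.id ℝ E :=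
  ContinuousLinearMap.ext fun x => inverse_apply_self hL x

lemma comp_inverse_self (hL : L.det ≠ 0) : L ∘L L.inverse = ContinuousLinearMap.id ℝ E :=
  ContinuousLinearMap.ext fun x => apply_inverse_self hL x

/-- The linear coefficient of the polynomial `det (1 + X N)` is the trace of `N`. -/
lemma hasDerivAt_det_id (H : Tensor E) :
    HasDerivAt (fun s : ℝ => (ContinuousLinearMap.id ℝ E + s • H).det) (tr H) 0 := by
  set b := (stdOrthonormalBasis ℝ E).toBasis
  set N := LinearMap.toMatrix b b (H : E →ₗ[ℝ] E)
  have h1 : ∀ s : ℝ, (ContinuousLinearMap.id ℝ E + s • H).det =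
      ((1 + (Polynomial.X : Polynomial ℝ) • N.map Polynomial.C).det).eval s := by
    intro s
    rw [ContinuousLinearMap.det, ← LinearMap.det_toMatrix b, ← Polynomial.coe_evalRingHom,
      RingHom.map_det]
    congr 1
    have h3 : LinearMap.toMatrix b b ((ContinuousLinearMap.id ℝ E + s • H : Tensor E) : E →ₗ[ℝ] E) =
        1 + s • N := by
      rw [← LinearMap.toMatrix_id b, ← map_smul, ← map_add]
      rfl
    rw [h3]
    ext i j
    by_cases hij : i = j <;> simp [hij] <;> exact mul_comm _ _
  have h4 := (((1 + (Polynomial.X : Polynomial ℝ) • N.map Polynomial.C).det)).hasDerivAt 0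
  rw [Matrix.derivative_det_one_add_X_smul] at h4
  simp_rw [h1]
  rwa [tr, LinearMap.trace_eq_matrix_trace ℝ b]

/-- Jacobi's formula: factoring out `L` reduces the derivative to the one at the identity. -/
lemma fderiv_det (hL : L.det ≠ 0) (H : Tensor E) :
    fderiv ℝ (fun A : Tensor E => A.det) L H = L.det * tr (L.inverse ∘L H) := by
  have h1 : HasFDerivAt (fun A : Tensor E => A.det) (fderiv ℝ (fun A : Tensor E => A.det) L)
      (L + (0 : ℝ) • H) := by
    simpa using (contDiff_det.differentiable one_ne_zero L).hasFDerivAt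
  have h2 : HasDerivAt (fun s : ℝ => L + s • H) H 0 := by
    simpa using ((hasDerivAt_id (0 : ℝ)).smul_const H).const_add L
  refine (h1.comp_hasDerivAt (0 : ℝ) h2).unique ?_
  refine ((hasDerivAt_det_id (L.inverse ∘L H)).const_mul L.det).congr_of_eventuallyEq ?_
  refine Eventually.of_forall fun s => ?_
  simp only [Function.comp]
  rw [← det_comp, ContinuousLinearMap.comp_add, ContinuousLinearMap.comp_smul,
    ← ContinuousLinearMap.comp_assoc, comp_inverse_self hL, ContinuousLinearMap.id_comp]
  rfl

lemma contDiffAt_inverse {n : WithTop ℕ∞} (hL : L.det ≠ 0) :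
    ContDiffAt ℝ n (ContinuousLinearMap.inverse : Tensor E → Tensor E) L := by
  have h := ContinuousLinearMap.coe_toContinuousLinearEquivOfDetNeZero L hL
  rw [← h]
  exact contDiffAt_map_inverse _

lemma isOpen_det_ne_zero : IsOpen {A : Tensor E | A.det ≠ 0} :=
  (contDiff_det (n := 0)).continuous.isOpen_preimage _ isOpen_compl_singleton

/-- Differentiation of `A A⁻¹ = I`, which holds near `L`, followed by multiplication by `L⁻¹`. -/
lemma fderiv_inverse (hL : L.det ≠ 0) (H : Tensor E) :
    fderiv ℝ (ContinuousLinearMap.inverse : Tensor E → Tensor E) L H =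
      -(L.inverse ∘L H ∘L L.inverse) := by
  have h1 := ((contDiffAt_inverse (n := 1) hL).differentiableAt one_ne_zero).hasFDerivAt
  have h2 : HasFDerivAt (fun A : Tensor E => A ∘L A.inverse) (0 : Tensor E →L[ℝ] Tensor E) L := by
    refine (hasFDerivAt_const (ContinuousLinearMap.id ℝ E) L).congr_of_eventuallyEq ?_
    filter_upwards [isOpen_det_ne_zero.mem_nhds hL] with A hA using comp_inverse_self hA
  have h3 := ((hasFDerivAt_id L).clm_comp h1).unique h2
  have h4 := congrArg (fun D : Tensor E →L[ℝ] Tensor E => L.inverse ∘L D H) h3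
  simp only [id, _root_.add_apply, ContinuousLinearMap.comp_apply,
    ContinuousLinearMap.compL_apply, ContinuousLinearMap.flip_apply,
    ContinuousLinearMap.coe_id', ContinuousLinearMap.comp_add, _root_.zero_apply,
    ContinuousLinearMap.comp_zero] at h4
  rw [← ContinuousLinearMap.comp_assoc, inverse_comp_self hL, ContinuousLinearMap.id_comp] at h4
  exact eq_neg_of_add_eq_zero_left h4

end TensorCalculus

/-! ### The Piola transform -/

section Piola

variable {V W : Type*} [NormedAddCommGroup V] [NormedSpace ℝ V] [NormedAddCommGroup W]
  [NormedSpace ℝ W] {B S : Set E} {m : E → E} {X : E} {n : ℕ} {Y : E → E} {F : E → Tensor E}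

lemma PiecewiseC.jump_comp {f : E → V} (hI : IsInterface B S m) (hf : PiecewiseC n B S m f)
    (hX : X ∈ S) {φ : V → W} (hφ : Continuous φ) : jump (m X) X (fun Z => φ (f Z)) =
      φ (sideLim (m X) X f) - φ (sideLim (-m X) X f) :=
  jump_eq ((hφ.tendsto _).comp (hf.tendsto_pos hI hX)) ((hφ.tendsto _).comp (hf.tendsto_neg hI hX))

/-- The divergence theorem for piecewise smooth vector fields vanishing on the boundary. -/
lemma integral_tr_fderiv (hdim : Module.finrank ℝ E = 3) (hB : IsOpen B)
    (hb : Bornology.IsBounded B) (hI : IsInterface B S m) (hY : PiecewiseC 1 B S m Y)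
    (h0 : VanishesOnBoundary B S Y) :
    ∫ X in B, tr (fderiv ℝ Y X) = -∫ X in S, ⟪jump (m X) X Y, m X⟫_ℝ ∂μHE[2] := by
  have hO := hI.isOpen_diff hB
  have hcomp : ∀ e : E, PiecewiseC 1 B S m fun X => ⟪Y X, e⟫_ℝ := fun e =>
    hY.comp_contDiff le_rfl hB hI (φ := fun y => ⟪y, e⟫_ℝ) (contDiff_id.inner ℝ contDiff_const)
  have hd : ∀ e : E, ∀ X ∈ B \ S, fderiv ℝ (fun X => ⟪Y X, e⟫_ℝ) X e = ⟪fderiv ℝ Y X e, e⟫_ℝ :=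
    fun e X hX => by
      rw [fderiv_inner_apply ℝ (hY.differentiableAt hB hI hX) (differentiableAt_const e)]
      simp
  have h1 : ∀ e : E, ∫ X in B, ⟪fderiv ℝ Y X e, e⟫_ℝ =
      -∫ X in S, ⟪jump (m X) X Y, e⟫_ℝ * ⟪e, m X⟫_ℝ ∂μHE[2] := fun e => by
    have := integral_fderiv_of_boundary hdim hB hb hI (hcomp e)
      (fun X hX => by simpa using (h0 X hX).inner (tendsto_const_nhds (x := e))) e
    rw [← setIntegral_diff_interface hdim hI, setIntegral_congr_fun hO.measurableSet (hd e),
      setIntegral_diff_interface hdim hI] at this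
    rw [this]
    congr 1
    refine setIntegral_congr_fun (hI.measurableSet hB) fun X hX => ?_
    rw [hY.jump_comp hI hX (φ := fun y => ⟪y, e⟫_ℝ) (by fun_prop), ← inner_sub_left,
      real_inner_comm e (m X)]
    rfl
  have i1 : ∀ e : E, IntegrableOn (fun X => ⟪fderiv ℝ Y X e, e⟫_ℝ) B := fun e =>
    ((hY.fderiv hB hI).comp_contDiff (n := 0) zero_le_one hB hI (φ := fun A : Tensor E => ⟪A e, e⟫_ℝ)
      (by exact ((ContinuousLinearMap.apply ℝ E e).contDiff.inner ℝ contDiff_const))).integrableOn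
        hdim hB hb hI
  have i2 : ∀ e : E, IntegrableOn (fun X => ⟪jump (m X) X Y, e⟫_ℝ * ⟪e, m X⟫_ℝ) S μHE[2] := fun e =>
    ((hY.bddContOn_jump hI).comp₂ hI.bddContOn_normal (φ := fun a n : E => ⟪a, e⟫_ℝ * ⟪e, n⟫_ℝ)
      (by fun_prop)).integrableOn hB hI
  have h2 : ∀ X, ⟪jump (m X) X Y, m X⟫_ℝ =
      ∑ i, ⟪jump (m X) X Y, basisVec i⟫_ℝ * ⟪(basisVec i : E), m X⟫_ℝ := fun X =>
    (sum_inner_basisVec_mul _ _).symm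
  simp_rw [tr_eq_sum, h2]
  rw [integral_finsetSum _ fun i _ => i1 _, integral_finsetSum _ fun i _ => i2 _,
    ← Finset.sum_neg_distrib]
  exact Finset.sum_congr rfl fun i _ => h1 _

/-- A piecewise smooth deformation gradient with determinant bounded away from zero. -/
structure IsDeformation (B S : Set E) (m : E → E) (F : E → Tensor E) : Prop where
  regular : PiecewiseC 1 B S m F
  det_pos : ∃ c > 0, ∀ X ∈ B \ S, c ≤ (F X).det
  symm : ∀ X ∈ B \ S, ∀ h k, fderiv ℝ F X h k = fderiv ℝ F X k h

lemma isClosed_le_det (c : ℝ) : IsClosed {A : Tensor E | c ≤ A.det} :=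
  isClosed_le continuous_const (contDiff_det (n := 0)).continuous

/-- Tensors of bounded norm whose determinant is bounded below. -/
lemma isCompact_le_det (k c : ℝ) : IsCompact {A : Tensor E | ‖A‖ ≤ k ∧ c ≤ A.det} := by
  refine ((isCompact_closedBall (0 : Tensor E) k).inter_right (isClosed_le_det c)).of_isClosed_subset
    ((isClosed_le continuous_norm continuous_const).inter (isClosed_le_det c)) fun A hA => ?_
  exact ⟨by simpa using hA.1, hA.2⟩

lemma contDiffOn_inverse {n : WithTop ℕ∞} :
    ContDiffOn ℝ n (ContinuousLinearMap.inverse : Tensor E → Tensor E) {A | A.det ≠ 0} :=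
  fun _ hA => (contDiffAt_inverse hA).contDiffWithinAt

namespace IsDeformation

lemma det_ne_zero (hF : IsDeformation B S m F) (hX : X ∈ B \ S) : (F X).det ≠ 0 := by
  obtain ⟨c, hc, h⟩ := hF.det_pos
  exact (hc.trans_le (h X hX)).ne'

/-- Bounded norm and a determinant bounded below confine the gradient to a compact set of invertible
tensors, so `φ` only has to be smooth on invertible tensors. -/
lemma comp (hB : IsOpen B) (hI : IsInterface B S m) (hF : IsDeformation B S m F)
    {φ : Tensor E → W} (hφ : ContDiffOn ℝ 1 φ {A | A.det ≠ 0}) :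
    PiecewiseC 1 B S m fun X => φ (F X) := by
  obtain ⟨c, hc0, hc⟩ := hF.det_pos
  obtain ⟨k, -, hk⟩ := hF.regular.norm_le
  exact hF.regular.comp le_rfl hB hI isOpen_det_ne_zero (isCompact_le_det k c)
    (fun A hA => (hc0.trans_le hA.2).ne') (fun X hX => ⟨hk X hX, hc X hX⟩) (by simpa using hφ)

lemma inverse (hB : IsOpen B) (hI : IsInterface B S m) (hF : IsDeformation B S m F) :
    PiecewiseC 1 B S m fun X => (F X).inverse := hF.comp hB hI contDiffOn_inverse

lemma det_pos_side (hI : IsInterface B S m) (hF : IsDeformation B S m F) : ∃ c > 0, ∀ X ∈ S,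
    c ≤ (sideLim (m X) X F).det ∧ c ≤ (sideLim (-m X) X F).det := by
  obtain ⟨c, hc0, hc⟩ := hF.det_pos
  exact ⟨c, hc0, fun X hX => ⟨hF.regular.pos_mem hI (isClosed_le_det c) hc hX,
    hF.regular.neg_mem hI (isClosed_le_det c) hc hX⟩⟩

lemma piola (hB : IsOpen B) (hI : IsInterface B S m) (hF : IsDeformation B S m F)
    (hY : PiecewiseC 1 B S m Y) : PiecewiseC 1 B S m fun X => (F X).det • (F X).inverse (Y X) :=
  (hF.comp hB hI (φ := fun A => A.det • A.inverse)
    (contDiff_det.contDiffOn.smul contDiffOn_inverse)).comp₂ le_rfl hB hI hY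
      (φ := fun (A : Tensor E) y => A y) (contDiff_fst.clm_apply contDiff_snd)

/-- This is Piola's identity. The derivative of the determinant and that of the inverse produce the
same trace with opposite signs, because the derivative of a deformation gradient is symmetric in its
two arguments. -/
lemma tr_fderiv_piola (hB : IsOpen B) (hI : IsInterface B S m) (hF : IsDeformation B S m F)
    (hY : PiecewiseC 1 B S m Y) (hX : X ∈ B \ S) :
    tr (fderiv ℝ (fun X => (F X).det • (F X).inverse (Y X)) X) =
      (F X).det * tr (fderiv ℝ Y X ∘L (F X).inverse) := by
  have hL := hF.det_ne_zero hX
  have hF' := (hF.regular.differentiableAt hB hI hX).hasFDerivAt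
  have hY' := (hY.differentiableAt hB hI hX).hasFDerivAt
  have hdet := ((contDiff_det (n := 1)).differentiable one_ne_zero (F X)).hasFDerivAt.comp X hF'
  have hinv :=
    ((contDiffAt_inverse (n := 1) hL).differentiableAt one_ne_zero).hasFDerivAt.comp X hF'
  have hW := (hdet.smul (hinv.clm_apply hY')).fderiv
  set v := (F X).inverse (Y X) with hv
  have key : ∀ h, fderiv ℝ (fun X => (F X).det • (F X).inverse (Y X)) X h =
      ((F X).det * tr ((F X).inverse ∘L fderiv ℝ F X h)) • v +
        (F X).det • ((F X).inverse (fderiv ℝ Y X h) - (F X).inverse (fderiv ℝ F X v h)) := by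
    intro h
    change fderiv ℝ (fun X => (F X).det • (F X).inverse (Y X)) X = _ at hW
    rw [hW]
    simp only [_root_.add_apply, _root_.smul_apply, ContinuousLinearMap.comp_apply,
      ContinuousLinearMap.smulRight_apply, ContinuousLinearMap.flip_apply, Function.comp,
      fderiv_det hL, fderiv_inverse hL, _root_.neg_apply]
    -- Symmetry puts the fixed vector `v` into the direction slot, so that the trace over `h` is
    -- that of `F⁻¹ (∂_v F)`, as in Jacobi's formula.
    rw [hF.symm X hX v h, ← hv]
    module
  rw [tr_eq_sum]
  simp_rw [key, inner_add_left, real_inner_smul_left, inner_sub_left, mul_sub]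
  rw [Finset.sum_add_distrib, Finset.sum_sub_distrib, ← Finset.mul_sum, ← Finset.mul_sum]
  have e1 : ∑ i, (F X).det * tr ((F X).inverse ∘L fderiv ℝ F X (basisVec i)) * ⟪v, basisVec i⟫_ℝ =
      (F X).det * tr ((F X).inverse ∘L fderiv ℝ F X v) := by
    conv_rhs => rw [← sum_inner_basisVec_smul v]
    rw [map_sum, ← trCLM_apply, ← ContinuousLinearMap.compL_apply, map_sum, map_sum, Finset.mul_sum]
    refine Finset.sum_congr rfl fun i _ => ?_
    simp only [map_smul, smul_eq_mul, ContinuousLinearMap.compL_apply, trCLM_apply]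
    ring
  have e2 : ∑ i, ⟪(F X).inverse (fderiv ℝ F X v (basisVec i)), basisVec i⟫_ℝ =
      tr ((F X).inverse ∘L fderiv ℝ F X v) := by rw [tr_eq_sum]; rfl
  have e3 : ∑ i, ⟪(F X).inverse (fderiv ℝ Y X (basisVec i)), basisVec i⟫_ℝ =
      tr (fderiv ℝ Y X ∘L (F X).inverse) := by rw [tr_comp_comm, tr_eq_sum]; rfl
  rw [e1, e2, e3]
  ring

/-- The divergence theorem in the deformed configuration. -/
lemma integral_div (hdim : Module.finrank ℝ E = 3) (hB : IsOpen B)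
    (hb : Bornology.IsBounded B) (hI : IsInterface B S m) (hF : IsDeformation B S m F)
    (hY : PiecewiseC 1 B S m Y) (h0 : VanishesOnBoundary B S Y) :
    ∫ X in B, (F X).det * tr (fderiv ℝ Y X ∘L (F X).inverse) =
      -∫ X in S, jump (m X) X
        (fun Z => ⟪Y Z, (F Z).det • transpose (F Z).inverse (m X)⟫_ℝ) ∂μHE[2] := by
  have hW := hF.piola hB hI hY
  have hW0 : VanishesOnBoundary B S fun X => (F X).det • (F X).inverse (Y X) := by
    intro X hX
    obtain ⟨k, -, hk⟩ := (hF.comp hB hI (φ := fun A => A.det • A.inverse)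
      (contDiff_det.contDiffOn.smul contDiffOn_inverse)).norm_le
    have h1 : Tendsto (fun Z => k * ‖Y Z‖) (𝓝[B \ S] X) (𝓝 0) := by
      simpa using (h0 X hX).norm.const_mul k
    refine squeeze_zero_norm' ?_ h1
    filter_upwards [self_mem_nhdsWithin] with Z hZ
    exact (((F Z).det • (F Z).inverse).le_opNorm (Y Z)).trans
      (mul_le_mul_of_nonneg_right (hk Z hZ) (norm_nonneg _))
  have h1 := integral_tr_fderiv hdim hB hb hI hW hW0
  rw [← setIntegral_diff_interface hdim hI, setIntegral_congr_fun
    (hI.isOpen_diff hB).measurableSet fun X hX => hF.tr_fderiv_piola hB hI hY hX,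
    setIntegral_diff_interface hdim hI] at h1
  rw [h1]
  congr 1
  refine setIntegral_congr_fun (hI.measurableSet hB) fun X hX => ?_
  have h2 := hW.jump_comp hI hX (φ := fun y => ⟪y, m X⟫_ℝ) (by fun_prop)
  rw [← inner_sub_left] at h2
  refine h2.symm.trans ?_
  congr 1
  funext Z
  rw [real_inner_smul_left, real_inner_smul_right, inner_transpose_right]

end IsDeformation

end Piola

/-! ### Space-time fields and their slices -/

section SpaceTime

variable {V : Type*} [NormedAddCommGroup V] [NormedSpace ℝ V] {B S : Set E} {m : E → E} {X : E}
  {T t : ℝ} {n : ℕ} {f : E → ℝ → V}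

lemma fderiv_fderiv_apply_comm {P : Type*} [NormedAddCommGroup P] [NormedSpace ℝ P] {g : P → V}
    {q : P} (hg : ContDiffAt ℝ 2 g q) (a b : P) :
    fderiv ℝ (fun q => fderiv ℝ g q b) q a = fderiv ℝ (fun q => fderiv ℝ g q a) q b := by
  have h1 : DifferentiableAt ℝ (fderiv ℝ g) q :=
    (hg.fderiv_right (m := 1) (by norm_num)).differentiableAt one_ne_zero
  rw [fderiv_clm_apply h1 (differentiableAt_const b), fderiv_clm_apply h1 (differentiableAt_const a)]
  simpa using (hg.isSymmSndFDerivAt (by simp)).eq a b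

namespace PiecewiseCTime

lemma isOpen_domain (hB : IsOpen B) (hI : IsInterface B S m) :
    IsOpen ((B \ S) ×ˢ Ioo 0 T) := (hI.isOpen_diff hB).prod isOpen_Ioo

/-- The joint derivative in space and time. -/
lemma fderiv (hB : IsOpen B) (hI : IsInterface B S m) (hf : PiecewiseCTime (n + 1) B S m T f) :
    PiecewiseCTime n B S m T
      fun X t => fderiv ℝ (fun q : E × ℝ => f q.1 q.2) (X, t) where
  contDiffOn := hf.contDiffOn.fderiv_of_isOpen (isOpen_domain hB hI) (by norm_cast)
  bounded k hk := by
    obtain ⟨c, hc⟩ := hf.bounded (k + 1) (by omega)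
    exact ⟨c, fun q hq => by
      have := hc q hq
      rwa [← norm_iteratedFDeriv_fderiv] at this⟩
  sides X hX t ht := by
    obtain ⟨U, ℓ, I, g₁, g₂, hXU, hUB, hd, htI, hIT, hIo, h1, h2, hs⟩ := hf.sides X hX t ht
    have ho : IsOpen (U ×ˢ I) := hd.isOpen.prod hIo
    refine ⟨U, ℓ, I, _root_.fderiv ℝ g₁, _root_.fderiv ℝ g₂, hXU, hUB, hd, htI, hIT, hIo,
      h1.fderiv_of_isOpen ho (by norm_cast), h2.fderiv_of_isOpen ho (by norm_cast),
      fun Y hY τ hτ => ?_⟩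
    have hc : ContinuousAt (fun q : E × ℝ => ℓ q.1) (Y, τ) :=
      ContinuousAt.comp (g := ℓ) (hd.differentiableAt hY).continuousAt continuousAt_fst
    refine ⟨fun hp => Filter.EventuallyEq.fderiv_eq ?_, fun hp => Filter.EventuallyEq.fderiv_eq ?_⟩
    · filter_upwards [ho.mem_nhds (mk_mem_prod hY hτ), hc.eventually (lt_mem_nhds hp)]
        with q hq hl using (hs q.1 hq.1 q.2 hq.2).1 hl
    · filter_upwards [ho.mem_nhds (mk_mem_prod hY hτ), hc.eventually (gt_mem_nhds hp)]
        with q hq hl using (hs q.1 hq.1 q.2 hq.2).2 hl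

lemma clm_comp {W : Type*} [NormedAddCommGroup W] [NormedSpace ℝ W] (hB : IsOpen B)
    (hI : IsInterface B S m) (hf : PiecewiseCTime n B S m T f) (L : V →L[ℝ] W) :
    PiecewiseCTime n B S m T fun X t => L (f X t) where
  contDiffOn := L.contDiff.comp_contDiffOn hf.contDiffOn
  bounded k hk := by
    obtain ⟨c, hc⟩ := hf.bounded k hk
    refine ⟨‖L‖ * c, fun q hq => ?_⟩
    exact (L.norm_iteratedFDeriv_comp_left (hf.contDiffOn.contDiffAt
      ((isOpen_domain hB hI).mem_nhds hq)) (by exact_mod_cast hk)).trans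
        (mul_le_mul_of_nonneg_left (hc q hq) (norm_nonneg _))
  sides X hX t ht := by
    obtain ⟨U, ℓ, I, g₁, g₂, hXU, hUB, hd, htI, hIT, hIo, h1, h2, hs⟩ := hf.sides X hX t ht
    exact ⟨U, ℓ, I, fun q => L (g₁ q), fun q => L (g₂ q), hXU, hUB, hd, htI, hIT, hIo,
      L.contDiff.comp_contDiffOn h1, L.contDiff.comp_contDiffOn h2, fun Y hY τ hτ =>
      ⟨fun hp => by rw [(hs Y hY τ hτ).1 hp], fun hp => by rw [(hs Y hY τ hτ).2 hp]⟩⟩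

lemma of_succ (hf : PiecewiseCTime (n + 1) B S m T f) : PiecewiseCTime n B S m T f where
  contDiffOn := hf.contDiffOn.of_le (by norm_cast; omega)
  bounded k hk := hf.bounded k (by omega)
  sides X hX t ht := by
    obtain ⟨U, ℓ, I, g₁, g₂, hXU, hUB, hd, htI, hIT, hIo, h1, h2, hs⟩ := hf.sides X hX t ht
    exact ⟨U, ℓ, I, g₁, g₂, hXU, hUB, hd, htI, hIT, hIo, h1.of_le (by norm_cast; omega),
      h2.of_le (by norm_cast; omega), hs⟩

lemma norm_le (hf : PiecewiseCTime n B S m T f) :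
    ∃ c, 0 ≤ c ∧ ∀ X ∈ B \ S, ∀ t ∈ Ioo 0 T, ‖f X t‖ ≤ c := by
  obtain ⟨c, hc⟩ := hf.bounded 0 (Nat.zero_le n)
  refine ⟨max c 0, le_max_right _ _, fun X hX t ht => ?_⟩
  have := hc (X, t) ⟨hX, ht⟩
  rw [norm_iteratedFDeriv_zero] at this
  exact this.trans (le_max_left c 0)

lemma differentiableAt (hB : IsOpen B) (hI : IsInterface B S m)
    (hf : PiecewiseCTime (n + 1) B S m T f) (hX : X ∈ B \ S) (ht : t ∈ Ioo 0 T) :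
    DifferentiableAt ℝ (fun q : E × ℝ => f q.1 q.2) (X, t) :=
  (hf.contDiffOn.contDiffAt ((isOpen_domain hB hI).mem_nhds ⟨hX, ht⟩)).differentiableAt (by simp)

lemma hasFDerivAt_slice (hB : IsOpen B) (hI : IsInterface B S m)
    (hf : PiecewiseCTime (n + 1) B S m T f) (hX : X ∈ B \ S) (ht : t ∈ Ioo 0 T) :
    HasFDerivAt (fun X => f X t) (_root_.fderiv ℝ (fun q : E × ℝ => f q.1 q.2) (X, t) ∘L
      ContinuousLinearMap.inl ℝ E ℝ) X :=
  HasFDerivAt.comp (g := fun q : E × ℝ => f q.1 q.2) (f := fun Y : E => (Y, t)) X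
    (hf.differentiableAt hB hI hX ht).hasFDerivAt (hasFDerivAt_prodMk_left X t)

lemma hasDerivAt_time (hB : IsOpen B) (hI : IsInterface B S m)
    (hf : PiecewiseCTime (n + 1) B S m T f) (hX : X ∈ B \ S) (ht : t ∈ Ioo 0 T) :
    HasDerivAt (fun τ => f X τ) (_root_.fderiv ℝ (fun q : E × ℝ => f q.1 q.2) (X, t) (0, 1)) t :=
  HasFDerivAt.comp_hasDerivAt (l := fun q : E × ℝ => f q.1 q.2) t
    (hf.differentiableAt hB hI hX ht).hasFDerivAt
    ((hasDerivAt_const t X).prodMk (hasDerivAt_id t))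

lemma slice_zero (hf : PiecewiseCTime 0 B S m T f) (ht : t ∈ Ioo 0 T) :
    PiecewiseC 0 B S m fun X => f X t := by
  refine PiecewiseC.of_bounds zero_le_one ?_ ?_ (by simp) fun X hX => ?_
  · exact hf.contDiffOn.comp (contDiff_prodMk_left t).contDiffOn fun X hX => ⟨hX, ht⟩
  · obtain ⟨c, -, hc⟩ := hf.norm_le
    exact ⟨c, fun X hX => hc X hX t ht⟩
  · obtain ⟨U, ℓ, I, g₁, g₂, hXU, hUB, hd, htI, hIT, hIo, h1, h2, hs⟩ := hf.sides X hX t ht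
    exact ⟨U, ℓ, fun Y => g₁ (Y, t), fun Y => g₂ (Y, t), hXU, hUB, hd,
      h1.comp (contDiff_prodMk_left t).contDiffOn fun Y hY => ⟨hY, htI⟩,
      h2.comp (contDiff_prodMk_left t).contDiffOn fun Y hY => ⟨hY, htI⟩, fun Y hY => hs Y hY t htI⟩

lemma slice (hB : IsOpen B) (hI : IsInterface B S m) (hf : PiecewiseCTime 1 B S m T f)
    (ht : t ∈ Ioo 0 T) : PiecewiseC 1 B S m fun X => f X t := by
  refine PiecewiseC.of_bounds le_rfl ?_ ?_ ?_ fun X hX => ?_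
  · exact hf.contDiffOn.comp (contDiff_prodMk_left t).contDiffOn fun X hX => ⟨hX, ht⟩
  · obtain ⟨c, -, hc⟩ := hf.norm_le
    exact ⟨c, fun X hX => hc X hX t ht⟩
  · intro _
    obtain ⟨c, hc0, hc⟩ := (fderiv (n := 0) hB hI hf).norm_le
    refine ⟨c * 1, fun X hX => ?_⟩
    rw [(hasFDerivAt_slice (n := 0) hB hI hf hX ht).fderiv]
    exact (ContinuousLinearMap.opNorm_comp_le _ _).trans (mul_le_mul (hc X hX t ht)
      (ContinuousLinearMap.norm_inl_le_one ℝ E ℝ) (norm_nonneg _) hc0)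
  · obtain ⟨U, ℓ, I, g₁, g₂, hXU, hUB, hd, htI, hIT, hIo, h1, h2, hs⟩ := hf.sides X hX t ht
    exact ⟨U, ℓ, fun Y => g₁ (Y, t), fun Y => g₂ (Y, t), hXU, hUB, hd,
      h1.comp (contDiff_prodMk_left t).contDiffOn fun Y hY => ⟨hY, htI⟩,
      h2.comp (contDiff_prodMk_left t).contDiffOn fun Y hY => ⟨hY, htI⟩, fun Y hY => hs Y hY t htI⟩

/-- The time derivative of a field that is continuous across the interface is continuous too. -/
lemma continuousOn_deriv (hB : IsOpen B) (hI : IsInterface B S m) (hf : PiecewiseCTime 1 B S m T f)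
    (hc : ContinuousOn (fun q : E × ℝ => f q.1 q.2) (B ×ˢ Ioo 0 T)) (ht : t ∈ Ioo 0 T) :
    ContinuousOn (fun X => deriv (fun τ => f X τ) t) B := by
  have hf' := fderiv (n := 0) hB hI hf
  intro X hXB
  refine ContinuousAt.continuousWithinAt ?_
  by_cases hXS : X ∈ S
  · obtain ⟨U, ℓ, I, g₁, g₂, hXU, hUB, hd, htI, hIT, hIo, h1, h2, hs⟩ := hf.sides X hXS t ht
    have ho : IsOpen (U ×ˢ I) := hd.isOpen.prod hIo
    have hslice : ∀ Y ∈ B, ∀ τ ∈ Ioo 0 T, ContinuousAt (fun Y => f Y τ) Y := fun Y hY τ hτ =>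
      ContinuousAt.comp (g := fun q : E × ℝ => f q.1 q.2) (f := fun Y : E => (Y, τ))
        (hc.continuousAt ((hB.prod isOpen_Ioo).mem_nhds (mk_mem_prod hY hτ)))
        (continuousAt_id.prodMk continuousAt_const)
    have hslice' : ∀ {g : E × ℝ → V}, ContDiffOn ℝ 1 g (U ×ˢ I) → ∀ Y ∈ U, ∀ τ ∈ I,
        ContinuousAt (fun Y => g (Y, τ)) Y := fun {g} hg Y hY τ hτ =>
      ContinuousAt.comp (g := g) (hg.continuousOn.continuousAt (ho.mem_nhds (mk_mem_prod hY hτ)))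
        (continuousAt_id.prodMk continuousAt_const)
    -- By continuity the field on the interface equals both one-sided extensions at all times near
    -- `t`. Their time derivatives therefore agree there with that of the field.
    have e1 : ∀ Y ∈ S ∩ U, ∀ τ ∈ I, f Y τ = g₁ (Y, τ) := fun Y hY τ hτ => by
      refine tendsto_nhds_unique ((hslice Y (hUB hY.2) τ (hIT hτ)).tendsto.comp
        (tendsto_add_smul_nhds Y (m Y))) (((hslice' (by simpa using h1) Y hY.2 τ hτ).tendsto.comp
        (tendsto_add_smul_nhds Y (m Y))).congr' ?_)
      filter_upwards [hd.eventually_normal_pos hY.2 hY.1] with s h3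
        using ((hs _ h3.1 τ hτ).1 h3.2).symm
    have e2 : ∀ Y ∈ S ∩ U, ∀ τ ∈ I, f Y τ = g₂ (Y, τ) := fun Y hY τ hτ => by
      refine tendsto_nhds_unique ((hslice Y (hUB hY.2) τ (hIT hτ)).tendsto.comp
        (tendsto_add_smul_nhds Y (-m Y))) (((hslice' (by simpa using h2) Y hY.2 τ hτ).tendsto.comp
        (tendsto_add_smul_nhds Y (-m Y))).congr' ?_)
      filter_upwards [hd.eventually_normal_neg hY.2 hY.1] with s h3
        using ((hs _ h3.1 τ hτ).2 h3.2).symm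
    have hder : ∀ {g : E × ℝ → V}, ContDiffOn ℝ 1 g (U ×ˢ I) → ∀ Y ∈ U,
        (∀ τ ∈ I, f Y τ = g (Y, τ)) →
        deriv (fun τ => f Y τ) t = _root_.fderiv ℝ g (Y, t) (0, 1) := fun {g} hg Y hY he => by
      have h3 : (fun τ => f Y τ) =ᶠ[𝓝 t] fun τ => g (Y, τ) := by
        filter_upwards [hIo.mem_nhds htI] with τ hτ using he τ hτ
      rw [h3.deriv_eq]
      exact (HasFDerivAt.comp_hasDerivAt (l := g) t ((hg.contDiffAt
        (ho.mem_nhds (mk_mem_prod hY htI))).differentiableAt one_ne_zero).hasFDerivAt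
        ((hasDerivAt_const t Y).prodMk (hasDerivAt_id t))).deriv
    have hcont : ∀ {g : E × ℝ → V}, ContDiffOn ℝ 1 g (U ×ˢ I) →
        ContinuousAt (fun Y => _root_.fderiv ℝ g (Y, t) (0, 1)) X := fun {g} hg =>
      (ContinuousAt.comp (g := _root_.fderiv ℝ g) (f := fun Y : E => (Y, t)) ((hg.continuousOn_fderiv_of_isOpen ho
        le_rfl).continuousAt (ho.mem_nhds (mk_mem_prod hXU htI)))
        (continuousAt_id.prodMk continuousAt_const)).clm_apply continuousAt_const
    have h1' : ContDiffOn ℝ 1 g₁ (U ×ˢ I) := by simpa using h1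
    have h2' : ContDiffOn ℝ 1 g₂ (U ×ˢ I) := by simpa using h2
    have v1 := hder h1' X hXU (e1 X ⟨hXS, hXU⟩)
    have v2 := hder h2' X hXU (e2 X ⟨hXS, hXU⟩)
    have c1 := (hcont h1').tendsto
    have c2 := (hcont h2').tendsto
    rw [← v1] at c1
    rw [← v2] at c2
    intro N hN
    rw [mem_map]
    filter_upwards [c1 hN, c2 hN, hd.isOpen.mem_nhds hXU] with Y hY1 hY2 hYU
    rcases lt_trichotomy (ℓ Y) 0 with h | h | h
    · rwa [mem_preimage, hder h2' Y hYU fun τ hτ => (hs Y hYU τ hτ).2 h]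
    · rwa [mem_preimage, hder h1' Y hYU (e1 Y ⟨(hd.mem_iff Y hYU).2 h, hYU⟩)]
    · rwa [mem_preimage, hder h1' Y hYU fun τ hτ => (hs Y hYU τ hτ).1 h]
  · have hO := (hI.isOpen_diff hB).mem_nhds ⟨hXB, hXS⟩
    have h1 : ContinuousAt (fun Y => _root_.fderiv ℝ (fun q : E × ℝ => f q.1 q.2) (Y, t) (0, 1)) X :=
      ((hf'.slice_zero ht).continuousOn.continuousAt hO).clm_apply continuousAt_const
    refine h1.congr ?_
    filter_upwards [hO] with Y hY using (hasDerivAt_time (n := 0) hB hI hf hY ht).deriv.symm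

end PiecewiseCTime

/-- A field that is continuous across the interface coincides there with differentiable extensions
from both sides. -/
lemma PiecewiseC.exists_extension (hB : IsOpen B) (hI : IsInterface B S m) {f : E → V}
    (hf : PiecewiseC 1 B S m f) (hc : ContinuousOn f B) (hX : X ∈ S) : ∃ Ψ₁ Ψ₂ : E → V,
      HasStrictFDerivAt Ψ₁ (sideLim (m X) X (_root_.fderiv ℝ f)) X ∧
      HasStrictFDerivAt Ψ₂ (sideLim (-m X) X (_root_.fderiv ℝ f)) X ∧
      ∀ᶠ Y in 𝓝[S] X, f Y = Ψ₁ Y ∧ f Y = Ψ₂ Y := by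
  obtain ⟨U, ℓ, hXU, hUB, hd⟩ := hI.locally_level X hX
  obtain ⟨U', g₁, g₂, hXU', hU', hUB', ho, h1, h2, hs, ht⟩ := hf.exists_trace hX hd hXU
  have hd' := hd.mono ho hU'
  have a1 := h1.contDiffAt (ho.mem_nhds hXU')
  have a2 := h2.contDiffAt (ho.mem_nhds hXU')
  have c1 := (h1.continuousOn_fderiv_of_isOpen ho (by simp)).continuousAt (ho.mem_nhds hXU')
  have c2 := (h2.continuousOn_fderiv_of_isOpen ho (by simp)).continuousAt (ho.mem_nhds hXU')
  refine ⟨g₁, g₂, ?_, ?_, ?_⟩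
  · convert a1.hasStrictFDerivAt (by simp) using 1
    refine Tendsto.limUnder_eq ((c1.tendsto.comp (tendsto_add_smul_nhds X (m X))).congr' ?_)
    filter_upwards [hd'.eventually_normal_pos hXU' hX] with s h3
    refine (Filter.EventuallyEq.fderiv_eq ?_).symm
    filter_upwards [ho.mem_nhds h3.1,
      (hd'.differentiableAt h3.1).continuousAt.eventually (lt_mem_nhds h3.2)] with Z h4 h5
      using (hs Z h4).1 h5
  · convert a2.hasStrictFDerivAt (by simp) using 1
    refine Tendsto.limUnder_eq ((c2.tendsto.comp (tendsto_add_smul_nhds X (-m X))).congr' ?_)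
    filter_upwards [hd'.eventually_normal_neg hXU' hX] with s h3
    refine (Filter.EventuallyEq.fderiv_eq ?_).symm
    filter_upwards [ho.mem_nhds h3.1,
      (hd'.differentiableAt h3.1).continuousAt.eventually (gt_mem_nhds h3.2)] with Z h4 h5
      using (hs Z h4).2 h5
  · filter_upwards [self_mem_nhdsWithin, mem_nhdsWithin_of_mem_nhds (ho.mem_nhds hXU')] with Y h3 h4
    have hY := hc.continuousAt (hB.mem_nhds (hI.subset h3))
    exact ⟨tendsto_nhds_unique (hY.tendsto.comp (tendsto_add_smul_nhds Y (m Y))) (ht Y ⟨h3, h4⟩).1,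
      tendsto_nhds_unique (hY.tendsto.comp (tendsto_add_smul_nhds Y (-m Y))) (ht Y ⟨h3, h4⟩).2⟩

/-- Hadamard's compatibility condition. -/
lemma PiecewiseC.fderiv_traces_tangent (hB : IsOpen B) (hI : IsInterface B S m) {f : E → E}
    (hf : PiecewiseC 1 B S m f) (hc : ContinuousOn f B) (hX : X ∈ S) {h : E} (hh : ⟪m X, h⟫_ℝ = 0) :
    sideLim (m X) X (_root_.fderiv ℝ f) h = sideLim (-m X) X (_root_.fderiv ℝ f) h := by
  obtain ⟨Ψ₁, Ψ₂, d1, d2, he⟩ := hf.exists_extension hB hI hc hX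
  obtain ⟨U, ℓ, hXU, hUB, hd⟩ := hI.locally_level X hX
  have hℓ := (hd.contDiffAt hXU).hasStrictFDerivAt one_ne_zero
  refine sub_eq_zero.1 (ext_inner_right ℝ fun e => ?_)
  rw [inner_zero_left]
  have hφ : HasStrictFDerivAt (fun Y => ⟪Ψ₁ Y - Ψ₂ Y, e⟫_ℝ)
      ((innerSL ℝ e) ∘L (sideLim (m X) X (_root_.fderiv ℝ f) -
        sideLim (-m X) X (_root_.fderiv ℝ f))) X := by
    have := (innerSL ℝ e).hasStrictFDerivAt.comp X (d1.sub d2)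
    refine this.congr_of_eventuallyEq (Eventually.of_forall fun Y => ?_)
    exact real_inner_comm _ _
  have hev : ∀ᶠ Y in 𝓝[{Y | ℓ Y = ℓ X}] X, ⟪Ψ₁ Y - Ψ₂ Y, e⟫_ℝ = 0 := by
    rw [eventually_nhdsWithin_iff] at he ⊢
    filter_upwards [he, hd.isOpen.mem_nhds hXU] with Y h3 h4 h5
    have h6 : ℓ Y = 0 := h5.trans ((hd.mem_iff X hXU).1 hX)
    have h7 := h3 ((hd.mem_iff Y h4).2 h6)
    rw [← h7.1, ← h7.2, sub_self, inner_zero_left]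
  have hX0 : ⟪Ψ₁ X - Ψ₂ X, e⟫_ℝ = 0 := hev.self_of_nhdsWithin rfl
  -- A function that vanishes on the level set is trivially extremal on it. Lagrange multipliers
  -- then make its differential proportional to that of `ℓ`, which annihilates tangent vectors.
  have hext : IsLocalExtrOn (fun Y => ⟪Ψ₁ Y - Ψ₂ Y, e⟫_ℝ) {Y | ℓ Y = ℓ X} X := by
    refine Or.inl ?_
    filter_upwards [hev] with Y hY
    rw [hY, hX0]
  obtain ⟨a, b, hab, h3⟩ := hext.exists_multipliers_of_hasStrictFDerivAt_1d hℓ hφ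
  have hpos := hd.fderiv_normal_pos hXU hX
  have hb : b ≠ 0 := by
    rintro rfl
    have h4 := DFunLike.congr_fun h3 (m X)
    simp only [zero_smul, add_zero, _root_.smul_apply, smul_eq_mul, _root_.zero_apply] at h4
    rcases mul_eq_zero.1 h4 with h5 | h5
    · exact hab (by simp [h5])
    · exact hpos.ne' h5
  have h4 := DFunLike.congr_fun h3 h
  simp only [_root_.add_apply, _root_.smul_apply, smul_eq_mul, _root_.zero_apply,
    hd.fderiv_apply hXU hX, hh, mul_zero, zero_add, ContinuousLinearMap.comp_apply] at h4
  have h5 := (mul_eq_zero.1 h4).resolve_left hb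
  rw [real_inner_comm]
  exact h5

/-- The determinant of a rank-one perturbation of the identity, in coordinates a column times a row.
-/
lemma det_id_add_dyad (a b : E) : (ContinuousLinearMap.id ℝ E + dyad a b).det = 1 + ⟪a, b⟫_ℝ := by
  have h1 : LinearMap.toMatrix (stdOrthonormalBasis ℝ E).toBasis (stdOrthonormalBasis ℝ E).toBasis
      ((ContinuousLinearMap.id ℝ E + dyad a b : Tensor E) : E →ₗ[ℝ] E) =
      1 + Matrix.replicateCol Unit (fun i => ⟪(basisVec i : E), a⟫_ℝ) *
        Matrix.replicateRow Unit (fun i => ⟪b, basisVec i⟫_ℝ) := by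
    rw [← LinearMap.toMatrix_id (stdOrthonormalBasis ℝ E).toBasis]
    ext i j
    simp only [Matrix.add_apply, Matrix.mul_apply, Finset.univ_unique, Finset.sum_singleton,
      Matrix.replicateCol_apply, Matrix.replicateRow_apply, LinearMap.toMatrix_apply,
      OrthonormalBasis.coe_toBasis, OrthonormalBasis.coe_toBasis_repr_apply,
      OrthonormalBasis.repr_apply_apply, ContinuousLinearMap.coe_coe, _root_.add_apply,
      inner_add_right, dyad_apply, real_inner_smul_right, LinearMap.id_apply,
      ContinuousLinearMap.id_apply]
    rw [mul_comm]
    rfl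
  rw [ContinuousLinearMap.det, ← LinearMap.det_toMatrix (stdOrthonormalBasis ℝ E).toBasis, h1,
    Matrix.det_one_add_replicateCol_mul_replicateRow, dotProduct, real_inner_comm,
    ← sum_inner_basisVec_mul b a]

/-- Nanson's formula only involves tangential derivatives. -/
lemma cofactor_eq_of_tangent {A A' : Tensor E} (hA : A.det ≠ 0) (hA' : A'.det ≠ 0) {n : E}
    (hn : ‖n‖ = 1) (h : ∀ x, ⟪n, x⟫_ℝ = 0 → A x = A' x) :
    A.det • transpose A.inverse n = A'.det • transpose A'.inverse n := by
  set c := A n - A' n with hc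
  -- The two tensors differ only in the direction `n`, so `A` is `A'` composed with a rank-one
  -- perturbation of the identity whose determinant is explicit.
  have h1 : ∀ x, A x = A' (x + ⟪n, x⟫_ℝ • A'.inverse c) := by
    intro x
    have h2 := h (x - ⟪n, x⟫_ℝ • n) (by
      rw [inner_sub_right, real_inner_smul_right, real_inner_self_eq_norm_sq, hn]; ring)
    rw [map_sub, map_sub, map_smul, map_smul, sub_eq_iff_eq_add] at h2
    rw [map_add, map_smul, apply_inverse_self hA', h2, hc]
    module
  have h2 : A = A' ∘L (ContinuousLinearMap.id ℝ E + dyad (A'.inverse c) n) :=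
    ContinuousLinearMap.ext fun x => h1 x
  have hdet : A.det = A'.det * (1 + ⟪A'.inverse c, n⟫_ℝ) := by
    rw [h2, det_comp, det_id_add_dyad]
  refine ext_inner_right ℝ fun y => ?_
  rw [← apply_inverse_self hA y]
  set x := A.inverse y
  rw [real_inner_smul_left, real_inner_smul_left, inner_transpose_left, inner_transpose_left,
    inverse_apply_self hA, h1, inverse_apply_self hA', inner_add_right, real_inner_smul_right, hdet,
    real_inner_comm n (A'.inverse c)]
  ring

end SpaceTime

/-! ### Kinematics -/

section Kinematics

variable {M : Mixture E} {Z : Fields E} {t : ℝ} {X : E}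

namespace Fields

/-- The displacement gradient. -/
def du (Z : Fields E) (X : E) (t : ℝ) : Tensor E :=
  fderiv ℝ (fun q : E × ℝ => Z.u q.1 q.2) (X, t) ∘L ContinuousLinearMap.inl ℝ E ℝ

/-- The time derivative of the displacement. -/
def dtu (Z : Fields E) (X : E) (t : ℝ) : E :=
  fderiv ℝ (fun q : E × ℝ => Z.u q.1 q.2) (X, t) (0, 1)

/-- The joint derivative of the displacement gradient in space and time. -/
def ddu (Z : Fields E) (X : E) (t : ℝ) : E × ℝ →L[ℝ] Tensor E :=
  fderiv ℝ (fun q : E × ℝ => Z.du q.1 q.2) (X, t)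

/-- The joint derivative of the time derivative of the displacement in space and time. -/
def ddtu (Z : Fields E) (X : E) (t : ℝ) : E × ℝ →L[ℝ] E :=
  fderiv ℝ (fun q : E × ℝ => Z.dtu q.1 q.2) (X, t)

/-- The joint derivative of the fluid velocity in space and time. -/
def dv (Z : Fields E) (X : E) (t : ℝ) : E × ℝ →L[ℝ] E :=
  fderiv ℝ (fun q : E × ℝ => Z.v q.1 q.2) (X, t)

variable (hM : M.Admissible) (hZ : Z.Regular M)
include hM hZ

lemma du_regular : PiecewiseCTime 1 M.B M.S M.m M.T Z.du :=
  (PiecewiseCTime.fderiv (n := 1) hM.isOpen hM.interface hZ.u_regular).clm_comp hM.isOpen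
    hM.interface ((ContinuousLinearMap.compL ℝ E (E × ℝ) E).flip (ContinuousLinearMap.inl ℝ E ℝ))

lemma dtu_regular : PiecewiseCTime 1 M.B M.S M.m M.T Z.dtu :=
  (PiecewiseCTime.fderiv (n := 1) hM.isOpen hM.interface hZ.u_regular).clm_comp hM.isOpen
    hM.interface (ContinuousLinearMap.apply ℝ E ((0, 1) : E × ℝ))

lemma ddu_regular : PiecewiseCTime 0 M.B M.S M.m M.T Z.ddu :=
  PiecewiseCTime.fderiv (n := 0) hM.isOpen hM.interface (du_regular hM hZ)

lemma ddtu_regular : PiecewiseCTime 0 M.B M.S M.m M.T Z.ddtu :=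
  PiecewiseCTime.fderiv (n := 0) hM.isOpen hM.interface (dtu_regular hM hZ)

lemma dv_regular : PiecewiseCTime 0 M.B M.S M.m M.T Z.dv :=
  PiecewiseCTime.fderiv (n := 0) hM.isOpen hM.interface hZ.v_regular

variable (ht : t ∈ Ioo 0 M.T)
include ht

lemma contDiffAt_u (hX : X ∈ M.B \ M.S) :
    ContDiffAt ℝ 2 (fun q : E × ℝ => Z.u q.1 q.2) (X, t) :=
  hZ.u_regular.contDiffOn.contDiffAt
    ((PiecewiseCTime.isOpen_domain hM.isOpen hM.interface).mem_nhds (mk_mem_prod hX ht))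

/-- It expresses the derivative of the displacement gradient as a second derivative of the
displacement, to which the symmetry of second derivatives applies. -/
lemma ddu_apply (hX : X ∈ M.B \ M.S) (a : E × ℝ) (k : E) : Z.ddu X t a k =
    fderiv ℝ (fun q => fderiv ℝ (fun q : E × ℝ => Z.u q.1 q.2) q (k, 0)) (X, t) a := by
  have h := fderiv_clm_apply ((du_regular hM hZ).differentiableAt (n := 0) hM.isOpen hM.interface hX
    ht) (differentiableAt_const k)
  have h' := DFunLike.congr_fun h a
  simp only [_root_.add_apply, ContinuousLinearMap.comp_apply, ContinuousLinearMap.flip_apply,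
    fderiv_fun_const, Pi.zero_apply, _root_.zero_apply, map_zero, zero_add] at h'
  exact h'.symm

lemma ddu_symm (hX : X ∈ M.B \ M.S) (h k : E) : Z.ddu X t (h, 0) k = Z.ddu X t (k, 0) h := by
  rw [ddu_apply hM hZ ht hX, ddu_apply hM hZ ht hX,
    fderiv_fderiv_apply_comm (contDiffAt_u hM hZ ht hX)]

/-- Space and time derivatives of the displacement commute. This is what makes the time derivative
of the deformation gradient equal to the gradient of the solid velocity. -/
lemma ddu_time (hX : X ∈ M.B \ M.S) (k : E) : Z.ddu X t (0, 1) k = Z.ddtu X t (k, 0) := by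
  rw [ddu_apply hM hZ ht hX, fderiv_fderiv_apply_comm (contDiffAt_u hM hZ ht hX)]
  rfl

lemma hasFDerivAt_u (hX : X ∈ M.B \ M.S) : HasFDerivAt (fun X => Z.u X t) (Z.du X t) X :=
  PiecewiseCTime.hasFDerivAt_slice (n := 1) hM.isOpen hM.interface hZ.u_regular hX ht

lemma defGrad_eq (hX : X ∈ M.B \ M.S) :
    Z.defGrad t X = ContinuousLinearMap.id ℝ E + Z.du X t :=
  ((hasFDerivAt_id X).add (hasFDerivAt_u hM hZ ht hX)).fderiv

lemma hasFDerivAt_chi (hX : X ∈ M.B \ M.S) : HasFDerivAt (Z.chi t) (Z.defGrad t X) X :=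
  ((hasFDerivAt_id X).add (hasFDerivAt_u hM hZ ht hX)).differentiableAt.hasFDerivAt

lemma hasDerivAt_chi (hX : X ∈ M.B \ M.S) : HasDerivAt (fun τ => Z.chi τ X) (Z.dtu X t) t :=
  (PiecewiseCTime.hasDerivAt_time (n := 1) hM.isOpen hM.interface hZ.u_regular hX ht).const_add X

lemma vs_eq (hX : X ∈ M.B \ M.S) : Z.vs t X = Z.dtu X t := (hasDerivAt_chi hM hZ ht hX).deriv

lemma hasDerivAt_vs' (hX : X ∈ M.B \ M.S) : HasDerivAt (fun τ => Z.vs τ X) (Z.ddtu X t (0, 1)) t := by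
  refine (PiecewiseCTime.hasDerivAt_time (n := 0) hM.isOpen hM.interface (dtu_regular hM hZ) hX
    ht).congr_of_eventuallyEq ?_
  filter_upwards [isOpen_Ioo.mem_nhds ht] with τ hτ using vs_eq hM hZ hτ hX

lemma as_eq (hX : X ∈ M.B \ M.S) : Z.as t X = Z.ddtu X t (0, 1) :=
  (hasDerivAt_vs' hM hZ ht hX).deriv

lemma hasDerivAt_vs (hX : X ∈ M.B \ M.S) : HasDerivAt (fun τ => Z.vs τ X) (Z.as t X) t :=
  (hasDerivAt_vs' hM hZ ht hX).differentiableAt.hasDerivAt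

lemma fderiv_vs (hX : X ∈ M.B \ M.S) : fderiv ℝ (Z.vs t) X = Z.ddu X t (0, 1) := by
  have h1 := PiecewiseCTime.hasFDerivAt_slice (n := 0) hM.isOpen hM.interface (dtu_regular hM hZ) hX
    ht
  have h2 : Z.vs t =ᶠ[𝓝 X] fun X => Z.dtu X t := by
    filter_upwards [(hM.interface.isOpen_diff hM.isOpen).mem_nhds hX] with Y hY
      using vs_eq hM hZ ht hY
  rw [h2.fderiv_eq, h1.fderiv]
  exact ContinuousLinearMap.ext fun k => (ddu_time hM hZ ht hX k).symm

lemma hasDerivAt_defGrad (hX : X ∈ M.B \ M.S) :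
    HasDerivAt (fun τ => Z.defGrad τ X) (fderiv ℝ (Z.vs t) X) t := by
  rw [fderiv_vs hM hZ ht hX]
  refine ((PiecewiseCTime.hasDerivAt_time (n := 0) hM.isOpen hM.interface (du_regular hM hZ) hX
    ht).const_add (ContinuousLinearMap.id ℝ E)).congr_of_eventuallyEq ?_
  filter_upwards [isOpen_Ioo.mem_nhds ht] with τ hτ using defGrad_eq hM hZ hτ hX

lemma fderiv_defGrad_apply (hX : X ∈ M.B \ M.S) (h : E) :
    fderiv ℝ (Z.defGrad t) X h = Z.ddu X t (h, 0) := by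
  have h1 := (PiecewiseCTime.hasFDerivAt_slice (n := 0) hM.isOpen hM.interface (du_regular hM hZ) hX
    ht).const_add (ContinuousLinearMap.id ℝ E)
  have h2 : Z.defGrad t =ᶠ[𝓝 X] fun X => ContinuousLinearMap.id ℝ E + Z.du X t := by
    filter_upwards [(hM.interface.isOpen_diff hM.isOpen).mem_nhds hX] with Y hY
      using defGrad_eq hM hZ ht hY
  rw [h2.fderiv_eq, h1.fderiv]
  rfl

lemma defGrad_regular : PiecewiseC 1 M.B M.S M.m (Z.defGrad t) :=
  (((du_regular hM hZ).slice hM.isOpen hM.interface ht).comp_contDiff le_rfl hM.isOpen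
    hM.interface (φ := fun A : Tensor E => ContinuousLinearMap.id ℝ E + A)
    (contDiff_const.add contDiff_id)).congr hM.isOpen hM.interface fun _ hX =>
      defGrad_eq hM hZ ht hX

lemma isDeformation : IsDeformation M.B M.S M.m (Z.defGrad t) where
  regular := defGrad_regular hM hZ ht
  det_pos := by
    obtain ⟨c, hc, h⟩ := hZ.jac_pos
    exact ⟨c, hc, h t ht⟩
  symm X hX h k := by
    rw [fderiv_defGrad_apply hM hZ ht hX, fderiv_defGrad_apply hM hZ ht hX, ddu_symm hM hZ ht hX]

lemma jac_ne_zero (hX : X ∈ M.B \ M.S) : Z.jac t X ≠ 0 := (isDeformation hM hZ ht).det_ne_zero hX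

lemma jac_pos' (hX : X ∈ M.B \ M.S) : 0 < Z.jac t X := by
  obtain ⟨c, hc, h⟩ := hZ.jac_pos
  exact hc.trans_le (h t ht X hX)

lemma defGradInv_regular : PiecewiseC 1 M.B M.S M.m (Z.defGradInv t) :=
  (isDeformation hM hZ ht).inverse hM.isOpen hM.interface

lemma vs_regular : PiecewiseC 1 M.B M.S M.m (Z.vs t) :=
  ((dtu_regular hM hZ).slice hM.isOpen hM.interface ht).congr hM.isOpen hM.interface
    fun _ hX => vs_eq hM hZ ht hX

lemma as_regular : PiecewiseC 0 M.B M.S M.m (Z.as t) :=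
  (((ddtu_regular hM hZ).slice_zero ht).comp_contDiff zero_le_one hM.isOpen
    hM.interface (φ := fun A : E × ℝ →L[ℝ] E => A (0, 1))
      (ContinuousLinearMap.apply ℝ E ((0, 1) : E × ℝ)).contDiff).congr hM.isOpen
        hM.interface fun _ hX => as_eq hM hZ ht hX

lemma vf_regular : PiecewiseC 1 M.B M.S M.m (Z.vf t) :=
  hZ.v_regular.slice hM.isOpen hM.interface ht

lemma hasDerivAt_v (hX : X ∈ M.B \ M.S) :
    HasDerivAt (fun τ => Z.v X τ) (deriv (fun τ => Z.v X τ) t) t :=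
  (PiecewiseCTime.hasDerivAt_time (n := 0) hM.isOpen hM.interface hZ.v_regular hX
    ht).differentiableAt.hasDerivAt

lemma deriv_v_eq (hX : X ∈ M.B \ M.S) : deriv (fun τ => Z.v X τ) t = Z.dv X t (0, 1) :=
  (PiecewiseCTime.hasDerivAt_time (n := 0) hM.isOpen hM.interface hZ.v_regular hX ht).deriv

lemma deriv_v_regular : PiecewiseC 0 M.B M.S M.m fun X => deriv (fun τ => Z.v X τ) t :=
  (((dv_regular hM hZ).slice_zero ht).comp_contDiff zero_le_one hM.isOpen
    hM.interface (φ := fun A : E × ℝ →L[ℝ] E => A (0, 1))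
      (ContinuousLinearMap.apply ℝ E ((0, 1) : E × ℝ)).contDiff).congr hM.isOpen hM.interface
        fun _ hX => deriv_v_eq hM hZ ht hX

lemma vrel_regular : PiecewiseC 1 M.B M.S M.m (Z.vrel t) :=
  (vf_regular hM hZ ht).comp₂ le_rfl hM.isOpen hM.interface (vs_regular hM hZ ht)
    (φ := fun a b : E => a - b) (contDiff_fst.sub contDiff_snd)

lemma phiS_regular : PiecewiseC 1 M.B M.S M.m (Z.phiS M t) :=
  hM.phiR_regular.comp₂ le_rfl hM.isOpen hM.interface ((isDeformation hM hZ ht).comp hM.isOpen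
    hM.interface (φ := fun A => A.det⁻¹) (contDiff_det.contDiffOn.inv fun _ h => h))
    (φ := fun a b : ℝ => a * b) (contDiff_fst.mul contDiff_snd)

lemma phiF_regular : PiecewiseC 1 M.B M.S M.m (Z.phiF M t) :=
  (phiS_regular hM hZ ht).comp_contDiff le_rfl hM.isOpen hM.interface
    (φ := fun a : ℝ => 1 - a) (contDiff_const.sub contDiff_id)

lemma vflt_regular : PiecewiseC 1 M.B M.S M.m (Z.vflt M t) :=
  (phiF_regular hM hZ ht).comp₂ le_rfl hM.isOpen hM.interface (vrel_regular hM hZ ht)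
    (φ := fun (a : ℝ) (b : E) => a • b) (contDiff_fst.smul contDiff_snd)

lemma grad_regular {V : Type*} [NormedAddCommGroup V] [NormedSpace ℝ V] [FiniteDimensional ℝ V]
    {f : E → V} (hf : PiecewiseC 1 M.B M.S M.m f) : PiecewiseC 0 M.B M.S M.m (Z.grad t f) :=
  (hf.fderiv hM.isOpen hM.interface).comp₂ zero_le_one hM.isOpen hM.interface
    (defGradInv_regular hM hZ ht).of_one (φ := fun (A : E →L[ℝ] V) (C : Tensor E) => A ∘L C)
    (contDiff_fst.clm_comp contDiff_snd)

lemma af_regular : PiecewiseC 0 M.B M.S M.m (Z.af t) :=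
  (deriv_v_regular hM hZ ht).comp₂ zero_le_one hM.isOpen hM.interface
    ((grad_regular hM hZ ht (vf_regular hM hZ ht)).comp₂ zero_le_one hM.isOpen hM.interface
      (vrel_regular hM hZ ht).of_one (φ := fun (A : E →L[ℝ] E) (x : E) => A x)
        (contDiff_fst.clm_apply contDiff_snd))
    (φ := fun a b : E => a + b) (contDiff_fst.add contDiff_snd)

lemma continuousOn_chi : ContinuousOn (Z.chi t) M.B := by
  refine continuousOn_id.add (hZ.u_continuous.comp (f := fun X : E => (X, t)) ?_ fun X hX => ⟨hX, ht⟩)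
  exact continuousOn_id.prodMk continuousOn_const

lemma chi_regular : PiecewiseC 1 M.B M.S M.m (Z.chi t) := by
  obtain ⟨c, hc⟩ := hM.isBounded.exists_norm_le
  have hid : PiecewiseC 1 M.B M.S M.m (id : E → E) :=
    PiecewiseC.of_bounds le_rfl contDiffOn_id ⟨c, fun X hX => hc X hX.1⟩
      (fun _ => ⟨1, fun X _ => by simpa using ContinuousLinearMap.norm_id_le⟩) fun X hX => by
        obtain ⟨U, ℓ, hXU, hUB, hd⟩ := hM.interface.locally_level X hX
        exact ⟨U, ℓ, id, id, hXU, hUB, hd, contDiffOn_id, contDiffOn_id, fun _ _ =>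
          ⟨fun _ => rfl, fun _ => rfl⟩⟩
  exact hid.comp₂ le_rfl hM.isOpen hM.interface
    ((hZ.u_regular.of_succ (n := 1)).slice hM.isOpen hM.interface ht)
    (φ := fun a b : E => a + b) (contDiff_fst.add contDiff_snd)

lemma continuousOn_vs : ContinuousOn (Z.vs t) M.B := by
  have h := PiecewiseCTime.continuousOn_deriv hM.isOpen hM.interface
    (hZ.u_regular.of_succ (n := 1)) hZ.u_continuous ht
  refine h.congr fun X hX => ?_
  simp only [vs, chi]
  rw [deriv_const_add]

/-- Nanson's formula gives the same area vector from both sides of the interface. -/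
lemma areaVec_sides (hX : X ∈ M.S) :
    (sideLim (M.m X) X (Z.defGrad t)).det •
        transpose (sideLim (M.m X) X (Z.defGrad t)).inverse (M.m X) =
      (sideLim (-M.m X) X (Z.defGrad t)).det •
        transpose (sideLim (-M.m X) X (Z.defGrad t)).inverse (M.m X) := by
  obtain ⟨c, hc, h⟩ := (isDeformation hM hZ ht).det_pos_side hM.interface
  exact cofactor_eq_of_tangent (hc.trans_le (h X hX).1).ne' (hc.trans_le (h X hX).2).ne'
    (hM.interface.norm_normal hX) fun x hx => (chi_regular hM hZ ht).fderiv_traces_tangent hM.isOpen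
      hM.interface (continuousOn_chi hM hZ ht) hX hx

/-- Taylor expansion in time with a remainder uniform in `X`, as the second time derivative of the
displacement is bounded. It recovers the velocity from the displacement at two times. -/
lemma norm_vs_le_of_displacement : ∃ C, 0 ≤ C ∧ ∀ X ∈ M.B \ M.S, ∀ h > 0, t + h < M.T →
    h * ‖Z.vs t X‖ ≤ ‖Z.u X (t + h)‖ + ‖Z.u X t‖ + C * h ^ 2 := by
  obtain ⟨K, hK0, hK⟩ := (ddtu_regular hM hZ).norm_le
  set C := K * ‖((0, 1) : E × ℝ)‖
  refine ⟨C, by positivity, fun X hX h hh hT => ?_⟩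
  have hmem : ∀ τ ∈ Icc t (t + h), τ ∈ Ioo 0 M.T := fun τ hτ =>
    ⟨ht.1.trans_le hτ.1, hτ.2.trans_lt hT⟩
  have h1 : ∀ τ ∈ Icc t (t + h), ‖Z.vs τ X - Z.vs t X‖ ≤ C * (τ - t) := by
    refine norm_image_sub_le_of_norm_deriv_le_segment'
      (fun τ hτ => (hasDerivAt_vs' hM hZ (hmem τ hτ) hX).hasDerivWithinAt) fun τ hτ => ?_
    have hτ' := hmem τ (Ico_subset_Icc_self hτ)
    exact ((Z.ddtu X τ).le_opNorm _).trans (mul_le_mul_of_nonneg_right (hK X hX τ hτ')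
      (norm_nonneg _))
  -- Second integration in time: the deviation of the displacement from its linear part has
  -- derivative `v_s(τ) - v_s(t)`, bounded by `C h`.
  have h2 := norm_image_sub_le_of_norm_deriv_le_segment' (a := t) (b := t + h)
    (f := fun τ => Z.u X τ - τ • Z.vs t X) (f' := fun τ => Z.vs τ X - Z.vs t X) (C := C * h)
    (fun τ hτ => by
      have h3 := PiecewiseCTime.hasDerivAt_time (n := 1) hM.isOpen hM.interface hZ.u_regular hX
        (hmem τ hτ)
      rw [vs_eq hM hZ (hmem τ hτ) hX]
      have h4 := h3.sub ((hasDerivAt_id τ).smul_const (Z.vs t X))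
      rw [one_smul] at h4
      exact h4.hasDerivWithinAt)
    (fun τ hτ => (h1 τ (Ico_subset_Icc_self hτ)).trans (mul_le_mul_of_nonneg_left
      (by linarith [hτ.2]) (by positivity))) (t + h) ⟨by linarith, le_rfl⟩
  have h5 : h • Z.vs t X = Z.u X (t + h) - Z.u X t -
      (Z.u X (t + h) - (t + h) • Z.vs t X - (Z.u X t - t • Z.vs t X)) := by module
  have h6 : h * ‖Z.vs t X‖ = ‖h • Z.vs t X‖ := by rw [norm_smul, Real.norm_of_nonneg hh.le]
  rw [h6, h5]
  refine (norm_sub_le _ _).trans (add_le_add (norm_sub_le _ _) (h2.trans_eq ?_))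
  ring

/-- The displacement tends to zero at the boundary for each time separately, without uniformity in
time, so the limit cannot simply be differentiated. Instead `h` is fixed first, with `C h` small,
and then `Y` approaches the boundary for the two displacements at `t` and `t + h`. -/
lemma vs_boundary (hbc : Z.ZeroBoundaryData M) : VanishesOnBoundary M.B M.S (Z.vs t) := by
  intro X hX
  obtain ⟨C, hC0, hC⟩ := norm_vs_le_of_displacement hM hZ ht
  rw [Metric.tendsto_nhds]
  intro ε hε
  obtain ⟨h, hh, hT, hCh⟩ : ∃ h > 0, t + h < M.T ∧ C * h < ε / 2 := by
    refine ⟨min ((M.T - t) / 2) (ε / (4 * (C + 1))), lt_min (by linarith [ht.2]) (by positivity),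
      by linarith [min_le_left ((M.T - t) / 2) (ε / (4 * (C + 1))), ht.2], ?_⟩
    refine (mul_le_mul_of_nonneg_left (min_le_right _ _) hC0).trans_lt ?_
    rw [mul_div_assoc', div_lt_div_iff₀ (by positivity) (by norm_num)]
    nlinarith
  have htm : t + h ∈ Ioo 0 M.T := ⟨by linarith [ht.1], hT⟩
  have h1 := (hbc.u_zero (t + h) htm X hX).norm
  have h2 := (hbc.u_zero t ht X hX).norm
  rw [norm_zero] at h1 h2
  filter_upwards [h1.eventually (gt_mem_nhds (show 0 < ε * h / 4 by positivity)),
    h2.eventually (gt_mem_nhds (show 0 < ε * h / 4 by positivity)), self_mem_nhdsWithin]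
    with Y h3 h4 hY
  rw [dist_zero_right]
  have h5 := hC Y hY h hh hT
  have h6 : C * h ^ 2 < ε / 2 * h := by nlinarith
  have h7 : h * ‖Z.vs t Y‖ < h * ε := by linarith
  exact lt_of_mul_lt_mul_left h7 hh.le

lemma isSolidTest_vs (hbc : Z.ZeroBoundaryData M) : IsSolidTest M (Z.vs t) :=
  ⟨vs_regular hM hZ ht, continuousOn_vs hM hZ ht, vs_boundary hM hZ ht hbc⟩

lemma isFluidTest_vrel (hbc : Z.ZeroBoundaryData M) : IsFluidTest M (Z.vrel t) :=
  ⟨vrel_regular hM hZ ht, fun X hX => by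
    have := (hbc.v_zero t ht X hX).sub (vs_boundary hM hZ ht hbc X hX)
    rwa [sub_zero] at this⟩

end Fields

end Kinematics

/-! ### Change of variables -/

section ChangeOfVariables

variable {M : Mixture E} {Z : Fields E} {t : ℝ} {X : E} {V : Type*} [NormedAddCommGroup V]
  [NormedSpace ℝ V]

namespace Fields

/-- The cofactor of the deformation gradient. -/
def cof (Z : Fields E) (t : ℝ) (X : E) : Tensor E := Z.jac t X • transpose (Z.defGradInv t X)

/-- The common value of the area vector on both sides of the interface. -/
def areaTrace (M : Mixture E) (Z : Fields E) (t : ℝ) (X : E) : E :=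
  sideLim (M.m X) X (Z.cof t) (M.m X)

lemma contDiffOn_cofactor {n : WithTop ℕ∞} :
    ContDiffOn ℝ n (fun A : Tensor E => A.det • transpose A.inverse) {A | A.det ≠ 0} :=
  contDiff_det.contDiffOn.smul (contDiff_transpose.comp_contDiffOn contDiffOn_inverse)

lemma eulerian_chi (hZ : Z.Regular M) (ht : t ∈ Ioo 0 M.T) (hX : X ∈ M.B) (f : E → V) :
    Z.eulerian M t f (Z.chi t X) = f X := by
  rw [eulerian, (hZ.chi_injOn t ht).leftInvOn_invFunOn hX]

variable (hM : M.Admissible) (hZ : Z.Regular M) (ht : t ∈ Ioo 0 M.T)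
include hM hZ ht

lemma cof_regular : PiecewiseC 1 M.B M.S M.m (Z.cof t) :=
  (isDeformation hM hZ ht).comp hM.isOpen hM.interface contDiffOn_cofactor

lemma sideLim_cof_pos (hX : X ∈ M.S) : sideLim (M.m X) X (Z.cof t) =
    (sideLim (M.m X) X (Z.defGrad t)).det • transpose (sideLim (M.m X) X (Z.defGrad t)).inverse := by
  obtain ⟨c, hc, h⟩ := (isDeformation hM hZ ht).det_pos_side hM.interface
  have h1 := (contDiffOn_cofactor (n := 0)).continuousOn.continuousAt
    (isOpen_det_ne_zero.mem_nhds (hc.trans_le (h X hX).1).ne')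
  exact (h1.tendsto.comp ((defGrad_regular hM hZ ht).tendsto_pos hM.interface hX)).limUnder_eq

lemma sideLim_cof_neg (hX : X ∈ M.S) : sideLim (-M.m X) X (Z.cof t) =
    (sideLim (-M.m X) X (Z.defGrad t)).det •
      transpose (sideLim (-M.m X) X (Z.defGrad t)).inverse := by
  obtain ⟨c, hc, h⟩ := (isDeformation hM hZ ht).det_pos_side hM.interface
  have h1 := (contDiffOn_cofactor (n := 0)).continuousOn.continuousAt
    (isOpen_det_ne_zero.mem_nhds (hc.trans_le (h X hX).2).ne')
  exact (h1.tendsto.comp ((defGrad_regular hM hZ ht).tendsto_neg hM.interface hX)).limUnder_eq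

lemma areaTrace_eq_neg (hX : X ∈ M.S) :
    sideLim (-M.m X) X (Z.cof t) (M.m X) = Z.areaTrace M t X := by
  rw [areaTrace, sideLim_cof_pos hM hZ ht hX, sideLim_cof_neg hM hZ ht hX]
  exact (areaVec_sides hM hZ ht hX).symm

lemma norm_areaTrace (hX : X ∈ M.S) :
    ‖Z.areaTrace M t X‖ = areaFactor (sideLim (M.m X) X (Z.defGrad t)) (M.m X) := by
  rw [areaTrace, sideLim_cof_pos hM hZ ht hX]
  rfl

lemma bddContOn_areaTrace : BddContOn M.S (Z.areaTrace M t) :=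
  ((cof_regular hM hZ ht).bddContOn_pos hM.interface).comp₂ hM.interface.bddContOn_normal
    (φ := fun (A : Tensor E) n => A n) (by fun_prop)

/-- The motion may fail to be differentiable on the interface, but there it coincides with its
smooth extension from the positive side, and the area formula asks for no more. -/
lemma measure_image_chi (hdim : Module.finrank ℝ E = 3) {A : Set E} (hA : A ⊆ M.S)
    (hAm : MeasurableSet A) :
    μHE[2] (Z.chi t '' A) = ∫⁻ X in A, ENNReal.ofReal ‖Z.areaTrace M t X‖ ∂μHE[2] := by
  obtain ⟨c, hc, h⟩ := (isDeformation hM hZ ht).det_pos_side hM.interface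
  rw [setLIntegral_congr_fun hAm fun X hX =>
    congrArg ENNReal.ofReal (norm_areaTrace hM hZ ht (hA hX))]
  refine measure_image_interface hdim (S := M.S) subset_rfl (fun X hX => ?_)
    ((continuousOn_chi hM hZ ht).mono hM.interface.subset)
    ((hZ.chi_injOn t ht).mono hM.interface.subset) (fun X hX => ?_)
    (fun X hX => (hc.trans_le (h X hX).1).ne') ?_ hA hAm
  · obtain ⟨U, ℓ, hXU, -, hd⟩ := hM.interface.locally_level X hX
    exact ⟨U, ℓ, hXU, hd⟩
  · obtain ⟨Ψ₁, _, h1, -, h2⟩ := (chi_regular hM hZ ht).exists_extension hM.isOpen hM.interface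
      (continuousOn_chi hM hZ ht) hX
    exact ⟨Ψ₁, h1, h2.mono fun _ h => h.1⟩
  · exact (bddContOn_areaTrace hM hZ ht).continuousOn.norm.congr fun X hX =>
      (norm_areaTrace hM hZ ht hX).symm

lemma integral_surface (hdim : Module.finrank ℝ E = 3) (f : E → V) :
    ∫ x in Z.surface M t, Z.eulerian M t f x ∂μHE[2] =
      ∫ X in M.S, ‖Z.areaTrace M t X‖ • f X ∂μHE[2] := by
  have hS := hM.interface.measurableSet hM.isOpen
  rw [surface, integral_image_eq_of_density hS
    ((continuousOn_chi hM hZ ht).mono hM.interface.subset)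
    ((hZ.chi_injOn t ht).mono hM.interface.subset)
    ((bddContOn_areaTrace hM hZ ht).continuousOn.norm.aemeasurable hS) (fun _ => norm_nonneg _)
    fun A hA hAm => measure_image_chi hM hZ ht hdim hA hAm]
  exact setIntegral_congr_fun hS fun X hX => by
    simp only [eulerian_chi hZ ht (hM.interface.subset hX)]

lemma integrableOn_surface (hdim : Module.finrank ℝ E = 3) {f : E → V}
    (hf : IntegrableOn (fun X => ‖Z.areaTrace M t X‖ • f X) M.S μHE[2]) :
    IntegrableOn (Z.eulerian M t f) (Z.surface M t) μHE[2] := by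
  have hS := hM.interface.measurableSet hM.isOpen
  rw [surface, integrableOn_image_iff_of_density hS
    ((continuousOn_chi hM hZ ht).mono hM.interface.subset)
    ((hZ.chi_injOn t ht).mono hM.interface.subset)
    ((bddContOn_areaTrace hM hZ ht).continuousOn.norm.aemeasurable hS) (fun _ => norm_nonneg _)
    fun A hA hAm => measure_image_chi hM hZ ht hdim hA hAm]
  exact hf.congr_fun (fun X hX => by
    simp only [eulerian_chi hZ ht (hM.interface.subset hX)]) hS

/-- By the area formula the current interface has finite area, so it is null. The volume change of
variables is then needed only off the interface, where the motion is differentiable. -/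
lemma body_ae_eq (hdim : Module.finrank ℝ E = 3) :
    Z.chi t '' (M.B \ M.S) =ᵐ[volume] Z.body M t := by
  have h1 : μHE[2] (Z.chi t '' M.S) < ⊤ := by
    rw [measure_image_chi hM hZ ht hdim subset_rfl (hM.interface.measurableSet hM.isOpen)]
    have h2 := ((bddContOn_areaTrace hM hZ ht).comp continuous_norm).integrableOn hM.isOpen hM.interface
    have h3 := h2.lintegral_lt_top
    exact h3
  have h0 := volume_eq_zero_of_area_lt_top hdim h1
  refine (LE.le.eventuallyLE (image_mono sdiff_subset)).antisymm ?_
  refine ae_le_set.2 (measure_mono_null ?_ h0)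
  rintro x ⟨⟨X, hX, rfl⟩, hx⟩
  by_contra h
  exact hx ⟨X, ⟨hX, fun hXS => h ⟨X, hXS, rfl⟩⟩, rfl⟩

lemma integral_body (hdim : Module.finrank ℝ E = 3) (f : E → V) :
    ∫ x in Z.body M t, Z.eulerian M t f x = ∫ X in M.B, Z.jac t X • f X := by
  have hO := hM.interface.isOpen_diff hM.isOpen
  rw [← setIntegral_congr_set (body_ae_eq hM hZ ht hdim),
    integral_image_eq_integral_abs_det_fderiv_smul volume hO.measurableSet
      (fun X hX => (hasFDerivAt_chi hM hZ ht hX).hasFDerivWithinAt)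
      ((hZ.chi_injOn t ht).mono sdiff_subset), ← setIntegral_diff_interface hdim hM.interface]
  refine setIntegral_congr_fun hO.measurableSet fun X hX => ?_
  have h1 : |(Z.defGrad t X).det| = Z.jac t X := abs_of_pos (jac_pos' hM hZ ht hX)
  simp only [h1, eulerian_chi hZ ht hX.1]

lemma integrableOn_body (hdim : Module.finrank ℝ E = 3) {f : E → V}
    (hf : IntegrableOn (fun X => Z.jac t X • f X) M.B) :
    IntegrableOn (Z.eulerian M t f) (Z.body M t) := by
  have hO := hM.interface.isOpen_diff hM.isOpen
  rw [← integrableOn_congr_set_ae (body_ae_eq hM hZ ht hdim),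
    integrableOn_image_iff_integrableOn_abs_det_fderiv_smul volume hO.measurableSet
      (fun X hX => (hasFDerivAt_chi hM hZ ht hX).hasFDerivWithinAt)
      ((hZ.chi_injOn t ht).mono sdiff_subset)]
  refine (hf.mono_set sdiff_subset).congr_fun (fun X hX => ?_) hO.measurableSet
  have h1 : |(Z.defGrad t X).det| = Z.jac t X := abs_of_pos (jac_pos' hM hZ ht hX)
  simp only [h1, eulerian_chi hZ ht hX.1]

end Fields

end ChangeOfVariables

/-! ### The strain energy -/

section StrainEnergy

variable {M : Mixture E} {Z : Fields E} {t : ℝ} {X : E} {F C H : Tensor E}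

/-- The isochoric part of the right Cauchy-Green tensor. -/
def isochoric (C : Tensor E) : Tensor E := C.det ^ (-(1 / 3) : ℝ) • C

/-- The right Cauchy-Green tensor of a deformation gradient. -/
def cauchyGreen (F : Tensor E) : Tensor E := transpose F ∘L F

lemma isOpen_det_pos : IsOpen {C : Tensor E | 0 < C.det} :=
  isOpen_lt continuous_const (contDiff_det (n := 0)).continuous

lemma contDiffOn_isochoric {n : WithTop ℕ∞} :
    ContDiffOn ℝ n (isochoric : Tensor E → Tensor E) {C | 0 < C.det} :=
  (contDiff_det.contDiffOn.rpow_const_of_ne fun _ h => ne_of_gt h).smul contDiffOn_id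

lemma contDiff_cauchyGreen {n : WithTop ℕ∞} : ContDiff ℝ n (cauchyGreen : Tensor E → Tensor E) :=
  contDiff_transpose.clm_comp contDiff_id

lemma det_cauchyGreen_pos (hF : F.det ≠ 0) : 0 < (cauchyGreen F).det := by
  rw [cauchyGreen, det_comp, det_transpose]
  exact mul_self_pos.2 hF

lemma isochoric_cauchyGreen_mem (hF : F.det ≠ 0) : isochoric (cauchyGreen F) ∈ posTensors := by
  intro x hx
  rw [isochoric, _root_.smul_apply, real_inner_smul_left, cauchyGreen,
    ContinuousLinearMap.comp_apply, inner_transpose_left, real_inner_self_eq_norm_sq]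
  have h1 : F x ≠ 0 := fun h => hx (by rw [← inverse_apply_self hF x, h, map_zero])
  have := Real.rpow_pos_of_pos (det_cauchyGreen_pos hF) (-(1 / 3))
  have := norm_pos_iff.2 h1
  positivity

/-- By homogeneity positivity need only be checked on the unit sphere, where compactness makes it
stable under small perturbations. -/
lemma isOpen_posTensors : IsOpen (posTensors : Set (Tensor E)) := by
  refine isOpen_iff_mem_nhds.2 fun A hA => ?_
  have h1 : ∀ᶠ A' in 𝓝 A, ∀ x ∈ Metric.sphere (0 : E) 1, 0 < ⟪A' x, x⟫_ℝ := by
    refine (isCompact_sphere (0 : E) 1).eventually_forall_of_forall_eventually fun x hx => ?_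
    have hc : Continuous fun q : Tensor E × E => ⟪q.1 q.2, q.2⟫_ℝ :=
      (continuous_fst.clm_apply continuous_snd).inner continuous_snd
    exact hc.continuousAt.eventually (lt_mem_nhds (hA x (Metric.ne_of_mem_sphere hx one_ne_zero)))
  filter_upwards [h1] with A' hA' x hx
  have h2 := hA' (‖x‖⁻¹ • x) (by simp [norm_smul, hx])
  rw [map_smul, real_inner_smul_left, real_inner_smul_right] at h2
  have h3 : 0 < ‖x‖⁻¹ := by positivity
  exact (mul_pos_iff_of_pos_left h3).1 ((mul_pos_iff_of_pos_left h3).1 h2)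

lemma hasFDerivAt_cauchyGreen (F : Tensor E) :
    HasFDerivAt cauchyGreen (fderiv ℝ cauchyGreen F) F :=
  ((contDiff_cauchyGreen (n := 1)).differentiable one_ne_zero F).hasFDerivAt

lemma fderiv_cauchyGreen (F H : Tensor E) :
    fderiv ℝ cauchyGreen F H = (2 : ℝ) • symPart (transpose F ∘L H) := by
  have h := ((transposeCLM (E := E)).hasFDerivAt (x := F)).clm_comp (hasFDerivAt_id F)
  change HasFDerivAt cauchyGreen _ F at h
  rw [h.fderiv, symPart, transpose_comp, transpose_transpose, smul_smul]
  simp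

lemma transpose_symPart (H : Tensor E) : transpose (symPart H) = symPart H := by
  rw [symPart, transpose_smul, transpose_add, transpose_transpose, add_comm]

/-- The scalar product with a fixed tensor as a continuous linear functional. -/
def ddotCLM (H : Tensor E) : Tensor E →L[ℝ] ℝ :=
  trCLM ∘L (ContinuousLinearMap.compL ℝ E E E).flip H ∘L transposeCLM

lemma ddotCLM_apply (A H : Tensor E) : ddotCLM H A = ddot A H := rfl

/-- The symmetric part as a continuous linear map. -/
def symPartCLM : Tensor E →L[ℝ] Tensor E :=
  (1 / 2 : ℝ) • (ContinuousLinearMap.id ℝ (Tensor E) + transposeCLM)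

lemma symPartCLM_apply (H : Tensor E) : symPartCLM H = symPart H := rfl

lemma ddot_dyad (a b : E) (H : Tensor E) : ddot (dyad a b) H = ⟪H b, a⟫_ℝ := by
  rw [ddot, transpose_dyad, tr_comp_comm, tr_comp_dyad]

lemma eq_sum_dyad (H : Tensor E) :
    H = ∑ i, ∑ j, ⟪H (basisVec j), basisVec i⟫_ℝ • dyad (basisVec i) (basisVec j) := by
  ext x
  conv_lhs => rw [← sum_inner_basisVec_smul (H x)]
  simp only [_root_.sum_apply, _root_.smul_apply, dyad_apply]
  refine Finset.sum_congr rfl fun i _ => ?_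
  simp_rw [smul_smul, ← Finset.sum_smul]
  congr 1
  conv_lhs => rw [← sum_inner_basisVec_smul x, map_sum, sum_inner]
  refine Finset.sum_congr rfl fun j _ => ?_
  rw [map_smul, real_inner_smul_left, real_inner_comm x, mul_comm]

/-- The components of the derivative are taken along symmetrized dyads, so expanding `H` in dyads
reproduces the differential on the symmetric part of `H`. -/
lemma ddot_strainEnergyDeriv (h : DifferentiableAt ℝ (M.strainEnergy X) C) (H : Tensor E) :
    ddot (M.strainEnergyDeriv X C) H = fderiv ℝ (M.strainEnergy X) C (symPart H) := by
  conv_rhs => rw [eq_sum_dyad H]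
  rw [← symPartCLM_apply, ← ddotCLM_apply, Mixture.strainEnergyDeriv]
  simp only [map_sum, map_smul, symPartCLM_apply, ddotCLM_apply, ddot_dyad, smul_eq_mul]
  refine Finset.sum_congr rfl fun i _ => Finset.sum_congr rfl fun j _ => ?_
  rw [h.lineDeriv_eq_fderiv, mul_comm]

variable (hM : M.Admissible)
include hM

lemma hasFDerivAt_strainEnergy (hX : X ∈ M.B \ M.S) (hF : F.det ≠ 0) :
    HasFDerivAt (M.strainEnergy X) (fderiv ℝ (fun A => M.Psi A X) (isochoric (cauchyGreen F)) ∘L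
      fderiv ℝ isochoric (cauchyGreen F)) (cauchyGreen F) := by
  have h1 := ((hM.Psi_contDiffOn X hX).contDiffAt (isOpen_posTensors.mem_nhds
    (isochoric_cauchyGreen_mem hF))).differentiableAt one_ne_zero
  have h2 := (contDiffOn_isochoric.contDiffAt (isOpen_det_pos.mem_nhds
    (det_cauchyGreen_pos hF))).differentiableAt (n := 1) one_ne_zero
  exact h1.hasFDerivAt.comp _ h2.hasFDerivAt

omit hM in
lemma continuousOn_isochoric_cauchyGreen :
    ContinuousOn (fun F : Tensor E => isochoric (cauchyGreen F)) {F | F.det ≠ 0} :=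
  (contDiffOn_isochoric (n := 0)).continuousOn.comp
    (contDiff_cauchyGreen (n := 0)).continuous.continuousOn fun _ hF => det_cauchyGreen_pos hF

omit hM in
lemma continuousOn_fderiv_isochoric :
    ContinuousOn (fun F : Tensor E => fderiv ℝ isochoric (cauchyGreen F)) {F | F.det ≠ 0} :=
  (contDiffOn_isochoric.continuousOn_fderiv_of_isOpen isOpen_det_pos le_rfl).comp
    (contDiff_cauchyGreen (n := 0)).continuous.continuousOn fun _ hF => det_cauchyGreen_pos hF

/-- The strain energy and its derivative along a field of deformation gradients. -/
lemma bddContOn_Psi {α : Type*} [TopologicalSpace α] {A : Set α} {G : α → Tensor E} {ξ : α → E}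
    {c : ℝ} (hG : BddContOn A G) (hc : 0 < c) (hdet : ∀ q ∈ A, c ≤ (G q).det)
    (hξ : ContinuousOn ξ A) (hξA : ∀ q ∈ A, ξ q ∈ M.B \ M.S) :
    BddContOn A (fun q => M.strainEnergy (ξ q) (cauchyGreen (G q))) ∧
    BddContOn A (fun q => fderiv ℝ (fun A => M.Psi A (ξ q)) (isochoric (cauchyGreen (G q)))) ∧
    BddContOn A (fun q => fderiv ℝ isochoric (cauchyGreen (G q))) := by
  obtain ⟨k, hk⟩ := hG.bounded
  have hK := isCompact_le_det (E := E) k c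
  have hKs : {F : Tensor E | ‖F‖ ≤ k ∧ c ≤ F.det} ⊆ {F | F.det ≠ 0} := fun F hF =>
    (hc.trans_le hF.2).ne'
  have hGK : ∀ q ∈ A, G q ∈ {F : Tensor E | ‖F‖ ≤ k ∧ c ≤ F.det} := fun q hq => ⟨hk q hq, hdet q hq⟩
  have hiso := continuousOn_isochoric_cauchyGreen (E := E)
  -- The compact set is the image, under the isochoric Cauchy–Green map, of all tensors of norm at
  -- most `k` and determinant at least `c`.
  obtain ⟨d, hd⟩ := hM.Psi_bounded _ (by
    rintro _ ⟨F, hF, rfl⟩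
    exact isochoric_cauchyGreen_mem (hKs hF)) (hK.image_of_continuousOn (hiso.mono hKs))
  have hpair : ContinuousOn (fun q => (isochoric (cauchyGreen (G q)), ξ q)) A :=
    (hiso.comp hG.continuousOn fun q hq => hKs (hGK q hq)).prodMk hξ
  have hmem : MapsTo (fun q => (isochoric (cauchyGreen (G q)), ξ q)) A
      (posTensors ×ˢ (M.B \ M.S)) := fun q hq =>
    ⟨isochoric_cauchyGreen_mem (hKs (hGK q hq)), hξA q hq⟩
  refine ⟨⟨hM.Psi_continuousOn.comp hpair hmem, d, fun q hq => ?_⟩,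
    ⟨hM.fderiv_Psi_continuousOn.comp hpair hmem, d, fun q hq => ?_⟩,
    hG.comp_of_isCompact (φ := fun F => fderiv ℝ isochoric (cauchyGreen F)) hK hGK
      (continuousOn_fderiv_isochoric.mono hKs)⟩
  · exact (hd _ ⟨G q, hGK q hq, rfl⟩ _ (hξA q hq)).1
  · exact (hd _ ⟨G q, hGK q hq, rfl⟩ _ (hξA q hq)).2

end StrainEnergy

/-! ### The rate of change of the energy -/

section EnergyRate

variable {M : Mixture E} {Z : Fields E} {t : ℝ} {X : E}

lemma PiecewiseCTime.bddContOn {V : Type*} [NormedAddCommGroup V] [NormedSpace ℝ V] {B S : Set E}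
    {m : E → E} {T : ℝ} {n : ℕ} {f : E → ℝ → V} (hf : PiecewiseCTime n B S m T f) :
    BddContOn ((B \ S) ×ˢ Ioo 0 T) fun q : E × ℝ => f q.1 q.2 := by
  obtain ⟨c, -, hc⟩ := hf.norm_le
  exact ⟨hf.contDiffOn.continuousOn, c, fun q hq => hc _ hq.1 _ hq.2⟩

lemma BddContOn.slice {V : Type*} [NormedAddCommGroup V] [NormedSpace ℝ V] {A : Set E} {I : Set ℝ}
    {k : E × ℝ → V} (hk : BddContOn (A ×ˢ I) k) (ht : t ∈ I) : BddContOn A fun X => k (X, t) :=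
  ⟨hk.continuousOn.comp (by fun_prop) fun _ hX => ⟨hX, ht⟩, hk.bounded.imp fun _ h X hX =>
    h (X, t) ⟨hX, ht⟩⟩

namespace Fields

/-- The energy per unit reference volume. -/
def energyRef (M : Mixture E) (Z : Fields E) (t : ℝ) (X : E) : ℝ :=
  1 / 2 * M.rhoS * M.phiR X * ‖Z.vs t X‖ ^ 2 +
    1 / 2 * M.rhoF * (Z.jac t X - M.phiR X) * ‖Z.v X t‖ ^ 2 +
    M.phiR X * M.strainEnergy X (cauchyGreen (Z.defGrad t X))

/-- The time derivative of the energy per unit reference volume. -/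
def energyRefRate (M : Mixture E) (Z : Fields E) (t : ℝ) (X : E) : ℝ :=
  1 / 2 * M.rhoS * M.phiR X * (2 * ⟪Z.vs t X, Z.as t X⟫_ℝ) +
    (1 / 2 * M.rhoF * (Z.jac t X * tr (Z.defGradInv t X ∘L fderiv ℝ (Z.vs t) X)) * ‖Z.v X t‖ ^ 2 +
    1 / 2 * M.rhoF * (Z.jac t X - M.phiR X) * (2 * ⟪Z.v X t, deriv (fun τ => Z.v X τ) t⟫_ℝ)) +
    M.phiR X * fderiv ℝ (fun A => M.Psi A X) (isochoric (cauchyGreen (Z.defGrad t X)))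
      (fderiv ℝ isochoric (cauchyGreen (Z.defGrad t X))
        (fderiv ℝ cauchyGreen (Z.defGrad t X) (fderiv ℝ (Z.vs t) X)))

/-- The power of the inertial forces and of the elastic stress. -/
def power (M : Mixture E) (Z : Fields E) (t : ℝ) (X : E) : ℝ :=
  Z.densS M t X * ⟪Z.vs t X, Z.as t X⟫_ℝ + 1 / 2 * M.rhoF * ‖Z.vf t X‖ ^ 2 * tr (Z.Ls t X) +
    Z.densF M t X * ⟪Z.vf t X, deriv (fun τ => Z.v X τ) t⟫_ℝ +
    ddot (Z.stressElastic M t X) (Z.Ls t X)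

variable (hM : M.Admissible) (hZ : Z.Regular M)
include hM hZ

lemma bddContOn_defGrad : BddContOn ((M.B \ M.S) ×ˢ Ioo 0 M.T) fun q => Z.defGrad q.2 q.1 :=
  ((BddContOn.const (ContinuousLinearMap.id ℝ E)).add (du_regular hM hZ).bddContOn).congr
    fun _ hq => defGrad_eq hM hZ hq.2 hq.1

/-- Throughout space and time the deformation gradient takes values in one compact set of invertible
tensors. -/
lemma bddContOn_comp_defGrad {W : Type*} [NormedAddCommGroup W] [NormedSpace ℝ W]
    {φ : Tensor E → W} (hφ : ContinuousOn φ {A | A.det ≠ 0}) :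
    BddContOn ((M.B \ M.S) ×ˢ Ioo 0 M.T) fun q => φ (Z.defGrad q.2 q.1) := by
  obtain ⟨c, hc, h⟩ := hZ.jac_pos
  have hF := bddContOn_defGrad hM hZ
  obtain ⟨k, hk⟩ := hF.bounded
  exact hF.comp_of_isCompact (isCompact_le_det k c)
    (fun q hq => ⟨hk q hq, h q.2 hq.2 q.1 hq.1⟩) (hφ.mono fun A hA => (hc.trans_le hA.2).ne')

lemma bddContOn_jac : BddContOn ((M.B \ M.S) ×ˢ Ioo 0 M.T) fun q => Z.jac q.2 q.1 :=
  bddContOn_comp_defGrad hM hZ (φ := fun A => A.det) (contDiff_det (n := 0)).continuous.continuousOn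

lemma bddContOn_defGradInv : BddContOn ((M.B \ M.S) ×ˢ Ioo 0 M.T) fun q => Z.defGradInv q.2 q.1 :=
  bddContOn_comp_defGrad hM hZ (contDiffOn_inverse (n := 0)).continuousOn

lemma bddContOn_vs : BddContOn ((M.B \ M.S) ×ˢ Ioo 0 M.T) fun q => Z.vs q.2 q.1 :=
  (dtu_regular hM hZ).bddContOn.congr fun _ hq => vs_eq hM hZ hq.2 hq.1

lemma bddContOn_as : BddContOn ((M.B \ M.S) ×ˢ Ioo 0 M.T) fun q => Z.as q.2 q.1 :=
  ((ddtu_regular hM hZ).bddContOn.clm_apply (BddContOn.const ((0, 1) : E × ℝ))).congr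
    fun _ hq => as_eq hM hZ hq.2 hq.1

lemma bddContOn_fderiv_vs :
    BddContOn ((M.B \ M.S) ×ˢ Ioo 0 M.T) fun q => fderiv ℝ (Z.vs q.2) q.1 :=
  ((ddu_regular hM hZ).bddContOn.clm_apply (BddContOn.const ((0, 1) : E × ℝ))).congr
    fun _ hq => fderiv_vs hM hZ hq.2 hq.1

omit hM in
lemma bddContOn_v : BddContOn ((M.B \ M.S) ×ˢ Ioo 0 M.T) fun q => Z.v q.1 q.2 :=
  hZ.v_regular.bddContOn

lemma bddContOn_deriv_v :
    BddContOn ((M.B \ M.S) ×ˢ Ioo 0 M.T) fun q => deriv (fun τ => Z.v q.1 τ) q.2 :=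
  ((dv_regular hM hZ).bddContOn.clm_apply (BddContOn.const ((0, 1) : E × ℝ))).congr
    fun _ hq => deriv_v_eq hM hZ hq.2 hq.1

omit hZ in
lemma bddContOn_phiR : BddContOn ((M.B \ M.S) ×ˢ Ioo 0 M.T) fun q : E × ℝ => M.phiR q.1 :=
  ⟨hM.phiR_regular.continuousOn.comp continuousOn_fst fun _ hq => hq.1,
    hM.phiR_regular.bddContOn.bounded.imp fun _ h q hq => h q.1 hq.1⟩

lemma bddContOn_strain :
    BddContOn ((M.B \ M.S) ×ˢ Ioo 0 M.T)
      (fun q => M.strainEnergy q.1 (cauchyGreen (Z.defGrad q.2 q.1))) ∧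
    BddContOn ((M.B \ M.S) ×ˢ Ioo 0 M.T) (fun q => fderiv ℝ (fun A => M.Psi A q.1)
      (isochoric (cauchyGreen (Z.defGrad q.2 q.1)))) ∧
    BddContOn ((M.B \ M.S) ×ˢ Ioo 0 M.T)
      (fun q => fderiv ℝ isochoric (cauchyGreen (Z.defGrad q.2 q.1))) := by
  obtain ⟨c, hc, h⟩ := hZ.jac_pos
  exact bddContOn_Psi hM (bddContOn_defGrad hM hZ) hc (fun q hq => h q.2 hq.2 q.1 hq.1)
    continuousOn_fst fun q hq => hq.1

lemma bddContOn_energyRef : BddContOn ((M.B \ M.S) ×ˢ Ioo 0 M.T) fun q => Z.energyRef M q.2 q.1 :=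
  ((((BddContOn.const _).mul (bddContOn_phiR hM)).mul (bddContOn_vs hM hZ).norm_sq).add
    (((BddContOn.const _).mul ((bddContOn_jac hM hZ).sub (bddContOn_phiR hM))).mul
      (bddContOn_v hZ).norm_sq)).add ((bddContOn_phiR hM).mul (bddContOn_strain hM hZ).1)

lemma bddContOn_energyRefRate :
    BddContOn ((M.B \ M.S) ×ˢ Ioo 0 M.T) fun q => Z.energyRefRate M q.2 q.1 := by
  have hdF := bddContOn_fderiv_vs hM hZ
  have hF := bddContOn_defGrad hM hZ
  have hcg := hF.comp (φ := fderiv ℝ (cauchyGreen : Tensor E → Tensor E))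
    ((contDiff_cauchyGreen (n := 1)).continuous_fderiv one_ne_zero)
  have hφ := bddContOn_phiR hM
  have hv := bddContOn_v hZ
  refine ((((BddContOn.const _).mul hφ).mul ((BddContOn.const _).mul ((bddContOn_vs hM hZ).inner
    (bddContOn_as hM hZ)))).add ((BddContOn.mul ((BddContOn.const _).mul ((bddContOn_jac hM hZ).mul
      (((bddContOn_defGradInv hM hZ).clm_comp hdF).comp continuous_tr))) hv.norm_sq).add
      (((BddContOn.const _).mul ((bddContOn_jac hM hZ).sub hφ)).mul ((BddContOn.const _).mul
        (hv.inner (bddContOn_deriv_v hM hZ)))))).add (hφ.mul ?_)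
  exact (bddContOn_strain hM hZ).2.1.clm_apply
    ((bddContOn_strain hM hZ).2.2.clm_apply (hcg.clm_apply hdF))

/-- Per unit reference volume the solid mass is constant and the fluid mass varies only through `J`.
Jacobi's formula and the chain rule through `C = FᵀF` do the rest. -/
lemma hasDerivAt_energyRef (ht : t ∈ Ioo 0 M.T) (hX : X ∈ M.B \ M.S) :
    HasDerivAt (fun τ => Z.energyRef M τ X) (Z.energyRefRate M t X) t := by
  have hL : (Z.defGrad t X).det ≠ 0 := jac_ne_zero hM hZ ht hX
  have hF := hasDerivAt_defGrad hM hZ ht hX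
  have hJ : HasDerivAt (fun τ => Z.jac τ X)
      (Z.jac t X * tr (Z.defGradInv t X ∘L fderiv ℝ (Z.vs t) X)) t := by
    have h1 := ((contDiff_det (n := 1)).differentiable one_ne_zero
      (Z.defGrad t X)).hasFDerivAt.comp_hasDerivAt t hF
    rw [fderiv_det hL] at h1
    exact h1
  have hC : HasDerivAt (fun τ => cauchyGreen (Z.defGrad τ X))
      (fderiv ℝ cauchyGreen (Z.defGrad t X) (fderiv ℝ (Z.vs t) X)) t :=
    HasFDerivAt.comp_hasDerivAt (l := cauchyGreen) (f := fun τ => Z.defGrad τ X) t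
      (hasFDerivAt_cauchyGreen (Z.defGrad t X)) hF
  have hΨ := HasFDerivAt.comp_hasDerivAt (f := fun τ => cauchyGreen (Z.defGrad τ X)) t
    (hasFDerivAt_strainEnergy hM hX hL) hC
  exact ((((hasDerivAt_vs hM hZ ht hX).norm_sq).const_mul _).add
    (((hJ.sub_const _).const_mul _).mul (hasDerivAt_v hM hZ ht hX).norm_sq)).add (hΨ.const_mul _)

lemma jac_mul_energyDensity (ht : t ∈ Ioo 0 M.T) (hX : X ∈ M.B \ M.S) :
    Z.jac t X * Z.energyDensity M t X = Z.energyRef M t X := by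
  have hJ := jac_ne_zero hM hZ ht hX
  simp only [energyDensity, kS, kF, psiS, densS, densF, phiF, phiS, energyRef]
  change Z.jac t X * (_ + 1 / 2 * _ * ‖Z.v X t‖ ^ 2 +
    _ * (_ * M.strainEnergy X (cauchyGreen (Z.defGrad t X)))) = _
  field_simp

/-- The factor `J` cancels. Cyclicity of the trace removes `F` against `F⁻¹` and leaves the stress
contracted with `Fᵀ ∂ₜF`, and `∂ₜC` is twice the symmetric part of that product. -/
lemma ddot_stressElastic (ht : t ∈ Ioo 0 M.T) (hX : X ∈ M.B \ M.S) :
    Z.jac t X * ddot (Z.stressElastic M t X) (Z.Ls t X) =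
      M.phiR X * fderiv ℝ (fun A => M.Psi A X) (isochoric (cauchyGreen (Z.defGrad t X)))
      (fderiv ℝ isochoric (cauchyGreen (Z.defGrad t X))
        (fderiv ℝ cauchyGreen (Z.defGrad t X) (fderiv ℝ (Z.vs t) X))) := by
  have hJ := jac_ne_zero hM hZ ht hX
  have hΨ := hasFDerivAt_strainEnergy hM hX hJ
  have h1 := ddot_strainEnergyDeriv hΨ.differentiableAt
    (transpose (Z.defGrad t X) ∘L fderiv ℝ (Z.vs t) X)
  rw [hΨ.fderiv, ContinuousLinearMap.comp_apply] at h1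
  rw [fderiv_cauchyGreen, map_smul, map_smul, smul_eq_mul, ← h1, stressElastic, Ls, grad, ddot, ddot,
    transpose_smul, transpose_comp, transpose_comp, transpose_transpose,
    ContinuousLinearMap.smul_comp, tr_smul]
  change _ = M.phiR X * (2 * tr (transpose (M.strainEnergyDeriv X (Z.rightCG t X)) ∘L _))
  set G := transpose (M.strainEnergyDeriv X (Z.rightCG t X))
  have h2 : tr (((Z.defGrad t X ∘L G) ∘L transpose (Z.defGrad t X)) ∘L
      fderiv ℝ (Z.vs t) X ∘L Z.defGradInv t X) =
      tr (G ∘L transpose (Z.defGrad t X) ∘L fderiv ℝ (Z.vs t) X) := by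
    have h3 := tr_comp_comm (Z.defGrad t X)
      ((G ∘L transpose (Z.defGrad t X)) ∘L fderiv ℝ (Z.vs t) X ∘L Z.defGradInv t X)
    have h4 : Z.defGradInv t X ∘L Z.defGrad t X = ContinuousLinearMap.id ℝ E := inverse_comp_self hJ
    simp only [ContinuousLinearMap.comp_assoc, h4, ContinuousLinearMap.comp_id] at h3 ⊢
    exact h3
  rw [h2]
  field_simp

lemma jac_mul_power (ht : t ∈ Ioo 0 M.T) (hX : X ∈ M.B \ M.S) :
    Z.jac t X * Z.power M t X = Z.energyRefRate M t X := by
  have hJ := jac_ne_zero hM hZ ht hX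
  have h1 := ddot_stressElastic hM hZ ht hX
  have h2 : tr (Z.Ls t X) = tr (Z.defGradInv t X ∘L fderiv ℝ (Z.vs t) X) := by
    rw [Ls, grad, tr_comp_comm]
  rw [power, mul_add, h1, energyRefRate, h2]
  congr 1
  simp only [densS, densF, phiF, phiS, vf]
  field_simp
  ring

/-- The domain moves with the solid; pulled back to the reference configuration it is fixed, and the
integrand has a time derivative bounded on all of `(0, T)`. The differentiation is thus purely
kinematic and holds at every time in that interval. -/
lemma hasDerivAt_energy (hdim : Module.finrank ℝ E = 3) (ht : t ∈ Ioo 0 M.T) :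
    HasDerivAt (Z.energy M) (∫ X in M.B, Z.jac t X * Z.power M t X) t := by
  have hO := hM.interface.isOpen_diff hM.isOpen
  have hE : ∀ τ ∈ Ioo 0 M.T, Z.energy M τ = ∫ X in M.B \ M.S, Z.energyRef M τ X := fun τ hτ => by
    rw [energy, integral_body hM hZ hτ hdim, ← setIntegral_diff_interface hdim hM.interface]
    exact setIntegral_congr_fun hO.measurableSet fun X hX => jac_mul_energyDensity hM hZ hτ hX
  obtain ⟨c, hc⟩ := (bddContOn_energyRefRate hM hZ).bounded
  have hint : ∀ τ ∈ Ioo 0 M.T, IntegrableOn (Z.energyRef M τ) (M.B \ M.S) := fun τ hτ =>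
    (((bddContOn_energyRef hM hZ).slice hτ).integrableOn_diff hdim hM.isOpen hM.isBounded
      hM.interface).mono_set sdiff_subset
  have h := hasDerivAt_integral_of_dominated_loc_of_deriv_le (μ := volume.restrict (M.B \ M.S))
    (F := fun τ X => Z.energyRef M τ X) (F' := fun τ X => Z.energyRefRate M τ X) (x₀ := t)
    (bound := fun _ => c) (s := Ioo 0 M.T) (isOpen_Ioo.mem_nhds ht)
    (by filter_upwards [isOpen_Ioo.mem_nhds ht] with τ hτ using (hint τ hτ).aestronglyMeasurable)
    (hint t ht)
    ((((bddContOn_energyRefRate hM hZ).slice ht).integrableOn_diff hdim hM.isOpen hM.isBounded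
      hM.interface).mono_set sdiff_subset).aestronglyMeasurable
    ((ae_restrict_iff' hO.measurableSet).2 (ae_of_all _ fun X hX τ hτ => hc (X, τ) ⟨hX, hτ⟩))
    (integrableOn_const ((measure_mono sdiff_subset).trans_lt hM.isBounded.measure_lt_top).ne)
    ((ae_restrict_iff' hO.measurableSet).2 (ae_of_all _ fun X hX τ hτ =>
      hasDerivAt_energyRef hM hZ hτ hX))
  have h2 : ∫ X in M.B, Z.jac t X * Z.power M t X = ∫ X in M.B \ M.S, Z.energyRefRate M t X := by
    rw [← setIntegral_diff_interface hdim hM.interface]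
    exact setIntegral_congr_fun hO.measurableSet fun X hX => jac_mul_power hM hZ ht hX
  rw [h2]
  refine h.2.congr_of_eventuallyEq ?_
  filter_upwards [isOpen_Ioo.mem_nhds ht] with τ hτ using hE τ hτ

end Fields

end EnergyRate

/-! ### Surface integrands -/

section Traces

variable {V W G : Type*} [NormedAddCommGroup V] [NormedSpace ℝ V] [NormedAddCommGroup W]
  [NormedSpace ℝ W] [NormedAddCommGroup G] [NormedSpace ℝ G]
  {B S : Set E} {m : E → E} {X : E} {n : ℕ}

/-- At every point `X` of the interface the function `f X` has the one-sided limits `a X` and `b X`,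
which are bounded and depend continuously on `X`. -/
structure HasTraces (S : Set E) (m : E → E) (f : E → E → V) (a b : E → V) : Prop where
  pos : ∀ X ∈ S, Tendsto (fun s : ℝ => f X (X + s • m X)) (𝓝[>] 0) (𝓝 (a X))
  neg : ∀ X ∈ S, Tendsto (fun s : ℝ => f X (X + s • (-m X))) (𝓝[>] 0) (𝓝 (b X))
  bdd_pos : BddContOn S a
  bdd_neg : BddContOn S b

namespace HasTraces

variable {f f' : E → E → V} {a b a' b' : E → V} {g : E → E → W} {c d : E → W}

lemma jump_eq (h : HasTraces S m f a b) (hX : X ∈ S) : jump (m X) X (f X) = a X - b X :=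
  PermeableInterface.jump_eq (h.pos X hX) (h.neg X hX)

lemma bddContOn_jump [FiniteDimensional ℝ V] (h : HasTraces S m f a b) :
    BddContOn S fun X => jump (m X) X (f X) :=
  (h.bdd_pos.sub h.bdd_neg).congr fun _ hX => h.jump_eq hX

lemma congr (h : HasTraces S m f a b) (hf : ∀ X Y, f' X Y = f X Y) : HasTraces S m f' a b := by
  have : f' = f := funext fun X => funext fun Y => hf X Y
  rwa [this]

lemma congr_traces (h : HasTraces S m f a b) (ha : ∀ X ∈ S, a' X = a X) (hb : ∀ X ∈ S, b' X = b X) :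
    HasTraces S m f a' b' where
  pos X hX := by rw [ha X hX]; exact h.pos X hX
  neg X hX := by rw [hb X hX]; exact h.neg X hX
  bdd_pos := h.bdd_pos.congr ha
  bdd_neg := h.bdd_neg.congr hb

lemma of_bddContOn {k : E → V} (hk : BddContOn S k) : HasTraces S m (fun X _ => k X) k k :=
  ⟨fun _ _ => tendsto_const_nhds, fun _ _ => tendsto_const_nhds, hk, hk⟩

lemma of_piecewise {k : E → V} (hI : IsInterface B S m) (hk : PiecewiseC n B S m k) :
    HasTraces S m (fun _ Y => k Y) (fun X => sideLim (m X) X k) (fun X => sideLim (-m X) X k) :=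
  ⟨fun _ hX => hk.tendsto_pos hI hX, fun _ hX => hk.tendsto_neg hI hX, hk.bddContOn_pos hI,
    hk.bddContOn_neg hI⟩

lemma of_continuous {k : E → V} (hB : IsOpen B) (hI : IsInterface B S m) (hk : PiecewiseC n B S m k)
    (hc : ContinuousOn k B) : HasTraces S m (fun _ Y => k Y) k k := by
  have h := of_piecewise hI hk
  have hX' : ∀ X ∈ S, ∀ ν, Tendsto (fun s : ℝ => k (X + s • ν)) (𝓝[>] 0) (𝓝 (k X)) := fun X hX ν =>
    (hc.continuousAt (hB.mem_nhds (hI.subset hX))).tendsto.comp (tendsto_add_smul_nhds X ν)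
  exact h.congr_traces (fun X hX => tendsto_nhds_unique (hX' X hX _) (h.pos X hX))
    fun X hX => tendsto_nhds_unique (hX' X hX _) (h.neg X hX)

lemma comp [FiniteDimensional ℝ V] (h : HasTraces S m f a b) {φ : V → W} (hφ : Continuous φ) :
    HasTraces S m (fun X Y => φ (f X Y)) (fun X => φ (a X)) (fun X => φ (b X)) :=
  ⟨fun X hX => (hφ.tendsto _).comp (h.pos X hX), fun X hX => (hφ.tendsto _).comp (h.neg X hX),
    h.bdd_pos.comp hφ, h.bdd_neg.comp hφ⟩

lemma comp₂ [FiniteDimensional ℝ V] [FiniteDimensional ℝ W] (h : HasTraces S m f a b)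
    (h' : HasTraces S m g c d) {φ : V → W → G} (hφ : Continuous fun q : V × W => φ q.1 q.2) :
    HasTraces S m (fun X Y => φ (f X Y) (g X Y)) (fun X => φ (a X) (c X)) (fun X => φ (b X) (d X)) :=
  ⟨fun X hX => (hφ.tendsto (a X, c X)).comp ((h.pos X hX).prodMk_nhds (h'.pos X hX)),
    fun X hX => (hφ.tendsto (b X, d X)).comp ((h.neg X hX).prodMk_nhds (h'.neg X hX)),
    h.bdd_pos.comp₂ h'.bdd_pos hφ, h.bdd_neg.comp₂ h'.bdd_neg hφ⟩

variable {α α' β β' : E → ℝ} {k k' : E → E → ℝ} {x x' y y' : E → E} {v v' : E → E → E}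

lemma add [FiniteDimensional ℝ V] (h : HasTraces S m f a b) (h' : HasTraces S m f' a' b') :
    HasTraces S m (fun X Y => f X Y + f' X Y) (fun X => a X + a' X) (fun X => b X + b' X) :=
  h.comp₂ h' (φ := fun a b => a + b) (by fun_prop)

lemma sub [FiniteDimensional ℝ V] (h : HasTraces S m f a b) (h' : HasTraces S m f' a' b') :
    HasTraces S m (fun X Y => f X Y - f' X Y) (fun X => a X - a' X) (fun X => b X - b' X) :=
  h.comp₂ h' (φ := fun a b => a - b) (by fun_prop)

lemma smul [FiniteDimensional ℝ V] (h : HasTraces S m k α β) (h' : HasTraces S m f a b) :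
    HasTraces S m (fun X Y => k X Y • f X Y) (fun X => α X • a X) (fun X => β X • b X) :=
  h.comp₂ h' (φ := fun a b => a • b) (by fun_prop)

lemma mul (h : HasTraces S m k α β) (h' : HasTraces S m k' α' β') :
    HasTraces S m (fun X Y => k X Y * k' X Y) (fun X => α X * α' X) (fun X => β X * β' X) :=
  h.smul h'

lemma inner (h : HasTraces S m v x y) (h' : HasTraces S m v' x' y') :
    HasTraces S m (fun X Y => ⟪v X Y, v' X Y⟫_ℝ) (fun X => ⟪x X, x' X⟫_ℝ) (fun X => ⟪y X, y' X⟫_ℝ) :=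
  h.comp₂ h' (φ := fun a b => ⟪a, b⟫_ℝ) (by fun_prop)

lemma norm (h : HasTraces S m v x y) :
    HasTraces S m (fun X Y => ‖v X Y‖) (fun X => ‖x X‖) (fun X => ‖y X‖) := h.comp continuous_norm

lemma norm_sq (h : HasTraces S m v x y) :
    HasTraces S m (fun X Y => ‖v X Y‖ ^ 2) (fun X => ‖x X‖ ^ 2) (fun X => ‖y X‖ ^ 2) :=
  h.comp (φ := fun x => ‖x‖ ^ 2) (by fun_prop)

lemma apply {T : E → E → Tensor E} {A A' : E → Tensor E} (h : HasTraces S m T A A')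
    (h' : HasTraces S m v x y) :
    HasTraces S m (fun X Y => T X Y (v X Y)) (fun X => A X (x X)) (fun X => A' X (y X)) :=
  h.comp₂ h' (φ := fun (T : Tensor E) x => T x) (by fun_prop)

end HasTraces

end Traces

/-! ### One-sided limits of the interface integrands. -/

section SurfaceIntegrands

variable {M : Mixture E} {Z : Fields E} {t : ℝ} {X : E}

namespace Fields

/-- The area vector depends only on tangential derivatives of the motion, which agree on both sides;
hence the single trace `areaTrace`. -/
lemma hasTraces_areaVec (hM : M.Admissible) (hZ : Z.Regular M) (ht : t ∈ Ioo 0 M.T) :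
    HasTraces M.S M.m (fun X Y => Z.areaVec t (M.m X) Y) (Z.areaTrace M t) (Z.areaTrace M t) :=
  ((HasTraces.of_piecewise hM.interface (cof_regular hM hZ ht)).apply
    (HasTraces.of_bddContOn hM.interface.bddContOn_normal)).congr_traces (fun _ _ => rfl)
      fun _ hX => (areaTrace_eq_neg hM hZ ht hX).symm

/-- The normal is the normalized area vector, so their product is its length. Where the area vector
vanishes both sides are zero. -/
lemma dyad_normal_apply (j ν Y : E) :
    dyad j (Z.normal t ν Y) (Z.areaVec t ν Y) = ‖Z.areaVec t ν Y‖ • j := by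
  rw [dyad_apply, normal, real_inner_smul_left, real_inner_self_eq_norm_sq]
  congr 1
  rcases eq_or_ne ‖Z.areaVec t ν Y‖ 0 with h | h
  · simp [h]
  · field_simp

/-- The scalar `p` is left free: the pore pressure gives the term of the weak form, and zero gives
the purely convective traction. -/
lemma hasTraces_convTraction {φ φ' : E → ℝ} {w w' N N' : E → E} {p : E → ℝ} {c c' : E → ℝ}
    (hφ : HasTraces M.S M.m (fun _ Y => Z.phiF M t Y) φ φ')
    (hw : HasTraces M.S M.m (fun _ Y => Z.vrel t Y) w w')
    (hN : HasTraces M.S M.m (fun X Y => Z.areaVec t (M.m X) Y) N N')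
    (hp : HasTraces M.S M.m (fun _ Y => p Y) c c') :
    HasTraces M.S M.m (fun X Y =>
        (Z.densF M t Y • dyad (Z.vrel t Y) (Z.vrel t Y)
          + p Y • ContinuousLinearMap.id ℝ E) (Z.areaVec t (M.m X) Y))
      (fun X => (M.rhoF * φ X * ⟪w X, N X⟫_ℝ) • w X + c X • N X)
      (fun X => (M.rhoF * φ' X * ⟪w' X, N' X⟫_ℝ) • w' X + c' X • N' X) :=
  (((((HasTraces.of_bddContOn (BddContOn.const M.rhoF)).mul hφ).mul (hw.inner hN)).smul hw).add
    (hp.smul hN)).congr fun X Y => by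
      simp only [densF, _root_.add_apply, _root_.smul_apply, dyad_apply,
        ContinuousLinearMap.id_apply, smul_smul]

lemma hasTraces_kinetic {φ φ' : E → ℝ} {w w' N N' f f' b b' : E → E} {β : E → E}
    (hφ : HasTraces M.S M.m (fun _ Y => Z.phiF M t Y) φ φ')
    (hw : HasTraces M.S M.m (fun _ Y => Z.vrel t Y) w w')
    (hf : HasTraces M.S M.m (fun _ Y => Z.vf t Y) f f')
    (hN : HasTraces M.S M.m (fun X Y => Z.areaVec t (M.m X) Y) N N')
    (hb : HasTraces M.S M.m (fun _ Y => β Y) b b') :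
    HasTraces M.S M.m (fun X Y =>
        ⟪(Z.kF M t Y • ContinuousLinearMap.id ℝ E
          - Z.densF M t Y • dyad (Z.vf t Y) (Z.vrel t Y)) (Z.areaVec t (M.m X) Y), β Y⟫_ℝ)
      (fun X => 1 / 2 * M.rhoF * φ X * ‖f X‖ ^ 2 * ⟪N X, b X⟫_ℝ -
        M.rhoF * φ X * ⟪w X, N X⟫_ℝ * ⟪f X, b X⟫_ℝ)
      (fun X => 1 / 2 * M.rhoF * φ' X * ‖f' X‖ ^ 2 * ⟪N' X, b' X⟫_ℝ -
        M.rhoF * φ' X * ⟪w' X, N' X⟫_ℝ * ⟪f' X, b' X⟫_ℝ) :=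
  (((((HasTraces.of_bddContOn (BddContOn.const (1 / 2 * M.rhoF))).mul hφ).mul hf.norm_sq).mul
    (hN.inner hb)).sub ((((HasTraces.of_bddContOn (BddContOn.const M.rhoF)).mul hφ).mul
      (hw.inner hN)).mul (hf.inner hb))).congr fun X Y => by
      simp only [kF, densF, _root_.sub_apply, _root_.smul_apply, dyad_apply,
        ContinuousLinearMap.id_apply, smul_smul, inner_sub_left, real_inner_smul_left]
      ring

/-- The scalar `p` is left free because the two variational forms use the multiplier with and
without the pore pressure subtracted. -/
lemma hasTraces_slip {φ φ' c c' : E → ℝ} {N N' b b' : E → E} {β : E → E} {p : E → E → ℝ}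
    {j : E → E}
    (hφ : HasTraces M.S M.m (fun _ Y => Z.phiF M t Y) φ φ')
    (hN : HasTraces M.S M.m (fun X Y => Z.areaVec t (M.m X) Y) N N')
    (hp : HasTraces M.S M.m p c c') (hj : BddContOn M.S j)
    (hb : HasTraces M.S M.m (fun _ Y => β Y) b b') :
    HasTraces M.S M.m (fun X Y =>
        ⟪((Z.phiF M t Y * p X Y) • ContinuousLinearMap.id ℝ E
          - (1 / 2 * Z.phiF M t Y * M.muS) • dyad (j X) (Z.normal t (M.m X) Y))
            (Z.areaVec t (M.m X) Y), β Y⟫_ℝ)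
      (fun X => φ X * c X * ⟪N X, b X⟫_ℝ - 1 / 2 * M.muS * φ X * ‖N X‖ * ⟪j X, b X⟫_ℝ)
      (fun X => φ' X * c' X * ⟪N' X, b' X⟫_ℝ - 1 / 2 * M.muS * φ' X * ‖N' X‖ * ⟪j X, b' X⟫_ℝ) :=
  (((hφ.mul hp).mul (hN.inner hb)).sub ((((HasTraces.of_bddContOn (BddContOn.const
    (1 / 2 * M.muS))).mul hφ).mul hN.norm).mul ((HasTraces.of_bddContOn hj).inner hb))).congr
    fun X Y => by
      simp only [_root_.sub_apply, _root_.smul_apply, dyad_normal_apply,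
        ContinuousLinearMap.id_apply, smul_smul, inner_sub_left, real_inner_smul_left]
      ring

lemma hasTraces_pressureFlux {φ φ' c c' : E → ℝ} {v v' w w' N N' : E → E} {π : E → ℝ}
    (hφ : HasTraces M.S M.m (fun _ Y => Z.phiF M t Y) φ φ')
    (hv : HasTraces M.S M.m (fun _ Y => Z.vs t Y) v v')
    (hw : HasTraces M.S M.m (fun _ Y => Z.vrel t Y) w w')
    (hN : HasTraces M.S M.m (fun X Y => Z.areaVec t (M.m X) Y) N N')
    (hπ : HasTraces M.S M.m (fun _ Y => π Y) c c') :
    HasTraces M.S M.m (fun X Y =>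
        ⟪π Y • (Z.vs t Y + Z.vflt M t Y), Z.areaVec t (M.m X) Y⟫_ℝ)
      (fun X => c X * (⟪v X, N X⟫_ℝ + φ X * ⟪w X, N X⟫_ℝ))
      (fun X => c' X * (⟪v' X, N' X⟫_ℝ + φ' X * ⟪w' X, N' X⟫_ℝ)) :=
  (hπ.mul ((hv.inner hN).add (hφ.mul (hw.inner hN)))).congr fun X Y => by
    simp only [vflt, real_inner_smul_left, inner_add_left]

lemma hasTraces_flux {φ φ' : E → ℝ} {w w' N N' : E → E}
    (hφ : HasTraces M.S M.m (fun _ Y => Z.phiF M t Y) φ φ')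
    (hw : HasTraces M.S M.m (fun _ Y => Z.vrel t Y) w w')
    (hN : HasTraces M.S M.m (fun X Y => Z.areaVec t (M.m X) Y) N N') :
    HasTraces M.S M.m (fun X Y => ⟪Z.vflt M t Y, Z.areaVec t (M.m X) Y⟫_ℝ)
      (fun X => φ X * ⟪w X, N X⟫_ℝ) (fun X => φ' X * ⟪w' X, N' X⟫_ℝ) :=
  (hφ.mul (hw.inner hN)).congr fun X Y => by simp only [vflt, real_inner_smul_left]

end Fields

end SurfaceIntegrands

/-! ### Balance of energy -/

section TensorProduct

variable {A A' H H' G : Tensor E}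

lemma ddot_add_left : ddot (A + A') H = ddot A H + ddot A' H := by
  simp only [ddot, transpose_add, ContinuousLinearMap.add_comp, tr_add]

lemma ddot_sub_left : ddot (A - A') H = ddot A H - ddot A' H := by
  simp only [ddot, transpose_sub, ContinuousLinearMap.sub_comp, tr_sub]

lemma ddot_smul_left (c : ℝ) : ddot (c • A) H = c * ddot A H := by
  simp only [ddot, transpose_smul, ContinuousLinearMap.smul_comp, tr_smul]

lemma ddot_add_right : ddot A (H + H') = ddot A H + ddot A H' := by
  simp only [ddot, ContinuousLinearMap.comp_add, tr_add]

lemma ddot_sub_right : ddot A (H - H') = ddot A H - ddot A H' := by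
  simp only [ddot, ContinuousLinearMap.comp_sub, tr_sub]

lemma ddot_smul_right (c : ℝ) : ddot A (c • H) = c * ddot A H := by
  simp only [ddot, ContinuousLinearMap.comp_smul, tr_smul]

lemma ddot_comp_transpose : ddot (A ∘L transpose G) H = ddot A (H ∘L G) := by
  rw [ddot, ddot, transpose_comp, transpose_transpose, tr_comp_comm, ← ContinuousLinearMap.comp_assoc,
    tr_comp_comm]

lemma ddot_transpose_right (hA : transpose A = A) : ddot A (transpose H) = ddot A H := by
  rw [ddot, ← tr_transpose, transpose_comp, transpose_transpose, transpose_transpose, tr_comp_comm,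
    ddot, hA]

lemma ddot_symPart_right (hA : transpose A = A) : ddot A (symPart H) = ddot A H := by
  rw [symPart, ddot_smul_right, ddot_add_right, ddot_transpose_right hA]
  ring

lemma ddot_comm : ddot A H = ddot H A := by
  rw [ddot, ← tr_transpose, transpose_comp, transpose_transpose, ddot]

lemma continuous_ddot : Continuous fun q : Tensor E × Tensor E => ddot q.1 q.2 := by
  have h1 : Continuous fun q : Tensor E × Tensor E => (transposeCLM q.1) ∘L q.2 := by fun_prop
  exact continuous_tr.comp h1

lemma BddContOn.ddot {α : Type*} [TopologicalSpace α] {K : Set α} {a b : α → Tensor E}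
    (ha : BddContOn K a) (hb : BddContOn K b) :
    BddContOn K fun X => PermeableInterface.ddot (a X) (b X) :=
  ha.comp₂ hb continuous_ddot

lemma BddContOn.symPart {α : Type*} [TopologicalSpace α] {K : Set α} {a : α → Tensor E}
    (ha : BddContOn K a) : BddContOn K fun X => PermeableInterface.symPart (a X) :=
  ha.comp symPartCLM.continuous

lemma BddContOn.transpose {α : Type*} [TopologicalSpace α] {K : Set α} {a : α → Tensor E}
    (ha : BddContOn K a) : BddContOn K fun X => PermeableInterface.transpose (a X) :=
  ha.comp transposeCLM.continuous

lemma BddContOn.fin_sum {α : Type*} [TopologicalSpace α] {K : Set α} {V : Type*}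
    [NormedAddCommGroup V] [NormedSpace ℝ V] [FiniteDimensional ℝ V] {n : ℕ} {a : Fin n → α → V}
    (ha : ∀ i, BddContOn K (a i)) : BddContOn K fun X => ∑ i, a i X := by
  have h : ∀ s : Finset (Fin n), BddContOn K fun X => ∑ i ∈ s, a i X := fun s => by
    induction s using Finset.induction_on with
    | empty => simpa using BddContOn.const (0 : V)
    | insert i s hi ih => simpa only [Finset.sum_insert hi] using (ha i).add ih
  exact h Finset.univ

end TensorProduct

lemma VanishesOnBoundary.of_norm_le {B S : Set E} {f g : E → E} (hf : VanishesOnBoundary B S f)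
    {c : ℝ} (hg : ∀ X ∈ B \ S, ‖g X‖ ≤ c * ‖f X‖) : VanishesOnBoundary B S g := by
  intro X hX
  have h : Tendsto (fun Y => c * ‖f Y‖) (𝓝[B \ S] X) (𝓝 0) := by
    simpa using (hf X hX).norm.const_mul c
  exact squeeze_zero_norm' (eventually_mem_nhdsWithin.mono hg) h

lemma VanishesOnBoundary.add {B S : Set E} {f g : E → E} (hf : VanishesOnBoundary B S f)
    (hg : VanishesOnBoundary B S g) : VanishesOnBoundary B S fun X => f X + g X := fun X hX => by
  simpa using (hf X hX).add (hg X hX)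

lemma VanishesOnBoundary.smul {B S : Set E} {f : E → E} {k : E → ℝ} (hf : VanishesOnBoundary B S f)
    (hk : BddContOn (B \ S) k) : VanishesOnBoundary B S fun X => k X • f X := by
  obtain ⟨c, hc⟩ := hk.bounded
  refine hf.of_norm_le (c := c) fun X hX => ?_
  rw [norm_smul]
  exact mul_le_mul_of_nonneg_right (hc X hX) (norm_nonneg _)

lemma VanishesOnBoundary.clm_apply {B S : Set E} {f : E → E} {k : E → Tensor E}
    (hf : VanishesOnBoundary B S f) (hk : BddContOn (B \ S) k) :
    VanishesOnBoundary B S fun X => k X (f X) := by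
  obtain ⟨c, hc⟩ := hk.bounded
  exact hf.of_norm_le (c := c) fun X hX => (k X).le_of_opNorm_le (hc X hX) _

/-! ### Pointwise identities in the bulk. -/

section Volume

variable {M : Mixture E} {Z : Fields E} {t : ℝ} {X : E}

namespace Fields

lemma inner_gradScalar (f : E → ℝ) (y : E) :
    ⟪y, Z.gradScalar t f X⟫_ℝ = fderiv ℝ f X (Z.defGradInv t X y) := by
  rw [gradScalar, inner_transpose_right, real_inner_comm, gradient,
    InnerProductSpace.toDual_symm_apply]

lemma gradScalar_inner (f : E → ℝ) (y : E) :
    ⟪Z.gradScalar t f X, y⟫_ℝ = fderiv ℝ f X (Z.defGradInv t X y) := by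
  rw [real_inner_comm, inner_gradScalar]

lemma divVec_smul {f : E → ℝ} {y : E → E} (hf : DifferentiableAt ℝ f X)
    (hy : DifferentiableAt ℝ y X) : Z.divVec t (fun Y => f Y • y Y) X =
      f X * Z.divVec t y X + ⟪y X, Z.gradScalar t f X⟫_ℝ := by
  have h1 : fderiv ℝ (fun Y => f Y • y Y) X = f X • fderiv ℝ y X + (fderiv ℝ f X).smulRight (y X) :=
    fderiv_fun_smul hf hy
  have h2 : ((fderiv ℝ f X).smulRight (y X)) ∘L Z.defGradInv t X =
      dyad (y X) (Z.gradScalar t f X) := by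
    ext z
    rw [dyad_apply, gradScalar_inner]
    rfl
  rw [divVec, divVec, grad, grad, h1, ContinuousLinearMap.add_comp, ContinuousLinearMap.smul_comp,
    tr_add, tr_smul, h2, tr_dyad]

lemma transpose_stressViscS : transpose (Z.stressViscS M t X) = Z.stressViscS M t X := by
  simp only [stressViscS, transpose_smul, transpose_sub, Ds, Df, transpose_symPart]

lemma transpose_stressViscF : transpose (Z.stressViscF M t X) = Z.stressViscF M t X := by
  simp only [stressViscF, transpose_smul, transpose_sub, transpose_add, Ds, Df, transpose_symPart]

/-- The power of the viscous stresses and of the drag is dissipated. -/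
lemma viscous_power : ddot (Z.stressViscS M t X + Z.stressViscF M t X) (Z.Ls t X) +
    ddot (Z.stressViscF M t X) (Z.Lf t X - Z.Ls t X) - ⟪Z.drag M t X, Z.vrel t X⟫_ℝ =
      Z.dissipation M t X := by
  have hS : ∀ L, ddot (Z.stressViscS M t X) L = ddot (Z.stressViscS M t X) (symPart L) := fun L =>
    (ddot_symPart_right transpose_stressViscS).symm
  have hF : ∀ L, ddot (Z.stressViscF M t X) L = ddot (Z.stressViscF M t X) (symPart L) := fun L =>
    (ddot_symPart_right transpose_stressViscF).symm
  rw [ddot_add_left, ddot_sub_right, hS, hF (Z.Ls t X), hF (Z.Lf t X), drag, inner_neg_left,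
    real_inner_smul_left, real_inner_self_eq_norm_sq, dissipation]
  change ddot _ (Z.Ds t X) + ddot _ (Z.Ds t X) + (ddot _ (Z.Df t X) - ddot _ (Z.Ds t X)) - _ = _
  simp only [stressViscS, stressViscF, ddot_add_left, ddot_smul_left, ddot_sub_left, ddot_sub_right]
  rw [ddot_comm (A := Z.Ds t X) (H := Z.Df t X)]
  ring

variable (hM : M.Admissible) (hZ : Z.Regular M) (ht : t ∈ Ioo 0 M.T)
include hM hZ ht

lemma grad_vrel (hX : X ∈ M.B \ M.S) :
    fderiv ℝ (Z.vrel t) X ∘L Z.defGradInv t X = Z.Lf t X - Z.Ls t X := by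
  have h : fderiv ℝ (Z.vrel t) X = fderiv ℝ (Z.vf t) X - fderiv ℝ (Z.vs t) X :=
    fderiv_fun_sub ((vf_regular hM hZ ht).differentiableAt hM.isOpen hM.interface hX)
      ((vs_regular hM hZ ht).differentiableAt hM.isOpen hM.interface hX)
  rw [h, ContinuousLinearMap.sub_comp]
  rfl

/-- The kinetic energy of the fluid per unit mass, times the density of the pure fluid. -/
lemma kinetic_regular : PiecewiseC 1 M.B M.S M.m fun X => 1 / 2 * M.rhoF * ‖Z.vf t X‖ ^ 2 :=
  (vf_regular hM hZ ht).comp_contDiff le_rfl hM.isOpen hM.interface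
    (φ := fun y : E => 1 / 2 * M.rhoF * ‖y‖ ^ 2) (contDiff_const.mul (contDiff_norm_sq ℝ))

lemma inner_gradScalar_kinetic (hX : X ∈ M.B \ M.S) (y : E) :
    ⟪y, Z.gradScalar t (fun X => 1 / 2 * M.rhoF * ‖Z.vf t X‖ ^ 2) X⟫_ℝ =
      M.rhoF * ⟪Z.vf t X, Z.Lf t X y⟫_ℝ := by
  have h := (((vf_regular hM hZ ht).differentiableAt hM.isOpen hM.interface
    hX).hasFDerivAt.norm_sq).const_mul (1 / 2 * M.rhoF)
  rw [inner_gradScalar, h.fderiv]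
  simp only [_root_.smul_apply, ContinuousLinearMap.comp_apply, innerSL_apply_apply, smul_eq_mul,
    Lf, grad, nsmul_eq_mul]
  push_cast
  ring

/-- The integrands of the weak formulation, for the actual velocities as test functions. -/
lemma weak_integrand (hX : X ∈ M.B \ M.S) :
    Z.jac t X * ⟪Z.densS M t X • Z.as t X + Z.densF M t X • Z.af t X
        + Z.gradScalar t (fun Y => Z.p Y t) X, Z.vs t X⟫_ℝ
      + Z.jac t X * ddot ((Z.stressElastic M t X + Z.stressViscS M t X + Z.stressViscF M t X)
        ∘L transpose (Z.defGradInv t X)) (fderiv ℝ (Z.vs t) X)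
      + Z.jac t X * (⟪Z.densF M t X • Z.af t X + Z.phiF M t X • Z.gradScalar t (fun Y => Z.p Y t) X
          - Z.drag M t X, Z.vrel t X⟫_ℝ
        + ddot (Z.stressViscF M t X ∘L transpose (Z.defGradInv t X)) (fderiv ℝ (Z.vrel t) X))
      - Z.jac t X * ⟪Z.vs t X + Z.vflt M t X,
          Z.gradScalar t (fun Y => Z.p Y t + 1 / 2 * M.rhoF * ‖Z.vf t Y‖ ^ 2) X⟫_ℝ
      = Z.jac t X * Z.power M t X + Z.jac t X * Z.dissipation M t X
        - Z.jac t X * Z.divVec t (fun Y => (1 / 2 * M.rhoF * ‖Z.vf t Y‖ ^ 2) • Z.vs t Y) X := by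
  have hp := (hZ.p_regular t ht).differentiableAt hM.isOpen hM.interface hX
  have hg := (kinetic_regular hM hZ ht).differentiableAt hM.isOpen hM.interface hX
  -- The pressure part of this gradient cancels the pressure terms of the momentum equations. The
  -- kinetic part, paired with `φ_f w`, cancels the convective acceleration; paired with `v_s`, it
  -- is a divergence up to the term `½ρ_F|v_f|² tr L_s` of the power.
  have h1 : ∀ y, ⟪y, Z.gradScalar t (fun Y => Z.p Y t + 1 / 2 * M.rhoF * ‖Z.vf t Y‖ ^ 2) X⟫_ℝ =
      ⟪Z.gradScalar t (fun Y => Z.p Y t) X, y⟫_ℝ + M.rhoF * ⟪Z.vf t X, Z.Lf t X y⟫_ℝ := fun y => by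
    rw [inner_gradScalar, fderiv_fun_add hp hg, _root_.add_apply, gradScalar_inner,
      ← inner_gradScalar_kinetic hM hZ ht hX, inner_gradScalar]
  rw [h1, ddot_comp_transpose, ddot_comp_transpose, grad_vrel hM hZ ht hX, divVec_smul hg
    ((vs_regular hM hZ ht).differentiableAt hM.isOpen hM.interface hX),
    inner_gradScalar_kinetic hM hZ ht hX, ← viscous_power, power, add_assoc (Z.stressElastic M t X),
    ddot_add_left]
  change _ + Z.jac t X * (_ + ddot (Z.stressViscS M t X + Z.stressViscF M t X) (Z.Ls t X)) + _ - _
    = _ - Z.jac t X * (_ * tr (Z.Ls t X) + _)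
  -- The solid and fluid tests add up to the fluid velocity, so the fluid inertia does work on
  -- `v_f`.
  have h2 : Z.vf t X = Z.vs t X + Z.vrel t X := by simp [vrel]
  have h3 : Z.af t X = deriv (fun τ => Z.v X τ) t + Z.Lf t X (Z.vrel t X) := rfl
  have h4 : fderiv ℝ (Z.vs t) X ∘L Z.defGradInv t X = Z.Ls t X := rfl
  simp only [h3, h4, vflt, inner_add_left, inner_add_right, inner_sub_left, real_inner_smul_left,
    real_inner_smul_right, map_add, map_smul, smul_add, densF]
  rw [h2]
  simp only [inner_add_left]
  rw [real_inner_comm (Z.vs t X) (Z.as t X), real_inner_comm (Z.vs t X) (deriv (fun τ => Z.v X τ) t),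
    real_inner_comm (Z.vrel t X) (deriv (fun τ => Z.v X τ) t),
    real_inner_comm (Z.vs t X) (Z.Lf t X (Z.vrel t X)),
    real_inner_comm (Z.vrel t X) (Z.Lf t X (Z.vrel t X))]
  ring

end Fields

end Volume

/-! ### Divergence theorem in the current configuration and bounds at a fixed time. -/

section Balance

variable {M : Mixture E} {Z : Fields E} {t : ℝ} {X : E}

lemma IsCoefficient.bddContOn {B S : Set E} {T : ℝ} {c : E → ℝ → ℝ} (hc : IsCoefficient B S T c)
    (ht : t ∈ Ioo 0 T) : BddContOn (B \ S) fun X => c X t := by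
  obtain ⟨h1, h2, K, hK⟩ := hc t ht
  exact ⟨h1, K, fun X hX => by rw [Real.norm_of_nonneg (h2 X hX)]; exact hK X hX⟩

lemma IsSurfaceTest.bddContOn {r : E → ℝ} (hr : IsSurfaceTest M r) : BddContOn M.S r :=
  ⟨hr.continuous, hr.bounded⟩

lemma setIntegral_congr_diff (hdim : Module.finrank ℝ E = 3) {B S : Set E} {m : E → E} (hB : IsOpen B)
    (hI : IsInterface B S m) {f g : E → ℝ} (h : ∀ X ∈ B \ S, f X = g X) :
    ∫ X in B, f X = ∫ X in B, g X := by
  rw [← setIntegral_diff_interface hdim hI, ← setIntegral_diff_interface hdim hI]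
  exact setIntegral_congr_fun (hI.isOpen_diff hB).measurableSet h

namespace Fields

variable (hM : M.Admissible) (hZ : Z.Regular M) (ht : t ∈ Ioo 0 M.T)
include hM hZ ht

/-- The divergence theorem in the current configuration. -/
lemma integral_divVec (hdim : Module.finrank ℝ E = 3) {Y : E → E} (hY : PiecewiseC 1 M.B M.S M.m Y)
    (h0 : VanishesOnBoundary M.B M.S Y) :
    ∫ X in M.B, Z.jac t X * Z.divVec t Y X =
      -∫ X in M.S, jump (M.m X) X (fun Q => ⟪Y Q, Z.areaVec t (M.m X) Q⟫_ℝ) ∂μHE[2] :=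
  (isDeformation hM hZ ht).integral_div hdim hM.isOpen hM.isBounded hM.interface hY h0

lemma slice_jac : BddContOn (M.B \ M.S) (Z.jac t) := (bddContOn_jac hM hZ).slice ht

lemma slice_phiF : BddContOn (M.B \ M.S) (Z.phiF M t) := (phiF_regular hM hZ ht).bddContOn

lemma slice_densS : BddContOn (M.B \ M.S) (Z.densS M t) :=
  (BddContOn.const _).mul (phiS_regular hM hZ ht).bddContOn

lemma slice_densF : BddContOn (M.B \ M.S) (Z.densF M t) :=
  (BddContOn.const _).mul (slice_phiF hM hZ ht)

lemma slice_grad {V : Type*} [NormedAddCommGroup V] [NormedSpace ℝ V] [FiniteDimensional ℝ V]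
    {f : E → V} (hf : PiecewiseC 1 M.B M.S M.m f) : BddContOn (M.B \ M.S) (Z.grad t f) :=
  (grad_regular hM hZ ht hf).bddContOn

lemma slice_divVec {f : E → E} (hf : PiecewiseC 1 M.B M.S M.m f) :
    BddContOn (M.B \ M.S) (Z.divVec t f) := (slice_grad hM hZ ht hf).comp continuous_tr

lemma slice_gradScalar {f : E → ℝ} (hf : PiecewiseC 1 M.B M.S M.m f) :
    BddContOn (M.B \ M.S) (Z.gradScalar t f) :=
  (defGradInv_regular hM hZ ht).bddContOn.transpose.clm_apply
    ((hf.fderiv hM.isOpen hM.interface).bddContOn.comp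
      (InnerProductSpace.toDual ℝ E).symm.continuous)

lemma slice_divTensor {A : E → Tensor E} (hA : PiecewiseC 1 M.B M.S M.m A) :
    BddContOn (M.B \ M.S) (Z.divTensor t A) :=
  BddContOn.fin_sum fun _ => ((slice_grad hM hZ ht hA).clm_apply (BddContOn.const _)).clm_apply
    (BddContOn.const _)

lemma slice_Ls : BddContOn (M.B \ M.S) (Z.Ls t) := slice_grad hM hZ ht (vs_regular hM hZ ht)

lemma slice_Lf : BddContOn (M.B \ M.S) (Z.Lf t) := slice_grad hM hZ ht (vf_regular hM hZ ht)

lemma slice_stressElastic : BddContOn (M.B \ M.S) (Z.stressElastic M t) := by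
  have hF := (bddContOn_defGrad hM hZ).slice ht
  have hG : BddContOn (M.B \ M.S) fun X => M.strainEnergyDeriv X (Z.rightCG t X) := by
    refine BddContOn.fin_sum fun i => BddContOn.fin_sum fun j => BddContOn.smul ?_ (BddContOn.const _)
    -- Off the interface the strain energy is differentiable, so its directional derivatives may be
    -- replaced by the chain-rule differential, whose factors are known to be continuous and
    -- bounded.
    refine BddContOn.congr ((((bddContOn_strain hM hZ).2.1.slice ht).clm_comp
      ((bddContOn_strain hM hZ).2.2.slice ht)).clm_apply
        (BddContOn.const (symPart (dyad (basisVec i) (basisVec j))))) fun X hX => ?_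
    have h := hasFDerivAt_strainEnergy hM hX (jac_ne_zero hM hZ ht hX)
    change lineDeriv ℝ _ (cauchyGreen (Z.defGrad t X)) _ = _
    rw [h.differentiableAt.lineDeriv_eq_fderiv, h.fderiv]
  refine BddContOn.smul (((BddContOn.const _).mul hM.phiR_regular.bddContOn).mul ?_)
    (hF.clm_comp (hG.clm_comp hF.transpose))
  obtain ⟨c, hc, h⟩ := hZ.jac_pos
  exact (slice_jac hM hZ ht).inv hc (h t ht)

lemma slice_stressViscS : BddContOn (M.B \ M.S) (Z.stressViscS M t) :=
  ((BddContOn.const _).mul (hM.muB_coeff.bddContOn ht)).smul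
    ((slice_Ls hM hZ ht).symPart.sub (slice_Lf hM hZ ht).symPart)

lemma slice_stressViscF : BddContOn (M.B \ M.S) (Z.stressViscF M t) :=
  (((BddContOn.const _).mul (hM.muF_coeff.bddContOn ht)).smul (slice_Lf hM hZ ht).symPart).add
    (((BddContOn.const _).mul (hM.muB_coeff.bddContOn ht)).smul
      ((slice_Lf hM hZ ht).symPart.sub (slice_Ls hM hZ ht).symPart))

lemma slice_resistance :
    BddContOn (M.B \ M.S) fun X => M.muD X t * Z.phiF M t X ^ 2 / M.kappa X t := by
  obtain ⟨c, hc, h⟩ := hM.kappa_pos t ht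
  exact ((hM.muD_coeff.bddContOn ht).mul ((slice_phiF hM hZ ht).comp (continuous_pow 2))).mul
    ((hM.kappa_coeff.bddContOn ht).inv hc h)

lemma slice_drag : BddContOn (M.B \ M.S) (Z.drag M t) :=
  ((slice_resistance hM hZ ht).smul (vrel_regular hM hZ ht).bddContOn).neg

lemma slice_dissipation : BddContOn (M.B \ M.S) (Z.dissipation M t) := by
  have hD := (slice_Lf hM hZ ht).symPart
  have hDD := hD.sub (slice_Ls hM hZ ht).symPart
  exact ((((BddContOn.const _).mul (hM.muF_coeff.bddContOn ht)).mul (hD.ddot hD)).add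
    (((BddContOn.const _).mul (hM.muB_coeff.bddContOn ht)).mul (hDD.ddot hDD))).add
      ((slice_resistance hM hZ ht).mul (vrel_regular hM hZ ht).bddContOn.norm_sq)

lemma slice_jumpFlt : BddContOn M.S (Z.jumpFlt M t) :=
  (vflt_regular hM hZ ht).bddContOn_jump hM.interface

lemma slice_jac_power : BddContOn (M.B \ M.S) fun X => Z.jac t X * Z.power M t X :=
  ((bddContOn_energyRefRate hM hZ).slice ht).congr fun _ hX => jac_mul_power hM hZ ht hX

lemma slice_jac_energyDensity : BddContOn (M.B \ M.S) fun X => Z.jac t X * Z.energyDensity M t X :=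
  ((bddContOn_energyRef hM hZ).slice ht).congr fun _ hX => jac_mul_energyDensity hM hZ ht hX

variable (hdim : Module.finrank ℝ E = 3)
include hdim

lemma integrableOn_of_slice {f : E → ℝ} (hf : BddContOn (M.B \ M.S) f) : IntegrableOn f M.B :=
  hf.integrableOn_diff hdim hM.isOpen hM.isBounded hM.interface

end Fields

end Balance

/-! ### The weak form tested with the actual velocities. -/

section WeakBalance

variable {M : Mixture E} {Z : Fields E} {t : ℝ} {X : E}

namespace Fields

variable (hM : M.Admissible) (hZ : Z.Regular M) (ht : t ∈ Ioo 0 M.T)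
include hM hZ ht

lemma hasTraces_of_regular {V : Type*} [NormedAddCommGroup V] [NormedSpace ℝ V] {n : ℕ} {k : E → V}
    (hk : PiecewiseC n M.B M.S M.m k) : HasTraces M.S M.m (fun _ Y => k Y)
      (fun X => sideLim (M.m X) X k) (fun X => sideLim (-M.m X) X k) :=
  HasTraces.of_piecewise hM.interface hk

lemma hasTraces_vs : HasTraces M.S M.m (fun _ Y => Z.vs t Y) (Z.vs t) (Z.vs t) :=
  HasTraces.of_continuous hM.isOpen hM.interface (vs_regular hM hZ ht) (continuousOn_vs hM hZ ht)

lemma hasTraces_vf : HasTraces M.S M.m (fun _ Y => Z.vf t Y)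
    (fun X => Z.vs t X + sideLim (M.m X) X (Z.vrel t))
    (fun X => Z.vs t X + sideLim (-M.m X) X (Z.vrel t)) :=
  ((hasTraces_vs hM hZ ht).add (hasTraces_of_regular hM hZ ht (vrel_regular hM hZ ht))).congr
    fun _ Y => by simp [vrel]

/-- The solid velocity is continuous across the interface, so its square has a single value there
and may be added to the multiplier. -/
lemma isSurfaceTest_multiplier : IsSurfaceTest M fun X => Z.q X t + M.rhoF * ‖Z.vs t X‖ ^ 2 := by
  have hv := (hasTraces_vs hM hZ ht).bdd_pos
  have h : BddContOn M.S fun X => Z.q X t + M.rhoF * ‖Z.vs t X‖ ^ 2 :=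
    BddContOn.add (k := fun X => Z.q X t) ⟨hZ.q_continuous t ht, hZ.q_bounded t ht⟩
      ((BddContOn.const _).mul hv.norm_sq)
  exact ⟨h.continuousOn, h.bounded⟩

/-- The surface terms of the weak formulation are integrable. -/
lemma surface_integrable {a b : E → E} {π r : E → ℝ} (ha : IsSolidTest M a) (hb : IsFluidTest M b)
    (hπ : PiecewiseC 1 M.B M.S M.m π) (hr : IsSurfaceTest M r) :
    BddContOn M.S (fun X => ⟪jump (M.m X) X (fun Y =>
        (Z.densF M t Y • dyad (Z.vrel t Y) (Z.vrel t Y)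
          + Z.p Y t • ContinuousLinearMap.id ℝ E) (Z.areaVec t (M.m X) Y)), a X⟫_ℝ) ∧
    BddContOn M.S (fun X => jump (M.m X) X (fun Y =>
        ⟪(Z.kF M t Y • ContinuousLinearMap.id ℝ E
          - Z.densF M t Y • dyad (Z.vf t Y) (Z.vrel t Y)) (Z.areaVec t (M.m X) Y), b Y⟫_ℝ)) ∧
    BddContOn M.S (fun X => jump (M.m X) X (fun Y =>
        ⟪((Z.phiF M t Y * (Z.q X t - Z.p Y t)) • ContinuousLinearMap.id ℝ E
          - (1 / 2 * Z.phiF M t Y * M.muS) • dyad (Z.jumpFlt M t X) (Z.normal t (M.m X) Y))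
            (Z.areaVec t (M.m X) Y), b Y⟫_ℝ)) ∧
    BddContOn M.S (fun X => jump (M.m X) X (fun Y =>
        ⟪π Y • (Z.vs t Y + Z.vflt M t Y), Z.areaVec t (M.m X) Y⟫_ℝ)) ∧
    BddContOn M.S (fun X => r X * jump (M.m X) X
      (fun Y => ⟪Z.vflt M t Y, Z.areaVec t (M.m X) Y⟫_ℝ)) := by
  have hφ := hasTraces_of_regular hM hZ ht (phiF_regular hM hZ ht)
  have hw := hasTraces_of_regular hM hZ ht (vrel_regular hM hZ ht)
  have hp := hasTraces_of_regular hM hZ ht (hZ.p_regular t ht)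
  have hq := HasTraces.of_bddContOn (m := M.m)
    (⟨hZ.q_continuous t ht, hZ.q_bounded t ht⟩ : BddContOn M.S fun X => Z.q X t)
  have hN := hasTraces_areaVec hM hZ ht
  have hv := hasTraces_vs hM hZ ht
  have hbt := hasTraces_of_regular hM hZ ht hb.regular
  exact ⟨(hasTraces_convTraction hφ hw hN hp).bddContOn_jump.inner
      (HasTraces.of_continuous hM.isOpen hM.interface ha.regular ha.continuous).bdd_pos,
    (hasTraces_kinetic hφ hw (hasTraces_vf hM hZ ht) hN hbt).bddContOn_jump,
    (hasTraces_slip hφ hN (hq.sub hp) (slice_jumpFlt hM hZ ht) hbt).bddContOn_jump,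
    (hasTraces_pressureFlux hφ hv hw hN (hasTraces_of_regular hM hZ ht hπ)).bddContOn_jump,
    hr.bddContOn.mul (hasTraces_flux hφ hw hN).bddContOn_jump⟩

/-- The volume terms of the weak formulation are integrable. -/
lemma volume_integrable {a b : E → E} {π : E → ℝ} (ha : IsSolidTest M a) (hb : IsFluidTest M b)
    (hπ : PiecewiseC 1 M.B M.S M.m π) :
    BddContOn (M.B \ M.S) (fun X => Z.jac t X *
      ⟪Z.densS M t X • Z.as t X + Z.densF M t X • Z.af t X
        + Z.gradScalar t (fun Y => Z.p Y t) X, a X⟫_ℝ) ∧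
    BddContOn (M.B \ M.S) (fun X => Z.jac t X *
      ddot ((Z.stressElastic M t X + Z.stressViscS M t X + Z.stressViscF M t X)
        ∘L transpose (Z.defGradInv t X)) (fderiv ℝ a X)) ∧
    BddContOn (M.B \ M.S) (fun X => Z.jac t X *
      (⟪Z.densF M t X • Z.af t X + Z.phiF M t X • Z.gradScalar t (fun Y => Z.p Y t) X
          - Z.drag M t X, b X⟫_ℝ
        + ddot (Z.stressViscF M t X ∘L transpose (Z.defGradInv t X)) (fderiv ℝ b X))) ∧
    BddContOn (M.B \ M.S) (fun X => Z.jac t X *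
      ⟪Z.vs t X + Z.vflt M t X, Z.gradScalar t π X⟫_ℝ) := by
  have hJ := slice_jac hM hZ ht
  have hG := (defGradInv_regular hM hZ ht).bddContOn.transpose
  have hp := slice_gradScalar hM hZ ht (hZ.p_regular t ht)
  have hf := (slice_densF hM hZ ht).smul (af_regular hM hZ ht).bddContOn
  exact ⟨hJ.mul (((((slice_densS hM hZ ht).smul (as_regular hM hZ ht).bddContOn).add hf).add
      hp).inner ha.regular.bddContOn),
    hJ.mul (((((slice_stressElastic hM hZ ht).add (slice_stressViscS hM hZ ht)).add
      (slice_stressViscF hM hZ ht)).clm_comp hG).ddot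
        (ha.regular.fderiv hM.isOpen hM.interface).bddContOn),
    hJ.mul ((((hf.add ((slice_phiF hM hZ ht).smul hp)).sub (slice_drag hM hZ ht)).inner
      hb.regular.bddContOn).add (((slice_stressViscF hM hZ ht).clm_comp hG).ddot
        (hb.regular.fderiv hM.isOpen hM.interface).bddContOn)),
    hJ.mul (((vs_regular hM hZ ht).bddContOn.add (vflt_regular hM hZ ht).bddContOn).inner
      (slice_gradScalar hM hZ ht hπ))⟩

/-- The surface terms of the weak formulation, for the actual velocities as test functions. -/
lemma weak_surface (hX : X ∈ M.S) :
    ⟪jump (M.m X) X (fun Y =>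
        (Z.densF M t Y • dyad (Z.vrel t Y) (Z.vrel t Y)
          + Z.p Y t • ContinuousLinearMap.id ℝ E) (Z.areaVec t (M.m X) Y)), Z.vs t X⟫_ℝ
    - jump (M.m X) X (fun Y =>
        ⟪(Z.kF M t Y • ContinuousLinearMap.id ℝ E
          - Z.densF M t Y • dyad (Z.vf t Y) (Z.vrel t Y)) (Z.areaVec t (M.m X) Y), Z.vrel t Y⟫_ℝ)
    - jump (M.m X) X (fun Y =>
        ⟪((Z.phiF M t Y * (Z.q X t - Z.p Y t)) • ContinuousLinearMap.id ℝ E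
          - (1 / 2 * Z.phiF M t Y * M.muS) • dyad (Z.jumpFlt M t X) (Z.normal t (M.m X) Y))
            (Z.areaVec t (M.m X) Y), Z.vrel t Y⟫_ℝ)
    - jump (M.m X) X (fun Y => ⟪(Z.p Y t + 1 / 2 * M.rhoF * ‖Z.vf t Y‖ ^ 2) •
        (Z.vs t Y + Z.vflt M t Y), Z.areaVec t (M.m X) Y⟫_ℝ)
    + (Z.q X t + M.rhoF * ‖Z.vs t X‖ ^ 2) *
        jump (M.m X) X (fun Y => ⟪Z.vflt M t Y, Z.areaVec t (M.m X) Y⟫_ℝ)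
    = ‖Z.areaTrace M t X‖ * Z.surfaceDissipation M t X
      - jump (M.m X) X (fun Y => ⟪(1 / 2 * M.rhoF * ‖Z.vf t Y‖ ^ 2) • Z.vs t Y,
          Z.areaVec t (M.m X) Y⟫_ℝ) := by
  have hφ := hasTraces_of_regular hM hZ ht (phiF_regular hM hZ ht)
  have hw := hasTraces_of_regular hM hZ ht (vrel_regular hM hZ ht)
  have hp := hasTraces_of_regular hM hZ ht (hZ.p_regular t ht)
  have hq := HasTraces.of_bddContOn (m := M.m)
    (⟨hZ.q_continuous t ht, hZ.q_bounded t ht⟩ : BddContOn M.S fun X => Z.q X t)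
  have hN := hasTraces_areaVec hM hZ ht
  have hv := hasTraces_vs hM hZ ht
  have hf := hasTraces_vf hM hZ ht
  have hk := (HasTraces.of_bddContOn (BddContOn.const (1 / 2 * M.rhoF))).mul hf.norm_sq
  have hj : Z.jumpFlt M t X = _ := (hφ.smul hw).jump_eq hX
  rw [(hasTraces_convTraction hφ hw hN hp).jump_eq hX, (hasTraces_kinetic hφ hw hf hN hw).jump_eq hX,
    (hasTraces_slip hφ hN (hq.sub hp) (slice_jumpFlt hM hZ ht) hw).jump_eq hX,
    (hasTraces_pressureFlux (π := fun Y => Z.p Y t + 1 / 2 * M.rhoF * ‖Z.vf t Y‖ ^ 2) hφ hv hw hN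
      (hp.add hk)).jump_eq hX,
    (hasTraces_flux hφ hw hN).jump_eq hX, ((hk.smul hv).inner hN).jump_eq hX, surfaceDissipation]
  -- Only one of the two factors is expanded in traces; the other stays abstract, since the slip
  -- terms are linear in it.
  have h1 : ∀ c, c * ‖Z.jumpFlt M t X‖ ^ 2 = c * ⟪Z.jumpFlt M t X,
      sideLim (M.m X) X (Z.phiF M t) • sideLim (M.m X) X (Z.vrel t) -
        sideLim (-M.m X) X (Z.phiF M t) • sideLim (-M.m X) X (Z.vrel t)⟫_ℝ := fun c => by
    rw [← hj, real_inner_self_eq_norm_sq]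
  rw [h1]
  -- What remains is algebra on each side. With `v_f = v + w`, the kinetic coefficient of the flux
  -- `φ w·N` is `w·v + v_f·w - |v_f|² = -|v|²`, which the term `ρ_F|v|²` of the multiplier test
  -- compensates.
  generalize sideLim (M.m X) X (Z.vrel t) = w, sideLim (-M.m X) X (Z.vrel t) = w',
    sideLim (M.m X) X (Z.phiF M t) = φ, sideLim (-M.m X) X (Z.phiF M t) = φ', Z.vs t X = v,
    Z.areaTrace M t X = N, Z.jumpFlt M t X = j
  simp only [← real_inner_self_eq_norm_sq (v + w), ← real_inner_self_eq_norm_sq (v + w'),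
    ← real_inner_self_eq_norm_sq v, inner_add_left, inner_add_right, inner_sub_left, inner_sub_right,
    real_inner_smul_left, real_inner_smul_right]
  rw [real_inner_comm w v, real_inner_comm w' v, real_inner_comm v N, real_inner_comm w N,
    real_inner_comm w' N]
  ring

end Fields

end WeakBalance

/-! ### The energy identity contained in the weak form. -/

section StabilityOfWeakSolutions

variable {M : Mixture E} {Z : Fields E} {t : ℝ}

lemma integral_add_add_sub {α : Type*} [MeasurableSpace α] {μ : Measure α} {f₁ f₂ f₃ f₄ : α → ℝ}
    (h₁ : Integrable f₁ μ) (h₂ : Integrable f₂ μ) (h₃ : Integrable f₃ μ) (h₄ : Integrable f₄ μ) :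
    ∫ x, f₁ x + f₂ x + f₃ x - f₄ x ∂μ =
      ∫ x, f₁ x ∂μ + ∫ x, f₂ x ∂μ + ∫ x, f₃ x ∂μ - ∫ x, f₄ x ∂μ := by
  change ∫ x, (f₁ + f₂ + f₃ - f₄) x ∂μ = _
  rw [integral_sub' ((h₁.add h₂).add h₃) h₄, integral_add' (h₁.add h₂) h₃, integral_add' h₁ h₂]

lemma integral_sub_sub_sub_add {α : Type*} [MeasurableSpace α] {μ : Measure α}
    {f₁ f₂ f₃ f₄ f₅ : α → ℝ} (h₁ : Integrable f₁ μ) (h₂ : Integrable f₂ μ) (h₃ : Integrable f₃ μ)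
    (h₄ : Integrable f₄ μ) (h₅ : Integrable f₅ μ) :
    ∫ x, f₁ x - f₂ x - f₃ x - f₄ x + f₅ x ∂μ =
      ∫ x, f₁ x ∂μ - ∫ x, f₂ x ∂μ - ∫ x, f₃ x ∂μ - ∫ x, f₄ x ∂μ + ∫ x, f₅ x ∂μ := by
  change ∫ x, (f₁ - f₂ - f₃ - f₄ + f₅) x ∂μ = _
  rw [integral_add' (((h₁.sub h₂).sub h₃).sub h₄) h₅, integral_sub' ((h₁.sub h₂).sub h₃) h₄,
    integral_sub' (h₁.sub h₂) h₃, integral_sub' h₁ h₂]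

namespace Fields

variable (hM : M.Admissible) (hZ : Z.Regular M) (ht : t ∈ Ioo 0 M.T)
include hM hZ ht

/-- All nine integrands are bounded, so the integrals merge into one over the bulk and one over the
interface. Cancellations between terms can then be carried out pointwise. -/
lemma weakForm_eq (hdim : Module.finrank ℝ E = 3) {a b : E → E} {π r : E → ℝ}
    (ha : IsSolidTest M a) (hb : IsFluidTest M b) (hπ : PiecewiseC 1 M.B M.S M.m π)
    (hr : IsSurfaceTest M r) : Z.weakForm M t a b π r =
    (∫ X in M.B, Z.jac t X * ⟪Z.densS M t X • Z.as t X + Z.densF M t X • Z.af t X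
        + Z.gradScalar t (fun Y => Z.p Y t) X, a X⟫_ℝ
      + Z.jac t X * ddot ((Z.stressElastic M t X + Z.stressViscS M t X + Z.stressViscF M t X)
        ∘L transpose (Z.defGradInv t X)) (fderiv ℝ a X)
      + Z.jac t X * (⟪Z.densF M t X • Z.af t X + Z.phiF M t X • Z.gradScalar t (fun Y => Z.p Y t) X
          - Z.drag M t X, b X⟫_ℝ
        + ddot (Z.stressViscF M t X ∘L transpose (Z.defGradInv t X)) (fderiv ℝ b X))
      - Z.jac t X * ⟪Z.vs t X + Z.vflt M t X, Z.gradScalar t π X⟫_ℝ)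
    + ∫ X in M.S, ⟪jump (M.m X) X (fun Y =>
        (Z.densF M t Y • dyad (Z.vrel t Y) (Z.vrel t Y)
          + Z.p Y t • ContinuousLinearMap.id ℝ E) (Z.areaVec t (M.m X) Y)), a X⟫_ℝ
      - jump (M.m X) X (fun Y =>
        ⟪(Z.kF M t Y • ContinuousLinearMap.id ℝ E
          - Z.densF M t Y • dyad (Z.vf t Y) (Z.vrel t Y)) (Z.areaVec t (M.m X) Y), b Y⟫_ℝ)
      - jump (M.m X) X (fun Y =>
        ⟪((Z.phiF M t Y * (Z.q X t - Z.p Y t)) • ContinuousLinearMap.id ℝ E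
          - (1 / 2 * Z.phiF M t Y * M.muS) • dyad (Z.jumpFlt M t X) (Z.normal t (M.m X) Y))
            (Z.areaVec t (M.m X) Y), b Y⟫_ℝ)
      - jump (M.m X) X (fun Y => ⟪π Y • (Z.vs t Y + Z.vflt M t Y), Z.areaVec t (M.m X) Y⟫_ℝ)
      + r X * jump (M.m X) X (fun Y => ⟪Z.vflt M t Y, Z.areaVec t (M.m X) Y⟫_ℝ) ∂μHE[2] := by
  obtain ⟨v1, v2, v3, v4⟩ := volume_integrable hM hZ ht ha hb hπ
  obtain ⟨s1, s2, s3, s4, s5⟩ := surface_integrable hM hZ ht ha hb hπ hr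
  have v1 := integrableOn_of_slice hM hZ ht hdim v1
  have v2 := integrableOn_of_slice hM hZ ht hdim v2
  have v3 := integrableOn_of_slice hM hZ ht hdim v3
  have v4 := integrableOn_of_slice hM hZ ht hdim v4
  have s1 := s1.integrableOn hM.isOpen hM.interface
  have s2 := s2.integrableOn hM.isOpen hM.interface
  have s3 := s3.integrableOn hM.isOpen hM.interface
  have s4 := s4.integrableOn hM.isOpen hM.interface
  have s5 := s5.integrableOn hM.isOpen hM.interface
  rw [integral_add_add_sub v1 v2 v3 v4, integral_sub_sub_sub_add s1 s2 s3 s4 s5, weakForm]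
  ring

lemma slice_surfaceDissipation :
    BddContOn M.S fun X => ‖Z.areaTrace M t X‖ * Z.surfaceDissipation M t X :=
  ((bddContOn_areaTrace hM hZ ht).comp continuous_norm).mul
    ((BddContOn.const (1 / 2 * M.muS)).mul (slice_jumpFlt hM hZ ht).norm_sq)

/-- The pointwise identities leave the divergence of `½ρ_F|v_f|² v_s` in the bulk and the jump of
its flux on the interface. The field vanishes on the boundary because `v_s` does, so the two cancel.
-/
lemma weakForm_velocities (hdim : Module.finrank ℝ E = 3) (hbc : Z.ZeroBoundaryData M) :
    Z.weakForm M t (Z.vs t) (Z.vrel t) (fun Y => Z.p Y t + 1 / 2 * M.rhoF * ‖Z.vf t Y‖ ^ 2)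
        (fun X => Z.q X t + M.rhoF * ‖Z.vs t X‖ ^ 2) =
      (∫ X in M.B, Z.jac t X * Z.power M t X) + (∫ X in M.B, Z.jac t X * Z.dissipation M t X) +
        ∫ X in M.S, ‖Z.areaTrace M t X‖ * Z.surfaceDissipation M t X ∂μHE[2] := by
  have hk := kinetic_regular hM hZ ht
  have hkv : PiecewiseC 1 M.B M.S M.m fun Y => (1 / 2 * M.rhoF * ‖Z.vf t Y‖ ^ 2) • Z.vs t Y :=
    hk.comp₂ le_rfl hM.isOpen hM.interface (vs_regular hM hZ ht)
      (φ := fun (a : ℝ) (b : E) => a • b) (contDiff_fst.smul contDiff_snd)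
  have hπ : PiecewiseC 1 M.B M.S M.m fun Y => Z.p Y t + 1 / 2 * M.rhoF * ‖Z.vf t Y‖ ^ 2 :=
    (hZ.p_regular t ht).comp₂ le_rfl hM.isOpen hM.interface hk (φ := fun a b : ℝ => a + b)
      (contDiff_fst.add contDiff_snd)
  rw [weakForm_eq hM hZ ht hdim (isSolidTest_vs hM hZ ht hbc) (isFluidTest_vrel hM hZ ht hbc) hπ
    (isSurfaceTest_multiplier hM hZ ht),
    setIntegral_congr_diff hdim hM.isOpen hM.interface fun X hX => weak_integrand hM hZ ht hX,
    setIntegral_congr_fun (hM.interface.measurableSet hM.isOpen) fun X hX => weak_surface hM hZ ht hX]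
  have hJ := slice_jac hM hZ ht
  have v1 := integrableOn_of_slice hM hZ ht hdim (slice_jac_power hM hZ ht)
  have v2 := integrableOn_of_slice hM hZ ht hdim (hJ.mul (slice_dissipation hM hZ ht))
  have v3 := integrableOn_of_slice hM hZ ht hdim (hJ.mul (slice_divVec hM hZ ht hkv))
  have s1 := (slice_surfaceDissipation hM hZ ht).integrableOn hM.isOpen hM.interface
  have s2 := (((hasTraces_of_regular hM hZ ht hkv).inner
    (hasTraces_areaVec hM hZ ht)).bddContOn_jump).integrableOn hM.isOpen hM.interface
  have h3 := integral_sub (v1.add v2) v3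
  simp only [Pi.add_apply, integral_add v1 v2] at h3
  rw [h3, integral_sub s1 s2, integral_divVec hM hZ ht hdim hkv ((vs_boundary hM hZ ht hbc).smul hk.bddContOn)]
  ring

end Fields

end StabilityOfWeakSolutions

/-! ### From the Hamilton-Rayleigh form to the weak form -/

section Equivalence

variable {M : Mixture E} {Z : Fields E} {t : ℝ} {X : E}

namespace Fields

lemma divVec_add {f g : E → E} (hf : DifferentiableAt ℝ f X) (hg : DifferentiableAt ℝ g X) :
    Z.divVec t (fun Y => f Y + g Y) X = Z.divVec t f X + Z.divVec t g X := by
  rw [divVec, grad, fderiv_fun_add hf hg, ContinuousLinearMap.add_comp, tr_add]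
  rfl

lemma divVec_transpose {A : E → Tensor E} {y : E → E} (hA : DifferentiableAt ℝ A X)
    (hy : DifferentiableAt ℝ y X) : Z.divVec t (fun Y => transpose (A Y) (y Y)) X =
      ⟪Z.divTensor t A X, y X⟫_ℝ + ddot (A X) (Z.grad t y X) := by
  have h1 : HasFDerivAt (fun Y => transpose (A Y)) (transposeCLM ∘L fderiv ℝ A X) X :=
    HasFDerivAt.comp (g := transposeCLM) X (transposeCLM (E := E)).hasFDerivAt hA.hasFDerivAt
  have h2 := h1.clm_apply hy.hasFDerivAt
  have h3 : Z.divVec t (fun Y => transpose (A Y) (y Y)) X =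
      tr (transpose (A X) ∘L Z.grad t y X) +
        ∑ j, ⟪transpose (Z.grad t A X (basisVec j)) (y X), basisVec j⟫_ℝ := by
    rw [divVec, grad, h2.fderiv, ContinuousLinearMap.add_comp, tr_add]
    congr 1
    rw [tr_eq_sum]
    rfl
  rw [h3, ddot, add_comm, divTensor, sum_inner]
  congr 1
  exact Finset.sum_congr rfl fun j _ => by rw [inner_transpose_left, real_inner_comm]

/-- The volume fractions add up to one, so the partial pressures add up to the pore pressure. -/
lemma stress_add : Z.stressS M t X + Z.stressF M t X =
    -(Z.p X t • ContinuousLinearMap.id ℝ E) + (Z.stressElastic M t X + Z.stressViscS M t X +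
      Z.stressViscF M t X) := by
  have h : Z.p X t = Z.phiS M t X * Z.p X t + Z.phiF M t X * Z.p X t := by simp only [phiF]; ring
  rw [stressS, stressF]
  conv_rhs => rw [h, add_smul]
  abel

lemma ddot_id_left (H : Tensor E) : ddot (ContinuousLinearMap.id ℝ E) H = tr H := by
  rw [ddot, transpose_id, ContinuousLinearMap.id_comp]

variable (hM : M.Admissible) (hZ : Z.Regular M) (ht : t ∈ Ioo 0 M.T)
include hM hZ ht

/-- Adding `p a` under the divergence removes the pressure from the total stress, so only the
elastic and viscous stresses are paired with the gradient of `a`. -/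
lemma solid_integrand (hS : PiecewiseC 1 M.B M.S M.m (Z.stressS M t))
    (hF : PiecewiseC 1 M.B M.S M.m (Z.stressF M t)) {a : E → E} (ha : PiecewiseC 1 M.B M.S M.m a)
    (hX : X ∈ M.B \ M.S) :
    Z.jac t X * ⟪Z.densS M t X • Z.as t X + Z.densF M t X • Z.af t X
        + Z.gradScalar t (fun Y => Z.p Y t) X, a X⟫_ℝ
      + Z.jac t X * ddot ((Z.stressElastic M t X + Z.stressViscS M t X + Z.stressViscF M t X)
        ∘L transpose (Z.defGradInv t X)) (fderiv ℝ a X)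
    = Z.jac t X * ⟪Z.densS M t X • Z.as t X + Z.densF M t X • Z.af t X
        - Z.divTensor t (fun Y => Z.stressS M t Y + Z.stressF M t Y) X, a X⟫_ℝ
      + Z.jac t X * Z.divVec t (fun Y => transpose (Z.stressS M t Y + Z.stressF M t Y) (a Y)
          + Z.p Y t • a Y) X := by
  have ha := ha.differentiableAt hM.isOpen hM.interface hX
  have hT : DifferentiableAt ℝ (fun Y => Z.stressS M t Y + Z.stressF M t Y) X :=
    (hS.differentiableAt hM.isOpen hM.interface hX).add
      (hF.differentiableAt hM.isOpen hM.interface hX)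
  have hp := (hZ.p_regular t ht).differentiableAt hM.isOpen hM.interface hX
  have hTa : DifferentiableAt ℝ (fun Y => transpose (Z.stressS M t Y + Z.stressF M t Y) (a Y)) X :=
    (transposeCLM.differentiableAt.comp X hT).clm_apply ha
  rw [divVec_add hTa (hp.fun_smul ha), divVec_transpose hT ha, divVec_smul hp ha, ddot_comp_transpose,
    stress_add, ddot_add_left (A := -_), ← neg_smul, ddot_smul_left, ddot_id_left]
  change _ + Z.jac t X * ddot _ (Z.grad t a X) = _ + Z.jac t X * (_ + (-_ * Z.divVec t a X + _) + _)
  rw [inner_add_left, inner_sub_left, real_inner_comm (a X) (Z.gradScalar t _ X)]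
  ring

/-- In the product rule for the gradient of `φ_f p`, the part `p ∇φ_f` cancels against the
interaction force, and `φ_f ∇p` remains. -/
lemma fluid_integrand (hF : PiecewiseC 1 M.B M.S M.m (Z.stressF M t)) {b : E → E}
    (hb : PiecewiseC 1 M.B M.S M.m b) (hX : X ∈ M.B \ M.S) :
    Z.jac t X * (⟪Z.densF M t X • Z.af t X + Z.phiF M t X • Z.gradScalar t (fun Y => Z.p Y t) X
          - Z.drag M t X, b X⟫_ℝ
        + ddot (Z.stressViscF M t X ∘L transpose (Z.defGradInv t X)) (fderiv ℝ b X))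
    = Z.jac t X * ⟪Z.densF M t X • Z.af t X - Z.divTensor t (Z.stressF M t) X
        - Z.interaction M t X, b X⟫_ℝ
      + Z.jac t X * Z.divVec t (fun Y => transpose (Z.stressF M t Y) (b Y)
          + (Z.phiF M t Y * Z.p Y t) • b Y) X := by
  have hb := hb.differentiableAt hM.isOpen hM.interface hX
  have hT := hF.differentiableAt hM.isOpen hM.interface hX
  have hp := (hZ.p_regular t ht).differentiableAt hM.isOpen hM.interface hX
  have hφ := (phiF_regular hM hZ ht).differentiableAt hM.isOpen hM.interface hX
  have hTb : DifferentiableAt ℝ (fun Y => transpose (Z.stressF M t Y) (b Y)) X :=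
    (transposeCLM.differentiableAt.comp X hT).clm_apply hb
  have hφp : DifferentiableAt ℝ (fun Y => Z.phiF M t Y * Z.p Y t) X := hφ.mul hp
  have h1 : ⟪b X, Z.gradScalar t (fun Y => Z.phiF M t Y * Z.p Y t) X⟫_ℝ =
      Z.phiF M t X * ⟪Z.gradScalar t (fun Y => Z.p Y t) X, b X⟫_ℝ +
        Z.p X t * ⟪Z.gradScalar t (Z.phiF M t) X, b X⟫_ℝ := by
    rw [inner_gradScalar, fderiv_fun_mul hφ hp, gradScalar_inner, gradScalar_inner]
    rfl
  rw [divVec_add hTb (hφp.fun_smul hb), divVec_transpose hT hb, divVec_smul hφp hb, ddot_comp_transpose,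
    stressF, ddot_add_left (A := -_), ← neg_smul, ddot_smul_left, ddot_id_left, h1, interaction]
  change Z.jac t X * (_ + ddot _ (Z.grad t b X)) =
    _ + Z.jac t X * (_ + (-_ * Z.divVec t b X + _) + _)
  simp only [inner_add_left, inner_sub_left, real_inner_smul_left]
  ring

lemma pressure_integrand {π : E → ℝ} (hπ : PiecewiseC 1 M.B M.S M.m π)
    (h0 : Z.divVec t (fun Y => Z.vs t Y + Z.vflt M t Y) X = 0) (hX : X ∈ M.B \ M.S) :
    Z.jac t X * ⟪Z.vs t X + Z.vflt M t X, Z.gradScalar t π X⟫_ℝ =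
      Z.jac t X * Z.divVec t (fun Y => π Y • (Z.vs t Y + Z.vflt M t Y)) X := by
  have hv : DifferentiableAt ℝ (fun Y => Z.vs t Y + Z.vflt M t Y) X :=
    ((vs_regular hM hZ ht).differentiableAt hM.isOpen hM.interface hX).add
      ((vflt_regular hM hZ ht).differentiableAt hM.isOpen hM.interface hX)
  rw [divVec_smul (hπ.differentiableAt hM.isOpen hM.interface hX) hv, h0, mul_zero, zero_add]

end Fields

end Equivalence

/-! ### Comparison of the interface terms of the two forms. -/

section Tractions

variable {M : Mixture E} {Z : Fields E} {t : ℝ} {X : E}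

namespace Fields

variable (hM : M.Admissible) (hZ : Z.Regular M) (ht : t ∈ Ioo 0 M.T)
include hM hZ ht

/-- The test `a` and the area vector are the same on both sides, so the two tractions differ exactly
by the flux of the field whose divergence appears in `solid_integrand`. -/
lemma solid_traction (hS : PiecewiseC 1 M.B M.S M.m (Z.stressS M t))
    (hF : PiecewiseC 1 M.B M.S M.m (Z.stressF M t)) {a : E → E} (ha : IsSolidTest M a) :
    BddContOn M.S (fun X => ⟪jump (M.m X) X (fun Y =>
        (Z.densF M t Y • dyad (Z.vrel t Y) (Z.vrel t Y) - Z.stressS M t Y - Z.stressF M t Y)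
          (Z.areaVec t (M.m X) Y)), a X⟫_ℝ) ∧
    BddContOn M.S (fun X => jump (M.m X) X (fun Y =>
        ⟪transpose (Z.stressS M t Y + Z.stressF M t Y) (a Y) + Z.p Y t • a Y,
          Z.areaVec t (M.m X) Y⟫_ℝ)) ∧
    ∀ X ∈ M.S, ⟪jump (M.m X) X (fun Y =>
        (Z.densF M t Y • dyad (Z.vrel t Y) (Z.vrel t Y)
          + Z.p Y t • ContinuousLinearMap.id ℝ E) (Z.areaVec t (M.m X) Y)), a X⟫_ℝ =
      ⟪jump (M.m X) X (fun Y =>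
        (Z.densF M t Y • dyad (Z.vrel t Y) (Z.vrel t Y) - Z.stressS M t Y - Z.stressF M t Y)
          (Z.areaVec t (M.m X) Y)), a X⟫_ℝ +
      jump (M.m X) X (fun Y =>
        ⟪transpose (Z.stressS M t Y + Z.stressF M t Y) (a Y) + Z.p Y t • a Y,
          Z.areaVec t (M.m X) Y⟫_ℝ) := by
  have hφ := hasTraces_of_regular hM hZ ht (phiF_regular hM hZ ht)
  have hw := hasTraces_of_regular hM hZ ht (vrel_regular hM hZ ht)
  have hp := hasTraces_of_regular hM hZ ht (hZ.p_regular t ht)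
  have hN := hasTraces_areaVec hM hZ ht
  have hat := HasTraces.of_continuous hM.isOpen hM.interface ha.regular ha.continuous
  have hSN := (hasTraces_of_regular hM hZ ht hS).apply hN
  have hFN := (hasTraces_of_regular hM hZ ht hF).apply hN
  -- A vanishing pressure leaves the convective traction alone.
  have h0 := hasTraces_convTraction hφ hw hN
    (HasTraces.of_bddContOn (m := M.m) (BddContOn.const (α := E) (A := M.S) (0 : ℝ)))
  have h1 := ((h0.sub hSN).sub hFN).congr (f' := fun X Y =>
        (Z.densF M t Y • dyad (Z.vrel t Y) (Z.vrel t Y) - Z.stressS M t Y - Z.stressF M t Y)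
          (Z.areaVec t (M.m X) Y)) fun X Y => by
    simp only [_root_.sub_apply, zero_smul, add_zero]
  have h2 := (((hSN.add hFN).add (hp.smul hN)).inner hat).congr (f' := fun X Y =>
      ⟪transpose (Z.stressS M t Y + Z.stressF M t Y) (a Y) + Z.p Y t • a Y,
          Z.areaVec t (M.m X) Y⟫_ℝ) fun X Y => by
    rw [inner_add_left, inner_transpose_left, real_inner_smul_left, inner_add_left,
      real_inner_smul_left, _root_.add_apply, real_inner_comm, real_inner_comm (a Y),
      real_inner_comm (Z.areaVec t (M.m X) Y) (a Y)]
  refine ⟨h1.bddContOn_jump.inner hat.bdd_pos, h2.bddContOn_jump, fun X hX => ?_⟩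
  rw [(hasTraces_convTraction hφ hw hN hp).jump_eq hX, h1.jump_eq hX, h2.jump_eq hX]
  simp only [inner_add_left, inner_sub_left, real_inner_smul_left]
  ring

lemma fluid_traction (hF : PiecewiseC 1 M.B M.S M.m (Z.stressF M t)) {b : E → E}
    (hb : IsFluidTest M b) :
    BddContOn M.S (fun X => jump (M.m X) X (fun Y =>
        ⟪((Z.phiF M t Y * Z.q X t) • ContinuousLinearMap.id ℝ E + Z.stressF M t Y
          - (1 / 2 * Z.phiF M t Y * M.muS) • dyad (Z.jumpFlt M t X) (Z.normal t (M.m X) Y))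
            (Z.areaVec t (M.m X) Y), -b Y⟫_ℝ)) ∧
    BddContOn M.S (fun X => jump (M.m X) X (fun Y =>
        ⟪transpose (Z.stressF M t Y) (b Y) + (Z.phiF M t Y * Z.p Y t) • b Y,
          Z.areaVec t (M.m X) Y⟫_ℝ)) ∧
    ∀ X ∈ M.S, -jump (M.m X) X (fun Y =>
        ⟪((Z.phiF M t Y * (Z.q X t - Z.p Y t)) • ContinuousLinearMap.id ℝ E
          - (1 / 2 * Z.phiF M t Y * M.muS) • dyad (Z.jumpFlt M t X) (Z.normal t (M.m X) Y))
            (Z.areaVec t (M.m X) Y), b Y⟫_ℝ) =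
      jump (M.m X) X (fun Y =>
        ⟪((Z.phiF M t Y * Z.q X t) • ContinuousLinearMap.id ℝ E + Z.stressF M t Y
          - (1 / 2 * Z.phiF M t Y * M.muS) • dyad (Z.jumpFlt M t X) (Z.normal t (M.m X) Y))
            (Z.areaVec t (M.m X) Y), -b Y⟫_ℝ) +
      jump (M.m X) X (fun Y =>
        ⟪transpose (Z.stressF M t Y) (b Y) + (Z.phiF M t Y * Z.p Y t) • b Y,
          Z.areaVec t (M.m X) Y⟫_ℝ) := by
  have hφ := hasTraces_of_regular hM hZ ht (phiF_regular hM hZ ht)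
  have hp := hasTraces_of_regular hM hZ ht (hZ.p_regular t ht)
  have hq := HasTraces.of_bddContOn (m := M.m)
    (⟨hZ.q_continuous t ht, hZ.q_bounded t ht⟩ : BddContOn M.S fun X => Z.q X t)
  have hN := hasTraces_areaVec hM hZ ht
  have hj := slice_jumpFlt hM hZ ht
  have hbt := hasTraces_of_regular hM hZ ht hb.regular
  have hbn := hbt.comp continuous_neg
  have hFN := (hasTraces_of_regular hM hZ ht hF).apply hN
  have h1 := ((hasTraces_slip hφ hN hq hj hbn).add (hFN.inner hbn)).congr (f' := fun X Y =>
        ⟪((Z.phiF M t Y * Z.q X t) • ContinuousLinearMap.id ℝ E + Z.stressF M t Y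
          - (1 / 2 * Z.phiF M t Y * M.muS) • dyad (Z.jumpFlt M t X) (Z.normal t (M.m X) Y))
            (Z.areaVec t (M.m X) Y), -b Y⟫_ℝ) fun X Y => by
    simp only [_root_.sub_apply, _root_.add_apply, inner_add_left, inner_sub_left]
    ring
  have h2 := ((hFN.add ((hφ.mul hp).smul hN)).inner hbt).congr (f' := fun X Y =>
      ⟪transpose (Z.stressF M t Y) (b Y) + (Z.phiF M t Y * Z.p Y t) • b Y,
          Z.areaVec t (M.m X) Y⟫_ℝ) fun X Y => by
    rw [inner_add_left, inner_transpose_left, real_inner_smul_left, inner_add_left,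
      real_inner_smul_left, real_inner_comm, real_inner_comm (b Y),
      real_inner_comm (Z.areaVec t (M.m X) Y) (b Y)]
  refine ⟨h1.bddContOn_jump, h2.bddContOn_jump, fun X hX => ?_⟩
  rw [(hasTraces_slip hφ hN (hq.sub hp) hj hbt).jump_eq hX, h1.jump_eq hX, h2.jump_eq hX]
  simp only [inner_add_left, inner_neg_right, real_inner_smul_left]
  ring

/-- The integrand is linear in `b`, but a jump built from limits respects this only where the traces
exist; hence the detour through them. -/
lemma kinetic_traction {b : E → E} (hb : IsFluidTest M b) (hX : X ∈ M.S) :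
    -jump (M.m X) X (fun Y =>
        ⟪(Z.kF M t Y • ContinuousLinearMap.id ℝ E
          - Z.densF M t Y • dyad (Z.vf t Y) (Z.vrel t Y)) (Z.areaVec t (M.m X) Y), b Y⟫_ℝ) =
      jump (M.m X) X (fun Y =>
        ⟪(Z.kF M t Y • ContinuousLinearMap.id ℝ E
          - Z.densF M t Y • dyad (Z.vf t Y) (Z.vrel t Y)) (Z.areaVec t (M.m X) Y), -b Y⟫_ℝ) := by
  have hφ := hasTraces_of_regular hM hZ ht (phiF_regular hM hZ ht)
  have hw := hasTraces_of_regular hM hZ ht (vrel_regular hM hZ ht)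
  have hf := hasTraces_vf hM hZ ht
  have hN := hasTraces_areaVec hM hZ ht
  have hbt := hasTraces_of_regular hM hZ ht hb.regular
  rw [(hasTraces_kinetic hφ hw hf hN hbt).jump_eq hX,
    (hasTraces_kinetic hφ hw hf hN (hbt.comp continuous_neg)).jump_eq hX]
  simp only [inner_neg_right]
  ring

end Fields

end Tractions

/-! ### Reduction of the Hamilton–Rayleigh form to the weak form. -/

section Reduction

variable {M : Mixture E} {Z : Fields E} {t : ℝ}

lemma IsFluidTest.neg {b : E → E} (hb : IsFluidTest M b) (hM : M.Admissible) :
    IsFluidTest M fun X => -b X where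
  regular := hb.regular.comp_contDiff le_rfl hM.isOpen hM.interface (φ := fun y : E => -y)
    contDiff_neg
  boundary X hX := by simpa using (hb.boundary X hX).neg

namespace Fields

variable (hM : M.Admissible) (hZ : Z.Regular M) (ht : t ∈ Ioo 0 M.T)
include hM hZ ht

/-- The weak form differs from the Hamilton-Rayleigh form by integrals of divergences. -/
lemma weakForm_eq_hamiltonForm (hdim : Module.finrank ℝ E = 3) (h : Z.SolvesHamilton M t)
    {a b : E → E} {π r : E → ℝ} (ha : IsSolidTest M a) (hb : IsFluidTest M b)
    (hπ : PiecewiseC 1 M.B M.S M.m π) (hbc : Z.ZeroBoundaryData M) :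
    Z.weakForm M t a b π r = Z.hamiltonForm M t a fun X => -b X := by
  have hJ := slice_jac hM hZ ht
  have hO := hM.isOpen
  have hI := hM.interface
  have hp := hZ.p_regular t ht
  have hTS : PiecewiseC 1 M.B M.S M.m fun Y => Z.stressS M t Y + Z.stressF M t Y :=
    h.stressS_regular.comp₂ le_rfl hO hI h.stressF_regular (φ := fun A A' : Tensor E => A + A')
      (contDiff_fst.add contDiff_snd)
  have hsmul : ∀ {k : E → ℝ} {y : E → E}, PiecewiseC 1 M.B M.S M.m k → PiecewiseC 1 M.B M.S M.m y →
      PiecewiseC 1 M.B M.S M.m fun Y => k Y • y Y := fun hk hy =>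
    hk.comp₂ le_rfl hO hI hy (φ := fun (k : ℝ) (y : E) => k • y) (contDiff_fst.smul contDiff_snd)
  have hadd : ∀ {x y : E → E}, PiecewiseC 1 M.B M.S M.m x → PiecewiseC 1 M.B M.S M.m y →
      PiecewiseC 1 M.B M.S M.m fun Y => x Y + y Y := fun hx hy =>
    hx.comp₂ le_rfl hO hI hy (φ := fun x y : E => x + y) (contDiff_fst.add contDiff_snd)
  have htr : ∀ {A : E → Tensor E} {y : E → E}, PiecewiseC 1 M.B M.S M.m A →
      PiecewiseC 1 M.B M.S M.m y → PiecewiseC 1 M.B M.S M.m fun Y => transpose (A Y) (y Y) :=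
    fun hA hy => hA.comp₂ le_rfl hO hI hy (φ := fun (A : Tensor E) (y : E) => transpose A y)
      ((contDiff_transpose.comp contDiff_fst).clm_apply contDiff_snd)
  have hφp : PiecewiseC 1 M.B M.S M.m fun Y => Z.phiF M t Y * Z.p Y t :=
    (phiF_regular hM hZ ht).comp₂ le_rfl hO hI hp (φ := fun a b : ℝ => a * b)
      (contDiff_fst.mul contDiff_snd)
  have hY1 := hadd (htr hTS ha.regular) (hsmul hp ha.regular)
  have hY2 := hadd (htr h.stressF_regular hb.regular) (hsmul hφp hb.regular)
  have hY3 := hsmul hπ (hadd (vs_regular hM hZ ht) (vflt_regular hM hZ ht))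
  -- The three fields whose divergences separate the two forms vanish on the boundary, so each
  -- divergence integral is minus the integral of a jump.
  have d1 := integral_divVec hM hZ ht hdim hY1 ((ha.boundary.clm_apply
    hTS.bddContOn.transpose).add (ha.boundary.smul hp.bddContOn))
  have d2 := integral_divVec hM hZ ht hdim hY2 ((hb.boundary.clm_apply
    h.stressF_regular.bddContOn.transpose).add (hb.boundary.smul hφp.bddContOn))
  have d3 := integral_divVec hM hZ ht hdim hY3 (((vs_boundary hM hZ ht hbc).add
    ((isFluidTest_vrel hM hZ ht hbc).boundary.smul (slice_phiF hM hZ ht))).smul hπ.bddContOn)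
  obtain ⟨v1, v2, v3, v4⟩ := volume_integrable hM hZ ht ha hb hπ
  have i1 := integrableOn_of_slice hM hZ ht hdim v1
  have i2 := integrableOn_of_slice hM hZ ht hdim v2
  have hf := (slice_densF hM hZ ht).smul (af_regular hM hZ ht).bddContOn
  have j1 := integrableOn_of_slice hM hZ ht hdim (hJ.mul ((((((slice_densS hM hZ ht).smul
    (as_regular hM hZ ht).bddContOn).add hf).sub (slice_divTensor hM hZ ht hTS))).inner
      ha.regular.bddContOn))
  have j2 := integrableOn_of_slice hM hZ ht hdim (hJ.mul (((hf.sub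
    (slice_divTensor hM hZ ht h.stressF_regular)).sub ((hp.bddContOn.smul (slice_gradScalar hM hZ ht
      (phiF_regular hM hZ ht))).add (slice_drag hM hZ ht))).inner hb.regular.bddContOn))
  have k1 := integrableOn_of_slice hM hZ ht hdim (hJ.mul (slice_divVec hM hZ ht hY1))
  have k2 := integrableOn_of_slice hM hZ ht hdim (hJ.mul (slice_divVec hM hZ ht hY2))
  have e1 := setIntegral_congr_diff hdim hO hI fun X hX =>
    solid_integrand hM hZ ht h.stressS_regular h.stressF_regular ha.regular hX
  rw [integral_add i1 i2, integral_add j1 k1] at e1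
  have e2 := setIntegral_congr_diff hdim hO hI fun X hX =>
    fluid_integrand hM hZ ht h.stressF_regular hb.regular hX
  have e2' := integral_add j2 k2
  have e3 := setIntegral_congr_diff hdim hO hI fun X hX =>
    pressure_integrand hM hZ ht hπ (h.solenoidal X hX) hX
  have hS := hI.measurableSet hO
  obtain ⟨b1, b2, b3⟩ := solid_traction hM hZ ht h.stressS_regular h.stressF_regular ha
  obtain ⟨c1, c2, c3⟩ := fluid_traction hM hZ ht h.stressF_regular hb
  have s1 := setIntegral_congr_fun (μ := μHE[2]) hS b3
  have s2 := setIntegral_congr_fun (μ := μHE[2]) hS c3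
  have s3 := setIntegral_congr_fun (μ := μHE[2]) hS fun X hX => kinetic_traction hM hZ ht hb hX
  -- The multiplier term vanishes by the constraint on the normal filtration velocity. The pressure
  -- test drops out through `d3` and `e3`, thanks to the solenoidal constraint.
  have s4 : ∫ X in M.S, r X * jump (M.m X) X
      (fun Y => ⟪Z.vflt M t Y, Z.areaVec t (M.m X) Y⟫_ℝ) ∂μHE[2] = 0 :=
    setIntegral_eq_zero_of_forall_eq_zero fun X hX => by rw [h.normal_jump X hX, mul_zero]
  rw [integral_add (b1.integrableOn hO hI) (b2.integrableOn hO hI)] at s1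
  rw [integral_neg, integral_add (c1.integrableOn hO hI) (c2.integrableOn hO hI)] at s2
  rw [integral_neg] at s3
  have h2 : ∫ X in M.B, Z.jac t X * ⟪Z.densF M t X • Z.af t X - Z.divTensor t (Z.stressF M t) X
        - Z.interaction M t X, -b X⟫_ℝ = -∫ X in M.B, Z.jac t X * ⟪Z.densF M t X • Z.af t X
          - Z.divTensor t (Z.stressF M t) X - Z.interaction M t X, b X⟫_ℝ := by
    rw [← integral_neg]
    simp only [inner_neg_right, mul_neg]
  -- The integrability statement `j2` has the interaction force written out. Unfolding it everywhere
  -- makes equal integrals literally equal, and the rest is linear arithmetic.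
  simp only [interaction] at e2 h2
  rw [weakForm, hamiltonForm]
  simp only [interaction]
  linarith

lemma solvesWeak_of_solvesHamilton (hdim : Module.finrank ℝ E = 3) (hbc : Z.ZeroBoundaryData M)
    (h : Z.SolvesHamilton M t) : Z.SolvesWeak M t := fun a b π r ha hb hπ _ => by
  rw [weakForm_eq_hamiltonForm hM hZ ht hdim h ha hb hπ hbc]
  exact h.equation a _ ha (hb.neg hM)

/-- The balance of energy. -/
lemma energy_balance (hdim : Module.finrank ℝ E = 3) (hbc : Z.ZeroBoundaryData M)
    (h : Z.SolvesWeak M t) :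
    (∫ X in M.B, Z.jac t X * Z.power M t X) + (∫ X in M.B, Z.jac t X * Z.dissipation M t X) +
      ∫ X in M.S, ‖Z.areaTrace M t X‖ * Z.surfaceDissipation M t X ∂μHE[2] = 0 := by
  rw [← weakForm_velocities hM hZ ht hdim hbc]
  exact h _ _ _ _ (isSolidTest_vs hM hZ ht hbc) (isFluidTest_vrel hM hZ ht hbc)
    ((hZ.p_regular t ht).comp₂ le_rfl hM.isOpen hM.interface (kinetic_regular hM hZ ht)
      (φ := fun a b : ℝ => a + b) (contDiff_fst.add contDiff_snd))
    (isSurfaceTest_multiplier hM hZ ht)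

end Fields

end Reduction

end PermeableInterface

end


theorem mainTheorem1 {E : Type*} [NormedAddCommGroup E] [InnerProductSpace ℝ E]
    [FiniteDimensional ℝ E] [CompleteSpace E] [MeasurableSpace E] [BorelSpace E]
    (hdim : Module.finrank ℝ E = 3)
    (M : PermeableInterface.Mixture E) (hM : M.Admissible)
    (Z : PermeableInterface.Fields E) (hZ : Z.Regular M) (hbc : Z.ZeroBoundaryData M)
    (hsol : ∀ᵐ t ∂(volume.restrict (Icc 0 M.T)), Z.SolvesHamilton M t ∨ Z.SolvesWeak M t) :
    ∀ᵐ t ∂(volume.restrict (Icc 0 M.T)),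
      IntegrableOn (Z.eulerian M t (Z.energyDensity M t)) (Z.body M t) ∧
      IntegrableOn (Z.eulerian M t (Z.dissipation M t)) (Z.body M t) ∧
      IntegrableOn (Z.eulerian M t (Z.surfaceDissipation M t)) (Z.surface M t) μHE[2] ∧
      ∃ e' : ℝ, HasDerivAt (Z.energy M) e' t ∧
        e' + (∫ x in Z.body M t, Z.eulerian M t (Z.dissipation M t) x)
          + (∫ x in Z.surface M t, Z.eulerian M t (Z.surfaceDissipation M t) x ∂μHE[2]) = 0 := by
  -- The regularity assumptions concern the open time interval; its endpoints form a null set.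
  have hT : ∀ᵐ t ∂(volume.restrict (Icc 0 M.T)), t ∈ Ioo 0 M.T := by
    rw [← Measure.restrict_congr_set Ioo_ae_eq_Icc]
    exact ae_restrict_mem measurableSet_Ioo
  filter_upwards [hsol, hT] with t hs ht
  have hw : Z.SolvesWeak M t := hs.elim
    (PermeableInterface.Fields.solvesWeak_of_solvesHamilton hM hZ ht hdim hbc) id
  have hJ := PermeableInterface.Fields.slice_jac hM hZ ht
  refine ⟨PermeableInterface.Fields.integrableOn_body hM hZ ht hdim
      (PermeableInterface.Fields.integrableOn_of_slice hM hZ ht hdim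
        (PermeableInterface.Fields.slice_jac_energyDensity hM hZ ht)),
    PermeableInterface.Fields.integrableOn_body hM hZ ht hdim
      (PermeableInterface.Fields.integrableOn_of_slice hM hZ ht hdim
        (hJ.mul (PermeableInterface.Fields.slice_dissipation hM hZ ht))),
    PermeableInterface.Fields.integrableOn_surface hM hZ ht hdim
      ((PermeableInterface.Fields.slice_surfaceDissipation hM hZ ht).integrableOn hM.isOpen
        hM.interface), _,
    PermeableInterface.Fields.hasDerivAt_energy hM hZ hdim ht, ?_⟩
  rw [PermeableInterface.Fields.integral_body hM hZ ht hdim,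
    PermeableInterface.Fields.integral_surface hM hZ ht hdim]
  exact PermeableInterface.Fields.energy_balance hM hZ ht hdim hbc hw
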